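/- Let $3<p<5$. There is a constant $c=c(p)>0$, depending only on $p$, such that the following holds. Let $T'>0$ and $\lambda>0$, let $(v_1,v_2)\in H^1(\mathbb{R}^3)\times L^2(\mathbb{R}^3)$ and $F\in L^{\frac{2p}{p-3}}_tL^{2p}_x([0,T']\times\mathbb{R}^3)$ (complex-valued) satisfy $$\|(v_1,v_2)\|_{H^1\times L^2}+\|F\|_{L^{\frac{2p}{p-3}}_tL^{2p}_x([0,T']\times\mathbb{R}^3)}\le\lambda ,$$ and put $$T=\min\bigl\{T',\;c\,\lambda^{-\frac{2(p-1)}{5-p}}\bigr\}.$$ Then there is a unique solution $$(v,\partial_t v)\in \Bigl(C([0,T];H^1(\mathbb{R}^3))\cap L^{\frac{2p}{p-3}}_tL^{2p}_x([0,T]\times\mathbb{R}^3)\Bigr)\times C([0,T];L^2(\mathbb{R}^3))$$ of the forced nonlinear wave equation $$-\partial_t^2v+\Delta v=|F+v|^{p-1}(F+v)\ \text{ on }[0,T]\times\mathbb{R}^3,\qquad (v,\partial_tv)|_{t=0}=(v_1,v_2),$$ where the equation is understood in the sense of distributions on $(0,T)\times\mathbb{R}^3$. Uniqueness holds among all solutions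 in this class. If $v_1$, $v_2$ and $F$ are real-valued, then so is $v$. -/

import Mathlib

open MeasureTheory Set
open scoped ENNReal SchwartzMap LineDeriv ContDiff

noncomputable section

namespace ForcedNLW

/-- Physical space `ℝ³` with its Euclidean norm and Lebesgue measure. -/
abbrev E3 : Type := EuclideanSpace ℝ (Fin 3)

/-- The Lebesgue space `L^r_x(ℝ³)` of complex-valued functions. -/
abbrev LpX (r : ℝ≥0∞) : Type := Lp ℂ r (volume : Measure E3)

/-- `L²_x(ℝ³)`. -/
abbrev L2 : Type := LpX 2

/-- The Hilbert space `L² × (L²)³` of pairs (function, vector field), with the norm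
`(‖f‖² + ∑ i, ‖gᵢ‖²)^{1/2}`. -/
abbrev L2Pair : Type := WithLp 2 (L2 × PiLp 2 (fun _ : Fin 3 => L2))

/-- The Sobolev space `H¹_x(ℝ³)`: all `f ∈ L²` whose distributional partial derivatives `∂ᵢ f`
are in `L²`. It is realized as the graph `{(f, ∇f)}`, so its norm is
`‖f‖_{H¹} = (‖f‖_{L²}² + ‖∇f‖_{L²}²)^{1/2}`. -/
def H1 : Submodule ℂ L2Pair where
  carrier := {u | ∀ i : Fin 3,
    ∂_{(EuclideanSpace.single i (1 : ℝ) : E3)} (u.fst : 𝓢'(E3, ℂ)) = (u.snd i : 𝓢'(E3, ℂ))}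
  add_mem' := by
    intro a b ha hb i
    have h1 := ha i
    have h2 := hb i
    simp only [← Lp.toTemperedDistributionCLM_apply] at h1 h2 ⊢
    simp only [WithLp.add_fst, WithLp.add_snd, PiLp.add_apply, map_add,
      LineDerivAdd.lineDerivOp_add, h1, h2]
  zero_mem' := by
    intro i
    simp only [← Lp.toTemperedDistributionCLM_apply, WithLp.zero_fst, WithLp.zero_snd,
      PiLp.zero_apply, map_zero, LineDeriv.lineDerivOp_zero]
  smul_mem' := by
    intro c a ha i
    have h1 := ha i
    simp only [← Lp.toTemperedDistributionCLM_apply] at h1 ⊢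
    simp only [WithLp.smul_fst, WithLp.smul_snd, PiLp.smul_apply, map_smul,
      LineDerivSMul.lineDerivOp_smul, h1]

/-- The inclusion `H¹ ⊂ L²`. -/
def toL2 (u : H1) : L2 := (u : L2Pair).fst

/-- The space exponent `2p`. -/
abbrev xExp (p : ℝ) : ℝ≥0∞ := ENNReal.ofReal (2 * p)

/-- The time exponent `2p / (p - 3)`. -/
abbrev tExp (p : ℝ) : ℝ≥0∞ := ENNReal.ofReal (2 * p / (p - 3))

instance xExp_fact (p : ℝ) [hp : Fact (3 < p)] : Fact (1 ≤ xExp p) :=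
  ⟨by
    have h := hp.out
    rw [← ENNReal.ofReal_one]
    exact ENNReal.ofReal_le_ofReal (by linarith)⟩

/-- `F ∈ L^{2p/(p-3)}_t L^{2p}_x([0,T] × ℝ³)`, for a curve `F` of functions in `L^{2p}_x`. -/
def MemMixed (p : ℝ) [Fact (3 < p)] (T : ℝ) (F : ℝ → LpX (xExp p)) : Prop :=
  MemLp F (tExp p) (volume.restrict (Icc 0 T))

/-- The norm of `F` in `L^{2p/(p-3)}_t L^{2p}_x([0,T] × ℝ³)`. -/
def mixedNorm (p : ℝ) [Fact (3 < p)] (T : ℝ) (F : ℝ → LpX (xExp p)) : ℝ :=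
  (eLpNorm F (tExp p) (volume.restrict (Icc 0 T))).toReal

/-- The nonlinearity `z ↦ |z|^{p-1} z`. -/
def nonlin (p : ℝ) (z : ℂ) : ℂ := ((‖z‖ ^ (p - 1) : ℝ) : ℂ) * z

/-- The wave operator `-∂ₜ² φ + Δ φ`, on smooth functions of `(t, x)`. -/
def waveOp (φ : ℝ × E3 → ℂ) (t : ℝ) (x : E3) : ℂ :=
  -iteratedDeriv 2 (fun s => φ (s, x)) t + Laplacian.laplacian (fun y => φ (t, y)) x

/-- Test functions: `φ ∈ C_c^∞((0,T) × ℝ³; ℂ)`. -/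
structure IsTest (T : ℝ) (φ : ℝ × E3 → ℂ) : Prop where
  smooth : ContDiff ℝ ∞ φ
  compact : HasCompactSupport φ
  supp : tsupport φ ⊆ Ioo 0 T ×ˢ univ

/-- `(v, w) = (v, ∂ₜ v)` is a solution, in the class
`(C([0,T]; H¹) ∩ L^{2p/(p-3)}_t L^{2p}_x([0,T] × ℝ³)) × C([0,T]; L²)`, of
`-∂ₜ² v + Δ v = |F + v|^{p-1} (F + v)` on `[0,T] × ℝ³` with `(v, ∂ₜ v)|_{t=0} = (v₁, v₂)`.
The equation holds in the sense of distributions on `(0,T) × ℝ³`, and the initial data are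
attained by the continuous curves `v` and `w`. -/
structure IsSolution (p : ℝ) [Fact (3 < p)] (T : ℝ) (F : ℝ → LpX (xExp p)) (v₁ : H1) (v₂ : L2)
    (v : ℝ → H1) (w : ℝ → L2) : Prop where
  continuousOn_fst : ContinuousOn v (Icc 0 T)
  continuousOn_snd : ContinuousOn w (Icc 0 T)
  mixed : ∃ V : ℝ → LpX (xExp p), MemMixed p T V ∧
    ∀ᵐ t ∂(volume.restrict (Icc 0 T)), (V t : E3 → ℂ) =ᵐ[volume] (toL2 (v t) : E3 → ℂ)
  deriv : ∀ t ∈ Icc 0 T, HasDerivWithinAt (fun s => toL2 (v s)) (w t) (Icc 0 T) t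
  init_fst : v 0 = v₁
  init_snd : w 0 = v₂
  equation : ∀ φ : ℝ × E3 → ℂ, IsTest T φ →
    ∫ t in Ioo 0 T, ∫ x : E3, (toL2 (v t) : E3 → ℂ) x * waveOp φ t x =
      ∫ t in Ioo 0 T, ∫ x : E3, nonlin p ((F t : E3 → ℂ) x + (toL2 (v t) : E3 → ℂ) x) * φ (t, x)

/-- The function `f` is real-valued (almost everywhere). -/
def IsRealValued {r : ℝ≥0∞} (f : LpX r) : Prop := ∀ᵐ x, (f x).im = 0

end ForcedNLW

end

/-! The Duhamel formula is solved by contraction in the single space `L^q_t L^{2p}_x` with `q =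
2p/(p-3)`. Since `1/q + 3/(2p) = 1/2`, this pair has the scaling of the energy, and the Strichartz
inequality bounds the linear solution with data `(v₁, v₂)` and forcing `G` by `K (‖√(-Δ) v₁‖ + ‖v₂‖
+ ‖G‖_{L¹_t L²_x})`, with `K` independent of `T`. The nonlinearity maps `L^{2p}` to `L²`, and Hölder
in time gives `‖|f|^{p-1} f‖_{L¹_t L²_x} ≤ T^{(5-p)/2} ‖f‖^p`; the power of `T` is positive exactly
because `p < 5`. On a ball of radius comparable to `λ` the Duhamel map contracts once `T^{(5-p)/2}
λ^{p-1}` is small, which is the stated existence time (`exists_mild`, `exists_time_constant`).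

The Strichartz inequality is proved by the `TT*` method, without Littlewood–Paley theory. In three
dimensions `(1 - cos(t√(-Δ)))/(-Δ)` is convolution with `1_{|x|<t}/(4π|x|)` (`fourier_ker`).
Comparing times `τ` and `R → ∞`, the form of `cos(τ√(-Δ))/(-Δ)` is controlled by the kernel `1/|x|`
on `|x| ≥ τ`, which lies in `L^{r/2}` for `r > 6`. Young's inequality then gives decay
`|τ|^{-(1-6/r)}` from `L^{r'}` to `L^r` (`dispersive`), used with `r = 2p`, and
Hardy–Littlewood–Sobolev in time (`hls`) integrates it. All operators are first cut to a frequency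
band, where they are bounded and land in every space needed. A sharp cutoff is not bounded on `L^r`,
so uniformity in the band comes from the Hilbert space side instead: the `TT*` norms increase with
the band and converge to the form without cutoff (`dual_estimate`). Duality gives Strichartz on each
band (`strichartz_band`), and a Cauchy argument removes the band (`strichartz`).

Distributional and Duhamel solutions are identified as follows. The Duhamel formula solves the
equation weakly (`weak_linV`). Conversely a weak solution with zero data and zero forcing vanishes,
because on a frequency band the Laplacian is bounded and the equation is a linear ODE
(`weak_unique`). Hence every solution in the class is mild, and two mild solutions agree by applying
the contraction estimate on successive short intervals (`IsMild.ae_eq`); no smallness of the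
competing solution is needed. Reality follows from uniqueness, since the complex conjugate solves
the same Duhamel equation when the data and the force are real. -/

noncomputable section

/-! ### Fourier multipliers on `L²` -/

namespace ForcedNLW

open Filter Topology FourierTransform

/-- Bounded measurable Fourier symbols. -/
def Symb (m : E3 → ℂ) : Prop := Measurable m ∧ ∃ C : ℝ, ∀ ξ, ‖m ξ‖ ≤ C

theorem Symb.mul {m n : E3 → ℂ} (hm : Symb m) (hn : Symb n) : Symb (fun ξ => m ξ * n ξ) := by
  obtain ⟨hm, C, hC⟩ := hm
  obtain ⟨hn, D, hD⟩ := hn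
  refine ⟨hm.mul hn, C * D, fun ξ => ?_⟩
  rw [norm_mul]
  exact mul_le_mul (hC ξ) (hD ξ) (norm_nonneg _) ((norm_nonneg _).trans (hC ξ))

theorem Symb.memLp_mul {m : E3 → ℂ} (hm : Symb m) (f : L2) :
    MemLp (fun ξ => m ξ * f ξ) 2 (volume : Measure E3) := by
  obtain ⟨hm, C, hC⟩ := hm
  refine MemLp.of_le_mul (c := C) (Lp.memLp f)
    (hm.aestronglyMeasurable.mul (Lp.aestronglyMeasurable f)) (ae_of_all _ fun ξ => ?_)
  rw [norm_mul]
  exact mul_le_mul_of_nonneg_right (hC ξ) (norm_nonneg _)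

theorem norm_toLp_mul_le {m : E3 → ℂ} (hm : Symb m) {C : ℝ}
    (hC : ∀ ξ, ‖m ξ‖ ≤ C) (f : L2) : ‖(hm.memLp_mul f).toLp‖ ≤ C * ‖f‖ := by
  refine Lp.norm_le_mul_norm_of_ae_le_mul ?_
  filter_upwards [(hm.memLp_mul f).coeFn_toLp] with ξ h
  rw [h, norm_mul]
  exact mul_le_mul_of_nonneg_right (hC ξ) (norm_nonneg _)

/-- Multiplication by a bounded measurable function on `L²`. -/
def mulL2 (m : E3 → ℂ) (hm : Symb m) : L2 →L[ℂ] L2 :=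
  LinearMap.mkContinuousOfExistsBound
    { toFun := fun f => (hm.memLp_mul f).toLp
      map_add' := by
        intro f g
        rw [← MemLp.toLp_add]
        apply Lp.ext
        refine (MemLp.coeFn_toLp _).trans ((MemLp.coeFn_toLp _).trans ?_).symm
        filter_upwards [Lp.coeFn_add f g] with ξ h
        rw [h]
        simp [mul_add]
      map_smul' := by
        intro c f
        rw [RingHom.id_apply, ← MemLp.toLp_const_smul]
        apply Lp.ext
        refine (MemLp.coeFn_toLp _).trans ((MemLp.coeFn_toLp _).trans ?_).symm
        filter_upwards [Lp.coeFn_smul c f] with ξ h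
        rw [h]
        simp [mul_left_comm] }
    (by
      obtain ⟨C, hC⟩ := hm.2
      exact ⟨C, fun f => norm_toLp_mul_le hm hC f⟩)

theorem mulL2_ae {m : E3 → ℂ} (hm : Symb m) (f : L2) :
    (mulL2 m hm f : E3 → ℂ) =ᵐ[volume] fun ξ => m ξ * f ξ :=
  (hm.memLp_mul f).coeFn_toLp

open Classical in
/-- The Fourier multiplier operator on `L²` with symbol `m` (zero if `m` is not bounded and
measurable). -/
def fmul (m : E3 → ℂ) : L2 →L[ℂ] L2 :=
  -- The fallback value allows multipliers to be written for arbitrary symbols; each lemma that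
  -- computes with them supplies `Symb`.
  if hm : Symb m then
    ((Lp.fourierTransformₗᵢ E3 ℂ).symm : L2 →L[ℂ] L2) ∘L (mulL2 m hm) ∘L
      ((Lp.fourierTransformₗᵢ E3 ℂ) : L2 →L[ℂ] L2)
  else 0

theorem fourier_fmul {m : E3 → ℂ} (hm : Symb m) (f : L2) :
    𝓕 (fmul m f) = mulL2 m hm (𝓕 f) := by
  rw [fmul, dif_pos hm]
  exact (Lp.fourierTransformₗᵢ E3 ℂ).apply_symm_apply _

theorem fmul_ae {m : E3 → ℂ} (hm : Symb m) (f : L2) :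
    ((𝓕 (fmul m f) : L2) : E3 → ℂ) =ᵐ[volume] fun ξ => m ξ * (𝓕 f : L2) ξ := by
  rw [fourier_fmul hm]
  exact mulL2_ae hm _

theorem L2_ext_fourier {f g : L2}
    (h : ((𝓕 f : L2) : E3 → ℂ) =ᵐ[volume] ((𝓕 g : L2) : E3 → ℂ)) : f = g :=
  (Lp.fourierTransformₗᵢ E3 ℂ).injective (Lp.ext h)

theorem fmul_fmul {m n : E3 → ℂ} (hm : Symb m) (hn : Symb n) (f : L2) :
    fmul m (fmul n f) = fmul (fun ξ => m ξ * n ξ) f := by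
  apply L2_ext_fourier
  filter_upwards [fmul_ae hm (fmul n f), fmul_ae hn f, fmul_ae (hm.mul hn) f] with ξ h1 h2 h3
  rw [h1, h2, h3, mul_assoc]

theorem fmul_comm {m n : E3 → ℂ} (hm : Symb m) (hn : Symb n) (f : L2) :
    fmul m (fmul n f) = fmul n (fmul m f) := by
  rw [fmul_fmul hm hn, fmul_fmul hn hm]
  simp_rw [mul_comm]

theorem norm_fmul_le {m : E3 → ℂ} (hm : Measurable m) {C : ℝ} (hC : ∀ ξ, ‖m ξ‖ ≤ C) (f : L2) :
    ‖fmul m f‖ ≤ C * ‖f‖ := by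
  have hs : Symb m := ⟨hm, C, hC⟩
  rw [← Lp.norm_fourier_eq, fourier_fmul hs, ← Lp.norm_fourier_eq f]
  exact norm_toLp_mul_le hs hC _

theorem fmul_one (f : L2) : fmul (fun _ => 1) f = f := by
  have hs : Symb (fun _ : E3 => (1 : ℂ)) := ⟨measurable_const, 1, fun _ => by simp⟩
  apply L2_ext_fourier
  filter_upwards [fmul_ae hs f] with ξ h
  rw [h, one_mul]

theorem inner_L2_eq (f g : L2) : inner ℂ f g = ∫ x : E3, (starRingEnd ℂ) (f x) * g x := by
  rw [L2.inner_def]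
  simp_rw [RCLike.inner_apply, mul_comm]

theorem inner_eq_integral_fourier (f g : L2) :
    inner ℂ f g = ∫ ξ : E3, (starRingEnd ℂ) ((𝓕 f : L2) ξ) * (𝓕 g : L2) ξ := by
  rw [← Lp.inner_fourier_eq, inner_L2_eq]

theorem inner_fmul_right {m : E3 → ℂ} (hm : Symb m) (f g : L2) :
    inner ℂ f (fmul m g) = ∫ ξ : E3, (starRingEnd ℂ) ((𝓕 f : L2) ξ) * (m ξ * (𝓕 g : L2) ξ) := by
  rw [inner_eq_integral_fourier]
  apply integral_congr_ae
  filter_upwards [fmul_ae hm g] with ξ h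
  rw [h]

theorem Symb.conj {m : E3 → ℂ} (hm : Symb m) : Symb (fun ξ => (starRingEnd ℂ) (m ξ)) := by
  obtain ⟨hm, C, hC⟩ := hm
  exact ⟨Complex.continuous_conj.measurable.comp hm, C, fun ξ => by simpa using hC ξ⟩

theorem inner_fmul_left {m : E3 → ℂ} (hm : Symb m) (f g : L2) :
    inner ℂ (fmul m f) g = inner ℂ f (fmul (fun ξ => (starRingEnd ℂ) (m ξ)) g) := by
  rw [inner_fmul_right hm.conj, inner_eq_integral_fourier]
  apply integral_congr_ae
  filter_upwards [fmul_ae hm f] with ξ h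
  rw [h, map_mul]
  ring

theorem norm_sq_L2 (f : L2) : ‖f‖ ^ 2 = ∫ x : E3, ‖f x‖ ^ 2 := by
  have h : ((‖f‖ ^ 2 : ℝ) : ℂ) = ((∫ x : E3, ‖f x‖ ^ 2 : ℝ) : ℂ) := by
    rw [← integral_complex_ofReal]
    have h2 : inner ℂ f f = ((‖f‖ ^ 2 : ℝ) : ℂ) := by
      rw [inner_self_eq_norm_sq_to_K]; norm_cast
    rw [← h2, inner_L2_eq]
    congr 1
    ext x
    rw [RCLike.conj_mul]
    norm_cast
  exact_mod_cast h

theorem integrable_norm_sq (f : L2) : Integrable (fun x : E3 => ‖f x‖ ^ 2) := by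
  simpa using (Lp.memLp f).integrable_norm_rpow (by norm_num) (by norm_num)

/-- Boundedly and pointwise almost everywhere convergent symbols give strongly convergent
multipliers. -/
theorem tendsto_fmul {ι : Type*} {l : Filter ι} [l.IsCountablyGenerated] {m : ι → E3 → ℂ}
    {m₀ : E3 → ℂ} {C : ℝ} (hm : ∀ i, Measurable (m i)) (hm₀ : Measurable m₀)
    (hC : ∀ i ξ, ‖m i ξ‖ ≤ C) (hC₀ : ∀ ξ, ‖m₀ ξ‖ ≤ C)
    (h : ∀ᵐ ξ, Tendsto (fun i => m i ξ) l (𝓝 (m₀ ξ))) (f : L2) :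
    Tendsto (fun i => fmul (m i) f) l (𝓝 (fmul m₀ f)) := by
  have hs : ∀ i, Symb (m i) := fun i => ⟨hm i, C, hC i⟩
  have hs₀ : Symb m₀ := ⟨hm₀, C, hC₀⟩
  rw [tendsto_iff_norm_sub_tendsto_zero]
  -- By Plancherel the squared distance is `∫ |m i - m₀|² |f̂|²`, dominated by `(2C)² |f̂|²`.
  have key : Tendsto (fun i => ‖fmul (m i) f - fmul m₀ f‖ ^ 2) l (𝓝 0) := by
    have e : ∀ i, ‖fmul (m i) f - fmul m₀ f‖ ^ 2
        = ∫ ξ : E3, ‖(m i ξ - m₀ ξ) * (𝓕 f : L2) ξ‖ ^ 2 := by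
      intro i
      rw [← Lp.norm_fourier_eq, norm_sq_L2]
      apply integral_congr_ae
      have h3 : (𝓕 (fmul (m i) f - fmul m₀ f) : L2) = 𝓕 (fmul (m i) f) - 𝓕 (fmul m₀ f) :=
        (Lp.fourierTransformₗᵢ E3 ℂ).map_sub _ _
      rw [h3]
      filter_upwards [fmul_ae (hs i) f, fmul_ae hs₀ f,
        Lp.coeFn_sub (𝓕 (fmul (m i) f) : L2) (𝓕 (fmul m₀ f))] with ξ h1 h2 h3
      rw [h3, Pi.sub_apply, h1, h2, sub_mul]
    simp_rw [e]
    have hz : (0 : ℝ) = ∫ ξ : E3, (0 : ℝ) := by simp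
    rw [hz]
    refine tendsto_integral_filter_of_dominated_convergence
      (fun ξ => (2 * C) ^ 2 * ‖(𝓕 f : L2) ξ‖ ^ 2) ?_ ?_ ?_ ?_
    · refine Eventually.of_forall fun i => ?_
      exact ((((hm i).sub hm₀).aestronglyMeasurable.mul (Lp.aestronglyMeasurable _)).norm.pow 2)
    · refine Eventually.of_forall fun i => ae_of_all _ fun ξ => ?_
      rw [norm_mul, mul_pow, norm_mul, Real.norm_of_nonneg (by positivity),
        Real.norm_of_nonneg (by positivity)]
      gcongr
      calc ‖m i ξ - m₀ ξ‖ ≤ ‖m i ξ‖ + ‖m₀ ξ‖ := norm_sub_le _ _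
        _ ≤ 2 * C := by linarith [hC i ξ, hC₀ ξ]
    · exact (integrable_norm_sq _).const_mul _
    · filter_upwards [h] with ξ hξ
      have : Tendsto (fun i => ‖(m i ξ - m₀ ξ) * (𝓕 f : L2) ξ‖ ^ 2) l
          (𝓝 (‖(m₀ ξ - m₀ ξ) * (𝓕 f : L2) ξ‖ ^ 2)) :=
        (((hξ.sub_const _).mul_const _).norm).pow 2
      simpa using this
  have := key.sqrt
  simpa using this

theorem fmul_add_symb {m n : E3 → ℂ} (hm : Symb m) (hn : Symb n) (f : L2) :
    fmul (fun ξ => m ξ + n ξ) f = fmul m f + fmul n f := by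
  have hmn : Symb (fun ξ => m ξ + n ξ) := by
    obtain ⟨hm, C, hC⟩ := hm
    obtain ⟨hn, D, hD⟩ := hn
    exact ⟨hm.add hn, C + D, fun ξ => (norm_add_le _ _).trans (add_le_add (hC ξ) (hD ξ))⟩
  apply L2_ext_fourier
  have e : (𝓕 (fmul m f + fmul n f) : L2) = 𝓕 (fmul m f) + 𝓕 (fmul n f) :=
    (Lp.fourierTransformₗᵢ E3 ℂ).map_add _ _
  rw [e]
  filter_upwards [fmul_ae hm f, fmul_ae hn f, fmul_ae hmn f,
    Lp.coeFn_add (𝓕 (fmul m f) : L2) (𝓕 (fmul n f))] with ξ h1 h2 h3 h4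
  rw [h3, h4, Pi.add_apply, h1, h2, add_mul]

theorem fmul_const_mul_symb {m : E3 → ℂ} (hm : Symb m) (c : ℂ) (f : L2) :
    fmul (fun ξ => c * m ξ) f = c • fmul m f := by
  have hc : Symb (fun ξ => c * m ξ) :=
    Symb.mul (m := fun _ => c) ⟨measurable_const, ‖c‖, fun _ => le_rfl⟩ hm
  apply L2_ext_fourier
  have e : (𝓕 (c • fmul m f) : L2) = c • 𝓕 (fmul m f) :=
    (Lp.fourierTransformₗᵢ E3 ℂ).map_smul _ _
  rw [e]
  filter_upwards [fmul_ae hm f, fmul_ae hc f,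
    Lp.coeFn_smul c (𝓕 (fmul m f) : L2)] with ξ h1 h2 h3
  rw [h2, h3, Pi.smul_apply, h1, smul_eq_mul, mul_assoc]

theorem fmul_sub_symb {m n : E3 → ℂ} (hm : Symb m) (hn : Symb n) (f : L2) :
    fmul (fun ξ => m ξ - n ξ) f = fmul m f - fmul n f := by
  have hn' : Symb (fun ξ => (-1 : ℂ) * n ξ) :=
    Symb.mul (m := fun _ => (-1 : ℂ)) ⟨measurable_const, 1, fun _ => by simp⟩ hn
  have h := fmul_add_symb hm hn' f
  rw [fmul_const_mul_symb hn] at h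
  simpa [sub_eq_add_neg] using h

end ForcedNLW

end

/-! ### Symbols of the wave propagators -/

noncomputable section

namespace ForcedNLW

open Filter Topology FourierTransform

/-- The symbol `2π|ξ|` of `√(-Δ)`. -/
def kap (ξ : E3) : ℝ := 2 * Real.pi * ‖ξ‖

theorem kap_nonneg (ξ : E3) : 0 ≤ kap ξ := by unfold kap; positivity

theorem kap_pos {ξ : E3} (h : ξ ≠ 0) : 0 < kap ξ := by
  have := norm_pos_iff.2 h
  unfold kap; positivity

theorem continuous_kap : Continuous kap := by unfold kap; fun_prop

/-- `cos(t√(-Δ))`. -/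
def cosSymb (t : ℝ) (ξ : E3) : ℂ := (Real.cos (t * kap ξ) : ℝ)

/-- `sin(t√(-Δ))/√(-Δ)`. -/
def sinSymb (t : ℝ) (ξ : E3) : ℂ := (t * Real.sinc (t * kap ξ) : ℝ)

/-- The symbol of `∂ⱼ`. -/
def gradSymb (j : Fin 3) (ξ : E3) : ℂ := 2 * Real.pi * Complex.I * (ξ j : ℝ)

/-- Writing `sin(tκ)/κ` through `sinc` keeps the symbol continuous at `ξ = 0`. This identity, which
needs no `κ ≠ 0`, is how the sine is recovered from it. -/
theorem kap_mul_sinSymb (t : ℝ) (ξ : E3) :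
    (kap ξ : ℂ) * sinSymb t ξ = (Real.sin (t * kap ξ) : ℝ) := by
  unfold sinSymb
  rw [← Complex.ofReal_mul]
  congr 1
  by_cases h : t * kap ξ = 0
  · rw [h]; simp only [Real.sin_zero, Real.sinc_zero, mul_one]; rw [mul_comm]; exact h
  · rw [Real.sinc_of_ne_zero h]
    obtain ⟨h1, h2⟩ := mul_ne_zero_iff.1 h
    field_simp

theorem norm_cosSymb_le (t : ℝ) (ξ : E3) : ‖cosSymb t ξ‖ ≤ 1 := by
  unfold cosSymb
  rw [Complex.norm_real]
  exact Real.abs_cos_le_one _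

theorem norm_sinSymb_le (t : ℝ) (ξ : E3) : ‖sinSymb t ξ‖ ≤ |t| := by
  unfold sinSymb
  rw [Complex.norm_real, norm_mul]
  exact mul_le_of_le_one_right (abs_nonneg _) (Real.abs_sinc_le_one _)

theorem norm_gradSymb_le (j : Fin 3) (ξ : E3) : ‖gradSymb j ξ‖ ≤ kap ξ := by
  unfold gradSymb kap
  have h := PiLp.norm_apply_le ξ j
  rw [norm_mul, Complex.norm_real]
  have : ‖(2 * (Real.pi : ℂ) * Complex.I)‖ = 2 * Real.pi := by
    simp [abs_of_pos Real.pi_pos]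
  rw [this]
  exact mul_le_mul_of_nonneg_left h (by positivity)

/-- One derivative costs at most `κ`, which cancels the denominator of `sin(tκ)/κ`. This is the gain
of one derivative that carries `L²` into `H¹`. -/
theorem norm_grad_sinSymb_le (j : Fin 3) (t : ℝ) (ξ : E3) :
    ‖gradSymb j ξ * sinSymb t ξ‖ ≤ 1 := by
  rw [norm_mul]
  calc ‖gradSymb j ξ‖ * ‖sinSymb t ξ‖ ≤ kap ξ * ‖sinSymb t ξ‖ := by
        gcongr; exact norm_gradSymb_le j ξ
    _ = ‖(kap ξ : ℂ) * sinSymb t ξ‖ := by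
        rw [norm_mul, Complex.norm_real, Real.norm_of_nonneg (kap_nonneg ξ)]
    _ ≤ 1 := by
        rw [kap_mul_sinSymb, Complex.norm_real]
        exact Real.abs_sin_le_one _

theorem continuous_gradSymb (j : Fin 3) : Continuous (gradSymb j) := by
  unfold gradSymb; fun_prop

theorem continuous_cosSymb_uncurry : Continuous (fun z : ℝ × E3 => cosSymb z.1 z.2) := by
  unfold cosSymb
  have := continuous_kap
  fun_prop

theorem continuous_sinSymb_uncurry : Continuous (fun z : ℝ × E3 => sinSymb z.1 z.2) := by
  unfold sinSymb
  have := continuous_kap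
  have h2 := Real.continuous_sinc
  fun_prop

theorem continuous_cosSymb (t : ℝ) : Continuous (cosSymb t) :=
  continuous_cosSymb_uncurry.comp (Continuous.prodMk continuous_const continuous_id)

theorem continuous_sinSymb (t : ℝ) : Continuous (sinSymb t) :=
  continuous_sinSymb_uncurry.comp (Continuous.prodMk continuous_const continuous_id)

theorem symb_cos (t : ℝ) : Symb (cosSymb t) :=
  ⟨(continuous_cosSymb t).measurable, 1, norm_cosSymb_le t⟩

theorem symb_sin (t : ℝ) : Symb (sinSymb t) :=
  ⟨(continuous_sinSymb t).measurable, |t|, norm_sinSymb_le t⟩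

theorem symb_grad_sin (j : Fin 3) (t : ℝ) : Symb (fun ξ => gradSymb j ξ * sinSymb t ξ) :=
  ⟨((continuous_gradSymb j).mul (continuous_sinSymb t)).measurable, 1, norm_grad_sinSymb_le j t⟩

theorem continuous_fmul_cos (f : L2) : Continuous (fun t => fmul (cosSymb t) f) := by
  rw [continuous_iff_continuousAt]
  intro t₀
  refine tendsto_fmul (C := 1) (fun t => (continuous_cosSymb t).measurable)
    (continuous_cosSymb t₀).measurable norm_cosSymb_le (norm_cosSymb_le t₀)
    (ae_of_all _ fun ξ => ?_) f
  exact (continuous_cosSymb_uncurry.comp (Continuous.prodMk continuous_id continuous_const)).tendsto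
    t₀

/-- Since `sin` is 1-Lipschitz, the factor `κ` in its argument cancels the one in the denominator.
The constant does not depend on the frequency, which serves to differentiate the sine propagator and
to dominate Duhamel integrals. -/
theorem fmul_symm_diff_sin (t s : ℝ) (ξ : E3) : ‖sinSymb t ξ - sinSymb s ξ‖ ≤ |t - s| := by
  by_cases h : kap ξ = 0
  · unfold sinSymb
    rw [h, ← Complex.ofReal_sub, Complex.norm_real]
    simp
  · have hk : 0 < kap ξ := lt_of_le_of_ne (kap_nonneg ξ) (Ne.symm h)
    have h1 : ‖(kap ξ : ℂ) * (sinSymb t ξ - sinSymb s ξ)‖ ≤ kap ξ * |t - s| := by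
      rw [mul_sub, kap_mul_sinSymb, kap_mul_sinSymb, ← Complex.ofReal_sub, Complex.norm_real,
        Real.norm_eq_abs]
      calc |Real.sin (t * kap ξ) - Real.sin (s * kap ξ)| ≤ |t * kap ξ - s * kap ξ| := by
            have := Real.lipschitzWith_sin.dist_le_mul (t * kap ξ) (s * kap ξ)
            simpa [Real.dist_eq] using this
        _ = kap ξ * |t - s| := by rw [← sub_mul, abs_mul, abs_of_pos hk, mul_comm]
    rw [norm_mul, Complex.norm_real, Real.norm_of_nonneg hk.le] at h1
    exact le_of_mul_le_mul_left h1 hk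

theorem norm_fmul_sin_sub_le (t s : ℝ) (f : L2) :
    ‖fmul (sinSymb t) f - fmul (sinSymb s) f‖ ≤ |t - s| * ‖f‖ := by
  rw [← fmul_sub_symb (symb_sin t) (symb_sin s)]
  exact norm_fmul_le ((symb_sin t).1.sub (symb_sin s).1) (fmul_symm_diff_sin t s) f

theorem continuous_fmul_sin (f : L2) : Continuous (fun t => fmul (sinSymb t) f) := by
  refine (LipschitzWith.of_dist_le_mul (K := ‖f‖₊) fun t s => ?_).continuous
  rw [dist_eq_norm, Real.dist_eq, mul_comm]
  exact norm_fmul_sin_sub_le t s f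

theorem continuous_fmul_grad_sin (j : Fin 3) (f : L2) :
    Continuous (fun t => fmul (fun ξ => gradSymb j ξ * sinSymb t ξ) f) := by
  rw [continuous_iff_continuousAt]
  intro t₀
  refine tendsto_fmul (C := 1) (fun t => (symb_grad_sin j t).1)
    (symb_grad_sin j t₀).1 (norm_grad_sinSymb_le j) (norm_grad_sinSymb_le j t₀)
    (ae_of_all _ fun ξ => ?_) f
  refine Tendsto.const_mul _ ?_
  exact (continuous_sinSymb_uncurry.comp (Continuous.prodMk continuous_id continuous_const)).tendsto
    t₀

theorem hasDerivAt_sinSymb (t : ℝ) (ξ : E3) :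
    HasDerivAt (fun s => sinSymb s ξ) (cosSymb t ξ) t := by
  by_cases h : kap ξ = 0
  · have e : (fun s => sinSymb s ξ) = fun s : ℝ => (s : ℂ) := by
      ext s; simp [sinSymb, h]
    rw [e]
    simpa [cosSymb, h] using (hasDerivAt_id t).ofReal_comp
  · have e : (fun s => sinSymb s ξ) = fun s : ℝ => ((Real.sin (s * kap ξ) / kap ξ : ℝ) : ℂ) := by
      ext s
      rw [Complex.ofReal_div, ← kap_mul_sinSymb, mul_div_cancel_left₀]
      exact_mod_cast h
    rw [e]
    refine HasDerivAt.ofReal_comp ?_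
    have := (((hasDerivAt_id t).mul_const (kap ξ)).sin).div_const (kap ξ)
    simp only [id_eq, one_mul] at this
    rwa [mul_div_cancel_right₀ _ h] at this

/-- A difference quotient of multipliers is the multiplier of the difference quotient. These symbols
are bounded by 1 and converge pointwise, so `tendsto_fmul` applies. -/
theorem hasDerivAt_fmul_sin (t : ℝ) (f : L2) :
    HasDerivAt (fun s => fmul (sinSymb s) f) (fmul (cosSymb t) f) t := by
  rw [hasDerivAt_iff_tendsto_slope]
  have e : ∀ s, slope (fun s => fmul (sinSymb s) f) t s
      = fmul (fun ξ => ((s - t)⁻¹ : ℝ) * (sinSymb s ξ - sinSymb t ξ)) f := by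
    intro s
    have hs : Symb (fun ξ => sinSymb s ξ - sinSymb t ξ) :=
      ⟨(symb_sin s).1.sub (symb_sin t).1, _, fmul_symm_diff_sin s t⟩
    rw [fmul_const_mul_symb hs, fmul_sub_symb (symb_sin s) (symb_sin t), slope_def_module]
    rfl
  simp_rw [funext e]
  refine tendsto_fmul (C := 1) (fun s => ?_) (symb_cos t).1 (fun s ξ => ?_) (norm_cosSymb_le t)
    (ae_of_all _ fun ξ => ?_) f
  · exact ((symb_sin s).1.sub (symb_sin t).1).const_mul _
  · rw [norm_mul, Complex.norm_real, norm_inv, Real.norm_eq_abs]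
    calc |s - t|⁻¹ * ‖sinSymb s ξ - sinSymb t ξ‖ ≤ |s - t|⁻¹ * |s - t| := by
          gcongr; exact fmul_symm_diff_sin s t ξ
      _ ≤ 1 := inv_mul_le_one
  · have := (hasDerivAt_iff_tendsto_slope.1 (hasDerivAt_sinSymb t ξ))
    refine this.congr fun s => ?_
    rw [slope_def_module, Complex.real_smul]

/-! ### The Sobolev space on the Fourier side -/

/-- The Fourier transform of tempered distributions turns `∂ⱼ` into multiplication by `2πiξⱼ`. The
resulting distribution is a locally integrable function, so equality of distributions is equality
almost everywhere. -/
theorem mem_H1_iff (u : L2Pair) :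
    u ∈ H1 ↔ ∀ j : Fin 3, ((𝓕 (u.snd j) : L2) : E3 → ℂ) =ᵐ[volume]
      fun ξ => gradSymb j ξ * (𝓕 u.fst : L2) ξ := by
  refine forall_congr' fun j => ?_
  have hg : (inner ℝ · (EuclideanSpace.single j (1 : ℝ) : E3) : E3 → ℝ).HasTemperateGrowth := by
    fun_prop
  have hgc : (fun x : E3 =>
      ((inner ℝ x (EuclideanSpace.single j (1 : ℝ) : E3) : ℝ) : ℂ)).HasTemperateGrowth := by
    fun_prop
  have hin : ∀ ξ : E3, inner ℝ ξ (EuclideanSpace.single j (1 : ℝ) : E3) = ξ j := by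
    intro ξ
    simp [EuclideanSpace.inner_single_right]
  have key : ∀ ψ : 𝓢(E3, ℂ),
      (𝓕 (∂_{(EuclideanSpace.single j (1 : ℝ) : E3)} (u.fst : 𝓢'(E3, ℂ)))) ψ
        = ∫ ξ : E3, ψ ξ • (gradSymb j ξ * (𝓕 u.fst : L2) ξ) := by
    intro ψ
    rw [TemperedDistribution.fourier_lineDerivOp_eq, Lp.fourier_toTemperedDistribution_eq]
    have hsm : ∀ (c : ℂ) (d : 𝓢'(E3, ℂ)), (c • d) ψ = c • d ψ := fun _ _ => rfl
    rw [hsm, TemperedDistribution.smulLeftCLM_apply_apply, Lp.toTemperedDistribution_apply,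
      ← integral_smul]
    congr 1
    ext ξ
    rw [SchwartzMap.smulLeftCLM_apply_apply hgc, hin]
    simp only [gradSymb, smul_eq_mul]
    ring
  constructor
  · intro h
    have h1 := congrArg (fun d : 𝓢'(E3, ℂ) => 𝓕 d) h
    simp only at h1
    rw [Lp.fourier_toTemperedDistribution_eq (u.snd j)] at h1
    -- Compactly supported smooth functions already determine a locally integrable function, so they
    -- are the only Schwartz functions tested here.
    refine ae_eq_of_integral_contDiff_smul_eq ((Lp.memLp _).locallyIntegrable (by norm_num)) ?_ ?_
    · exact ((Lp.memLp (𝓕 u.fst : L2)).locallyIntegrable (by norm_num)).continuous_smul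
        (continuous_gradSymb j)
    · intro g hg1 hg2
      have hg₁ : HasCompactSupport (Complex.ofRealCLM ∘ g) := hg2.comp_left rfl
      have hg₂ : ContDiff ℝ ∞ (Complex.ofRealCLM ∘ g) := by fun_prop
      have h2 := key (hg₁.toSchwartzMap hg₂)
      rw [h1, Lp.toTemperedDistribution_apply] at h2
      simpa using h2
  · intro h
    have h1 : 𝓕 (∂_{(EuclideanSpace.single j (1 : ℝ) : E3)} (u.fst : 𝓢'(E3, ℂ)))
        = 𝓕 (u.snd j : 𝓢'(E3, ℂ)) := by
      ext ψ
      rw [key, Lp.fourier_toTemperedDistribution_eq, Lp.toTemperedDistribution_apply]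
      apply integral_congr_ae
      filter_upwards [h] with ξ hξ
      rw [hξ]
    have h2 := congrArg (fun d : 𝓢'(E3, ℂ) => 𝓕⁻ d) h1
    simpa using h2

end ForcedNLW

end

noncomputable section

namespace ForcedNLW

open Filter Topology FourierTransform

/-! ### Duhamel integrals of strongly continuous families -/

section Duhamel

variable {X Y : Type*} [NormedAddCommGroup X] [NormedSpace ℂ X] [CompleteSpace X]
  [NormedAddCommGroup Y] [NormedSpace ℂ Y]

/-- The propagators are only strongly continuous in time. Each orbit is bounded on a compact
interval, and Banach–Steinhaus makes the bound uniform. -/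
theorem exists_bound_of_strongly_continuous {K : ℝ → X →L[ℂ] Y}
    (hK : ∀ x, Continuous fun t => K t x) (R : ℝ) :
    ∃ M : ℝ, 0 ≤ M ∧ ∀ t, |t| ≤ R → ‖K t‖ ≤ M := by
  have h : ∀ x, ∃ C, ∀ t : Icc (-R) R, ‖K t x‖ ≤ C := by
    intro x
    obtain ⟨C, hC⟩ := isCompact_Icc.exists_bound_of_continuousOn (hK x).continuousOn (s := Icc (-R) R)
    exact ⟨C, fun t => hC t t.2⟩
  obtain ⟨C, hC⟩ := banach_steinhaus h
  refine ⟨max C 0, le_max_right _ _, fun t ht => ?_⟩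
  exact (hC ⟨t, abs_le.1 ht⟩).trans (le_max_left _ _)

/-- Local uniform boundedness upgrades strong continuity to joint continuity; this is what makes `s
↦ K (t - s) (G s)` measurable. -/
theorem continuous_uncurry_of_strongly_continuous {K : ℝ → X →L[ℂ] Y}
    (hK : ∀ x, Continuous fun t => K t x) : Continuous (fun z : ℝ × X => K z.1 z.2) := by
  rw [continuous_iff_continuousAt]
  rintro ⟨t₀, x₀⟩
  obtain ⟨M, hM0, hM⟩ := exists_bound_of_strongly_continuous hK (|t₀| + 1)
  unfold ContinuousAt
  rw [tendsto_iff_norm_sub_tendsto_zero]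
  have hev : ∀ᶠ z : ℝ × X in 𝓝 (t₀, x₀), |z.1| ≤ |t₀| + 1 := by
    have : Continuous fun z : ℝ × X => |z.1| := by fun_prop
    exact this.continuousAt.eventually_le_const (by simp)
  refine squeeze_zero' (Eventually.of_forall fun _ => norm_nonneg _)
    (g := fun z => M * ‖z.2 - x₀‖ + ‖K z.1 x₀ - K t₀ x₀‖) ?_ ?_
  · filter_upwards [hev] with z hz
    calc ‖K z.1 z.2 - K t₀ x₀‖ = ‖K z.1 (z.2 - x₀) + (K z.1 x₀ - K t₀ x₀)‖ := by
          rw [map_sub]; congr 1; abel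
      _ ≤ ‖K z.1 (z.2 - x₀)‖ + ‖K z.1 x₀ - K t₀ x₀‖ := norm_add_le _ _
      _ ≤ _ := by
          gcongr
          exact (K z.1).le_of_opNorm_le (hM _ hz) _
  · have : Continuous fun z : ℝ × X => M * ‖z.2 - x₀‖ + ‖K z.1 x₀ - K t₀ x₀‖ := by
      have h1 := (hK x₀).comp (continuous_fst (X := ℝ) (Y := X))
      simp only [Function.comp_def] at h1
      fun_prop
    have h := this.tendsto (t₀, x₀)
    simpa using h

theorem aestronglyMeasurable_family {α : Type*} [MeasurableSpace α] {μ : Measure α}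
    {K : ℝ → X →L[ℂ] Y} (hK : ∀ x, Continuous fun t => K t x) {τ : α → ℝ} {G : α → X}
    (hτ : AEStronglyMeasurable τ μ) (hG : AEStronglyMeasurable G μ) :
    AEStronglyMeasurable (fun s => K (τ s) (G s)) μ :=
  (continuous_uncurry_of_strongly_continuous hK).comp_aestronglyMeasurable (hτ.prodMk hG)

/-- The Duhamel integral `∫₀ᵗ K(t-s) G(s) ds`. -/
def duh (K : ℝ → X →L[ℂ] Y) (G : ℝ → X) (t : ℝ) : Y := ∫ s in Icc 0 t, K (t - s) (G s)

omit [CompleteSpace X] in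
-- The variable endpoint moves into an indicator, so that the measure no longer depends on `t` and
-- the theorems on parametric integrals apply.
theorem duh_eq {K : ℝ → X →L[ℂ] Y} {G : ℝ → X} {T t : ℝ} (ht : t ∈ Icc 0 T) :
    duh K G t = ∫ s in Icc 0 T, (Iic t).indicator (fun s => K (t - s) (G s)) s := by
  rw [integral_indicator measurableSet_Iic, Measure.restrict_restrict measurableSet_Iic, duh]
  congr 2
  ext s
  simp only [mem_Icc, mem_inter_iff, mem_Iic]
  constructor
  · rintro ⟨h1, h2⟩; exact ⟨h2, h1, h2.trans ht.2⟩
  · rintro ⟨h1, h2, _⟩; exact ⟨h2, h1⟩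

theorem integrable_duh {K : ℝ → X →L[ℂ] Y} (hK : ∀ x, Continuous fun t => K t x) {G : ℝ → X}
    {t : ℝ} (hG : IntegrableOn G (Icc 0 t)) :
    IntegrableOn (fun s => K (t - s) (G s)) (Icc 0 t) := by
  obtain ⟨M, hM0, hM⟩ := exists_bound_of_strongly_continuous hK (2 * |t|)
  refine Integrable.mono' (hG.norm.const_mul M) (aestronglyMeasurable_family hK
    (by fun_prop) hG.aestronglyMeasurable) ?_
  filter_upwards [ae_restrict_mem measurableSet_Icc] with s hs
  refine (K (t - s)).le_of_opNorm_le (hM _ ?_) _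
  rw [abs_le]
  constructor <;> linarith [hs.1, hs.2, le_abs_self t, abs_nonneg t]

theorem continuousOn_duh {K : ℝ → X →L[ℂ] Y} (hK : ∀ x, Continuous fun t => K t x) {G : ℝ → X}
    {T : ℝ} (hG : IntegrableOn G (Icc 0 T)) : ContinuousOn (duh K G) (Icc 0 T) := by
  obtain ⟨M, hM0, hM⟩ := exists_bound_of_strongly_continuous hK (|T|)
  suffices h : ContinuousOn (fun t => ∫ s in Icc 0 T,
      (Iic t).indicator (fun s => K (t - s) (G s)) s) (Icc 0 T) from
    h.congr fun t ht => duh_eq ht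
  intro t₀ ht₀
  refine continuousWithinAt_of_dominated (bound := fun s => M * ‖G s‖) ?_ ?_
    (hG.norm.const_mul M) ?_
  · filter_upwards with t
    exact (aestronglyMeasurable_family hK (by fun_prop) hG.aestronglyMeasurable).indicator
      measurableSet_Iic
  · filter_upwards [self_mem_nhdsWithin] with t ht
    filter_upwards [ae_restrict_mem measurableSet_Icc] with s hs
    rw [norm_indicator_eq_indicator_norm]
    by_cases hst : s ∈ Iic t
    · rw [indicator_of_mem hst]
      refine (K (t - s)).le_of_opNorm_le (hM _ ?_) _
      rw [abs_of_nonneg (sub_nonneg.2 hst)]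
      linarith [hs.1, ht.2, le_abs_self T]
    · rw [indicator_of_notMem hst]
      positivity
  · have : ∀ᵐ s ∂(volume.restrict (Icc 0 T)), s ≠ t₀ :=
      ae_restrict_of_ae (Measure.ae_ne volume t₀)
    filter_upwards [this] with s hs
    rcases lt_or_gt_of_ne hs with h | h
    · have h1 : ContinuousAt (fun t => K (t - s) (G s)) t₀ :=
        ((hK (G s)).comp (continuous_id.sub continuous_const)).continuousAt
      refine (h1.congr ?_).continuousWithinAt
      filter_upwards [Ioi_mem_nhds h] with t ht
      rw [indicator_of_mem (mem_Iic.2 (le_of_lt ht))]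
    · have h1 : ContinuousAt (fun _ : ℝ => (0 : Y)) t₀ := continuousAt_const
      refine (h1.congr ?_).continuousWithinAt
      filter_upwards [Iio_mem_nhds h] with t ht
      rw [indicator_of_notMem (by simpa using ht)]

/-- For merely integrable `G` the boundary term `S(0) G(t)` of the usual differentiation rule has no
meaning, but `S 0 = 0` removes it. With the indicator included, `t ↦ 1_{s ≤ t} S(t-s) G(s)` is
Lipschitz with constant `‖G s‖` across the kink `t = s`, and it is differentiable at `t` for every
`s ≠ t`. Differentiation under the integral then applies for integrable `G`. -/
theorem hasDerivWithinAt_duh [CompleteSpace Y] {S C : ℝ → X →L[ℂ] Y}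
    (hC : ∀ x, Continuous fun t => C t x) (hS0 : S 0 = 0)
    (hLip : ∀ t s x, ‖S t x - S s x‖ ≤ |t - s| * ‖x‖)
    (hder : ∀ t x, HasDerivAt (fun s => S s x) (C t x) t) {G : ℝ → X} {T : ℝ}
    (hG : IntegrableOn G (Icc 0 T)) {t : ℝ} (ht : t ∈ Icc 0 T) :
    HasDerivWithinAt (duh S G) (duh C G t) (Icc 0 T) t := by
  have hS : ∀ x, Continuous fun t => S t x := fun x =>
    continuous_iff_continuousAt.2 fun t => (hder t x).continuousAt
  have hmeas : ∀ τ, AEStronglyMeasurable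
      (fun s => (Iic τ).indicator (fun s => S (τ - s) (G s)) s) (volume.restrict (Icc 0 T)) :=
    fun τ => (aestronglyMeasurable_family hS (by fun_prop) hG.aestronglyMeasurable).indicator
      measurableSet_Iic
  have hb : ∀ τ σ s : ℝ, ‖(Iic τ).indicator (fun s => S (τ - s) (G s)) s
      - (Iic σ).indicator (fun s => S (σ - s) (G s)) s‖ ≤ |τ - σ| * ‖G s‖ := by
    intro τ σ s
    by_cases h1 : s ≤ τ <;> by_cases h2 : s ≤ σ
    · rw [indicator_of_mem (mem_Iic.2 h1), indicator_of_mem (mem_Iic.2 h2)]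
      simpa using hLip (τ - s) (σ - s) (G s)
    · rw [indicator_of_mem (mem_Iic.2 h1), indicator_of_notMem (by simpa using h2)]
      have := hLip (τ - s) 0 (G s)
      rw [hS0, zero_apply] at this
      refine this.trans (mul_le_mul_of_nonneg_right ?_ (norm_nonneg _))
      push Not at h2
      rw [sub_zero, abs_of_nonneg (by linarith), abs_of_nonneg (by linarith)]
      linarith
    · rw [indicator_of_notMem (by simpa using h1), indicator_of_mem (mem_Iic.2 h2)]
      have := hLip 0 (σ - s) (G s)
      rw [hS0, zero_apply] at this
      refine this.trans (mul_le_mul_of_nonneg_right ?_ (norm_nonneg _))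
      push Not at h1
      rw [zero_sub, abs_neg, abs_of_nonneg (by linarith), abs_of_nonpos (by linarith)]
      linarith
    · rw [indicator_of_notMem (by simpa using h1), indicator_of_notMem (by simpa using h2)]
      simp only [sub_zero, norm_zero]
      positivity
  have key := (hasDerivAt_integral_of_dominated_loc_of_lip (μ := volume.restrict (Icc 0 T))
    (F := fun τ s => (Iic τ).indicator (fun s => S (τ - s) (G s)) s) (x₀ := t)
    (F' := fun s => (Iic t).indicator (fun s => C (t - s) (G s)) s) (s := univ)
    (bound := fun s => ‖G s‖) univ_mem (Eventually.of_forall hmeas) ?_ ?_ ?_ hG.norm ?_).2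
  · rw [duh_eq ht]
    exact key.hasDerivWithinAt.congr (fun τ hτ => duh_eq hτ) (duh_eq ht)
  · refine Integrable.mono' ((hG.norm.const_mul |t|)) (hmeas t) ?_
    filter_upwards [ae_restrict_mem measurableSet_Icc] with s hs
    -- Comparison with time `0`: there the indicator leaves at most `s = 0`, where `S 0 = 0` makes
    -- the integrand vanish.
    have h1 := hb t 0 s
    by_cases h2 : s ≤ 0
    · have h3 : s = 0 := le_antisymm h2 hs.1
      rw [h3] at h1 ⊢
      rw [indicator_of_mem (mem_Iic.2 le_rfl) (fun s => S (0 - s) (G s))] at h1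
      simpa [hS0] using h1
    · rw [indicator_of_notMem (a := s) (s := Iic 0) (by simpa using h2)] at h1
      simpa using h1
  · exact (aestronglyMeasurable_family hC (by fun_prop) hG.aestronglyMeasurable).indicator
      measurableSet_Iic
  · filter_upwards with s
    refine LipschitzOnWith.of_dist_le_mul fun τ _ σ _ => ?_
    rw [dist_eq_norm, Real.dist_eq, mul_comm]
    simpa using hb τ σ s
  · have : ∀ᵐ s ∂(volume.restrict (Icc 0 T)), s ≠ t :=
      ae_restrict_of_ae (Measure.ae_ne volume t)
    filter_upwards [this] with s hs
    rcases lt_or_gt_of_ne hs with h | h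
    · rw [indicator_of_mem (mem_Iic.2 h.le)]
      have h1 : HasDerivAt (fun τ => S (τ - s) (G s)) (C (t - s) (G s)) t := by
        have := (hder (t - s) (G s)).scomp t ((hasDerivAt_id t).sub_const s)
        simpa [Function.comp_def] using this
      refine h1.congr_of_eventuallyEq ?_
      filter_upwards [Ioi_mem_nhds h] with τ hτ
      rw [indicator_of_mem (mem_Iic.2 (le_of_lt hτ))]
    · rw [indicator_of_notMem (by simpa using h)]
      refine (hasDerivAt_const t (0 : Y)).congr_of_eventuallyEq ?_
      filter_upwards [Iio_mem_nhds h] with τ hτ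
      rw [indicator_of_notMem (by simpa using hτ)]

theorem duh_map {Z : Type*} [NormedAddCommGroup Z] [NormedSpace ℂ Z] [CompleteSpace Y]
    [CompleteSpace Z] {K : ℝ → X →L[ℂ] Y}
    (hK : ∀ x, Continuous fun t => K t x) (A : Y →L[ℂ] Z) {G : ℝ → X} {t : ℝ}
    (hG : IntegrableOn G (Icc 0 t)) : A (duh K G t) = duh (fun τ => A ∘L K τ) G t := by
  unfold duh
  rw [← ContinuousLinearMap.integral_comp_comm A (integrable_duh hK hG)]
  rfl

end Duhamel

/-! ### The wave propagators -/

/-- The map `x ↦ (f x, (gⱼ x)ⱼ)` into `L² × (L²)³`. -/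
def pairL {X : Type*} [NormedAddCommGroup X] [NormedSpace ℂ X] (f : X →L[ℂ] L2)
    (g : Fin 3 → X →L[ℂ] L2) : X →L[ℂ] L2Pair :=
  ((WithLp.prodContinuousLinearEquiv 2 ℂ L2 (PiLp 2 (fun _ : Fin 3 => L2))).symm :
      L2 × PiLp 2 (fun _ : Fin 3 => L2) →L[ℂ] L2Pair) ∘L
    (f.prod (((PiLp.continuousLinearEquiv 2 ℂ (fun _ : Fin 3 => L2)).symm :
      (Fin 3 → L2) →L[ℂ] PiLp 2 (fun _ : Fin 3 => L2)) ∘L ContinuousLinearMap.pi g))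

@[simp]
theorem pairL_fst {X : Type*} [NormedAddCommGroup X] [NormedSpace ℂ X] (f : X →L[ℂ] L2)
    (g : Fin 3 → X →L[ℂ] L2) (x : X) : (pairL f g x).fst = f x := rfl

@[simp]
theorem pairL_snd {X : Type*} [NormedAddCommGroup X] [NormedSpace ℂ X] (f : X →L[ℂ] L2)
    (g : Fin 3 → X →L[ℂ] L2) (x : X) (j : Fin 3) : (pairL f g x).snd j = g j x := rfl

theorem continuous_pairL {X A : Type*} [NormedAddCommGroup X] [NormedSpace ℂ X]
    [TopologicalSpace A] {f : A → X →L[ℂ] L2} {g : A → Fin 3 → X →L[ℂ] L2} (x : X)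
    (hf : Continuous fun t => f t x) (hg : ∀ j, Continuous fun t => g t j x) :
    Continuous fun t => pairL (f t) (g t) x := by
  refine (WithLp.prodContinuousLinearEquiv 2 ℂ L2
    (PiLp 2 (fun _ : Fin 3 => L2))).symm.continuous.comp (hf.prodMk ?_)
  exact (PiLp.continuousLinearEquiv 2 ℂ (fun _ : Fin 3 => L2)).symm.continuous.comp
    (continuous_pi hg)

/-- Differentiation is continuous on tempered distributions and `L²` embeds continuously in them, so
the graph of the weak gradient is closed. Completeness of `H¹` follows. -/
theorem isClosed_H1 : IsClosed (H1 : Set L2Pair) := by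
  have : (H1 : Set L2Pair) = {u : L2Pair | ∀ j : Fin 3,
      LineDeriv.lineDerivOpCLM ℂ 𝓢'(E3, ℂ) (EuclideanSpace.single j (1 : ℝ) : E3)
        (Lp.toTemperedDistributionCLM ℂ volume 2 u.fst)
      = Lp.toTemperedDistributionCLM ℂ volume 2 (u.snd j)} := rfl
  rw [this]
  simp only [ofPred_forall]
  refine isClosed_iInter fun j => isClosed_eq ?_ ?_
  · exact (ContinuousLinearMap.continuous _).comp ((ContinuousLinearMap.continuous _).comp
      (by fun_prop))
  · exact (ContinuousLinearMap.continuous _).comp (by fun_prop)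

instance : CompleteSpace H1 := isClosed_H1.completeSpace_coe

/-- The inclusion `H¹ ⊂ L²` as a continuous linear map. -/
def toL2L : H1 →L[ℂ] L2 :=
  (ContinuousLinearMap.fst ℂ L2 (PiLp 2 (fun _ : Fin 3 => L2))) ∘L
    ((WithLp.prodContinuousLinearEquiv 2 ℂ L2 (PiLp 2 (fun _ : Fin 3 => L2))) :
      L2Pair →L[ℂ] L2 × PiLp 2 (fun _ : Fin 3 => L2)) ∘L H1.subtypeL

theorem toL2L_apply (u : H1) : toL2L u = toL2 u := rfl

/-- The weak partial derivative `∂ⱼ : H¹ → L²`. -/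
def gradL (j : Fin 3) : H1 →L[ℂ] L2 :=
  (ContinuousLinearMap.proj (R := ℂ) (φ := fun _ : Fin 3 => L2) j) ∘L
    ((PiLp.continuousLinearEquiv 2 ℂ (fun _ : Fin 3 => L2)) :
      PiLp 2 (fun _ : Fin 3 => L2) →L[ℂ] (Fin 3 → L2)) ∘L
    (ContinuousLinearMap.snd ℂ L2 (PiLp 2 (fun _ : Fin 3 => L2))) ∘L
    ((WithLp.prodContinuousLinearEquiv 2 ℂ L2 (PiLp 2 (fun _ : Fin 3 => L2))) :
      L2Pair →L[ℂ] L2 × PiLp 2 (fun _ : Fin 3 => L2)) ∘L H1.subtypeL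

theorem fourier_gradL (j : Fin 3) (u : H1) : ((𝓕 (gradL j u) : L2) : E3 → ℂ) =ᵐ[volume]
    fun ξ => gradSymb j ξ * (𝓕 (toL2 u) : L2) ξ :=
  (mem_H1_iff u).1 u.2 j

/-- `sin(t√(-Δ))/√(-Δ) : L² → H¹`. -/
def sinH1 (t : ℝ) : L2 →L[ℂ] H1 :=
  -- The product symbol is taken as one multiplier: it is bounded although `gradSymb j` alone is
  -- not.
  (pairL (fmul (sinSymb t)) fun j => fmul (fun ξ => gradSymb j ξ * sinSymb t ξ)).codRestrict H1
    (by
      intro g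
      rw [mem_H1_iff]
      intro j
      rw [pairL_snd, pairL_fst]
      filter_upwards [fmul_ae (symb_sin t) g, fmul_ae (symb_grad_sin j t) g] with ξ h1 h2
      rw [h2, h1, mul_assoc])

/-- `cos(t√(-Δ)) : H¹ → H¹`. -/
def cosH1 (t : ℝ) : H1 →L[ℂ] H1 :=
  (pairL (fmul (cosSymb t) ∘L toL2L) fun j => fmul (cosSymb t) ∘L gradL j).codRestrict H1
    (by
      intro u
      rw [mem_H1_iff]
      intro j
      rw [pairL_snd, pairL_fst]
      simp only [ContinuousLinearMap.comp_apply, toL2L_apply]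
      filter_upwards [fmul_ae (symb_cos t) (toL2 u), fmul_ae (symb_cos t) (gradL j u),
        fourier_gradL j u] with ξ h1 h2 h3
      rw [h2, h1, h3, mul_left_comm])

/-- `-√(-Δ) sin(t√(-Δ)) : H¹ → L²`. -/
def velH1 (t : ℝ) : H1 →L[ℂ] L2 :=
  -- `-κ sin(tκ) = ∑ⱼ (2πiξⱼ)² sin(tκ)/κ`: one derivative falls on the datum, the other is absorbed
  -- by the sine propagator.
  ∑ j : Fin 3, fmul (fun ξ => gradSymb j ξ * sinSymb t ξ) ∘L gradL j

theorem continuous_sinH1 (g : L2) : Continuous fun t => sinH1 t g :=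
  Continuous.subtype_mk (continuous_pairL g (continuous_fmul_sin g)
    fun j => continuous_fmul_grad_sin j g) _

theorem continuous_cosH1 (u : H1) : Continuous fun t => cosH1 t u :=
  Continuous.subtype_mk (continuous_pairL u (continuous_fmul_cos (toL2 u))
    fun j => continuous_fmul_cos (gradL j u)) _

theorem continuous_velH1 (u : H1) : Continuous fun t => velH1 t u := by
  unfold velH1
  simp only [sum_apply, ContinuousLinearMap.comp_apply]
  exact continuous_finsetSum _ fun j _ => continuous_fmul_grad_sin j _

/-- The symbol `-iξⱼ/|ξ|`. -/
def rieszSymb (j : Fin 3) (ξ : E3) : ℂ := -Complex.I * ((ξ j / ‖ξ‖ : ℝ) : ℂ)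

theorem norm_rieszSymb_le (j : Fin 3) (ξ : E3) : ‖rieszSymb j ξ‖ ≤ 1 := by
  unfold rieszSymb
  rw [norm_mul, norm_neg, Complex.norm_I, one_mul, Complex.norm_real, norm_div, norm_norm]
  exact div_le_one_of_le₀ (PiLp.norm_apply_le ξ j) (norm_nonneg _)

theorem symb_riesz (j : Fin 3) : Symb (rieszSymb j) := by
  refine ⟨?_, 1, norm_rieszSymb_le j⟩
  unfold rieszSymb
  fun_prop

/-- `√(-Δ) : H¹ → L²`. -/
def absD : H1 →L[ℂ] L2 := ∑ j : Fin 3, fmul (rieszSymb j) ∘L gradL j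

theorem sum_sq_eq (ξ : E3) : ∑ j : Fin 3, (ξ j) ^ 2 = ‖ξ‖ ^ 2 := by
  rw [EuclideanSpace.norm_sq_eq]; simp

theorem fourier_sum (a : Fin 3 → L2) : (𝓕 (∑ j, a j) : L2) = ∑ j, 𝓕 (a j) :=
  map_sum (Lp.fourierTransformₗᵢ E3 ℂ) a Finset.univ

theorem coeFn_sum3 (a : Fin 3 → L2) :
    ((∑ j, a j : L2) : E3 → ℂ) =ᵐ[volume] fun ξ => ∑ j, a j ξ := by
  simp only [Fin.sum_univ_three]
  filter_upwards [Lp.coeFn_add (a 0 + a 1) (a 2), Lp.coeFn_add (a 0) (a 1)] with ξ h1 h2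
  rw [h1, Pi.add_apply, h2, Pi.add_apply]

/-- The Riesz symbols satisfy `∑ⱼ (-iξⱼ/|ξ|)(2πiξⱼ) = 2π|ξ|`, so `√(-Δ)` is built from the weak
gradient by bounded multipliers only. -/
theorem fourier_absD (u : H1) : ((𝓕 (absD u) : L2) : E3 → ℂ) =ᵐ[volume]
    fun ξ => (kap ξ : ℂ) * (𝓕 (toL2 u) : L2) ξ := by
  unfold absD
  simp only [sum_apply, ContinuousLinearMap.comp_apply]
  rw [fourier_sum]
  have h1 : ∀ᵐ ξ : E3, ∀ j, (𝓕 (fmul (rieszSymb j) (gradL j u)) : L2) ξ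
      = rieszSymb j ξ * (gradSymb j ξ * (𝓕 (toL2 u) : L2) ξ) := by
    rw [ae_all_iff]
    intro j
    filter_upwards [fmul_ae (symb_riesz j) (gradL j u), fourier_gradL j u] with ξ h1 h2
    rw [h1, h2]
  filter_upwards [coeFn_sum3 fun j => 𝓕 (fmul (rieszSymb j) (gradL j u)), h1] with ξ h2 h3
  rw [h2]
  simp_rw [h3, ← mul_assoc, ← Finset.sum_mul]
  congr 1
  unfold rieszSymb gradSymb kap
  by_cases h : ‖ξ‖ = 0
  · have : ξ = 0 := by simpa using h
    simp [this]
  have e : ∀ j : Fin 3, -Complex.I * ((ξ j / ‖ξ‖ : ℝ) : ℂ) * (2 * Real.pi * Complex.I * (ξ j : ℝ))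
      = ((2 * Real.pi / ‖ξ‖ * (ξ j) ^ 2 : ℝ) : ℂ) := by
    intro j
    push_cast
    ring_nf
    rw [Complex.I_sq]
    ring
  simp_rw [e]
  rw [← Complex.ofReal_sum, ← Finset.mul_sum, sum_sq_eq]
  congr 1
  field_simp

/-- A factor `κ` is traded between symbol and function. It is used where `m / κ` has better bounds
than `m`, and to make only the homogeneous norm of `v₁` appear in the Strichartz estimate. -/
theorem fmul_toL2_eq_fmul_absD {m n : E3 → ℂ} (hm : Symb m) (hn : Symb n)
    (h : ∀ᵐ ξ, m ξ = n ξ * kap ξ) (u : H1) : fmul m (toL2 u) = fmul n (absD u) := by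
  apply L2_ext_fourier
  filter_upwards [fmul_ae hm (toL2 u), fmul_ae hn (absD u), fourier_absD u, h] with ξ h1 h2 h3 h4
  rw [h1, h2, h3, h4, mul_assoc]

/-- The symbol `sin(t√(-Δ))`. -/
def sineSymb (t : ℝ) (ξ : E3) : ℂ := (Real.sin (t * kap ξ) : ℝ)

theorem norm_sineSymb_le (t : ℝ) (ξ : E3) : ‖sineSymb t ξ‖ ≤ 1 := by
  unfold sineSymb
  rw [Complex.norm_real]
  exact Real.abs_sin_le_one _

theorem continuous_sineSymb (t : ℝ) : Continuous (sineSymb t) := by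
  unfold sineSymb
  have := continuous_kap
  fun_prop

theorem symb_sine (t : ℝ) : Symb (sineSymb t) :=
  ⟨(continuous_sineSymb t).measurable, 1, norm_sineSymb_le t⟩

theorem velH1_eq (t : ℝ) (u : H1) : velH1 t u = -fmul (sineSymb t) (absD u) := by
  have hneg : Symb (fun ξ => (-1 : ℂ) * sineSymb t ξ) :=
    Symb.mul (m := fun _ => (-1 : ℂ)) ⟨measurable_const, 1, fun _ => by simp⟩ (symb_sine t)
  have : -fmul (sineSymb t) (absD u) = fmul (fun ξ => (-1 : ℂ) * sineSymb t ξ) (absD u) := by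
    rw [fmul_const_mul_symb (symb_sine t), neg_one_smul]
  rw [this]
  apply L2_ext_fourier
  unfold velH1
  simp only [sum_apply, ContinuousLinearMap.comp_apply]
  rw [fourier_sum]
  have h1 : ∀ᵐ ξ : E3, ∀ j,
      (𝓕 (fmul (fun ξ => gradSymb j ξ * sinSymb t ξ) (gradL j u)) : L2) ξ
      = gradSymb j ξ * sinSymb t ξ * (gradSymb j ξ * (𝓕 (toL2 u) : L2) ξ) := by
    rw [ae_all_iff]
    intro j
    filter_upwards [fmul_ae (symb_grad_sin j t) (gradL j u), fourier_gradL j u] with ξ h1 h2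
    rw [h1, h2]
  filter_upwards [coeFn_sum3 fun j => 𝓕 (fmul (fun ξ => gradSymb j ξ * sinSymb t ξ) (gradL j u)),
    h1, fmul_ae hneg (absD u), fourier_absD u] with ξ h2 h3 h4 h5
  rw [h2, h4, h5]
  simp_rw [h3]
  have e : ∀ j : Fin 3, gradSymb j ξ * sinSymb t ξ * (gradSymb j ξ * (𝓕 (toL2 u) : L2) ξ)
      = (((ξ j) ^ 2 : ℝ) : ℂ) * (-(4 * Real.pi ^ 2) * sinSymb t ξ * (𝓕 (toL2 u) : L2) ξ) := by
    intro j
    unfold gradSymb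
    push_cast
    ring_nf
    rw [Complex.I_sq]
    ring
  simp_rw [e]
  rw [← Finset.sum_mul, ← Complex.ofReal_sum, sum_sq_eq, sineSymb, ← kap_mul_sinSymb]
  unfold kap
  push_cast
  ring

theorem abs_cos_sub_le (t s k : ℝ) (hk : 0 ≤ k) :
    |Real.cos (t * k) - Real.cos (s * k)| ≤ |t - s| * k := by
  have := Real.lipschitzWith_cos.dist_le_mul (t * k) (s * k)
  rw [Real.dist_eq, Real.dist_eq, ← sub_mul, abs_mul, abs_of_nonneg hk] at this
  simpa using this

theorem ae_ne_zero_E3 : ∀ᵐ ξ : E3, ξ ≠ 0 := Measure.ae_ne volume 0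

/-- The difference quotients of `cos(tκ)` grow like `κ`. Divided by `κ` and applied to `√(-Δ)u` they
are bounded by 1 and converge to `-sin(tκ)`; this is where `u ∈ H¹` enters. -/
theorem hasDerivAt_fmul_cos_toL2 (t : ℝ) (u : H1) :
    HasDerivAt (fun s => fmul (cosSymb s) (toL2 u)) (velH1 t u) t := by
  rw [velH1_eq, hasDerivAt_iff_tendsto_slope]
  set n : ℝ → E3 → ℂ := fun s ξ =>
    (((s - t)⁻¹ * ((Real.cos (s * kap ξ) - Real.cos (t * kap ξ)) / kap ξ) : ℝ) : ℂ) with hn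
  have hnm : ∀ s, Measurable (n s) := by
    intro s
    have := continuous_kap.measurable
    simp only [hn]
    fun_prop
  have hnb : ∀ s ξ, ‖n s ξ‖ ≤ 1 := by
    intro s ξ
    simp only [hn]
    rw [Complex.norm_real, norm_mul, norm_inv, norm_div, Real.norm_eq_abs, Real.norm_eq_abs,
      Real.norm_of_nonneg (kap_nonneg ξ)]
    calc |s - t|⁻¹ * (|Real.cos (s * kap ξ) - Real.cos (t * kap ξ)| / kap ξ)
        ≤ |s - t|⁻¹ * |s - t| := by
          gcongr
          exact div_le_of_le_mul₀ (kap_nonneg ξ) (abs_nonneg _) (abs_cos_sub_le s t _ (kap_nonneg ξ))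
      _ ≤ 1 := inv_mul_le_one
  have hns : ∀ s, Symb (n s) := fun s => ⟨hnm s, 1, hnb s⟩
  have e : ∀ s, slope (fun s => fmul (cosSymb s) (toL2 u)) t s = fmul (n s) (absD u) := by
    intro s
    have hs : Symb (fun ξ => cosSymb s ξ - cosSymb t ξ) :=
      ⟨(symb_cos s).1.sub (symb_cos t).1, 1 + 1, fun ξ => (norm_sub_le _ _).trans
        (add_le_add (norm_cosSymb_le _ _) (norm_cosSymb_le _ _))⟩
    have hs' : Symb (fun ξ => (((s - t)⁻¹ : ℝ) : ℂ) * (cosSymb s ξ - cosSymb t ξ)) :=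
      Symb.mul (m := fun _ => (((s - t)⁻¹ : ℝ) : ℂ)) ⟨measurable_const, _, fun _ => le_rfl⟩ hs
    rw [← fmul_toL2_eq_fmul_absD hs' (hns s), fmul_const_mul_symb hs,
      fmul_sub_symb (symb_cos s) (symb_cos t), slope_def_module]
    · rfl
    · filter_upwards [ae_ne_zero_E3] with ξ hξ
      have := (kap_pos hξ).ne'
      simp only [hn, cosSymb]
      rw [← Complex.ofReal_sub, ← Complex.ofReal_mul, ← Complex.ofReal_mul]
      congr 1
      field_simp
  simp_rw [funext e]
  have hneg : Symb (fun ξ => (-1 : ℂ) * sineSymb t ξ) :=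
    Symb.mul (m := fun _ => (-1 : ℂ)) ⟨measurable_const, 1, fun _ => by simp⟩ (symb_sine t)
  have : -fmul (sineSymb t) (absD u) = fmul (fun ξ => (-1 : ℂ) * sineSymb t ξ) (absD u) := by
    rw [fmul_const_mul_symb (symb_sine t), neg_one_smul]
  rw [this]
  refine tendsto_fmul (C := 1) hnm hneg.1 hnb (fun ξ => by simpa using norm_sineSymb_le t ξ) ?_ _
  filter_upwards [ae_ne_zero_E3] with ξ hξ
  have hk := (kap_pos hξ).ne'
  have h1 : HasDerivAt (fun s => Real.cos (s * kap ξ) / kap ξ) (-Real.sin (t * kap ξ)) t := by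
    have := (((hasDerivAt_id t).mul_const (kap ξ)).cos).div_const (kap ξ)
    simp only [id_eq, one_mul] at this
    rwa [mul_div_cancel_right₀ _ hk] at this
  have h2 := (hasDerivAt_iff_tendsto_slope.1 h1).ofReal
  have h3 : ((-Real.sin (t * kap ξ) : ℝ) : ℂ) = -1 * sineSymb t ξ := by
    simp [sineSymb]
  rw [h3] at h2
  refine h2.congr fun s => ?_
  simp only [hn, slope_def_module, smul_eq_mul]
  rw [sub_div]

/-! ### The linear wave equation -/

/-- The solution of `-∂ₜ²v + Δv = G` with data `(v₁, v₂)`. -/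
def linV (v₁ : H1) (v₂ : L2) (G : ℝ → L2) (t : ℝ) : H1 :=
  -- The Duhamel term carries a minus sign because the equation reads `∂ₜ²v = Δv - G`.
  cosH1 t v₁ + sinH1 t v₂ - duh sinH1 G t

/-- The time derivative of `linV`. -/
def linW (v₁ : H1) (v₂ : L2) (G : ℝ → L2) (t : ℝ) : L2 :=
  velH1 t v₁ + fmul (cosSymb t) v₂ - duh (fun τ => fmul (cosSymb τ)) G t

theorem continuousOn_linV (v₁ : H1) (v₂ : L2) {G : ℝ → L2} {T : ℝ}
    (hG : IntegrableOn G (Icc 0 T)) : ContinuousOn (linV v₁ v₂ G) (Icc 0 T) :=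
  ((continuous_cosH1 v₁).add (continuous_sinH1 v₂)).continuousOn.sub
    (continuousOn_duh continuous_sinH1 hG)

theorem continuousOn_linW (v₁ : H1) (v₂ : L2) {G : ℝ → L2} {T : ℝ}
    (hG : IntegrableOn G (Icc 0 T)) : ContinuousOn (linW v₁ v₂ G) (Icc 0 T) :=
  ((continuous_velH1 v₁).add (continuous_fmul_cos v₂)).continuousOn.sub
    (continuousOn_duh continuous_fmul_cos hG)

theorem toL2_linV (v₁ : H1) (v₂ : L2) {G : ℝ → L2} {t : ℝ} (hG : IntegrableOn G (Icc 0 t)) :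
    toL2 (linV v₁ v₂ G t) = fmul (cosSymb t) (toL2 v₁) + fmul (sinSymb t) v₂
      - duh (fun τ => fmul (sinSymb τ)) G t := by
  rw [← toL2L_apply, linV, map_sub, map_add, duh_map continuous_sinH1 toL2L hG]
  rfl

theorem sinSymb_zero : fmul (sinSymb 0) = 0 := by
  ext1 f
  have := norm_fmul_le (symb_sin 0).1 (norm_sinSymb_le 0) f
  simpa using this

theorem cosSymb_zero (f : L2) : fmul (cosSymb 0) f = f := by
  have : cosSymb 0 = fun _ => 1 := by ext ξ; simp [cosSymb]
  rw [this, fmul_one]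

theorem hasDerivWithinAt_linV (v₁ : H1) (v₂ : L2) {G : ℝ → L2} {T : ℝ}
    (hG : IntegrableOn G (Icc 0 T)) {t : ℝ} (ht : t ∈ Icc 0 T) :
    HasDerivWithinAt (fun s => toL2 (linV v₁ v₂ G s)) (linW v₁ v₂ G t) (Icc 0 T) t := by
  have h1 := ((hasDerivAt_fmul_cos_toL2 t v₁).add (hasDerivAt_fmul_sin t v₂)).hasDerivWithinAt
    (s := Icc 0 T)
  have h2 := hasDerivWithinAt_duh (S := fun τ => fmul (sinSymb τ)) continuous_fmul_cos
    sinSymb_zero norm_fmul_sin_sub_le hasDerivAt_fmul_sin hG ht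
  have hG' : ∀ s ∈ Icc 0 T, IntegrableOn G (Icc 0 s) := fun s hs =>
    hG.mono_set (Icc_subset_Icc_right hs.2)
  exact (h1.sub h2).congr (fun s hs => toL2_linV v₁ v₂ (hG' s hs)) (toL2_linV v₁ v₂ (hG' t ht))

theorem linV_zero (v₁ : H1) (v₂ : L2) (G : ℝ → L2) : linV v₁ v₂ G 0 = v₁ := by
  have h1 : cosH1 0 v₁ = v₁ := by
    apply Subtype.ext
    change pairL _ _ _ = _
    refine WithLp.ofLp_injective 2 (Prod.ext ?_ ?_)
    · exact cosSymb_zero _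
    · refine PiLp.ext fun j => ?_
      exact cosSymb_zero _
  have h2 : sinH1 0 v₂ = 0 := by
    apply Subtype.ext
    change pairL _ _ _ = _
    refine WithLp.ofLp_injective 2 (Prod.ext ?_ ?_)
    · change fmul (sinSymb 0) v₂ = 0
      rw [sinSymb_zero]; rfl
    · refine PiLp.ext fun j => ?_
      change fmul (fun ξ => gradSymb j ξ * sinSymb 0 ξ) v₂ = 0
      have : (fun ξ => gradSymb j ξ * sinSymb 0 ξ) = fun ξ => 0 * cosSymb 0 ξ := by
        ext ξ; simp [sinSymb]
      rw [this, fmul_const_mul_symb (symb_cos 0), zero_smul]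
  have h3 : duh sinH1 G 0 = 0 := by simp [duh]
  rw [linV, h1, h2, h3]
  simp

theorem linW_zero (v₁ : H1) (v₂ : L2) (G : ℝ → L2) : linW v₁ v₂ G 0 = v₂ := by
  have h1 : velH1 0 v₁ = 0 := by
    rw [velH1_eq]
    have : sineSymb 0 = fun ξ => 0 * cosSymb 0 ξ := by
      ext ξ; simp [sineSymb]
    rw [this, fmul_const_mul_symb (symb_cos 0), zero_smul, neg_zero]
  have h3 : duh (fun τ => fmul (cosSymb τ)) G 0 = 0 := by simp [duh]
  rw [linW, h1, cosSymb_zero, h3]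
  simp

end ForcedNLW

end

noncomputable section

namespace ForcedNLW

open Filter Topology

/-! ### Radial integrals, Hardy–Littlewood–Sobolev and Young inequalities -/

theorem lintegral_radial {E : Type*} [NormedAddCommGroup E] [NormedSpace ℝ E] [Nontrivial E]
    [FiniteDimensional ℝ E] [MeasurableSpace E] [BorelSpace E] (μ : Measure E)
    [μ.IsAddHaarMeasure] {f : ℝ → ℝ} (hf : ∀ x, 0 ≤ x → 0 ≤ f x)
    (hi : IntegrableOn (fun y : ℝ => y ^ (Module.finrank ℝ E - 1) • f y) (Ioi 0)) :
    ∫⁻ x : E, ENNReal.ofReal (f ‖x‖) ∂μ = ENNReal.ofReal (Module.finrank ℝ E •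
      μ.real (Metric.ball 0 1) • ∫ y in Ioi (0 : ℝ), y ^ (Module.finrank ℝ E - 1) • f y) := by
  rw [← integral_fun_norm_addHaar, ofReal_integral_eq_lintegral_ofReal
    ((integrable_fun_norm_addHaar μ).2 hi) (ae_of_all _ fun x => hf _ (norm_nonneg _))]

theorem integral_indicator_Ici_rpow {e : ℝ} (he : e < -1) {c : ℝ} (hc : 0 < c) :
    IntegrableOn (fun y : ℝ => (Ici c).indicator (fun y => y ^ e) y) (Ioi 0) ∧
    ∫ y in Ioi (0 : ℝ), (Ici c).indicator (fun y => y ^ e) y = c ^ (e + 1) / (-(e + 1)) := by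
  have hsub : Ioi (0 : ℝ) ∩ Ici c = Ici c := inter_eq_right.2 fun x hx => hc.trans_le hx
  constructor
  · rw [IntegrableOn, integrable_indicator_iff measurableSet_Ici, IntegrableOn,
      Measure.restrict_restrict measurableSet_Ici, inter_comm, hsub,
      Measure.restrict_congr_set Ioi_ae_eq_Ici.symm]
    exact integrableOn_Ioi_rpow_of_lt he hc
  · rw [setIntegral_indicator measurableSet_Ici, hsub, integral_Ici_eq_integral_Ioi,
      integral_Ioi_rpow_of_lt he hc, neg_div, div_neg]

theorem integral_indicator_Iio_rpow {e : ℝ} (he : -1 < e) {c : ℝ} (hc : 0 < c) :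
    IntegrableOn (fun y : ℝ => (Iio c).indicator (fun y => y ^ e) y) (Ioi 0) ∧
    ∫ y in Ioi (0 : ℝ), (Iio c).indicator (fun y => y ^ e) y = c ^ (e + 1) / (e + 1) := by
  have hsub : Ioi (0 : ℝ) ∩ Iio c = Ioo 0 c := rfl
  constructor
  · rw [IntegrableOn, integrable_indicator_iff measurableSet_Iio, IntegrableOn,
      Measure.restrict_restrict measurableSet_Iio, inter_comm, hsub,
      Measure.restrict_congr_set Ioo_ae_eq_Ioc]
    exact (intervalIntegrable_iff_integrableOn_Ioc_of_le hc.le).1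
      (intervalIntegral.intervalIntegrable_rpow' he)
  · rw [setIntegral_indicator measurableSet_Iio, hsub, ← integral_Ioc_eq_integral_Ioo,
      ← intervalIntegral.integral_of_le hc.le, integral_rpow (Or.inl he),
      Real.zero_rpow (by linarith), sub_zero]

theorem lintegral_real_near {e : ℝ} (he : -1 < e) {c : ℝ} (hc : 0 < c) :
    ∫⁻ x : ℝ, ENNReal.ofReal ((Iio c).indicator (fun y => y ^ e) |x|)
      = ENNReal.ofReal (2 * (c ^ (e + 1) / (e + 1))) := by
  obtain ⟨h1, h2⟩ := integral_indicator_Iio_rpow he hc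
  have := lintegral_radial (volume : Measure ℝ) (f := (Iio c).indicator (fun y => y ^ e))
    (fun x hx => indicator_apply_nonneg fun _ => Real.rpow_nonneg hx _) (by simpa using h1)
  simpa [h2, Real.norm_eq_abs, Measure.real, Real.ball_eq_Ioo, one_add_one_eq_two] using this

theorem lintegral_real_far {e : ℝ} (he : e < -1) {c : ℝ} (hc : 0 < c) :
    ∫⁻ x : ℝ, ENNReal.ofReal ((Ici c).indicator (fun y => y ^ e) |x|)
      = ENNReal.ofReal (2 * (c ^ (e + 1) / (-(e + 1)))) := by
  obtain ⟨h1, h2⟩ := integral_indicator_Ici_rpow he hc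
  have := lintegral_radial (volume : Measure ℝ) (f := (Ici c).indicator (fun y => y ^ e))
    (fun x hx => indicator_apply_nonneg fun _ => Real.rpow_nonneg hx _) (by simpa using h1)
  simp only [Module.finrank_self, Nat.sub_self, pow_zero, one_smul, h2] at this
  simpa [Real.norm_eq_abs, Measure.real, Real.ball_eq_Ioo, one_add_one_eq_two] using this

/-- The exterior of a ball: `∫_{|x| ≥ c} |x|^e dx` in three dimensions. -/
theorem lintegral_E3_far {e : ℝ} (he : e < -3) :
    ∃ A : ℝ, 0 ≤ A ∧ ∀ c : ℝ, 0 < c →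
      ∫⁻ x : E3, ENNReal.ofReal ((Ici c).indicator (fun y => y ^ e) ‖x‖)
        = ENNReal.ofReal (A * c ^ (e + 3)) := by
  refine ⟨3 * ((volume : Measure E3).real (Metric.ball 0 1) * (-(e + 3))⁻¹), ?_, fun c hc => ?_⟩
  · have : 0 ≤ (-(e + 3))⁻¹ := by rw [inv_nonneg]; linarith
    positivity
  obtain ⟨h1, h2⟩ := integral_indicator_Ici_rpow (e := e + 2) (by linarith) hc
  have e1 : ∀ y ∈ Ioi (0 : ℝ), y ^ (Module.finrank ℝ E3 - 1) • (Ici c).indicator (fun y => y ^ e) y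
      = (Ici c).indicator (fun y => y ^ (e + 2)) y := by
    intro y hy
    have hy' : (0 : ℝ) < y := hy
    by_cases h : y ∈ Ici c
    · simp only [indicator_of_mem h, finrank_euclideanSpace, Fintype.card_fin, smul_eq_mul]
      rw [Real.rpow_add hy', mul_comm]
      norm_num
    · simp [indicator_of_notMem h]
  have := lintegral_radial (volume : Measure E3) (f := (Ici c).indicator (fun y => y ^ e))
    (fun x hx => indicator_apply_nonneg fun _ => Real.rpow_nonneg hx _)
    ((integrableOn_congr_fun e1 measurableSet_Ioi).2 h1)
  rw [this, setIntegral_congr_fun measurableSet_Ioi e1, h2]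
  congr 1
  simp only [finrank_euclideanSpace, Fintype.card_fin, nsmul_eq_mul, smul_eq_mul]
  have : e + 2 + 1 = e + 3 := by ring
  rw [this]
  push_cast
  ring

/-- `∫_{|x| < 1} |x|^{-2} dx < ∞` in three dimensions. -/
theorem integrableOn_inv_norm_sq (c : ℝ) :
    IntegrableOn (fun x : E3 => (‖x‖ ^ 2)⁻¹) (Metric.ball 0 c) := by
  rw [integrableOn_fun_norm_addHaar volume (f := fun y : ℝ => (y ^ 2)⁻¹)]
  refine (integrableOn_congr_fun (g := fun _ : ℝ => (1 : ℝ)) (fun y hy => ?_) measurableSet_Ioo).2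
    (integrableOn_const (by simp))
  have : y ≠ 0 := hy.1.ne'
  simp only [finrank_euclideanSpace, Fintype.card_fin, smul_eq_mul]
  norm_num
  field_simp

/-- The convolution is split at distance `b`. Nearby the bound `y ≤ u` is used with `∫_{|x|<b}
|x|^{-l} ∼ b^{1-l}`. Far away Hölder with exponents `a` and `2/l` leaves `∫_{|x|≥b} |x|^{-2} = 2/b`.
Restricting to `{y ≤ u}` makes the final bound `u^{a-1} v^{1-l}`, which integrates against `y` with
`u = y t`. -/
theorem hls_inner {l a : ℝ} (hl0 : 0 < l) (hl1 : l < 1) (ha : a = 2 / (2 - l)) {y : ℝ → ℝ≥0∞}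
    (hy : Measurable y) {u v : ℝ} (hu : 0 < u) (hv : 0 < v)
    (hM : ∫⁻ s, y s ^ a = ENNReal.ofReal v) (t : ℝ) :
    ∫⁻ s in {s | y s ≤ ENNReal.ofReal u}, ENNReal.ofReal (|t - s| ^ (-l)) * y s
      ≤ ENNReal.ofReal ((2 / (1 - l) + 2) * (u ^ (a - 1) * v ^ (1 - l))) := by
  have h2l : 0 < 2 - l := by linarith
  have ha1 : 1 < a := by rw [ha, lt_div_iff₀ h2l]; linarith
  have ha0 : 0 < a := by linarith
  -- The splitting radius that makes the near and far parts have the same size.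
  set b : ℝ := v / u ^ a with hb
  have hb0 : 0 < b := by positivity
  have hconj : a.HolderConjugate (2 / l) := by
    rw [Real.holderConjugate_iff]
    refine ⟨ha1, ?_⟩
    rw [ha, inv_div, inv_div]; ring
  -- near part
  have hnear : ∫⁻ s, ENNReal.ofReal ((Iio b).indicator (fun y => y ^ (-l)) |t - s|)
      * ENNReal.ofReal u ≤ ENNReal.ofReal (2 / (1 - l) * (u ^ (a - 1) * v ^ (1 - l))) := by
    rw [lintegral_mul_const' _ _ ENNReal.ofReal_ne_top,
      lintegral_sub_left_eq_self (fun x : ℝ => ENNReal.ofReal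
        ((Iio b).indicator (fun y => y ^ (-l)) |x|)) t,
      lintegral_real_near (by linarith) hb0, ← ENNReal.ofReal_mul' hu.le]
    refine ENNReal.ofReal_le_ofReal (le_of_eq ?_)
    have e1 : b ^ (1 - l) = v ^ (1 - l) * u ^ (a - 2) := by
      rw [hb, Real.div_rpow hv.le (by positivity), ← Real.rpow_mul hu.le]
      have : a * (1 - l) = -(a - 2) := by rw [ha]; field_simp; ring
      rw [this, Real.rpow_neg hu.le, div_inv_eq_mul]
    have e2 : u ^ (a - 1) = u ^ (a - 2) * u := by
      rw [← Real.rpow_add_one hu.ne']; congr 1; ring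
    have e3 : -l + 1 = 1 - l := by ring
    rw [e3, e1, e2]
    ring
  -- far part
  have hfar : ∫⁻ s, y s * ENNReal.ofReal ((Ici b).indicator (fun y => y ^ (-l)) |t - s|)
      ≤ ENNReal.ofReal (2 * (u ^ (a - 1) * v ^ (1 - l))) := by
    have hm : Measurable fun s : ℝ =>
        ENNReal.ofReal ((Ici b).indicator (fun y => y ^ (-l)) |t - s|) := by
      have h1 : Measurable ((Ici b).indicator (fun y : ℝ => y ^ (-l))) :=
        (by fun_prop : Measurable fun y : ℝ => y ^ (-l)).indicator measurableSet_Ici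
      fun_prop
    refine (ENNReal.lintegral_mul_le_Lp_mul_Lq volume hconj hy.aemeasurable
      hm.aemeasurable).trans ?_
    have e1 : ∀ s : ℝ, ENNReal.ofReal ((Ici b).indicator (fun y => y ^ (-l)) |t - s|) ^ (2 / l)
        = ENNReal.ofReal ((Ici b).indicator (fun y => y ^ (-2 : ℝ)) |t - s|) := by
      intro s
      by_cases h : |t - s| ∈ Ici b
      · have h0 : 0 < |t - s| := hb0.trans_le h
        rw [indicator_of_mem h, indicator_of_mem h, ENNReal.ofReal_rpow_of_pos (by positivity),
          ← Real.rpow_mul h0.le]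
        congr 2
        field_simp
      · rw [indicator_of_notMem h, indicator_of_notMem h, ENNReal.ofReal_zero,
          ENNReal.zero_rpow_of_pos (by positivity)]
    simp_rw [e1]
    rw [lintegral_sub_left_eq_self (fun x : ℝ => ENNReal.ofReal
        ((Ici b).indicator (fun y => y ^ (-2 : ℝ)) |x|)) t,
      lintegral_real_far (by norm_num) hb0, hM, ENNReal.ofReal_rpow_of_pos hv,
      ENNReal.ofReal_rpow_of_pos (by norm_num; positivity), ← ENNReal.ofReal_mul (by positivity)]
    refine ENNReal.ofReal_le_ofReal ?_
    have e2 : (2 : ℝ) * (b ^ ((-2 : ℝ) + 1) / -(-2 + 1)) = 2 * (u ^ a / v) := by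
      norm_num
      rw [Real.rpow_neg_one, hb, inv_div]
    have e3 : 1 / a = 1 - l / 2 := by rw [ha]; field_simp
    have e4 : 1 / (2 / l) = l / 2 := by field_simp
    rw [e2, e4, e3, Real.mul_rpow (by norm_num) (by positivity),
      Real.div_rpow (by positivity) hv.le, ← Real.rpow_mul hu.le]
    have e5 : a * (l / 2) = a - 1 := by rw [ha]; field_simp; ring
    have e6 : v ^ (1 - l / 2) = v ^ (1 - l) * v ^ (l / 2) := by
      rw [← Real.rpow_add hv]; congr 1; ring
    rw [e5, e6]
    have h2 : (2 : ℝ) ^ (l / 2) ≤ 2 := by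
      calc (2 : ℝ) ^ (l / 2) ≤ 2 ^ (1 : ℝ) :=
            Real.rpow_le_rpow_of_exponent_le (by norm_num) (by linarith)
        _ = 2 := by norm_num
    have h3 : v ^ (l / 2) ≠ 0 := by positivity
    calc v ^ (1 - l) * v ^ (l / 2) * (2 ^ (l / 2) * (u ^ (a - 1) / v ^ (l / 2)))
        = 2 ^ (l / 2) * (u ^ (a - 1) * v ^ (1 - l)) := by field_simp
      _ ≤ _ := by gcongr
  have hset : MeasurableSet {s | y s ≤ ENNReal.ofReal u} := measurableSet_le hy measurable_const
  have h1l : 0 < 1 - l := by linarith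
  calc ∫⁻ s in {s | y s ≤ ENNReal.ofReal u}, ENNReal.ofReal (|t - s| ^ (-l)) * y s
      ≤ ∫⁻ s, (ENNReal.ofReal ((Iio b).indicator (fun y => y ^ (-l)) |t - s|) * ENNReal.ofReal u
        + y s * ENNReal.ofReal ((Ici b).indicator (fun y => y ^ (-l)) |t - s|)) := by
        rw [← lintegral_indicator hset]
        refine lintegral_mono fun s => ?_
        by_cases hs : y s ≤ ENNReal.ofReal u
        · rw [indicator_of_mem (show s ∈ {s | y s ≤ ENNReal.ofReal u} from hs)]
          by_cases h : |t - s| < b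
          · rw [indicator_of_mem (mem_Iio.2 h)]
            refine le_add_right ?_
            gcongr
          · rw [indicator_of_mem (s := Ici b) (mem_Ici.2 (not_lt.1 h)), mul_comm]
            exact le_add_left le_rfl
        · rw [indicator_of_notMem (show s ∉ {s | y s ≤ ENNReal.ofReal u} from hs)]
          exact zero_le
    _ ≤ _ := by
        rw [lintegral_add_left]
        · refine (add_le_add hnear hfar).trans ?_
          rw [← ENNReal.ofReal_add (by positivity) (by positivity)]
          refine ENNReal.ofReal_le_ofReal (le_of_eq (by ring))
        · have h1 : Measurable ((Iio b).indicator (fun y : ℝ => y ^ (-l))) :=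
            (by fun_prop : Measurable fun y : ℝ => y ^ (-l)).indicator measurableSet_Iio
          fun_prop

/-- The diagonal Hardy–Littlewood–Sobolev inequality on the line. -/
theorem hls {l a : ℝ} (hl0 : 0 < l) (hl1 : l < 1) (ha : a = 2 / (2 - l)) {y : ℝ → ℝ≥0∞}
    (hy : Measurable y) (hfin : ∀ t, y t ≠ ⊤) (hM : ∫⁻ s, y s ^ a ≠ ⊤) :
    ∫⁻ t, ∫⁻ s, ENNReal.ofReal (|t - s| ^ (-l)) * y s * y t
      ≤ ENNReal.ofReal (2 * (2 / (1 - l) + 2)) * (∫⁻ s, y s ^ a) ^ (2 / a) := by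
  have h2l : 0 < 2 - l := by linarith
  have h1l : 0 < 1 - l := by linarith
  have ha1 : 1 < a := by rw [ha, lt_div_iff₀ h2l]; linarith
  have ha0 : 0 < a := by linarith
  by_cases hM0 : ∫⁻ s, y s ^ a = 0
  · have h0 : ∀ᵐ s, y s = 0 := by
      have := (lintegral_eq_zero_iff (hy.pow_const a)).1 hM0
      filter_upwards [this] with s hs
      simpa [ha0, ha0.le, not_lt.2 ha0.le] using hs
    have : ∫⁻ t, ∫⁻ s, ENNReal.ofReal (|t - s| ^ (-l)) * y s * y t = 0 := by
      rw [lintegral_eq_zero_iff']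
      · filter_upwards [h0] with t ht
        simp [ht]
      · refine (Measurable.lintegral_prod_right' (f := fun z : ℝ × ℝ =>
          ENNReal.ofReal (|z.1 - z.2| ^ (-l)) * y z.2 * y z.1) ?_).aemeasurable
        fun_prop
    rw [this]
    exact zero_le
  set v := (∫⁻ s, y s ^ a).toReal with hv
  have hv0 : 0 < v := ENNReal.toReal_pos hM0 hM
  have hMv : ∫⁻ s, y s ^ a = ENNReal.ofReal v := (ENNReal.ofReal_toReal hM).symm
  set K := 2 / (1 - l) + 2 with hK
  have hK0 : 0 < K := by positivity
  -- The kernel is symmetric, so it suffices to integrate over `y s ≤ y t`. There `hls_inner` with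
  -- `u = y t` bounds the inner integral by a multiple of `(y t)^{a-1}`, and the remaining factor `y
  -- t` completes the power `a`.
  set A : ℝ → ℝ → ℝ≥0∞ := fun t s =>
    if y s ≤ y t then ENNReal.ofReal (|t - s| ^ (-l)) * y s * y t else 0 with hA
  have hAm : Measurable (Function.uncurry A) := by
    refine Measurable.ite ?_ (by fun_prop) measurable_const
    exact measurableSet_le (by fun_prop) (by fun_prop)
  have hAle : ∫⁻ t, ∫⁻ s, A t s ≤ ENNReal.ofReal K * (∫⁻ s, y s ^ a) ^ (2 / a) := by
    have hpt : ∀ t, ∫⁻ s, A t s ≤ ENNReal.ofReal (K * v ^ (1 - l)) * y t ^ a := by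
      intro t
      by_cases ht : y t = 0
      · have : ∀ s, A t s = 0 := by intro s; simp [hA, ht]
        simp [this]
      · set u := (y t).toReal with hu
        have hu0 : 0 < u := ENNReal.toReal_pos ht (hfin t)
        have hyu : y t = ENNReal.ofReal u := (ENNReal.ofReal_toReal (hfin t)).symm
        have e : ∫⁻ s, A t s = (∫⁻ s in {s | y s ≤ ENNReal.ofReal u},
            ENNReal.ofReal (|t - s| ^ (-l)) * y s) * y t := by
          rw [← lintegral_mul_const' _ _ (hfin t), ← lintegral_indicator
            (measurableSet_le hy measurable_const)]
          refine lintegral_congr fun s => ?_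
          simp only [hA, indicator_apply, mem_ofPred_eq, hyu]
        rw [e]
        refine (mul_le_mul_left (hls_inner hl0 hl1 ha hy hu0 hv0 hMv t) _).trans ?_
        rw [hyu, ENNReal.ofReal_rpow_of_pos hu0, ← ENNReal.ofReal_mul (by positivity),
          ← ENNReal.ofReal_mul (by positivity)]
        refine ENNReal.ofReal_le_ofReal (le_of_eq ?_)
        have : u ^ a = u ^ (a - 1) * u := by
          rw [← Real.rpow_add_one hu0.ne']; congr 1; ring
        rw [this]; ring
    calc ∫⁻ t, ∫⁻ s, A t s ≤ ∫⁻ t, ENNReal.ofReal (K * v ^ (1 - l)) * y t ^ a :=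
          lintegral_mono hpt
      _ = ENNReal.ofReal (K * v ^ (1 - l)) * ENNReal.ofReal v := by
          rw [lintegral_const_mul _ (by fun_prop), hMv]
      _ = ENNReal.ofReal K * (∫⁻ s, y s ^ a) ^ (2 / a) := by
          rw [hMv, ENNReal.ofReal_rpow_of_pos hv0, ← ENNReal.ofReal_mul (by positivity),
            ← ENNReal.ofReal_mul (by positivity)]
          congr 1
          -- Of the total power `2/a = 2 - l` of `v`, the part `1 - l` comes from the inner bound
          -- and the part `1` from the outer integral.
          have : (2 / a) = (1 - l) + 1 := by rw [ha]; field_simp; ring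
          rw [this, Real.rpow_add_one hv0.ne']
          ring
  have hswap : ∫⁻ t, ∫⁻ s, A s t = ∫⁻ t, ∫⁻ s, A t s :=
    lintegral_lintegral_swap (f := fun t s => A s t) (hAm.comp measurable_swap).aemeasurable
  calc ∫⁻ t, ∫⁻ s, ENNReal.ofReal (|t - s| ^ (-l)) * y s * y t
      ≤ ∫⁻ t, ∫⁻ s, (A t s + A s t) := by
        refine lintegral_mono fun t => lintegral_mono fun s => ?_
        rcases le_total (y s) (y t) with h | h
        · simp only [hA, h, if_true]
          exact le_add_right le_rfl
        · simp only [hA, h, if_true]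
          refine le_add_left (le_of_eq ?_)
          rw [abs_sub_comm]; ring
    _ = (∫⁻ t, ∫⁻ s, A t s) + ∫⁻ t, ∫⁻ s, A s t := by
        have hm : Measurable fun t => ∫⁻ s, A t s := hAm.lintegral_prod_right'
        rw [← lintegral_add_left hm]
        refine lintegral_congr fun t => ?_
        rw [← lintegral_add_left]
        exact hAm.comp (measurable_const.prodMk measurable_id)
    _ ≤ ENNReal.ofReal K * (∫⁻ s, y s ^ a) ^ (2 / a)
        + ENNReal.ofReal K * (∫⁻ s, y s ^ a) ^ (2 / a) := by
        rw [hswap]; exact add_le_add hAle hAle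
    _ = _ := by
        rw [← two_mul, ← mul_assoc, ENNReal.ofReal_mul (by norm_num)]
        norm_num

/-- Young's inequality in trilinear form. -/
theorem young_trilinear {r b : ℝ} (hr : 2 < r) (hb : b = r / (r - 1)) {k g h : E3 → ℝ≥0∞}
    (hk : Measurable k) (hg : AEMeasurable g) (hh : AEMeasurable h) :
    ∫⁻ x, ∫⁻ y, k (x - y) * g y * h x
      ≤ (∫⁻ x, k x ^ (r / 2)) ^ (2 / r) * (∫⁻ x, g x ^ b) ^ (1 / b) *
        (∫⁻ x, h x ^ b) ^ (1 / b) := by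
  have hr0 : 0 < r := by linarith
  have hr1 : 0 < r - 1 := by linarith
  have hb0 : 0 < b := by rw [hb]; positivity
  have hg2 : AEMeasurable (fun z : E3 × E3 => g z.2) (volume.prod volume) := hg.comp_snd
  have hh1 : AEMeasurable (fun z : E3 × E3 => h z.1) (volume.prod volume) := hh.comp_fst
  have hk2 : AEMeasurable (fun z : E3 × E3 => k (z.1 - z.2)) (volume.prod volume) := by fun_prop
  -- The integrand is the product of these three functions to the powers `1 - 2/r`, `1/r`, `1/r`.
  -- Each omits one of `k`, `g`, `h`, so its double integral factors after a translation, and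
  -- three-function Hölder concludes.
  set f : Fin 3 → E3 × E3 → ℝ≥0∞ := ![fun z => g z.2 ^ b * h z.1 ^ b,
    fun z => k (z.1 - z.2) ^ (r / 2) * g z.2 ^ b, fun z => k (z.1 - z.2) ^ (r / 2) * h z.1 ^ b]
    with hf
  set P : Fin 3 → ℝ := ![1 - 2 / r, 1 / r, 1 / r] with hP
  have hmeas : AEMeasurable (fun z : E3 × E3 => k (z.1 - z.2) * g z.2 * h z.1)
      (volume.prod volume) := by fun_prop
  have h0 : (∫⁻ x, ∫⁻ y, k (x - y) * g y * h x)
      = ∫⁻ z : E3 × E3, k (z.1 - z.2) * g z.2 * h z.1 ∂(volume.prod volume) :=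
    (lintegral_prod _ hmeas).symm
  have key := ENNReal.lintegral_prod_norm_pow_le (μ := (volume : Measure E3).prod volume)
    Finset.univ (f := f) (p := P) ?_ ?_ ?_
  · simp only [Fin.prod_univ_three] at key
    set KK := ∫⁻ x, k x ^ (r / 2)
    set GG := ∫⁻ x, g x ^ b
    set HH := ∫⁻ x, h x ^ b
    have e0 : ∫⁻ z, f 0 z ∂((volume : Measure E3).prod volume) = HH * GG := by
      simp only [hf, Matrix.cons_val_zero]
      rw [lintegral_prod _ (by fun_prop)]
      have : ∀ x, ∫⁻ y, g y ^ b * h x ^ b = GG * h x ^ b := fun x =>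
        lintegral_mul_const'' _ (by fun_prop)
      simp_rw [this]
      rw [lintegral_const_mul'' _ (by fun_prop), mul_comm]
    have e1 : ∫⁻ z, f 1 z ∂((volume : Measure E3).prod volume) = KK * GG := by
      change ∫⁻ z : E3 × E3, k (z.1 - z.2) ^ (r / 2) * g z.2 ^ b ∂_ = _
      rw [lintegral_prod_symm _ (by fun_prop)]
      have : ∀ y, ∫⁻ x, k (x - y) ^ (r / 2) * g y ^ b = KK * g y ^ b := fun y => by
        rw [lintegral_mul_const _ (by fun_prop)]
        congr 1
        exact lintegral_sub_right_eq_self (fun x => k x ^ (r / 2)) y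
      simp_rw [this]
      rw [lintegral_const_mul'' _ (by fun_prop)]
    have e2 : ∫⁻ z, f 2 z ∂((volume : Measure E3).prod volume) = KK * HH := by
      change ∫⁻ z : E3 × E3, k (z.1 - z.2) ^ (r / 2) * h z.1 ^ b ∂_ = _
      rw [lintegral_prod _ (by fun_prop)]
      have : ∀ x, ∫⁻ y, k (x - y) ^ (r / 2) * h x ^ b = KK * h x ^ b := fun x => by
        rw [lintegral_mul_const _ (by fun_prop)]
        congr 1
        exact lintegral_sub_left_eq_self (fun x => k x ^ (r / 2)) x
      simp_rw [this]
      rw [lintegral_const_mul'' _ (by fun_prop)]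
    rw [e0, e1, e2] at key
    rw [h0]
    have p0 : 0 ≤ 1 - 2 / r := by rw [sub_nonneg, div_le_one hr0]; exact hr.le
    have p1 : 0 ≤ 1 / r := by positivity
    calc _ = ∫⁻ z, f 0 z ^ P 0 * f 1 z ^ P 1 * f 2 z ^ P 2 ∂((volume : Measure E3).prod volume) := by
          refine lintegral_congr fun z => ?_
          simp only [hf, hP, Matrix.cons_val_zero, Matrix.cons_val_one, Matrix.cons_val]
          rw [ENNReal.mul_rpow_of_nonneg _ _ p0, ENNReal.mul_rpow_of_nonneg _ _ p1,
            ENNReal.mul_rpow_of_nonneg _ _ p1]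
          simp only [← ENNReal.rpow_mul]
          have a1 : b * (1 - 2 / r) + b * (1 / r) = 1 := by rw [hb]; field_simp; ring
          have a2 : r / 2 * (1 / r) + r / 2 * (1 / r) = 1 := by field_simp; ring
          have n1 : 0 ≤ b * (1 - 2 / r) := by positivity
          have n2 : 0 ≤ b * (1 / r) := by positivity
          have n3 : 0 ≤ r / 2 * (1 / r) := by positivity
          have s1 : ∀ c : ℝ≥0∞, c = c ^ (r / 2 * (1 / r)) * c ^ (r / 2 * (1 / r)) := fun c => by
            rw [← ENNReal.rpow_add_of_nonneg _ _ n3 n3, a2, ENNReal.rpow_one]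
          have s2 : ∀ c : ℝ≥0∞, c = c ^ (b * (1 - 2 / r)) * c ^ (b * (1 / r)) := fun c => by
            rw [← ENNReal.rpow_add_of_nonneg _ _ n1 n2, a1, ENNReal.rpow_one]
          conv_lhs => rw [s1 (k (z.1 - z.2)), s2 (g z.2), s2 (h z.1)]
          generalize r / 2 * (1 / r) = α, b * (1 - 2 / r) = β, b * (1 / r) = γ
          ring
      _ ≤ _ := key
      _ = _ := by
          simp only [hP, Matrix.cons_val_zero, Matrix.cons_val_one, Matrix.cons_val]
          rw [ENNReal.mul_rpow_of_nonneg _ _ p0, ENNReal.mul_rpow_of_nonneg _ _ p1,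
            ENNReal.mul_rpow_of_nonneg _ _ p1]
          have a1 : (1 / b) = (1 - 2 / r) + (1 / r) := by rw [hb]; field_simp; ring
          have a2 : (2 / r) = 1 / r + 1 / r := by ring
          rw [a1, ENNReal.rpow_add_of_nonneg _ _ p0 p1, ENNReal.rpow_add_of_nonneg _ _ p0 p1, a2,
            ENNReal.rpow_add_of_nonneg _ _ p1 p1]
          ring
  · intro i _
    fin_cases i
    · simp only [hf]; exact (hg2.pow_const b).mul (hh1.pow_const b)
    · simp only [hf]; exact (hk2.pow_const _).mul (hg2.pow_const b)
    · simp only [hf]; exact (hk2.pow_const _).mul (hh1.pow_const b)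
  · simp only [hP, Fin.sum_univ_three, Matrix.cons_val_zero, Matrix.cons_val_one, Matrix.cons_val]
    ring
  · intro i _
    have p0 : 0 ≤ 1 - 2 / r := by rw [sub_nonneg, div_le_one hr0]; exact hr.le
    fin_cases i
    · exact p0
    · simp only [hP]; exact div_nonneg zero_le_one hr0.le
    · simp only [hP]; exact div_nonneg zero_le_one hr0.le

end ForcedNLW

end

noncomputable section

namespace ForcedNLW

open Filter Topology FourierTransform

/-! ### The Fourier transform of the truncated Newton kernel -/

/-- The `L²` transform agrees with the transform of the associated tempered distribution. The
multiplication formula moves the latter onto the integral transform, and the two functions agree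
against all test functions. -/
theorem fourier_L2_eq_of_integrable {g : L2} (hg : Integrable (g : E3 → ℂ)) :
    ((𝓕 g : L2) : E3 → ℂ) =ᵐ[volume] 𝓕 (g : E3 → ℂ) := by
  have hcont : Continuous (𝓕 (g : E3 → ℂ)) :=
    VectorFourier.fourierIntegral_continuous Real.continuous_fourierChar
      continuous_inner hg
  refine ae_eq_of_integral_contDiff_smul_eq ((Lp.memLp _).locallyIntegrable (by norm_num))
    hcont.locallyIntegrable ?_
  intro φ h1 h2
  have hg₁ : HasCompactSupport (Complex.ofRealCLM ∘ φ) := h2.comp_left rfl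
  have hg₂ : ContDiff ℝ ∞ (Complex.ofRealCLM ∘ φ) := by fun_prop
  set ψ := hg₁.toSchwartzMap hg₂ with hψ
  have e1 := congrArg (fun d : 𝓢'(E3, ℂ) => d ψ) (Lp.fourier_toTemperedDistribution_eq g)
  simp only [TemperedDistribution.fourier_apply, Lp.toTemperedDistribution_apply] at e1
  have e2 : ∫ x, (𝓕 ψ : 𝓢(E3, ℂ)) x • g x = ∫ x, ψ x • 𝓕 (g : E3 → ℂ) x := by
    have := VectorFourier.integral_fourierIntegral_smul_eq_flip (L := innerₗ E3)
      (μ := volume) (ν := volume) Real.continuous_fourierChar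
      continuous_inner ψ.integrable hg
    rw [flip_innerₗ] at this
    exact this
  rw [e2] at e1
  simpa [hψ] using e1.symm

/-- The splitting `ℝ³ = ℝ × ℝ²`. -/
def splitE3 : E3 ≃ᵐ ℝ × EuclideanSpace ℝ (Fin 2) :=
  (MeasurableEquiv.toLp 2 (Fin 3 → ℝ)).symm.trans
    ((MeasurableEquiv.piFinSuccAbove (fun _ : Fin 3 => ℝ) 0).trans
      (MeasurableEquiv.prodCongr (MeasurableEquiv.refl ℝ) (MeasurableEquiv.toLp 2 (Fin 2 → ℝ))))

theorem measurePreserving_splitE3 : MeasurePreserving splitE3 := by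
  have h1 := EuclideanSpace.volume_preserving_symm_measurableEquiv_toLp (Fin 3)
  have h2 := volume_preserving_piFinSuccAbove (fun _ : Fin 3 => ℝ) 0
  have h3 : MeasurePreserving (Prod.map id (MeasurableEquiv.toLp 2 (Fin 2 → ℝ)))
      (volume : Measure (ℝ × (Fin 2 → ℝ))) volume :=
    (MeasurePreserving.id volume).prod (PiLp.volume_preserving_toLp (Fin 2))
  exact h3.comp (h2.comp h1)

theorem splitE3_fst (z : E3) : (splitE3 z).1 = z 0 := rfl

theorem splitE3_norm (z : E3) : ‖z‖ = √((splitE3 z).1 ^ 2 + ‖(splitE3 z).2‖ ^ 2) := by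
  rw [EuclideanSpace.norm_eq, EuclideanSpace.norm_sq_eq]
  congr 1
  rw [Fin.sum_univ_succ]
  simp only [Real.norm_eq_abs, sq_abs]
  rfl

/-- The radial profile `1_{u<t}/(4πu)` of the truncated Newton kernel. -/
def ker (t u : ℝ) : ℝ := (Iio t).indicator (fun u => (4 * Real.pi * u)⁻¹) u

theorem integrable_ker (t : ℝ) : Integrable (fun z : E3 => ker t ‖z‖) := by
  rw [integrable_fun_norm_addHaar volume (f := ker t)]
  have h : IntegrableOn ((Iio t).indicator fun y : ℝ => y * (4 * Real.pi)⁻¹) (Ioi 0) := by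
    rw [IntegrableOn, integrable_indicator_iff measurableSet_Iio, IntegrableOn,
      Measure.restrict_restrict measurableSet_Iio]
    refine IntegrableOn.mono_set (t := Icc 0 t) ?_ fun x hx => ⟨le_of_lt hx.2, le_of_lt hx.1⟩
    exact (by fun_prop : Continuous fun y : ℝ => y * (4 * Real.pi)⁻¹).integrableOn_Icc
  refine (integrableOn_congr_fun (fun y hy => ?_) measurableSet_Ioi).2 h
  have hy' : y ≠ 0 := (ne_of_gt hy)
  simp only [finrank_euclideanSpace, Fintype.card_fin, smul_eq_mul, ker]
  by_cases hyt : y ∈ Iio t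
  · rw [indicator_of_mem hyt, indicator_of_mem hyt]
    norm_num
    field_simp
  · rw [indicator_of_notMem hyt, indicator_of_notMem hyt, mul_zero]

/-- The slice at height `s` is a disc of radius `√(t² - s²)`. In polar coordinates the integrand is
`ρ/√(s²+ρ²)`, the derivative of `√(s²+ρ²)`, so the integral is the linear function `(t - |s|)/2`.
The three-dimensional transform is thereby reduced to that of a tent. -/
theorem integral_ker_slice (t : ℝ) {s : ℝ} (hs : s ≠ 0) :
    ∫ y : EuclideanSpace ℝ (Fin 2), ker t √(s ^ 2 + ‖y‖ ^ 2) = max (t - |s|) 0 / 2 := by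
  have hs2 : 0 < s ^ 2 := by positivity
  by_cases hst : t ≤ |s|
  · rw [max_eq_right (by linarith), zero_div]
    have : ∀ y : EuclideanSpace ℝ (Fin 2), ker t √(s ^ 2 + ‖y‖ ^ 2) = 0 := by
      intro y
      refine indicator_of_notMem ?_ _
      rw [mem_Iio, not_lt]
      refine hst.trans (Real.abs_le_sqrt ?_)
      nlinarith [sq_nonneg ‖y‖]
    simp [this]
  push Not at hst
  have ht0 : 0 < t := (abs_nonneg s).trans_lt hst
  have hd : 0 ≤ t ^ 2 - s ^ 2 := by nlinarith [sq_abs s, abs_nonneg s]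
  set R := √(t ^ 2 - s ^ 2) with hR
  have hR0 : 0 ≤ R := Real.sqrt_nonneg _
  have hRsq : R ^ 2 = t ^ 2 - s ^ 2 := Real.sq_sqrt hd
  rw [max_eq_left (by linarith),
    integral_fun_norm_addHaar volume (fun ρ : ℝ => ker t √(s ^ 2 + ρ ^ 2))]
  have e1 : ∀ ρ ∈ Ioi (0 : ℝ), ρ ^ (Module.finrank ℝ (EuclideanSpace ℝ (Fin 2)) - 1) •
      ker t √(s ^ 2 + ρ ^ 2)
      = (Iio R).indicator (fun ρ => ρ / (4 * Real.pi * √(s ^ 2 + ρ ^ 2))) ρ := by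
    intro ρ hρ
    have hρ0 : (0 : ℝ) < ρ := hρ
    have hiff : √(s ^ 2 + ρ ^ 2) < t ↔ ρ < R := by
      rw [Real.sqrt_lt' ht0, ← pow_lt_pow_iff_left₀ hρ0.le hR0 (two_ne_zero), hRsq]
      constructor <;> intro h <;> linarith
    simp only [finrank_euclideanSpace, Fintype.card_fin, smul_eq_mul, ker, indicator_apply, mem_Iio,
      hiff]
    split_ifs
    · norm_num; ring
    · simp
  rw [setIntegral_congr_fun measurableSet_Ioi e1, setIntegral_indicator measurableSet_Iio]
  have hsub : Ioi (0 : ℝ) ∩ Iio R = Ioo 0 R := rfl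
  rw [hsub, ← integral_Ioc_eq_integral_Ioo, ← intervalIntegral.integral_of_le hR0]
  have hpos : ∀ ρ : ℝ, 0 < s ^ 2 + ρ ^ 2 := fun ρ => by positivity
  have hder : ∀ ρ ∈ uIcc 0 R, HasDerivAt (fun ρ => √(s ^ 2 + ρ ^ 2) / (4 * Real.pi))
      (ρ / (4 * Real.pi * √(s ^ 2 + ρ ^ 2))) ρ := by
    intro ρ _
    have h1 : HasDerivAt (fun ρ : ℝ => s ^ 2 + ρ ^ 2) (2 * ρ) ρ := by
      simpa using ((hasDerivAt_id ρ).pow 2).const_add (s ^ 2)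
    have h2 := (h1.sqrt (hpos ρ).ne').div_const (4 * Real.pi)
    refine h2.congr_deriv ?_
    have := Real.sqrt_pos.2 (hpos ρ)
    have := Real.pi_pos
    field_simp
  rw [intervalIntegral.integral_eq_sub_of_hasDerivAt hder]
  · have e2 : √(s ^ 2 + R ^ 2) = t := by
      rw [hRsq]; ring_nf; exact Real.sqrt_sq ht0.le
    have e3 : √(s ^ 2 + 0 ^ 2) = |s| := by
      rw [← Real.sqrt_sq_eq_abs]; congr 1; ring
    have e4 : (volume : Measure (EuclideanSpace ℝ (Fin 2))).real (Metric.ball 0 1) = Real.pi := by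
      rw [Measure.real, EuclideanSpace.volume_ball_fin_two]
      simp [Real.pi_pos.le]
    rw [e2, e3, e4]
    have := Real.pi_pos
    simp only [finrank_euclideanSpace, Fintype.card_fin, nsmul_eq_mul, smul_eq_mul]
    push_cast
    field_simp
    ring
  · refine Continuous.intervalIntegrable ?_ _ _
    refine Continuous.div (by fun_prop) (by fun_prop) fun ρ => ?_
    have := Real.sqrt_pos.2 (hpos ρ)
    have := Real.pi_pos
    positivity

theorem integral_cos_tent {k t : ℝ} (hk : k ≠ 0) (ht : 0 ≤ t) :
    ∫ s, Real.cos (k * s) * (max (t - |s|) 0 / 2) = (1 - Real.cos (t * k)) / k ^ 2 := by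
  have e0 : ∀ s : ℝ, Real.cos (k * s) * (max (t - |s|) 0 / 2)
      = (fun u : ℝ => Real.cos (k * u) * (max (t - u) 0 / 2)) |s| := by
    intro s
    simp only
    rcases abs_choice s with h | h <;> rw [h]
    rw [mul_neg, Real.cos_neg]
  rw [integral_congr_ae (ae_of_all _ e0), integral_comp_abs
    (f := fun u : ℝ => Real.cos (k * u) * (max (t - u) 0 / 2))]
  have e1 : ∀ u ∈ Ioi (0 : ℝ), Real.cos (k * u) * (max (t - u) 0 / 2)
      = (Iio t).indicator (fun u => Real.cos (k * u) * ((t - u) / 2)) u := by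
    intro u _
    by_cases h : u < t
    · rw [indicator_of_mem (mem_Iio.2 h), max_eq_left (by linarith)]
    · rw [indicator_of_notMem (by simpa using h), max_eq_right (by linarith)]
      simp
  rw [setIntegral_congr_fun measurableSet_Ioi e1, setIntegral_indicator measurableSet_Iio]
  have hsub : Ioi (0 : ℝ) ∩ Iio t = Ioo 0 t := rfl
  rw [hsub, ← integral_Ioc_eq_integral_Ioo, ← intervalIntegral.integral_of_le ht]
  have hder : ∀ u ∈ uIcc 0 t, HasDerivAt
      (fun u => ((t - u) * (Real.sin (k * u) / k) - Real.cos (k * u) / k ^ 2) / 2)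
      (Real.cos (k * u) * ((t - u) / 2)) u := by
    intro u _
    have h0 : HasDerivAt (fun u : ℝ => k * u) k u := by
      simpa using (hasDerivAt_id u).const_mul k
    have h1 := (((hasDerivAt_id u).const_sub t).mul (h0.sin.div_const k)).sub
      (h0.cos.div_const (k ^ 2))
    refine (h1.div_const 2).congr_deriv ?_
    simp only [id_eq]
    field_simp
    ring
  rw [intervalIntegral.integral_eq_sub_of_hasDerivAt hder]
  · simp only [sub_self, mul_zero, Real.sin_zero, Real.cos_zero, zero_div, mul_comm k t]
    field_simp
    ring
  · exact Continuous.intervalIntegrable (by fun_prop) _ _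

theorem integral_cos_ker_axis {k t : ℝ} (hk : k ≠ 0) (ht : 0 ≤ t) :
    ∫ z : E3, Real.cos (k * z 0) * ker t ‖z‖ = (1 - Real.cos (t * k)) / k ^ 2 := by
  set f : ℝ × EuclideanSpace ℝ (Fin 2) → ℝ := fun w =>
    Real.cos (k * w.1) * ker t √(w.1 ^ 2 + ‖w.2‖ ^ 2) with hf
  have e1 : (fun z : E3 => Real.cos (k * z 0) * ker t ‖z‖) = fun z => f (splitE3 z) := by
    ext z
    rw [splitE3_norm z, ← splitE3_fst]
  have hint : Integrable (fun z : E3 => Real.cos (k * z 0) * ker t ‖z‖) := by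
    refine (integrable_ker t).bdd_mul (c := 1) ?_ (ae_of_all _ fun z => Real.abs_cos_le_one _)
    exact (by fun_prop : Continuous fun z : E3 => Real.cos (k * z 0)).aestronglyMeasurable
  rw [e1] at hint ⊢
  rw [measurePreserving_splitE3.integral_comp' f]
  have hint2 : Integrable f (volume.prod volume) :=
    (measurePreserving_splitE3.integrable_comp_emb splitE3.measurableEmbedding).1 hint
  rw [← integral_cos_tent hk ht]
  refine (integral_prod f hint2).trans (integral_congr_ae ?_)
  filter_upwards [Measure.ae_ne volume 0] with s hs
  simp only [hf]
  rw [integral_const_mul, integral_ker_slice t hs]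

/-- The kernel is radial, so `ξ` may be moved to the first coordinate axis by an isometry. -/
theorem integral_cos_ker {ξ : E3} (hξ : ξ ≠ 0) {t : ℝ} (ht : 0 ≤ t) :
    ∫ z : E3, Real.cos (2 * Real.pi * inner ℝ z ξ) * ker t ‖z‖
      = (1 - Real.cos (t * kap ξ)) / kap ξ ^ 2 := by
  set e : E3 := EuclideanSpace.single 0 ‖ξ‖ with he
  have hn : ‖e‖ = ‖ξ‖ := by simp [he]
  -- The reflection in the hyperplane orthogonal to `e - ξ` exchanges the two vectors `e` and `ξ` of
  -- equal length.
  set ρ := (ℝ ∙ (e - ξ))ᗮ.reflection with hρ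
  have hρe : ρ e = ξ := Submodule.reflection_sub hn
  have hin : ∀ z : E3, inner ℝ (ρ z) ξ = z 0 * ‖ξ‖ := by
    intro z
    rw [← hρe, LinearIsometryEquiv.inner_map_map, he, EuclideanSpace.inner_single_right]
    simp [mul_comm]
  rw [← ρ.measurePreserving.integral_comp' (f := ρ.toHomeomorph.toMeasurableEquiv)
    (fun z => Real.cos (2 * Real.pi * inner ℝ z ξ) * ker t ‖z‖)]
  rw [← integral_cos_ker_axis (kap_pos hξ).ne' ht]
  congr 1
  ext z
  change Real.cos (2 * Real.pi * inner ℝ (ρ z) ξ) * ker t ‖ρ z‖ = _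
  rw [hin, LinearIsometryEquiv.norm_map]
  unfold kap
  ring_nf

/-- The kernel is even, so only the cosine part of the exponential survives. -/
theorem fourier_ker {ξ : E3} (hξ : ξ ≠ 0) {t : ℝ} (ht : 0 ≤ t) :
    𝓕 (fun z : E3 => (ker t ‖z‖ : ℂ)) ξ = (((1 - Real.cos (t * kap ξ)) / kap ξ ^ 2 : ℝ) : ℂ) := by
  have hc : Integrable fun z : E3 => Real.cos (2 * Real.pi * inner ℝ z ξ) * ker t ‖z‖ := by
    refine (integrable_ker t).bdd_mul (c := 1) ?_ (ae_of_all _ fun z => Real.abs_cos_le_one _)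
    exact (by fun_prop : Continuous fun z : E3 =>
      Real.cos (2 * Real.pi * inner ℝ z ξ)).aestronglyMeasurable
  have hs : Integrable fun z : E3 => Real.sin (2 * Real.pi * inner ℝ z ξ) * ker t ‖z‖ := by
    refine (integrable_ker t).bdd_mul (c := 1) ?_ (ae_of_all _ fun z => Real.abs_sin_le_one _)
    exact (by fun_prop : Continuous fun z : E3 =>
      Real.sin (2 * Real.pi * inner ℝ z ξ)).aestronglyMeasurable
  have hs0 : ∫ z : E3, Real.sin (2 * Real.pi * inner ℝ z ξ) * ker t ‖z‖ = 0 := by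
    have h := integral_neg_eq_self
      (fun z : E3 => Real.sin (2 * Real.pi * inner ℝ z ξ) * ker t ‖z‖) volume
    simp only [inner_neg_left, mul_neg, Real.sin_neg, neg_mul, norm_neg, integral_neg] at h
    linarith
  rw [Real.fourier_eq', ← integral_cos_ker hξ ht]
  have e : ∀ z : E3, Complex.exp (((-2 * Real.pi * inner ℝ z ξ : ℝ) : ℂ) * Complex.I) •
      (ker t ‖z‖ : ℂ) = ((Real.cos (2 * Real.pi * inner ℝ z ξ) * ker t ‖z‖ : ℝ) : ℂ)
        - ((Real.sin (2 * Real.pi * inner ℝ z ξ) * ker t ‖z‖ : ℝ) : ℂ) * Complex.I := by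
    intro z
    have : (-2 * Real.pi * inner ℝ z ξ : ℝ) = -(2 * Real.pi * inner ℝ z ξ) := by ring
    rw [this, Complex.exp_mul_I, ← Complex.ofReal_cos, ← Complex.ofReal_sin, Real.cos_neg,
      Real.sin_neg, smul_eq_mul]
    push_cast
    ring
  simp_rw [e]
  rw [integral_sub hc.ofReal (hs.ofReal.mul_const _), integral_mul_const, integral_complex_ofReal,
    integral_complex_ofReal, hs0]
  simp

end ForcedNLW

end

noncomputable section

namespace ForcedNLW

open Filter Topology FourierTransform

/-! ### The dispersive estimate -/

/-- Elements of `L¹ ∩ L^∞`. -/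
def Nice (g : L2) : Prop := Integrable (g : E3 → ℂ) ∧ ∃ M : ℝ, ∀ᵐ x, ‖g x‖ ≤ M

/-- The symbol `(1 - cos(t√(-Δ)))/(-Δ)`. -/
def newtonSymb (t : ℝ) (ξ : E3) : ℂ := (((1 - Real.cos (t * kap ξ)) / kap ξ ^ 2 : ℝ) : ℂ)

theorem symb_newton (t : ℝ) : Symb (newtonSymb t) := by
  refine ⟨?_, t ^ 2 / 2, fun ξ => ?_⟩
  · have := continuous_kap.measurable
    unfold newtonSymb
    fun_prop
  · unfold newtonSymb
    rw [Complex.norm_real, Real.norm_of_nonneg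
      (div_nonneg (by linarith [Real.cos_le_one (t * kap ξ)]) (sq_nonneg _))]
    refine div_le_of_le_mul₀ (sq_nonneg _) (by positivity) ?_
    have := Real.one_sub_sq_div_two_le_cos (x := t * kap ξ)
    nlinarith

/-- The complex-valued truncated Newton kernel. -/
def kerC (t : ℝ) (z : E3) : ℂ := (ker t ‖z‖ : ℂ)

theorem integrable_kerC (t : ℝ) : Integrable (kerC t) := (integrable_ker t).ofReal

theorem memLp_two_of_integrable_bdd {f : E3 → ℂ} (hf : Integrable f) {M : ℝ}
    (hM : ∀ᵐ x, ‖f x‖ ≤ M) : MemLp f 2 (volume : Measure E3) := by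
  rw [memLp_two_iff_integrable_sq_norm hf.aestronglyMeasurable]
  refine Integrable.mono' (hf.norm.const_mul M) (hf.aestronglyMeasurable.norm.pow 2) ?_
  filter_upwards [hM] with x hx
  rw [Real.norm_of_nonneg (by positivity), sq]
  exact mul_le_mul_of_nonneg_right hx (norm_nonneg _)

open scoped Convolution in
-- The truncated kernel is integrable and `g` lies in `L¹ ∩ L^∞`. The convolution is therefore in
-- `L¹ ∩ L^∞`, hence in `L²`, and the classical convolution theorem identifies its transform.
theorem fmul_newton_ae {g : L2} (hg : Nice g) {t : ℝ} (ht : 0 ≤ t) :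
    (fmul (newtonSymb t) g : E3 → ℂ) =ᵐ[volume] fun x => ∫ y, g y * kerC t (x - y) := by
  obtain ⟨hg1, M, hM⟩ := hg
  set c : E3 → ℂ := (g : E3 → ℂ) ⋆[ContinuousLinearMap.mul ℂ ℂ] kerC t with hc
  have hci : Integrable c := hg1.integrable_convolution _ (integrable_kerC t)
  have hcb : ∀ x, ‖c x‖ ≤ M * ∫ z, ‖kerC t z‖ := by
    intro x
    have e : (M * ∫ z, ‖kerC t z‖) = ∫ y, M * ‖kerC t (x - y)‖ := by
      rw [integral_const_mul, integral_sub_left_eq_self (fun z => ‖kerC t z‖) volume x]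
    rw [e]
    refine norm_integral_le_of_norm_le (((integrable_kerC t).norm.comp_sub_left x).const_mul M) ?_
    filter_upwards [hM] with y hy
    simp only [ContinuousLinearMap.mul_apply']
    rw [norm_mul]
    gcongr
  have hc2 : MemLp c 2 (volume : Measure E3) := memLp_two_of_integrable_bdd hci (ae_of_all _ hcb)
  have key : fmul (newtonSymb t) g = hc2.toLp c := by
    apply L2_ext_fourier
    have hi : Integrable (hc2.toLp c : E3 → ℂ) := (integrable_congr hc2.coeFn_toLp).2 hci
    have e2 : 𝓕 (hc2.toLp c : E3 → ℂ) = 𝓕 c := by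
      ext ξ
      rw [Real.fourier_eq, Real.fourier_eq]
      apply integral_congr_ae
      filter_upwards [hc2.coeFn_toLp] with x hx
      rw [hx]
    filter_upwards [fmul_ae (symb_newton t) g, fourier_L2_eq_of_integrable hg1,
      fourier_L2_eq_of_integrable hi, ae_ne_zero_E3] with ξ h1 h2 h3 h4
    rw [h1, h2, h3, e2, hc, Real.fourier_mul_convolution_eq hg1 (integrable_kerC t)]
    have : 𝓕 (kerC t) ξ = newtonSymb t ξ := fourier_ker h4 ht
    rw [this, mul_comm]
  rw [key]
  exact hc2.coeFn_toLp

/-- The kernel `1_{|z| ≥ τ}/|z|`. -/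
def farKer (τ : ℝ) (z : E3) : ℝ≥0∞ := ENNReal.ofReal ((Ici τ).indicator (fun u => u⁻¹) ‖z‖)

theorem measurable_farKer (τ : ℝ) : Measurable (farKer τ) := by
  have : Measurable ((Ici τ).indicator fun u : ℝ => u⁻¹) :=
    Measurable.indicator (by fun_prop) measurableSet_Ici
  unfold farKer
  fun_prop

/-- The two truncations cancel on `|z| < τ`, and the bound outside does not depend on `R`. This
uniformity is what survives the limit `R → ∞`. -/
theorem enorm_kerC_sub_le {τ R : ℝ} (hτ : 0 < τ) (hR : τ ≤ R) (z : E3) :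
    ‖kerC R z - kerC τ z‖ₑ ≤ farKer τ z := by
  unfold kerC farKer ker
  by_cases h1 : ‖z‖ < τ
  · rw [indicator_of_mem (mem_Iio.2 (h1.trans_le hR)), indicator_of_mem (mem_Iio.2 h1)]
    simp
  · rw [indicator_of_notMem (s := Iio τ) (by simpa using h1),
      indicator_of_mem (s := Ici τ) (mem_Ici.2 (not_lt.1 h1))]
    have hz : 0 < ‖z‖ := hτ.trans_le (not_lt.1 h1)
    rw [Complex.ofReal_zero, sub_zero, ← ofReal_norm, Complex.norm_real]
    refine ENNReal.ofReal_le_ofReal ?_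
    by_cases h2 : ‖z‖ ∈ Iio R
    · rw [indicator_of_mem h2, Real.norm_of_nonneg (by have := Real.pi_pos; positivity)]
      refine inv_anti₀ hz ?_
      nlinarith [Real.pi_gt_three]
    · rw [indicator_of_notMem h2, norm_zero]
      positivity

/-- The quadratic form bounding the dispersive kernel. -/
def farForm (τ : ℝ) (g h : L2) : ℝ≥0∞ := ∫⁻ x, ∫⁻ y, farKer τ (x - y) * ‖g y‖ₑ * ‖h x‖ₑ

theorem enorm_inner_newton_sub_le {g : L2} (hg : Nice g) (h : L2) {τ R : ℝ}
    (hτ : 0 < τ) (hR : τ ≤ R) :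
    ‖inner ℂ h (fmul (newtonSymb R) g) - inner ℂ h (fmul (newtonSymb τ) g)‖ₑ
      ≤ farForm τ g h := by
  rw [← inner_sub_right, inner_L2_eq]
  refine (enorm_integral_le_lintegral_enorm _).trans ?_
  refine lintegral_mono_ae ?_
  have hint : ∀ t x, Integrable fun y => g y * kerC t (x - y) := by
    intro t x
    obtain ⟨hg1, M, hM⟩ := hg
    exact ((integrable_kerC t).comp_sub_left x).bdd_mul hg1.aestronglyMeasurable hM
  filter_upwards [fmul_newton_ae hg hτ.le, fmul_newton_ae hg (hτ.le.trans hR),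
    Lp.coeFn_sub (fmul (newtonSymb R) g) (fmul (newtonSymb τ) g)] with x h1 h2 h3
  rw [h3, Pi.sub_apply, h1, h2, ← integral_sub (hint R x) (hint τ x), enorm_mul,
    RCLike.enorm_conj, mul_comm, lintegral_mul_const' _ _ enorm_ne_top]
  gcongr
  refine (enorm_integral_le_lintegral_enorm _).trans (lintegral_mono fun y => ?_)
  rw [← mul_sub, enorm_mul, mul_comm]
  gcongr
  exact enorm_kerC_sub_le hτ hR _

/-- The density `conj ĥ ĝ / κ²`. -/
def formDens (g h : L2) (ξ : E3) : ℂ :=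
  (starRingEnd ℂ) ((𝓕 h : L2) ξ) * (𝓕 g : L2) ξ * (((kap ξ ^ 2)⁻¹ : ℝ) : ℂ)

theorem norm_sq_le_kap_sq (ξ : E3) : ‖ξ‖ ^ 2 ≤ kap ξ ^ 2 := by
  unfold kap
  rw [mul_pow]
  have : 1 ≤ (2 * Real.pi) ^ 2 := by nlinarith [Real.pi_gt_three]
  nlinarith [sq_nonneg ‖ξ‖]

theorem aestronglyMeasurable_formDens (g h : L2) :
    AEStronglyMeasurable (formDens g h) volume := by
  have h1 : AEStronglyMeasurable (fun ξ : E3 => (((kap ξ ^ 2)⁻¹ : ℝ) : ℂ)) volume := by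
    have := continuous_kap.measurable
    exact (by fun_prop : Measurable fun ξ : E3 => (((kap ξ ^ 2)⁻¹ : ℝ) : ℂ)).aestronglyMeasurable
  exact ((Complex.continuous_conj.comp_aestronglyMeasurable (Lp.aestronglyMeasurable _)).mul
    (Lp.aestronglyMeasurable _)).mul h1

theorem ae_norm_fourier_le {g : L2} (hg : Integrable (g : E3 → ℂ)) :
    ∀ᵐ ξ, ‖(𝓕 g : L2) ξ‖ ≤ ∫ x, ‖g x‖ := by
  filter_upwards [fourier_L2_eq_of_integrable hg] with ξ h
  rw [h]
  exact VectorFourier.norm_fourierIntegral_le_integral_norm _ _ _ _ _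

/-- The integral of `|x|^{-2}` over the unit ball. -/
def ballConst : ℝ := ∫ x in Metric.ball (0 : E3) 1, (‖x‖ ^ 2)⁻¹

theorem ballConst_nonneg : 0 ≤ ballConst := integral_nonneg fun _ => by positivity

theorem integrable_norm_mul_norm (g h : L2) : Integrable fun x : E3 => ‖g x‖ * ‖h x‖ :=
  (Lp.memLp g).norm.integrable_mul (Lp.memLp h).norm

theorem integral_norm_mul_norm_le (g h : L2) : ∫ x : E3, ‖g x‖ * ‖h x‖ ≤ ‖g‖ * ‖h‖ := by
  have h1 : ∀ f : L2, (∫ x : E3, ‖f x‖ ^ (2 : ℝ)) ^ (1 / 2 : ℝ) = ‖f‖ := by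
    intro f
    have := norm_sq_L2 f
    have e : ∫ x : E3, ‖f x‖ ^ (2 : ℝ) = ‖f‖ ^ 2 := by rw [this]; norm_cast
    rw [e, ← Real.sqrt_eq_rpow, Real.sqrt_sq (norm_nonneg _)]
  have := integral_mul_norm_le_Lp_mul_Lq (μ := (volume : Measure E3)) (f := (g : E3 → ℂ))
    (g := (h : E3 → ℂ)) Real.HolderConjugate.two_two (by simpa using Lp.memLp g)
    (by simpa using Lp.memLp h)
  rwa [h1, h1] at this

/-- In three dimensions `κ^{-2}` is integrable near the origin, where the transforms are bounded
because `g` and `h` are in `L¹`. Outside the unit ball `κ^{-2} ≤ 1` and Cauchy–Schwarz in `L²`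
suffices. -/
theorem formDens_bound {g h : L2} (hg : Integrable (g : E3 → ℂ)) (hh : Integrable (h : E3 → ℂ)) :
    Integrable (formDens g h) ∧ ∫ ξ, ‖formDens g h ξ‖ ≤
      (∫ x, ‖h x‖) * (∫ x, ‖g x‖) * ballConst + ‖h‖ * ‖g‖ := by
  set b : E3 → ℝ := fun ξ => (∫ x, ‖h x‖) * (∫ x, ‖g x‖) *
    (Metric.ball (0 : E3) 1).indicator (fun x => (‖x‖ ^ 2)⁻¹) ξ
      + ‖(𝓕 h : L2) ξ‖ * ‖(𝓕 g : L2) ξ‖ with hb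
  have hb1 : Integrable fun ξ : E3 => (∫ x, ‖h x‖) * (∫ x, ‖g x‖) *
      (Metric.ball (0 : E3) 1).indicator (fun x => (‖x‖ ^ 2)⁻¹) ξ :=
    ((integrable_indicator_iff measurableSet_ball).2 (integrableOn_inv_norm_sq 1)).const_mul _
  have hbi : Integrable b := hb1.add (integrable_norm_mul_norm _ _)
  have hle : ∀ᵐ ξ, ‖formDens g h ξ‖ ≤ b ξ := by
    filter_upwards [ae_norm_fourier_le hg, ae_norm_fourier_le hh, ae_ne_zero_E3] with ξ h1 h2 h3
    have hξ : 0 < ‖ξ‖ := norm_pos_iff.2 h3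
    have hinv : (kap ξ ^ 2)⁻¹ ≤ (‖ξ‖ ^ 2)⁻¹ := inv_anti₀ (by positivity) (norm_sq_le_kap_sq ξ)
    have hk0 : 0 ≤ (kap ξ ^ 2)⁻¹ := by positivity
    unfold formDens
    rw [norm_mul, norm_mul, RCLike.norm_conj, Complex.norm_real, Real.norm_of_nonneg hk0]
    simp only [hb]
    by_cases hm : ξ ∈ Metric.ball (0 : E3) 1
    · rw [indicator_of_mem hm]
      have : ‖(𝓕 h : L2) ξ‖ * ‖(𝓕 g : L2) ξ‖ * (kap ξ ^ 2)⁻¹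
          ≤ (∫ x, ‖h x‖) * (∫ x, ‖g x‖) * (‖ξ‖ ^ 2)⁻¹ := by
        have : 0 ≤ ∫ x, ‖h x‖ := (norm_nonneg _).trans h2
        gcongr
      have h5 : 0 ≤ ‖(𝓕 h : L2) ξ‖ * ‖(𝓕 g : L2) ξ‖ := by positivity
      linarith
    · rw [indicator_of_notMem hm, mul_zero, zero_add]
      have h6 : 1 ≤ ‖ξ‖ := by simpa using hm
      have : (kap ξ ^ 2)⁻¹ ≤ 1 := hinv.trans (inv_le_one_of_one_le₀ (one_le_pow₀ h6))
      exact mul_le_of_le_one_right (by positivity) this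
  refine ⟨Integrable.mono' hbi (aestronglyMeasurable_formDens g h) hle, ?_⟩
  calc ∫ ξ, ‖formDens g h ξ‖ ≤ ∫ ξ, b ξ :=
        integral_mono_of_nonneg (ae_of_all _ fun _ => norm_nonneg _) hbi hle
    _ ≤ _ := by
        simp only [hb]
        rw [integral_add hb1 (integrable_norm_mul_norm _ _), integral_const_mul,
          integral_indicator measurableSet_ball]
        refine add_le_add le_rfl ?_
        refine (integral_norm_mul_norm_le _ _).trans (le_of_eq ?_)
        rw [Lp.norm_fourier_eq, Lp.norm_fourier_eq]

/-- The form `⟨h, cos(τ√(-Δ)) (-Δ)⁻¹ g⟩`. -/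
def cosForm (τ : ℝ) (g h : L2) : ℂ := ∫ ξ, formDens g h ξ * cosSymb τ ξ

theorem integrable_formDens_mul {g h : L2} (hg : Integrable (g : E3 → ℂ))
    (hh : Integrable (h : E3 → ℂ)) {m : E3 → ℂ} (hm : Symb m) :
    Integrable fun ξ => formDens g h ξ * m ξ := by
  obtain ⟨hm, C, hC⟩ := hm
  exact (formDens_bound hg hh).1.mul_bdd hm.aestronglyMeasurable (ae_of_all _ hC)

theorem inner_newton_eq {g h : L2} (hg : Integrable (g : E3 → ℂ)) (hh : Integrable (h : E3 → ℂ))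
    (t : ℝ) : inner ℂ h (fmul (newtonSymb t) g) = cosForm 0 g h - cosForm t g h := by
  unfold cosForm
  rw [inner_fmul_right (symb_newton t), ← integral_sub (integrable_formDens_mul hg hh (symb_cos 0))
    (integrable_formDens_mul hg hh (symb_cos t))]
  congr 1
  ext ξ
  unfold formDens newtonSymb cosSymb
  rw [zero_mul, Real.cos_zero]
  push_cast
  ring

theorem enorm_cosForm_sub_le {g h : L2} (hg : Nice g) (hh : Nice h) {τ R : ℝ}
    (hτ : 0 < τ) (hR : τ ≤ R) : ‖cosForm τ g h - cosForm R g h‖ₑ ≤ farForm τ g h := by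
  have := enorm_inner_newton_sub_le hg h hτ hR
  rw [inner_newton_eq hg.1 hh.1, inner_newton_eq hg.1 hh.1, sub_sub_sub_cancel_left] at this
  exact this

theorem abs_integral_cos_le {N k : ℝ} (hk : 0 < k) :
    |∫ R in N..(2 * N), Real.cos (R * k)| ≤ 2 / k := by
  rw [intervalIntegral.integral_comp_mul_right (fun x => Real.cos x) hk.ne', integral_cos,
    smul_eq_mul, abs_mul, abs_of_pos (inv_pos.2 hk), div_eq_inv_mul]
  gcongr
  have h1 := abs_le.1 (Real.abs_sin_le_one (2 * N * k))
  have h2 := abs_le.1 (Real.abs_sin_le_one (N * k))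
  rw [abs_le]
  constructor <;> linarith

/-- The average of `cos(Rκ)` over `[n, 2n]` is at most `2/(nκ)`, so the averaged form tends to zero
by dominated convergence. Averaging replaces a Riemann–Lebesgue argument in the radial variable. -/
theorem tendsto_average_cosForm {g h : L2} (hg : Integrable (g : E3 → ℂ))
    (hh : Integrable (h : E3 → ℂ)) :
    Tendsto (fun n : ℕ => (((n : ℝ)⁻¹ : ℝ) : ℂ) * ∫ R in (n : ℝ)..(2 * n), cosForm R g h) atTop
      (𝓝 0) := by
  obtain ⟨hi, -⟩ := formDens_bound hg hh
  have hswap : ∀ n : ℕ, (((n : ℝ)⁻¹ : ℝ) : ℂ) * ∫ R in (n : ℝ)..(2 * n), cosForm R g h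
      = ∫ ξ, formDens g h ξ *
        (((n : ℝ)⁻¹ * ∫ R in (n : ℝ)..(2 * n), Real.cos (R * kap ξ) : ℝ) : ℂ) := by
    intro n
    have hn : (n : ℝ) ≤ 2 * n := by have : (0 : ℝ) ≤ n := Nat.cast_nonneg n; linarith
    rw [intervalIntegral.integral_of_le hn, ← integral_const_mul]
    unfold cosForm
    have e : ∀ R, (((n : ℝ)⁻¹ : ℝ) : ℂ) * ∫ ξ, formDens g h ξ * cosSymb R ξ
        = ∫ ξ, (((n : ℝ)⁻¹ : ℝ) : ℂ) * (formDens g h ξ * cosSymb R ξ) :=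
      fun R => (integral_const_mul _ _).symm
    simp_rw [e]
    rw [integral_integral_swap]
    · refine integral_congr_ae (ae_of_all _ fun ξ => ?_)
      simp only
      rw [integral_const_mul, integral_const_mul]
      unfold cosSymb
      rw [integral_complex_ofReal, intervalIntegral.integral_of_le hn]
      push_cast
      ring
    · refine Integrable.const_mul ?_ _
      have h1 : Integrable (fun z : ℝ × E3 => formDens g h z.2)
          ((volume.restrict (Ioc (n : ℝ) (2 * n))).prod volume) := hi.comp_snd _
      exact h1.mul_bdd (c := 1) continuous_cosSymb_uncurry.aestronglyMeasurable
        (ae_of_all _ fun z => norm_cosSymb_le z.1 z.2)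
  simp_rw [hswap]
  have hz : (0 : ℂ) = ∫ ξ : E3, (0 : ℂ) := by simp
  rw [hz]
  have hcb : ∀ (n : ℕ) (k : ℝ), |(n : ℝ)⁻¹ * ∫ R in (n : ℝ)..(2 * n), Real.cos (R * k)| ≤ 1 := by
    intro n k
    have hn0 : (0 : ℝ) ≤ n := Nat.cast_nonneg n
    have h1 : ‖∫ R in (n : ℝ)..(2 * n), Real.cos (R * k)‖ ≤ 1 * |2 * (n : ℝ) - n| :=
      intervalIntegral.norm_integral_le_of_norm_le_const fun x _ => Real.abs_cos_le_one _
    rw [Real.norm_eq_abs] at h1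
    rw [abs_mul, abs_of_nonneg (inv_nonneg.2 hn0)]
    have h2 : |2 * (n : ℝ) - n| = n := by rw [abs_of_nonneg] <;> linarith
    rw [h2, one_mul] at h1
    calc (n : ℝ)⁻¹ * _ ≤ (n : ℝ)⁻¹ * n := by gcongr
      _ ≤ 1 := inv_mul_le_one
  refine tendsto_integral_of_dominated_convergence (fun ξ => ‖formDens g h ξ‖) ?_ hi.norm ?_ ?_
  · intro n
    refine hi.aestronglyMeasurable.mul ?_
    have h1 : Continuous fun ξ : E3 => ∫ R in (n : ℝ)..(2 * n), Real.cos (R * kap ξ) := by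
      refine intervalIntegral.continuous_parametric_intervalIntegral_of_continuous' ?_ _ _
      have := continuous_kap
      simp only [Function.uncurry_def]
      fun_prop
    exact (Complex.continuous_ofReal.comp (continuous_const.mul h1)).aestronglyMeasurable
  · intro n
    refine ae_of_all _ fun ξ => ?_
    rw [norm_mul, Complex.norm_real]
    exact mul_le_of_le_one_right (norm_nonneg _) (hcb n _)
  · filter_upwards [ae_ne_zero_E3] with ξ hξ
    have hk := kap_pos hξ
    rw [← mul_zero (formDens g h ξ), ← Complex.ofReal_zero]
    refine Tendsto.const_mul _ ((Complex.continuous_ofReal.tendsto 0).comp ?_)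
    rw [tendsto_zero_iff_abs_tendsto_zero]
    refine squeeze_zero (g := fun n : ℕ => (n : ℝ)⁻¹ * (2 / kap ξ)) (fun _ => abs_nonneg _)
      (fun n => ?_) ?_
    · simp only [Function.comp_apply]
      rw [abs_mul, abs_of_nonneg (by positivity)]
      gcongr
      exact abs_integral_cos_le hk
    · simpa using (tendsto_inv_atTop_nhds_zero_nat (𝕜 := ℝ)).mul_const (2 / kap ξ)

theorem continuous_cosForm {g h : L2} (hg : Integrable (g : E3 → ℂ))
    (hh : Integrable (h : E3 → ℂ)) : Continuous fun R => cosForm R g h := by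
  obtain ⟨hi, -⟩ := formDens_bound hg hh
  unfold cosForm
  refine continuous_of_dominated (bound := fun ξ => ‖formDens g h ξ‖) ?_ ?_ hi.norm ?_
  · exact fun R => (integrable_formDens_mul hg hh (symb_cos R)).aestronglyMeasurable
  · intro R
    refine ae_of_all _ fun ξ => ?_
    rw [norm_mul]
    exact mul_le_of_le_one_right (norm_nonneg _) (norm_cosSymb_le _ _)
  · refine ae_of_all _ fun ξ => continuous_const.mul ?_
    exact continuous_cosSymb_uncurry.comp (Continuous.prodMk continuous_id continuous_const)

/-- The difference of the forms at `τ` and `R` is bounded by `farForm τ` for every `R ≥ τ`.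
Averaging over `R ∈ [n, 2n]` and letting `n → ∞` removes the term at `R`. -/
theorem enorm_cosForm_le_farForm {g h : L2} (hg : Nice g) (hh : Nice h) {τ : ℝ} (hτ : 0 < τ) :
    ‖cosForm τ g h‖ₑ ≤ farForm τ g h := by
  by_cases hJ : farForm τ g h = ⊤
  · rw [hJ]; exact le_top
  set J := (farForm τ g h).toReal with hJdef
  have hb : ∀ R, τ ≤ R → ‖cosForm τ g h - cosForm R g h‖ ≤ J := by
    intro R hR
    have := ENNReal.toReal_mono hJ (enorm_cosForm_sub_le hg hh hτ hR)
    simpa using this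
  have hev : ∀ᶠ n : ℕ in atTop, ‖cosForm τ g h‖ - J ≤
      ‖(((n : ℝ)⁻¹ : ℝ) : ℂ) * ∫ R in (n : ℝ)..(2 * n), cosForm R g h‖ := by
    filter_upwards [eventually_ge_atTop (Nat.ceil τ + 1)] with n hn
    have hnτ : τ ≤ n := (Nat.le_ceil τ).trans (by exact_mod_cast (Nat.le_succ _).trans hn)
    have hn0 : (0 : ℝ) < n := hτ.trans_le hnτ
    have hci : IntervalIntegrable (fun R => cosForm R g h) volume n (2 * n) :=
      (continuous_cosForm hg.1 hh.1).intervalIntegrable _ _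
    have h1 : ‖∫ R in (n : ℝ)..(2 * n), (cosForm τ g h - cosForm R g h)‖
        ≤ J * |2 * (n : ℝ) - n| := by
      refine intervalIntegral.norm_integral_le_of_norm_le_const fun R hR => hb R ?_
      rw [uIoc_of_le (by linarith)] at hR
      exact hnτ.trans hR.1.le
    have h2 : |2 * (n : ℝ) - n| = n := by rw [abs_of_nonneg] <;> linarith
    rw [intervalIntegral.integral_sub (by simp) hci, intervalIntegral.integral_const, h2] at h1
    set I := ∫ R in (n : ℝ)..(2 * n), cosForm R g h with hI
    have h3 : ‖(2 * (n : ℝ) - n) • cosForm τ g h‖ = n * ‖cosForm τ g h‖ := by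
      rw [norm_smul, Real.norm_eq_abs, h2]
    have h4 := norm_sub_norm_le ((2 * (n : ℝ) - n) • cosForm τ g h) I
    rw [norm_mul, Complex.norm_real, norm_inv, Real.norm_of_nonneg hn0.le]
    rw [inv_mul_eq_div, le_div_iff₀ hn0]
    nlinarith
  have hlim := (tendsto_average_cosForm hg.1 hh.1).norm
  rw [norm_zero] at hlim
  have h0 : ‖cosForm τ g h‖ - J ≤ 0 := ge_of_tendsto hlim hev
  rw [← ENNReal.ofReal_toReal hJ, ← ofReal_norm]
  exact ENNReal.ofReal_le_ofReal (by linarith)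

/-- The dispersive estimate for `cos(τ√(-Δ)) (-Δ)⁻¹` from `L^{r'}` to `L^r`. -/
theorem dispersive {r b : ℝ} (hr : 6 < r) (hb : b = r / (r - 1)) :
    ∃ A : ℝ, 0 ≤ A ∧ ∀ (g h : L2), Nice g → Nice h → ∀ τ : ℝ, τ ≠ 0 →
      ‖cosForm τ g h‖ₑ ≤ ENNReal.ofReal (A * |τ| ^ (-(1 - 6 / r))) *
        (∫⁻ x, ‖g x‖ₑ ^ b) ^ (1 / b) * (∫⁻ x, ‖h x‖ₑ ^ b) ^ (1 / b) := by
  -- `|x|^{-r/2}` is integrable at infinity in `ℝ³` exactly when `r > 6`. The exponent of `|τ|`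
  -- comes from `(|τ|^{3 - r/2})^{2/r} = |τ|^{-(1-6/r)}`.
  obtain ⟨A, hA0, hA⟩ := lintegral_E3_far (e := -(r / 2)) (by linarith)
  have hr0 : 0 < r := by linarith
  refine ⟨A ^ (2 / r), by positivity, fun g h hg hh τ hτ => ?_⟩
  have hτ' : 0 < |τ| := abs_pos.2 hτ
  have heven : cosForm τ g h = cosForm |τ| g h := by
    unfold cosForm cosSymb
    rcases abs_choice τ with h | h <;> rw [h]
    simp_rw [neg_mul, Real.cos_neg]
  rw [heven]
  refine (enorm_cosForm_le_farForm hg hh hτ').trans ?_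
  refine (young_trilinear (by linarith) hb (measurable_farKer _)
    (Lp.aestronglyMeasurable g).enorm (Lp.aestronglyMeasurable h).enorm).trans (le_of_eq ?_)
  congr 2
  have e : ∀ x : E3, farKer |τ| x ^ (r / 2)
      = ENNReal.ofReal ((Ici |τ|).indicator (fun y => y ^ (-(r / 2))) ‖x‖) := by
    intro x
    unfold farKer
    by_cases hx : ‖x‖ ∈ Ici |τ|
    · have hx0 : 0 < ‖x‖ := hτ'.trans_le hx
      rw [indicator_of_mem hx, indicator_of_mem hx, ENNReal.ofReal_rpow_of_pos (by positivity),
        Real.inv_rpow hx0.le, Real.rpow_neg hx0.le]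
    · rw [indicator_of_notMem hx, indicator_of_notMem hx, ENNReal.ofReal_zero,
        ENNReal.zero_rpow_of_pos (by positivity)]
  simp_rw [e]
  rw [hA _ hτ', ENNReal.ofReal_rpow_of_nonneg (by positivity) (by positivity),
    Real.mul_rpow hA0 (by positivity), ← Real.rpow_mul hτ'.le]
  congr 3
  field_simp
  ring

end ForcedNLW

end

noncomputable section

namespace ForcedNLW

open Filter Topology FourierTransform

/-! ### The power nonlinearity -/

/-- Bernoulli's inequality for `y/x`, multiplied by `x^β · x`. In this form nothing is divided by
`x`, and the case `x = 0` is included. -/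
theorem rpow_sub_rpow_mul_le {x y β : ℝ} (hy : 0 ≤ y) (hyx : y ≤ x) (hβ : 1 ≤ β) :
    (x ^ β - y ^ β) * x ≤ β * x ^ β * (x - y) := by
  rcases (hy.trans hyx).eq_or_lt with hx | hx
  · have : y = 0 := le_antisymm (hyx.trans hx.symm.le) hy
    simp [← hx, this]
  · have h := one_add_mul_self_le_rpow_one_add (s := y / x - 1)
      (by have := div_nonneg hy hx.le; linarith) hβ
    rw [show 1 + (y / x - 1) = y / x by ring, Real.div_rpow hy hx.le,
      le_div_iff₀ (Real.rpow_pos_of_pos hx β)] at h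
    have h2 := mul_le_mul_of_nonneg_right h hx.le
    have h3 : (1 + β * (y / x - 1)) * x ^ β * x = x ^ β * (x + β * (y - x)) := by
      field_simp
    rw [h3] at h2
    linarith

theorem norm_nonlin {b : ℝ} (hb : 1 < b) (z : ℂ) : ‖nonlin b z‖ = ‖z‖ ^ b := by
  rw [nonlin, norm_mul, Complex.norm_real, Real.norm_of_nonneg (by positivity)]
  rcases (norm_nonneg z).eq_or_lt with hz | hz
  · rw [← hz, Real.zero_rpow (by linarith : b ≠ 0), mul_zero]
  · rw [← Real.rpow_add_one hz.ne']
    congr 1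
    ring

/-- With `‖w‖ ≤ ‖z‖`, the difference is `|z|^{b-1}(z - w) + (|z|^{b-1} - |w|^{b-1}) w`. The first
term contributes the constant 1 and the second `b - 1`. -/
theorem norm_nonlin_sub_le {b : ℝ} (hb : 2 ≤ b) (z w : ℂ) :
    ‖nonlin b z - nonlin b w‖ ≤ b * ((‖z‖ + ‖w‖) ^ (b - 1) * ‖z - w‖) := by
  wlog h : ‖w‖ ≤ ‖z‖ generalizing z w with H
  · have := H w z (le_of_not_ge h)
    rwa [norm_sub_rev, norm_sub_rev w z, add_comm] at this
  have e : nonlin b z - nonlin b w = ((‖z‖ ^ (b - 1) : ℝ) : ℂ) * (z - w) +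
      ((‖z‖ ^ (b - 1) - ‖w‖ ^ (b - 1) : ℝ) : ℂ) * w := by
    simp only [nonlin]
    push_cast
    ring
  have hmono : ‖w‖ ^ (b - 1) ≤ ‖z‖ ^ (b - 1) :=
    Real.rpow_le_rpow (norm_nonneg _) h (by linarith)
  have h1 : (‖z‖ ^ (b - 1) - ‖w‖ ^ (b - 1)) * ‖w‖ ≤ (b - 1) * ‖z‖ ^ (b - 1) * ‖z - w‖ :=
    calc (‖z‖ ^ (b - 1) - ‖w‖ ^ (b - 1)) * ‖w‖
        ≤ (‖z‖ ^ (b - 1) - ‖w‖ ^ (b - 1)) * ‖z‖ :=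
          mul_le_mul_of_nonneg_left h (sub_nonneg.2 hmono)
      _ ≤ (b - 1) * ‖z‖ ^ (b - 1) * (‖z‖ - ‖w‖) :=
          rpow_sub_rpow_mul_le (norm_nonneg _) h (by linarith)
      _ ≤ _ := mul_le_mul_of_nonneg_left (norm_sub_norm_le z w)
          (mul_nonneg (by linarith) (by positivity))
  have h2 : ‖z‖ ^ (b - 1) ≤ (‖z‖ + ‖w‖) ^ (b - 1) :=
    Real.rpow_le_rpow (norm_nonneg _) (by linarith [norm_nonneg w]) (by linarith)
  rw [e]
  refine (norm_add_le _ _).trans ?_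
  rw [norm_mul, norm_mul, Complex.norm_real, Complex.norm_real,
    Real.norm_of_nonneg (by positivity), Real.norm_of_nonneg (sub_nonneg.2 hmono)]
  calc ‖z‖ ^ (b - 1) * ‖z - w‖ + (‖z‖ ^ (b - 1) - ‖w‖ ^ (b - 1)) * ‖w‖
      ≤ b * (‖z‖ ^ (b - 1) * ‖z - w‖) := by linarith
    _ ≤ _ := by gcongr

theorem continuous_nonlin {b : ℝ} (hb : 1 < b) : Continuous (nonlin b) := by
  unfold nonlin
  exact (Complex.continuous_ofReal.comp
    (continuous_norm.rpow_const fun _ => Or.inr (by linarith))).mul continuous_id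

theorem eLpNorm_nonlin {b : ℝ} (hb : 1 < b) (f : E3 → ℂ) :
    eLpNorm (fun x => nonlin b (f x)) 2 volume = eLpNorm f (xExp b) volume ^ b := by
  have h := eLpNorm_norm_rpow (μ := volume) (p := 2) f (by linarith : 0 < b)
  have h2 : (2 : ℝ≥0∞) * ENNReal.ofReal b = xExp b := by
    rw [xExp, ENNReal.ofReal_mul (by norm_num)]
    simp
  rw [h2] at h
  rw [← h]
  refine eLpNorm_congr_norm_ae (Eventually.of_forall fun x => ?_)
  rw [norm_nonlin hb, Real.norm_of_nonneg (by positivity)]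

section

variable (b : ℝ) [hb : Fact (3 < b)]

theorem memLp_nonlin (f : LpX (xExp b)) : MemLp (fun x => nonlin b (f x)) 2 volume := by
  have hb1 : 1 < b := by linarith [hb.out]
  refine ⟨(continuous_nonlin hb1).comp_aestronglyMeasurable (Lp.aestronglyMeasurable f), ?_⟩
  rw [eLpNorm_nonlin hb1]
  exact ENNReal.rpow_lt_top_of_nonneg (by linarith) (Lp.eLpNorm_ne_top f)

/-- The nonlinearity as a map `L^{2b} → L²`. -/
def Nl (f : LpX (xExp b)) : L2 := (memLp_nonlin b f).toLp _

theorem Nl_ae (f : LpX (xExp b)) : (Nl b f : E3 → ℂ) =ᵐ[volume] fun x => nonlin b (f x) :=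
  (memLp_nonlin b f).coeFn_toLp

theorem norm_Nl (f : LpX (xExp b)) : ‖Nl b f‖ = ‖f‖ ^ b := by
  rw [Nl, Lp.norm_toLp, eLpNorm_nonlin (by linarith [hb.out]), ← ENNReal.toReal_rpow, Lp.norm_def]

theorem norm_Nl_sub_le (f g : LpX (xExp b)) :
    ‖Nl b f - Nl b g‖ ≤ b * ((‖f‖ + ‖g‖) ^ (b - 1) * ‖f - g‖) := by
  have hb3 := hb.out
  have hb0 : 0 < b - 1 := by linarith
  set h : E3 → ℝ := fun x => ‖f x‖ + ‖g x‖ with hh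
  have hm : AEStronglyMeasurable h volume :=
    (Lp.aestronglyMeasurable f).norm.add (Lp.aestronglyMeasurable g).norm
  have hnorm : eLpNorm h (xExp b) volume ≤ ENNReal.ofReal (‖f‖ + ‖g‖) := by
    refine (eLpNorm_add_le (Lp.aestronglyMeasurable f).norm (Lp.aestronglyMeasurable g).norm
      (xExp_fact b).out).trans ?_
    rw [eLpNorm_norm, eLpNorm_norm, ENNReal.ofReal_add (norm_nonneg _) (norm_nonneg _),
      ← Lp.enorm_def, ← Lp.enorm_def, ofReal_norm, ofReal_norm]
  -- Hölder with `1/2 = (b-1)/(2b) + 1/(2b)`: the power `b - 1` of an `L^{2b}` function lies in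
  -- `L^e`.
  set e : ℝ≥0∞ := ENNReal.ofReal (2 * b / (b - 1)) with he
  have : ENNReal.HolderTriple e (xExp b) 2 := ⟨by
    have h2 : (2 : ℝ≥0∞) = ENNReal.ofReal 2 := by simp
    rw [he, xExp, h2, ← ENNReal.ofReal_inv_of_pos (by positivity),
      ← ENNReal.ofReal_inv_of_pos (by positivity), ← ENNReal.ofReal_inv_of_pos (by positivity),
      ← ENNReal.ofReal_add (by positivity) (by positivity)]
    congr 1
    field_simp
    ring⟩
  have hpow : eLpNorm (fun x => h x ^ (b - 1)) e volume ≤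
      ENNReal.ofReal ((‖f‖ + ‖g‖) ^ (b - 1)) := by
    have h1 := eLpNorm_norm_rpow (μ := volume) (p := e) h hb0
    have h2 : e * ENNReal.ofReal (b - 1) = xExp b := by
      rw [he, xExp, ← ENNReal.ofReal_mul (by positivity)]
      congr 1
      field_simp
    rw [h2] at h1
    have h3 : (fun x => ‖h x‖ ^ (b - 1)) = fun x => h x ^ (b - 1) := by
      funext x
      rw [Real.norm_of_nonneg (by positivity)]
    rw [← h3, h1, ← ENNReal.ofReal_rpow_of_nonneg (by positivity) hb0.le]
    gcongr
  have hprod : eLpNorm (fun x => nonlin b (f x) - nonlin b (g x)) 2 volume ≤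
      ENNReal.ofReal b * eLpNorm (fun x => h x ^ (b - 1)) e volume *
        eLpNorm (fun x => f x - g x) (xExp b) volume := by
    have := eLpNorm_le_eLpNorm_mul_eLpNorm_of_nnnorm (p := e) (q := xExp b) (r := 2)
      (μ := volume) (f := fun x => h x ^ (b - 1)) (g := fun x => f x - g x)
      (AEMeasurable.pow_const hm.aemeasurable _).aestronglyMeasurable
      ((Lp.aestronglyMeasurable f).sub (Lp.aestronglyMeasurable g))
      (fun (u : ℝ) (z : ℂ) => (b * u : ℝ) • z) b.toNNReal (Eventually.of_forall fun x => by
        rw [nnnorm_smul, nnnorm_mul, Real.nnnorm_of_nonneg (by linarith : 0 ≤ b),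
          Real.toNNReal_of_nonneg (by linarith : 0 ≤ b)])
    refine le_trans (eLpNorm_mono fun x => ?_) this
    refine (norm_nonlin_sub_le (by linarith) _ _).trans_eq ?_
    rw [norm_smul, Real.norm_of_nonneg (by positivity)]
    ring
  have hfin : ‖Nl b f - Nl b g‖ₑ ≤ ENNReal.ofReal (b * ((‖f‖ + ‖g‖) ^ (b - 1) * ‖f - g‖)) := by
    rw [Lp.enorm_def]
    have e1 : eLpNorm (Nl b f - Nl b g : L2) 2 volume =
        eLpNorm (fun x => nonlin b (f x) - nonlin b (g x)) 2 volume := by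
      refine eLpNorm_congr_ae ?_
      filter_upwards [Lp.coeFn_sub (Nl b f) (Nl b g), Nl_ae b f, Nl_ae b g] with x h1 h2 h3
      rw [h1, Pi.sub_apply, h2, h3]
    have e2 : eLpNorm (fun x => f x - g x) (xExp b) volume = ENNReal.ofReal ‖f - g‖ := by
      rw [ofReal_norm, Lp.enorm_def]
      refine eLpNorm_congr_ae ?_
      filter_upwards [Lp.coeFn_sub f g] with x h1
      rw [h1, Pi.sub_apply]
    rw [e1]
    refine hprod.trans ?_
    rw [e2, ENNReal.ofReal_mul (by linarith : 0 ≤ b), ENNReal.ofReal_mul (by positivity),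
      ← mul_assoc]
    gcongr
  rw [← ofReal_norm] at hfin
  exact (ENNReal.ofReal_le_ofReal_iff (by positivity)).1 hfin

theorem continuous_Nl : Continuous (Nl b) := by
  have hb3 := hb.out
  rw [continuous_iff_continuousAt]
  intro f
  rw [ContinuousAt, tendsto_iff_norm_sub_tendsto_zero]
  have h : Tendsto (fun g : LpX (xExp b) => b * ((‖g‖ + ‖f‖) ^ (b - 1) * ‖g - f‖)) (𝓝 f) (𝓝 0) := by
    have : Continuous fun g : LpX (xExp b) => b * ((‖g‖ + ‖f‖) ^ (b - 1) * ‖g - f‖) := by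
      refine continuous_const.mul (Continuous.mul ?_ (by fun_prop))
      exact (by fun_prop : Continuous fun g : LpX (xExp b) => ‖g‖ + ‖f‖).rpow_const
        fun _ => Or.inr (by linarith)
    have h2 := this.tendsto f
    simpa using h2
  exact squeeze_zero (fun _ => norm_nonneg _) (fun g => norm_Nl_sub_le b g f) h

end

end ForcedNLW

end

noncomputable section

namespace ForcedNLW

open Filter Topology FourierTransform

/-! ### Frequency bands -/

/-- The frequency band `(n+1)⁻¹ ≤ κ ≤ n+1`. -/
def bandSet (n : ℕ) : Set E3 := {ξ | ((n : ℝ) + 1)⁻¹ ≤ kap ξ ∧ kap ξ ≤ (n : ℝ) + 1}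

theorem measurableSet_bandSet (n : ℕ) : MeasurableSet (bandSet n) := by
  have := continuous_kap.measurable
  unfold bandSet
  measurability

/-- The symbol of the projection onto a frequency band. -/
def band (n : ℕ) : E3 → ℂ := (bandSet n).indicator 1

theorem band_of_mem {n : ℕ} {ξ : E3} (h : ξ ∈ bandSet n) : band n ξ = 1 := indicator_of_mem h _

theorem band_of_notMem {n : ℕ} {ξ : E3} (h : ξ ∉ bandSet n) : band n ξ = 0 :=
  indicator_of_notMem h _

theorem norm_band_le (n : ℕ) (ξ : E3) : ‖band n ξ‖ ≤ 1 := by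
  by_cases h : ξ ∈ bandSet n
  · rw [band_of_mem h, norm_one]
  · rw [band_of_notMem h, norm_zero]; exact zero_le_one

theorem conj_band (n : ℕ) (ξ : E3) : (starRingEnd ℂ) (band n ξ) = band n ξ := by
  by_cases h : ξ ∈ bandSet n
  · rw [band_of_mem h, map_one]
  · rw [band_of_notMem h, map_zero]

theorem measurable_band (n : ℕ) : Measurable (band n) :=
  measurable_const.indicator (measurableSet_bandSet n)

theorem symb_band (n : ℕ) : Symb (band n) := ⟨measurable_band n, 1, norm_band_le n⟩

theorem kap_pos_of_mem_band {n : ℕ} {ξ : E3} (h : ξ ∈ bandSet n) : 0 < kap ξ :=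
  lt_of_lt_of_le (by positivity) h.1

theorem bandSet_mono {m n : ℕ} (h : m ≤ n) : bandSet m ⊆ bandSet n := by
  intro ξ hξ
  have : (m : ℝ) ≤ n := by exact_mod_cast h
  exact ⟨le_trans (by gcongr) hξ.1, hξ.2.trans (by linarith)⟩

theorem band_mul_band {m n : ℕ} (h : m ≤ n) (ξ : E3) : band m ξ * band n ξ = band m ξ := by
  by_cases hξ : ξ ∈ bandSet m
  · rw [band_of_mem hξ, band_of_mem (bandSet_mono h hξ), one_mul]
  · rw [band_of_notMem hξ, zero_mul]

theorem eventually_mem_bandSet {ξ : E3} (h : ξ ≠ 0) : ∀ᶠ n : ℕ in atTop, ξ ∈ bandSet n := by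
  have hk := kap_pos h
  obtain ⟨N, hN⟩ := exists_nat_ge (max (kap ξ) (kap ξ)⁻¹)
  filter_upwards [eventually_ge_atTop N] with n hn
  have hn' : (N : ℝ) ≤ n := by exact_mod_cast hn
  refine ⟨inv_le_of_inv_le₀ hk ?_, ?_⟩
  · linarith [le_max_right (kap ξ) (kap ξ)⁻¹]
  · linarith [le_max_left (kap ξ) (kap ξ)⁻¹]

theorem tendsto_band {ξ : E3} (h : ξ ≠ 0) : Tendsto (fun n => band n ξ) atTop (𝓝 1) :=
  tendsto_const_nhds.congr' <| by
    filter_upwards [eventually_mem_bandSet h] with n hn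
    rw [band_of_mem hn]

theorem tendsto_fmul_band (f : L2) : Tendsto (fun n => fmul (band n) f) atTop (𝓝 f) := by
  have h := tendsto_fmul (l := atTop) (m := band) (m₀ := fun _ => 1) (C := 1) measurable_band
    measurable_const norm_band_le (fun _ => by simp)
    (by filter_upwards [ae_ne_zero_E3] with ξ hξ using tendsto_band hξ) f
  rwa [fmul_one] at h

theorem volume_bandSet_lt_top (n : ℕ) : volume (bandSet n) < ⊤ := by
  refine (measure_mono (fun ξ hξ => ?_)).trans_lt
    (measure_closedBall_lt_top (x := (0 : E3)) (r := (n : ℝ) + 1))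
  rw [mem_closedBall_zero_iff]
  have h := hξ.2
  unfold kap at h
  have : 1 ≤ 2 * Real.pi := by linarith [Real.pi_gt_three]
  nlinarith [norm_nonneg ξ]

theorem memLp_band (n : ℕ) : MemLp (band n) 2 volume :=
  memLp_indicator_const 2 (measurableSet_bandSet n) 1 (Or.inr (volume_bandSet_lt_top n).ne)

theorem L2_eq_fourierInv_of_integrable {f : L2} (hf : Integrable ((𝓕 f : L2) : E3 → ℂ)) :
    (f : E3 → ℂ) =ᵐ[volume] 𝓕⁻ ((𝓕 f : L2) : E3 → ℂ) := by
  set g : L2 := 𝓕 f with hg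
  have hcont : Continuous (𝓕⁻ (g : E3 → ℂ)) :=
    VectorFourier.fourierIntegral_continuous Real.continuous_fourierChar
      (L := -innerₗ E3) (continuous_inner (𝕜 := ℝ) (E := E3)).neg hf
  refine ae_eq_of_integral_contDiff_smul_eq ((Lp.memLp _).locallyIntegrable (by norm_num))
    hcont.locallyIntegrable ?_
  intro φ h1 h2
  have hg₁ : HasCompactSupport (Complex.ofRealCLM ∘ φ) := h2.comp_left rfl
  have hg₂ : ContDiff ℝ ∞ (Complex.ofRealCLM ∘ φ) := by fun_prop
  set ψ := hg₁.toSchwartzMap hg₂ with hψ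
  have e1 := congrArg (fun d : 𝓢'(E3, ℂ) => d ψ) (Lp.fourierInv_toTemperedDistribution_eq g)
  have e0 : (𝓕⁻ g : L2) = f := FourierTransform.fourierInv_fourier_eq f
  rw [e0] at e1
  simp only [TemperedDistribution.fourierInv_apply, Lp.toTemperedDistribution_apply] at e1
  have e2 : ∫ x, (𝓕⁻ ψ : 𝓢(E3, ℂ)) x • g x = ∫ x, ψ x • 𝓕⁻ (g : E3 → ℂ) x := by
    have := VectorFourier.integral_fourierIntegral_smul_eq_flip (L := -innerₗ E3)
      (μ := volume) (ν := volume) Real.continuous_fourierChar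
      (continuous_inner (𝕜 := ℝ) (E := E3)).neg ψ.integrable hf
    have hflip : (-innerₗ E3).flip = -innerₗ E3 := by
      ext x y
      simp [real_inner_comm]
    rw [hflip] at this
    rw [SchwartzMap.fourierInv_coe]
    exact this
  rw [e2] at e1
  simpa [hψ] using e1.symm

/-- The band has finite measure, so Cauchy–Schwarz makes the localized transform integrable and
Fourier inversion gives a sup bound. The constant depends on `n` and serves only qualitative
purposes. -/
theorem exists_sup_bound_band (n : ℕ) :
    ∃ C : ℝ, 0 ≤ C ∧ ∀ f : L2, ∀ᵐ x, ‖fmul (band n) f x‖ ≤ C * ‖f‖ := by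
  set B : L2 := (memLp_band n).toLp _ with hB
  refine ⟨‖B‖, norm_nonneg _, fun f => ?_⟩
  have e : ((𝓕 (fmul (band n) f) : L2) : E3 → ℂ) =ᵐ[volume] fun ξ => B ξ * (𝓕 f : L2) ξ := by
    filter_upwards [fmul_ae (symb_band n) f, (memLp_band n).coeFn_toLp] with ξ h1 h2
    rw [h1, hB, h2]
  have hn : (fun ξ => ‖(𝓕 (fmul (band n) f) : L2) ξ‖) =ᵐ[volume]
      fun ξ => ‖B ξ‖ * ‖(𝓕 f : L2) ξ‖ := by
    filter_upwards [e] with ξ h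
    rw [h, norm_mul]
  have hi : Integrable ((𝓕 (fmul (band n) f) : L2) : E3 → ℂ) := by
    rw [← integrable_norm_iff (Lp.aestronglyMeasurable _)]
    exact (integrable_norm_mul_norm B (𝓕 f)).congr hn.symm
  filter_upwards [L2_eq_fourierInv_of_integrable hi] with x hx
  rw [hx]
  refine (VectorFourier.norm_fourierIntegral_le_integral_norm _ _ _ _ _).trans ?_
  rw [integral_congr_ae hn]
  refine (integral_norm_mul_norm_le _ _).trans_eq ?_
  rw [Lp.norm_fourier_eq]

/-! ### Multipliers localized to a band -/

/-- The symbol `cos(t√(-Δ))/√(-Δ)` on a band. -/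
def bcSymb (n : ℕ) (t : ℝ) (ξ : E3) : ℂ := band n ξ * (((kap ξ)⁻¹ : ℝ) : ℂ) * cosSymb t ξ

/-- The symbol `sin(t√(-Δ))/√(-Δ)` on a band. -/
def bsSymb (n : ℕ) (t : ℝ) (ξ : E3) : ℂ := band n ξ * sinSymb t ξ

/-- The lower edge of the band is there for this: it keeps `κ^{-1}` bounded. -/
theorem symb_invBand (n : ℕ) : Symb fun ξ => band n ξ * (((kap ξ)⁻¹ : ℝ) : ℂ) := by
  refine ⟨?_, n + 1, fun ξ => ?_⟩
  · have := continuous_kap.measurable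
    have := measurable_band n
    fun_prop
  · by_cases h : ξ ∈ bandSet n
    · beta_reduce
      rw [band_of_mem h, one_mul, Complex.norm_real, norm_inv,
        Real.norm_of_nonneg (kap_nonneg ξ)]
      exact inv_le_of_inv_le₀ (by positivity) h.1
    · beta_reduce
      rw [band_of_notMem h, zero_mul, norm_zero]
      positivity

theorem symb_bc (n : ℕ) (t : ℝ) : Symb (bcSymb n t) := (symb_invBand n).mul (symb_cos t)

theorem symb_bs (n : ℕ) (t : ℝ) : Symb (bsSymb n t) := (symb_band n).mul (symb_sin t)

theorem continuous_fmul_bc (n : ℕ) (f : L2) : Continuous fun t => fmul (bcSymb n t) f := by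
  have e : (fun t => fmul (bcSymb n t) f) = fun t =>
      fmul (fun ξ => band n ξ * (((kap ξ)⁻¹ : ℝ) : ℂ)) (fmul (cosSymb t) f) := by
    ext1 t
    rw [fmul_fmul (symb_invBand n) (symb_cos t)]
    rfl
  rw [e]
  exact (ContinuousLinearMap.continuous _).comp (continuous_fmul_cos f)

theorem continuous_fmul_bs (n : ℕ) (f : L2) : Continuous fun t => fmul (bsSymb n t) f := by
  have e : (fun t => fmul (bsSymb n t) f) = fun t => fmul (band n) (fmul (sinSymb t) f) := by
    ext1 t
    rw [fmul_fmul (symb_band n) (symb_sin t)]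
    rfl
  rw [e]
  exact (ContinuousLinearMap.continuous _).comp (continuous_fmul_sin f)

theorem conj_bc (n : ℕ) (t : ℝ) (ξ : E3) : (starRingEnd ℂ) (bcSymb n t ξ) = bcSymb n t ξ := by
  rw [bcSymb, cosSymb, map_mul, map_mul, conj_band, Complex.conj_ofReal, Complex.conj_ofReal]

theorem conj_bs (n : ℕ) (t : ℝ) (ξ : E3) : (starRingEnd ℂ) (bsSymb n t ξ) = bsSymb n t ξ := by
  rw [bsSymb, sinSymb, map_mul, conj_band, Complex.conj_ofReal]

/-- The addition formula for the cosine. Taken together, the cosine and sine evolutions have a Gram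
kernel depending only on `t - s`, namely the one the dispersive estimate controls. -/
theorem bc_mul_add_bs_mul (n : ℕ) (s t : ℝ) (ξ : E3) :
    bcSymb n s ξ * bcSymb n t ξ + bsSymb n s ξ * bsSymb n t ξ =
      (((kap ξ ^ 2)⁻¹ : ℝ) : ℂ) * (cosSymb (t - s) ξ * band n ξ) := by
  by_cases h : ξ ∈ bandSet n
  · have hk := (kap_pos_of_mem_band h).ne'
    have hs : ∀ t, sinSymb t ξ = ((Real.sin (t * kap ξ) / kap ξ : ℝ) : ℂ) := by
      intro t
      have := kap_mul_sinSymb t ξ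
      have hk' : (kap ξ : ℂ) ≠ 0 := by exact_mod_cast hk
      rw [Complex.ofReal_div, ← this]
      field_simp
    simp only [bcSymb, bsSymb, hs, cosSymb, band_of_mem h, one_mul, mul_one]
    rw [sub_mul, Real.cos_sub]
    norm_cast
    field_simp
  · simp [bcSymb, bsSymb, band_of_notMem h]

theorem integrable_conj_mul_symb (g h : L2) {m : E3 → ℂ} (hm : Symb m) :
    Integrable fun ξ => (starRingEnd ℂ) ((𝓕 h : L2) ξ) * (m ξ * (𝓕 g : L2) ξ) := by
  obtain ⟨hm, C, hC⟩ := hm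
  have h1 := (L2.integrable_inner (𝕜 := ℂ) (𝓕 h : L2) (𝓕 g)).mul_bdd (g := m)
    hm.aestronglyMeasurable (ae_of_all _ hC)
  refine h1.congr (ae_of_all _ fun ξ => ?_)
  simp only [RCLike.inner_apply]
  ring

/-- The form `⟨cos(τ√(-Δ))(-Δ)⁻¹ g, h⟩` localized to a band. -/
def bandForm (n : ℕ) (τ : ℝ) (g h : L2) : ℂ := ∫ ξ, formDens g h ξ * (cosSymb τ ξ * band n ξ)

theorem inner_bc_add_inner_bs (n : ℕ) (s t : ℝ) (g h : L2) :
    inner ℂ (fmul (bcSymb n s) h) (fmul (bcSymb n t) g) +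
      inner ℂ (fmul (bsSymb n s) h) (fmul (bsSymb n t) g) = bandForm n (t - s) g h := by
  have hc : (fun ξ => (starRingEnd ℂ) (bcSymb n s ξ)) = bcSymb n s := funext (conj_bc n s)
  have hs : (fun ξ => (starRingEnd ℂ) (bsSymb n s ξ)) = bsSymb n s := funext (conj_bs n s)
  have hcc := (symb_bc n s).mul (symb_bc n t)
  have hss := (symb_bs n s).mul (symb_bs n t)
  rw [inner_fmul_left (symb_bc n s), inner_fmul_left (symb_bs n s), hc, hs,
    fmul_fmul (symb_bc n s) (symb_bc n t), fmul_fmul (symb_bs n s) (symb_bs n t),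
    inner_fmul_right hcc, inner_fmul_right hss,
    ← integral_add (integrable_conj_mul_symb g h hcc) (integrable_conj_mul_symb g h hss)]
  refine integral_congr_ae (ae_of_all _ fun ξ => ?_)
  have := bc_mul_add_bs_mul n s t ξ
  simp only [formDens]
  linear_combination (starRingEnd ℂ) ((𝓕 h : L2) ξ) * (𝓕 g : L2) ξ * this

theorem norm_bandForm_le {g h : L2} (hg : Integrable (g : E3 → ℂ)) (hh : Integrable (h : E3 → ℂ))
    (n : ℕ) (τ : ℝ) : ‖bandForm n τ g h‖ ≤
      (∫ x, ‖h x‖) * (∫ x, ‖g x‖) * ballConst + ‖h‖ * ‖g‖ := by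
  obtain ⟨hi, hb⟩ := formDens_bound hg hh
  refine (norm_integral_le_of_norm_le hi.norm (ae_of_all _ fun ξ => ?_)).trans hb
  rw [norm_mul, norm_mul]
  exact mul_le_of_le_one_right (norm_nonneg _)
    (mul_le_one₀ (norm_cosSymb_le τ ξ) (norm_nonneg _) (norm_band_le n ξ))

theorem tendsto_bandForm {g h : L2} (hg : Integrable (g : E3 → ℂ)) (hh : Integrable (h : E3 → ℂ))
    (τ : ℝ) : Tendsto (fun n => bandForm n τ g h) atTop (𝓝 (cosForm τ g h)) := by
  obtain ⟨hi, -⟩ := formDens_bound hg hh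
  refine tendsto_integral_of_dominated_convergence (fun ξ => ‖formDens g h ξ‖) (fun n => ?_)
    hi.norm (fun n => ae_of_all _ fun ξ => ?_) ?_
  · exact hi.aestronglyMeasurable.mul
      ((symb_cos τ).mul (symb_band n)).1.aestronglyMeasurable
  · rw [norm_mul, norm_mul]
    exact mul_le_of_le_one_right (norm_nonneg _)
      (mul_le_one₀ (norm_cosSymb_le τ ξ) (norm_nonneg _) (norm_band_le n ξ))
  · filter_upwards [ae_ne_zero_E3] with ξ hξ
    have := ((tendsto_band hξ).const_mul (cosSymb τ ξ)).const_mul (formDens g h ξ)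
    simpa using this

end ForcedNLW

end

noncomputable section

namespace ForcedNLW

open Filter Topology FourierTransform

/-! ### The dual estimate -/

section

variable {A : Set ℝ} {H : ℝ → L2} {M : ℝ}

theorem integrableOn_strong_family {K : ℝ → L2 →L[ℂ] L2} (hK : ∀ x, Continuous fun t => K t x)
    {T : ℝ} (hAT : A ⊆ Icc 0 T) (hHm : AEStronglyMeasurable H (volume.restrict A))
    (hHM : ∀ t, ‖H t‖ ≤ M) (hA : MeasurableSet A) (s₀ : ℝ) :
    IntegrableOn (fun t => K (t - s₀) (H t)) A := by
  obtain ⟨B, hB0, hB⟩ := exists_bound_of_strongly_continuous hK (|T| + |s₀|)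
  refine IntegrableOn.of_bound ((measure_mono hAT).trans_lt measure_Icc_lt_top)
    (aestronglyMeasurable_family hK (by fun_prop) hHm) (B * M) ?_
  filter_upwards [ae_restrict_mem hA] with t ht
  refine (ContinuousLinearMap.le_opNorm _ _).trans ?_
  have h1 := hAT ht
  have h2 : |t - s₀| ≤ |T| + |s₀| := by
    refine (abs_sub _ _).trans ?_
    have : |t| ≤ |T| := abs_le_abs_of_nonneg h1.1 h1.2
    linarith
  exact mul_le_mul (hB _ h2) (hHM t) (norm_nonneg _) hB0

theorem inner_integral_self {x : ℝ → L2} (hx : IntegrableOn x A) :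
    inner ℂ (∫ t in A, x t) (∫ t in A, x t) = ∫ t in A, ∫ s in A, inner ℂ (x s) (x t) := by
  rw [← integral_inner hx]
  refine integral_congr_ae (ae_of_all _ fun t => ?_)
  beta_reduce
  rw [← inner_conj_symm, ← integral_inner hx, ← integral_conj]
  refine integral_congr_ae (ae_of_all _ fun s => ?_)
  exact inner_conj_symm _ _

theorem integrableOn_inner_left {x : ℝ → L2} (hx : IntegrableOn x A) (c : L2) :
    IntegrableOn (fun s => inner ℂ (x s) c) A :=
  hx.inner_const c

theorem integrableOn_integral_inner {x : ℝ → L2} (hx : IntegrableOn x A) :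
    IntegrableOn (fun t => ∫ s in A, inner ℂ (x s) (x t)) A := by
  refine (hx.const_inner (𝕜 := ℂ) (∫ t in A, x t)).congr (ae_of_all _ fun t => ?_)
  beta_reduce
  rw [← inner_conj_symm, ← integral_inner hx, ← integral_conj]
  refine integral_congr_ae (ae_of_all _ fun s => ?_)
  exact inner_conj_symm _ _

/-- The `TT*` identity: expanding both squares gives a double integral of inner products, and
`inner_bc_add_inner_bs` sums them. The base time `s₀` cancels in the difference, which later allows
a separate base time for each Duhamel source. -/
theorem norm_sq_add_norm_sq_eq {T : ℝ} (hA : MeasurableSet A) (hAT : A ⊆ Icc 0 T)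
    (hHm : AEStronglyMeasurable H (volume.restrict A))
    (hHM : ∀ t, ‖H t‖ ≤ M) (n : ℕ) (s₀ : ℝ) :
    ((‖∫ t in A, fmul (bcSymb n (t - s₀)) (H t)‖ ^ 2 +
      ‖∫ t in A, fmul (bsSymb n (t - s₀)) (H t)‖ ^ 2 : ℝ) : ℂ) =
      ∫ t in A, ∫ s in A, bandForm n (t - s) (H t) (H s) := by
  have hx := integrableOn_strong_family (continuous_fmul_bc n) hAT hHm hHM hA s₀
  have hy := integrableOn_strong_family (continuous_fmul_bs n) hAT hHm hHM hA s₀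
  push_cast
  have e1 := inner_self_eq_norm_sq_to_K (𝕜 := ℂ) (∫ t in A, fmul (bcSymb n (t - s₀)) (H t))
  have e2 := inner_self_eq_norm_sq_to_K (𝕜 := ℂ) (∫ t in A, fmul (bsSymb n (t - s₀)) (H t))
  rw [inner_integral_self hx] at e1
  rw [inner_integral_self hy] at e2
  refine (congrArg₂ (· + ·) e1 e2).symm.trans ?_
  rw [← integral_add (integrableOn_integral_inner hx) (integrableOn_integral_inner hy)]
  refine integral_congr_ae (ae_of_all _ fun t => ?_)
  beta_reduce
  rw [← integral_add (integrableOn_inner_left hx _) (integrableOn_inner_left hy _)]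
  refine integral_congr_ae (ae_of_all _ fun s => ?_)
  beta_reduce
  rw [inner_bc_add_inner_bs, sub_sub_sub_cancel_right]

/-- The narrower integral is the projection of the wider one onto the smaller band, and that
projection is a contraction of `L²`. -/
theorem norm_integral_band_le {T : ℝ} (hA : MeasurableSet A) (hAT : A ⊆ Icc 0 T)
    (hHm : AEStronglyMeasurable H (volume.restrict A)) (hHM : ∀ t, ‖H t‖ ≤ M)
    {σ : ℕ → ℝ → E3 → ℂ} (hσ : ∀ n t, Symb (σ n t))
    (hc : ∀ n x, Continuous fun t => fmul (σ n t) x)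
    (hb : ∀ m n, m ≤ n → ∀ t ξ, band m ξ * σ n t ξ = σ m t ξ)
    {m n : ℕ} (hmn : m ≤ n) (s₀ : ℝ) :
    ‖∫ t in A, fmul (σ m (t - s₀)) (H t)‖ ≤ ‖∫ t in A, fmul (σ n (t - s₀)) (H t)‖ := by
  have hx := integrableOn_strong_family (hc n) hAT hHm hHM hA s₀
  have e : ∫ t in A, fmul (σ m (t - s₀)) (H t) =
      fmul (band m) (∫ t in A, fmul (σ n (t - s₀)) (H t)) := by
    rw [← ContinuousLinearMap.integral_comp_comm _ hx]
    refine integral_congr_ae (ae_of_all _ fun t => ?_)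
    beta_reduce
    rw [fmul_fmul (symb_band m) (hσ n _)]
    congr 2
    ext ξ
    exact (hb m n hmn _ ξ).symm
  rw [e]
  have := norm_fmul_le (measurable_band m) (norm_band_le m)
    (∫ t in A, fmul (σ n (t - s₀)) (H t))
  rwa [one_mul] at this

theorem tendsto_integral_bandForm {T : ℝ} (hA : MeasurableSet A) (hAT : A ⊆ Icc 0 T)
    (hHm : AEStronglyMeasurable H (volume.restrict A))
    (hHM : ∀ t, ‖H t‖ ≤ M) (hI : ∀ t, Integrable (H t : E3 → ℂ))
    (hIM : ∀ t, ∫ x, ‖H t x‖ ≤ M) :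
    Tendsto (fun n => ∫ t in A, ∫ s in A, bandForm n (t - s) (H t) (H s)) atTop
      (𝓝 (∫ t in A, ∫ s in A, cosForm (t - s) (H t) (H s))) := by
  have hM0 : 0 ≤ M := (norm_nonneg _).trans (hHM 0)
  set B : ℝ := M * M * ballConst + M * M with hB
  have hfin : volume A < ⊤ := (measure_mono hAT).trans_lt measure_Icc_lt_top
  have : IsFiniteMeasure (volume.restrict A) := ⟨by simpa using hfin⟩
  have hbd : ∀ n t s, ‖bandForm n (t - s) (H t) (H s)‖ ≤ B := by
    intro n t s
    refine (norm_bandForm_le (hI t) (hI s) n (t - s)).trans ?_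
    have h0 : ∀ t, 0 ≤ ∫ x, ‖H t x‖ := fun t => integral_nonneg fun _ => norm_nonneg _
    have := ballConst_nonneg
    exact add_le_add (mul_le_mul_of_nonneg_right
      (mul_le_mul (hIM s) (hIM t) (h0 t) hM0) this)
      (mul_le_mul (hHM s) (hHM t) (norm_nonneg _) hM0)
  have hx := fun n => integrableOn_strong_family (continuous_fmul_bc n) hAT hHm hHM hA 0
  have hy := fun n => integrableOn_strong_family (continuous_fmul_bs n) hAT hHm hHM hA 0
  have he : ∀ n t s, bandForm n (t - s) (H t) (H s) =
      inner ℂ (fmul (bcSymb n (s - 0)) (H s)) (fmul (bcSymb n (t - 0)) (H t)) +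
      inner ℂ (fmul (bsSymb n (s - 0)) (H s)) (fmul (bsSymb n (t - 0)) (H t)) := by
    intro n t s
    rw [inner_bc_add_inner_bs, sub_sub_sub_cancel_right]
  have hm1 : ∀ n t, AEStronglyMeasurable (fun s => bandForm n (t - s) (H t) (H s))
      (volume.restrict A) := by
    intro n t
    simp only [he]
    exact ((integrableOn_inner_left (hx n) _).add
      (integrableOn_inner_left (hy n) _)).aestronglyMeasurable
  refine tendsto_integral_of_dominated_convergence (fun _ => B * volume.real A) (fun n => ?_)
    (integrable_const _) (fun n => ae_of_all _ fun t => ?_) (ae_of_all _ fun t => ?_)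
  · refine (((integrableOn_integral_inner (hx n)).add
      (integrableOn_integral_inner (hy n))).congr (ae_of_all _ fun t => ?_)).aestronglyMeasurable
    simp only [he, Pi.add_apply]
    rw [← integral_add (integrableOn_inner_left (hx n) _) (integrableOn_inner_left (hy n) _)]
  · refine (norm_integral_le_of_norm_le_const (ae_of_all _ fun s => hbd n t s)).trans_eq ?_
    simp
  · exact tendsto_integral_of_dominated_convergence (fun _ => B) (fun n => hm1 n t)
      (integrable_const _) (fun n => ae_of_all _ fun s => hbd n t s)
      (ae_of_all _ fun s => tendsto_bandForm (hI t) (hI s) _)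

end

theorem band_mul_bc {m n : ℕ} (h : m ≤ n) (t : ℝ) (ξ : E3) :
    band m ξ * bcSymb n t ξ = bcSymb m t ξ := by
  rw [bcSymb, ← mul_assoc, ← mul_assoc, band_mul_band h, bcSymb]

theorem band_mul_bs {m n : ℕ} (h : m ≤ n) (t : ℝ) (ξ : E3) :
    band m ξ * bsSymb n t ξ = bsSymb m t ξ := by
  rw [bsSymb, ← mul_assoc, band_mul_band h, bsSymb]

/-- The band form itself has no uniform `L^{r'} → L^r` bound, because sharp frequency cutoffs are
not bounded there. The left-hand side, however, is nondecreasing in `n` and tends to the double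
integral of `cosForm`, to which `dispersive` and then `hls` apply. The bound `M` only justifies the
limits and does not enter `K`. The majorant `y` of the `L^{r'}` norms is a separate argument so that
its measurability need not be derived. -/
theorem dual_estimate {r b l a : ℝ} (hr : 6 < r) (hb : b = r / (r - 1)) (hl : l = 1 - 6 / r)
    (ha : a = 2 / (2 - l)) :
    ∃ K : ℝ, 0 ≤ K ∧ ∀ (T : ℝ) (A : Set ℝ), MeasurableSet A → A ⊆ Icc 0 T →
      ∀ (H : ℝ → L2) (M : ℝ), AEStronglyMeasurable H (volume.restrict A) →
      (∀ t, ‖H t‖ ≤ M) → (∀ t, Nice (H t)) → (∀ t, ∫ x, ‖H t x‖ ≤ M) →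
      ∀ y : ℝ → ℝ≥0∞, Measurable y → (∀ t, y t ≠ ⊤) → ∫⁻ s, y s ^ a ≠ ⊤ →
      (∀ t ∈ A, (∫⁻ x, ‖H t x‖ₑ ^ b) ^ (1 / b) ≤ y t) →
      ∀ (n : ℕ) (s₀ : ℝ), ‖∫ t in A, fmul (bcSymb n (t - s₀)) (H t)‖ ^ 2 +
        ‖∫ t in A, fmul (bsSymb n (t - s₀)) (H t)‖ ^ 2 ≤
          K * (∫⁻ s, y s ^ a).toReal ^ (2 / a) := by
  obtain ⟨C, hC0, hC⟩ := dispersive hr hb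
  have hl0 : 0 < l := by
    rw [hl, sub_pos, div_lt_one (by linarith)]; exact hr
  have hl1 : l < 1 := by
    rw [hl]; have : 0 < 6 / r := by positivity
    linarith
  have ha0 : 0 < a := by rw [ha]; exact div_pos two_pos (by linarith)
  have h1l : 0 < 1 - l := by linarith
  refine ⟨C * (2 * (2 / (1 - l) + 2)), by positivity, ?_⟩
  intro T A hA hAT H M hHm hHM hN hIM y hy hyf hyI hHy n s₀
  have hI := fun t => (hN t).1
  set Q : ℕ → ℝ := fun k => ‖∫ t in A, fmul (bcSymb k (t - s₀)) (H t)‖ ^ 2 +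
        ‖∫ t in A, fmul (bsSymb k (t - s₀)) (H t)‖ ^ 2 with hQ
  have hmono : ∀ k, n ≤ k → Q n ≤ Q k := by
    intro k hk
    have h1 := norm_integral_band_le hA hAT hHm hHM symb_bc continuous_fmul_bc
      (fun _ _ h => band_mul_bc h) hk s₀
    have h2 := norm_integral_band_le hA hAT hHm hHM symb_bs continuous_fmul_bs
      (fun _ _ h => band_mul_bs h) hk s₀
    simp only [hQ]
    gcongr
  have hlim : Tendsto (fun k => ‖((Q k : ℝ) : ℂ)‖) atTop
      (𝓝 ‖∫ t in A, ∫ s in A, cosForm (t - s) (H t) (H s)‖) := by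
    have := (tendsto_integral_bandForm hA hAT hHm hHM hI hIM).norm
    refine this.congr fun k => ?_
    rw [← norm_sq_add_norm_sq_eq hA hAT hHm hHM k s₀]
  have hle : Q n ≤ ‖∫ t in A, ∫ s in A, cosForm (t - s) (H t) (H s)‖ := by
    refine ge_of_tendsto hlim ?_
    filter_upwards [eventually_ge_atTop n] with k hk
    rw [Complex.norm_real]
    exact (hmono k hk).trans (le_abs_self _)
  refine hle.trans ?_
  have hbound : ‖∫ t in A, ∫ s in A, cosForm (t - s) (H t) (H s)‖ₑ ≤
      ENNReal.ofReal C * (ENNReal.ofReal (2 * (2 / (1 - l) + 2)) * (∫⁻ s, y s ^ a) ^ (2 / a)) := by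
    calc ‖∫ t in A, ∫ s in A, cosForm (t - s) (H t) (H s)‖ₑ
        ≤ ∫⁻ t in A, ∫⁻ s in A, ‖cosForm (t - s) (H t) (H s)‖ₑ :=
          (enorm_integral_le_lintegral_enorm _).trans
            (lintegral_mono fun t => enorm_integral_le_lintegral_enorm _)
      _ ≤ ∫⁻ t in A, ∫⁻ s in A,
            ENNReal.ofReal C * (ENNReal.ofReal (|t - s| ^ (-l)) * y s * y t) := by
          refine lintegral_mono_ae ?_
          filter_upwards [ae_restrict_mem hA] with t ht
          refine lintegral_mono_ae ?_
          filter_upwards [ae_restrict_mem hA, ae_restrict_of_ae (Measure.ae_ne volume t)]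
            with s hs hst
          -- The dispersive bound fails at `τ = 0`; the diagonal is discarded as a null set.
          refine (hC (H t) (H s) (hN t) (hN s) (t - s) (sub_ne_zero.2 hst.symm)).trans ?_
          rw [← hl, ENNReal.ofReal_mul hC0, mul_assoc, mul_assoc, mul_assoc]
          refine mul_le_mul_right ?_ _
          refine mul_le_mul_right ?_ _
          rw [mul_comm]
          exact mul_le_mul' (hHy s hs) (hHy t ht)
      _ ≤ ∫⁻ t, ∫⁻ s, ENNReal.ofReal C * (ENNReal.ofReal (|t - s| ^ (-l)) * y s * y t) :=
          (setLIntegral_le_lintegral _ _).trans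
            (lintegral_mono fun t => setLIntegral_le_lintegral _ _)
      _ = ENNReal.ofReal C * ∫⁻ t, ∫⁻ s, ENNReal.ofReal (|t - s| ^ (-l)) * y s * y t := by
          rw [← lintegral_const_mul' _ _ ENNReal.ofReal_ne_top]
          refine lintegral_congr fun t => ?_
          rw [lintegral_const_mul' _ _ ENNReal.ofReal_ne_top]
      _ ≤ _ := by
          gcongr
          exact hls hl0 hl1 ha hy hyf hyI
  have htr := ENNReal.toReal_mono (by
    refine ENNReal.mul_ne_top ENNReal.ofReal_ne_top (ENNReal.mul_ne_top ENNReal.ofReal_ne_top ?_)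
    exact ENNReal.rpow_ne_top_of_nonneg (by positivity) hyI) hbound
  rw [toReal_enorm, ENNReal.toReal_mul, ENNReal.toReal_mul, ENNReal.toReal_ofReal hC0,
    ENNReal.toReal_ofReal (by positivity), ← ENNReal.toReal_rpow, ← mul_assoc] at htr
  exact htr

end ForcedNLW

end

noncomputable section

namespace ForcedNLW

open Filter Topology FourierTransform

/-! ### Band-limited functions in Lebesgue spaces -/

theorem lintegral_enorm_sq (g : L2) : ∫⁻ x, ‖g x‖ₑ ^ (2 : ℝ) = ‖g‖ₑ ^ (2 : ℝ) := by
  rw [Lp.enorm_def, eLpNorm_eq_lintegral_rpow_enorm_toReal (by norm_num) (by norm_num),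
    ← ENNReal.rpow_mul]
  norm_num

theorem lintegral_rpow_le_of_bdd {g : L2} {M : ℝ} (hM : ∀ᵐ x, ‖g x‖ ≤ M) {s : ℝ} (hs : 2 ≤ s) :
    ∫⁻ x, ‖g x‖ₑ ^ s ≤ ENNReal.ofReal M ^ (s - 2) * ‖g‖ₑ ^ (2 : ℝ) := by
  have hs2 : 0 ≤ s - 2 := by linarith
  rw [← lintegral_enorm_sq, ← lintegral_const_mul'' _
    ((Lp.aestronglyMeasurable g).enorm.pow_const _)]
  refine lintegral_mono_ae ?_
  filter_upwards [hM] with x hx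
  calc ‖g x‖ₑ ^ s = ‖g x‖ₑ ^ (s - 2) * ‖g x‖ₑ ^ (2 : ℝ) := by
        rw [← ENNReal.rpow_add_of_nonneg _ _ hs2 (by norm_num), sub_add_cancel]
    _ ≤ _ := by
        gcongr
        rw [← ofReal_norm]
        exact ENNReal.ofReal_le_ofReal hx

theorem lintegral_rpow_lt_top_of_bdd {g : L2} {M : ℝ} (hM : ∀ᵐ x, ‖g x‖ ≤ M) {s : ℝ}
    (hs : 2 ≤ s) : ∫⁻ x, ‖g x‖ₑ ^ s < ⊤ :=
  (lintegral_rpow_le_of_bdd hM hs).trans_lt (ENNReal.mul_lt_top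
    (ENNReal.rpow_lt_top_of_nonneg (by linarith) ENNReal.ofReal_ne_top)
    (ENNReal.rpow_lt_top_of_nonneg (by norm_num) enorm_ne_top))

/-- The constant in the embedding of band-limited `L²` functions into `L^∞`. -/
def bandSup (n : ℕ) : ℝ := (exists_sup_bound_band n).choose

theorem bandSup_nonneg (n : ℕ) : 0 ≤ bandSup n := (exists_sup_bound_band n).choose_spec.1

theorem norm_fmul_band_apply_le (n : ℕ) (f : L2) :
    ∀ᵐ x, ‖fmul (band n) f x‖ ≤ bandSup n * ‖f‖ := (exists_sup_bound_band n).choose_spec.2 f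

theorem norm_fmul_band_le (n : ℕ) (f : L2) : ‖fmul (band n) f‖ ≤ ‖f‖ := by
  have := norm_fmul_le (measurable_band n) (norm_band_le n) f
  rwa [one_mul] at this

theorem eLpNorm_xExp {b : ℝ} (hb : 1 ≤ b) (f : E3 → ℂ) :
    eLpNorm f (xExp b) volume = (∫⁻ x, ‖f x‖ₑ ^ (2 * b)) ^ (1 / (2 * b)) := by
  rw [eLpNorm_eq_lintegral_rpow_enorm_toReal _ ENNReal.ofReal_ne_top,
    ENNReal.toReal_ofReal (by linarith)]
  exact (ENNReal.ofReal_pos.2 (by linarith)).ne'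

section

variable (b : ℝ) [hb : Fact (3 < b)]

theorem eLpNorm_band_le (n : ℕ) (f : L2) :
    eLpNorm (fmul (band n) f) (xExp b) volume ≤ ENNReal.ofReal ((bandSup n + 1) * ‖f‖) := by
  have hb3 := hb.out
  have hC := bandSup_nonneg n
  rw [eLpNorm_xExp (by linarith), one_div, ENNReal.rpow_inv_le_iff (by linarith)]
  refine (lintegral_rpow_le_of_bdd (norm_fmul_band_apply_le n f) (by linarith)).trans ?_
  -- Interpolation between `L²` and `L^∞`; `bandSup n + 1` majorizes both constants.
  calc ENNReal.ofReal (bandSup n * ‖f‖) ^ (2 * b - 2) * ‖fmul (band n) f‖ₑ ^ (2 : ℝ)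
      ≤ ENNReal.ofReal ((bandSup n + 1) * ‖f‖) ^ (2 * b - 2) *
          ENNReal.ofReal ((bandSup n + 1) * ‖f‖) ^ (2 : ℝ) := by
        refine mul_le_mul' (ENNReal.rpow_le_rpow (ENNReal.ofReal_le_ofReal ?_) (by linarith))
          (ENNReal.rpow_le_rpow ?_ (by norm_num))
        · nlinarith [norm_nonneg f]
        · rw [← ofReal_norm]
          refine ENNReal.ofReal_le_ofReal ((norm_fmul_band_le n f).trans ?_)
          nlinarith [norm_nonneg f]
    _ = _ := by
        rw [← ENNReal.rpow_add_of_nonneg _ _ (by linarith) (by norm_num), sub_add_cancel]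

theorem memLp_fmul_band (n : ℕ) (f : L2) : MemLp (fmul (band n) f) (xExp b) volume :=
  ⟨Lp.aestronglyMeasurable _, (eLpNorm_band_le b n f).trans_lt ENNReal.ofReal_lt_top⟩

/-- The projection onto a frequency band as a map `L² → L^{2b}`. -/
def bandX (n : ℕ) : L2 →L[ℂ] LpX (xExp b) :=
  LinearMap.mkContinuous
    { toFun := fun f => (memLp_fmul_band b n f).toLp _
      map_add' := fun f g => by
        rw [← MemLp.toLp_add, MemLp.toLp_eq_toLp_iff, map_add]
        exact Lp.coeFn_add _ _
      map_smul' := fun c f => by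
        rw [RingHom.id_apply, ← MemLp.toLp_const_smul, MemLp.toLp_eq_toLp_iff, map_smul]
        exact Lp.coeFn_smul _ _ } (bandSup n + 1) fun f => by
    change ‖(memLp_fmul_band b n f).toLp _‖ ≤ _
    rw [Lp.norm_toLp]
    exact ENNReal.toReal_le_of_le_ofReal
      (mul_nonneg (by linarith [bandSup_nonneg n]) (norm_nonneg _)) (eLpNorm_band_le b n f)

theorem bandX_ae (n : ℕ) (f : L2) :
    (bandX b n f : E3 → ℂ) =ᵐ[volume] (fmul (band n) f : E3 → ℂ) :=
  (memLp_fmul_band b n f).coeFn_toLp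

theorem lintegral_band_rpow (n : ℕ) (f : L2) :
    ∫⁻ x, ‖fmul (band n) f x‖ₑ ^ (2 * b) = ‖bandX b n f‖ₑ ^ (2 * b) := by
  have hb3 := hb.out
  rw [Lp.enorm_def, eLpNorm_congr_ae (bandX_ae b n f), eLpNorm_xExp (by linarith),
    ← ENNReal.rpow_mul, one_div, inv_mul_cancel₀ (by linarith), ENNReal.rpow_one]

end

/-! ### Duality maps -/

section

variable (p : ℝ) [hp : Fact (3 < p)]

/-- `|g|^{2p-2} g` for `g` the projection of `f` onto a frequency band. -/
def dualMap (n : ℕ) (f : L2) : L2 :=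
  -- The power map of degree `2p - 1` takes `L^{2(2p-1)}` to `L²`, so the dual function is again an
  -- element of `L²` depending continuously on `f`.
  haveI : Fact (3 < 2 * p - 1) := ⟨by linarith [hp.out]⟩
  Nl (2 * p - 1) (bandX (2 * p - 1) n f)

theorem continuous_dualMap (n : ℕ) : Continuous (dualMap p n) := by
  have : Fact (3 < 2 * p - 1) := ⟨by linarith [hp.out]⟩
  exact (continuous_Nl (2 * p - 1)).comp (ContinuousLinearMap.continuous _)

theorem dualMap_ae (n : ℕ) (f : L2) : (dualMap p n f : E3 → ℂ) =ᵐ[volume]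
    fun x => nonlin (2 * p - 1) (fmul (band n) f x) := by
  have : Fact (3 < 2 * p - 1) := ⟨by linarith [hp.out]⟩
  filter_upwards [Nl_ae (2 * p - 1) (bandX (2 * p - 1) n f), bandX_ae (2 * p - 1) n f]
    with x h1 h2
  rw [← h2]
  exact h1

theorem norm_dualMap_ae (n : ℕ) (f : L2) : ∀ᵐ x, ‖dualMap p n f x‖ =
    ‖fmul (band n) f x‖ ^ (2 * p - 1) := by
  filter_upwards [dualMap_ae p n f] with x h
  rw [h, norm_nonlin (by linarith [hp.out])]

theorem enorm_dualMap_ae (n : ℕ) (f : L2) : ∀ᵐ x, ‖dualMap p n f x‖ₑ =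
    ‖fmul (band n) f x‖ₑ ^ (2 * p - 1) := by
  filter_upwards [norm_dualMap_ae p n f] with x h
  rw [← ofReal_norm, h, ← ofReal_norm,
    ENNReal.ofReal_rpow_of_nonneg (norm_nonneg _) (by linarith [hp.out])]

theorem lintegral_dualMap_lt_top (n : ℕ) (f : L2) : ∫⁻ x, ‖dualMap p n f x‖ₑ < ⊤ := by
  rw [lintegral_congr_ae (enorm_dualMap_ae p n f)]
  exact lintegral_rpow_lt_top_of_bdd (norm_fmul_band_apply_le n f) (by linarith [hp.out])

theorem nice_dualMap (n : ℕ) (f : L2) : Nice (dualMap p n f) := by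
  refine ⟨⟨Lp.aestronglyMeasurable _, lintegral_dualMap_lt_top p n f⟩,
    (bandSup n * ‖f‖) ^ (2 * p - 1), ?_⟩
  filter_upwards [norm_dualMap_ae p n f, norm_fmul_band_apply_le n f] with x h1 h2
  rw [h1]
  exact Real.rpow_le_rpow (norm_nonneg _) h2 (by linarith [hp.out])

theorem exists_bound_dualMap (n : ℕ) (R : ℝ) : ∃ M : ℝ, 0 ≤ M ∧ ∀ f : L2, ‖f‖ ≤ R →
    ‖dualMap p n f‖ ≤ M ∧ ∫ x, ‖dualMap p n f x‖ ≤ M := by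
  have hp3 := hp.out
  have hF : Fact (3 < 2 * p - 1) := ⟨by linarith⟩
  set M₁ : ℝ := (‖bandX (2 * p - 1) n‖ * R) ^ (2 * p - 1) with hM₁
  set M₂ : ℝ := (ENNReal.ofReal (bandSup n * R) ^ (2 * p - 1 - 2) *
    ENNReal.ofReal R ^ (2 : ℝ)).toReal with hM₂
  refine ⟨max (max M₁ M₂) 0, le_max_right _ _, fun f hf => ⟨?_, ?_⟩⟩
  · refine le_trans ?_ ((le_max_left M₁ M₂).trans (le_max_left _ _))
    refine (norm_Nl (2 * p - 1) _).trans_le ?_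
    refine Real.rpow_le_rpow (norm_nonneg _) ?_ (by linarith)
    exact (ContinuousLinearMap.le_opNorm _ _).trans (by gcongr)
  · refine le_trans ?_ ((le_max_right M₁ M₂).trans (le_max_left _ _))
    rw [integral_norm_eq_lintegral_enorm (Lp.aestronglyMeasurable _)]
    refine ENNReal.toReal_mono ?_ ?_
    · exact ENNReal.mul_ne_top (ENNReal.rpow_ne_top_of_nonneg (by linarith) ENNReal.ofReal_ne_top)
        (ENNReal.rpow_ne_top_of_nonneg (by norm_num) ENNReal.ofReal_ne_top)
    rw [lintegral_congr_ae (enorm_dualMap_ae p n f)]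
    refine (lintegral_rpow_le_of_bdd (norm_fmul_band_apply_le n f) (by linarith)).trans ?_
    refine mul_le_mul' (ENNReal.rpow_le_rpow (ENNReal.ofReal_le_ofReal ?_) (by linarith))
      (ENNReal.rpow_le_rpow ?_ (by norm_num))
    · exact mul_le_mul_of_nonneg_left hf (bandSup_nonneg n)
    · rw [← ofReal_norm]
      exact ENNReal.ofReal_le_ofReal ((norm_fmul_band_le n f).trans hf)

/-- `b` is the conjugate exponent of `2p`, so `(2p - 1) b = 2p`: the dual function has exactly the
`L^{(2p)'}` size that duality requires. -/
theorem lintegral_dualMap_rpow (n : ℕ) (f : L2) {b : ℝ} (hb : b = 2 * p / (2 * p - 1)) :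
    (∫⁻ x, ‖dualMap p n f x‖ₑ ^ b) ^ (1 / b) = ‖bandX p n f‖ₑ ^ (2 * p - 1) := by
  have hp3 := hp.out
  have h1 : ∫⁻ x, ‖dualMap p n f x‖ₑ ^ b = ∫⁻ x, ‖fmul (band n) f x‖ₑ ^ (2 * p) := by
    refine lintegral_congr_ae ?_
    filter_upwards [enorm_dualMap_ae p n f] with x h
    rw [h, ← ENNReal.rpow_mul, hb]
    congr 1
    have hne : 2 * p - 1 ≠ 0 := by linarith
    field_simp
  rw [h1, lintegral_band_rpow, ← ENNReal.rpow_mul, hb]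
  congr 1
  field_simp

theorem inner_dualMap (n : ℕ) (f : L2) :
    inner ℂ (dualMap p n f) (fmul (band n) f) = ((‖bandX p n f‖ ^ (2 * p) : ℝ) : ℂ) := by
  have hp3 := hp.out
  have h1 : inner ℂ (dualMap p n f) (fmul (band n) f) =
      ∫ x, ((‖fmul (band n) f x‖ ^ (2 * p) : ℝ) : ℂ) := by
    rw [inner_L2_eq]
    refine integral_congr_ae ?_
    filter_upwards [dualMap_ae p n f] with x h
    rw [h]
    set z := fmul (band n) f x
    rw [nonlin, map_mul, Complex.conj_ofReal, mul_assoc, Complex.conj_mul']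
    norm_cast
    rcases (norm_nonneg z).eq_or_lt with hz | hz
    · rw [← hz, Real.zero_rpow (by linarith : 2 * p ≠ 0)]
      simp
    · rw [← Real.rpow_natCast ‖z‖ 2, ← Real.rpow_add hz]
      congr 1
      push_cast
      ring
  rw [h1, integral_complex_ofReal]
  congr 1
  rw [integral_eq_lintegral_of_nonneg_ae (ae_of_all _ fun x => by positivity)
    ((Lp.aestronglyMeasurable (fmul (band n) f)).norm.aemeasurable.pow_const
      _).aestronglyMeasurable]
  have h2 := lintegral_band_rpow p n f
  have h3 : ∀ x, ENNReal.ofReal (‖fmul (band n) f x‖ ^ (2 * p)) =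
      ‖fmul (band n) f x‖ₑ ^ (2 * p) := fun x => by
    rw [← ofReal_norm, ENNReal.ofReal_rpow_of_nonneg (norm_nonneg _) (by linarith)]
  simp only [h3]
  rw [h2, ← ENNReal.toReal_rpow, toReal_enorm]

end

end ForcedNLW

end

noncomputable section

namespace ForcedNLW

open Filter Topology FourierTransform

/-! ### The Strichartz estimate on a band -/

theorem integral_inner_left {A : Set ℝ} {x : ℝ → L2} (hx : IntegrableOn x A) (c : L2) :
    ∫ t in A, inner ℂ (x t) c = inner ℂ (∫ t in A, x t) c := by
  rw [← inner_conj_symm, ← integral_inner hx, ← integral_conj]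
  refine integral_congr_ae (ae_of_all _ fun s => ?_)
  exact (inner_conj_symm _ _).symm

theorem norm_integral_inner_le {A : Set ℝ} {x : ℝ → L2} (hx : IntegrableOn x A) (c : L2) :
    ‖∫ t in A, inner ℂ (x t) c‖ ≤ ‖∫ t in A, x t‖ * ‖c‖ := by
  rw [integral_inner_left hx]
  exact norm_inner_le_norm _ _

theorem inner_fmul_bc (n : ℕ) (t : ℝ) (f g : L2) :
    inner ℂ f (fmul (bcSymb n t) g) = inner ℂ (fmul (bcSymb n t) f) g := by
  rw [inner_fmul_left (symb_bc n t), show (fun ξ => (starRingEnd ℂ) (bcSymb n t ξ)) = bcSymb n t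
    from funext (conj_bc n t)]

theorem inner_fmul_bs (n : ℕ) (t : ℝ) (f g : L2) :
    inner ℂ f (fmul (bsSymb n t) g) = inner ℂ (fmul (bsSymb n t) f) g := by
  rw [inner_fmul_left (symb_bs n t), show (fun ξ => (starRingEnd ℂ) (bsSymb n t ξ)) = bsSymb n t
    from funext (conj_bs n t)]

/-- On a band `cos(tκ)` equals `cos(tκ)/κ` applied to `√(-Δ)v₁`, so both free terms are given by the
operators of `dual_estimate`. -/
theorem fmul_band_linV (n : ℕ) (v₁ : H1) (v₂ : L2) {G : ℝ → L2} {t : ℝ}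
    (hG : IntegrableOn G (Icc 0 t)) :
    fmul (band n) (toL2 (linV v₁ v₂ G t)) = fmul (bcSymb n t) (absD v₁) + fmul (bsSymb n t) v₂
      - duh (fun τ => fmul (bsSymb n τ)) G t := by
  rw [toL2_linV v₁ v₂ hG, map_sub, map_add, fmul_fmul (symb_band n) (symb_sin t),
    fmul_fmul (symb_band n) (symb_cos t), duh_map continuous_fmul_sin (fmul (band n)) hG]
  congr 1
  · congr 1
    refine fmul_toL2_eq_fmul_absD ((symb_band n).mul (symb_cos t)) (symb_bc n t)
      (ae_of_all _ fun ξ => ?_) v₁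
    by_cases h : ξ ∈ bandSet n
    · have : (kap ξ : ℂ) ≠ 0 := by exact_mod_cast (kap_pos_of_mem_band h).ne'
      rw [bcSymb, Complex.ofReal_inv]
      field_simp
    · simp [bcSymb, band_of_notMem h]
  · unfold duh
    refine integral_congr_ae (ae_of_all _ fun s => ?_)
    exact fmul_fmul (symb_band n) (symb_sin _) _

/-- Fubini over the triangle `s ≤ t`, with the self-adjoint propagator moved onto `H`. For each `s`
the inner integral is an adjoint evolution started at time `s`. -/
theorem integral_inner_duh_eq {T M : ℝ} {H G : ℝ → L2}
    {K : ℝ → L2 →L[ℂ] L2} (hK : ∀ x, Continuous fun t => K t x)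
    (hKs : ∀ t f g, inner ℂ f (K t g) = inner ℂ (K t f) g)
    (hHm : AEStronglyMeasurable H (volume.restrict (Icc 0 T))) (hHM : ∀ t, ‖H t‖ ≤ M)
    (hG : IntegrableOn G (Icc 0 T)) :
    ∫ t in Icc 0 T, inner ℂ (H t) (duh K G t) =
      ∫ s in Icc 0 T, inner ℂ (∫ t in Icc s T, K (t - s) (H t)) (G s) := by
  set μ : Measure ℝ := volume.restrict (Icc 0 T) with hμ
  obtain ⟨B, hB0, hB⟩ := exists_bound_of_strongly_continuous hK (2 * |T|)
  set k : ℝ × ℝ → ℂ := {z : ℝ × ℝ | z.2 ≤ z.1}.indicator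
    fun z => inner ℂ (H z.1) (K (z.1 - z.2) (G z.2)) with hk
  have hmem : ∀ᵐ z ∂(μ.prod μ), z.1 ∈ Icc 0 T ∧ z.2 ∈ Icc 0 T := by
    rw [hμ, Measure.prod_restrict]
    exact ae_restrict_mem (measurableSet_Icc.prod measurableSet_Icc)
  have hset : MeasurableSet {z : ℝ × ℝ | z.2 ≤ z.1} :=
    measurableSet_le measurable_snd measurable_fst
  have hkm : AEStronglyMeasurable k (μ.prod μ) := by
    refine AEStronglyMeasurable.indicator ?_ hset
    exact hHm.comp_fst.inner (aestronglyMeasurable_family hK (by fun_prop)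
      hG.aestronglyMeasurable.comp_snd)
  have hkb : ∀ᵐ z ∂(μ.prod μ), ‖k z‖ ≤ M * (B * ‖G z.2‖) := by
    filter_upwards [hmem] with z hz
    refine (norm_indicator_le_norm_self _ _).trans ?_
    refine (norm_inner_le_norm _ _).trans ?_
    have h2 : |z.1 - z.2| ≤ 2 * |T| := by
      have h3 := abs_le_abs_of_nonneg hz.1.1 hz.1.2
      have h4 := abs_le_abs_of_nonneg hz.2.1 hz.2.2
      linarith [abs_sub z.1 z.2]
    refine mul_le_mul (hHM _) ?_ (norm_nonneg _) ((norm_nonneg _).trans (hHM 0))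
    exact (ContinuousLinearMap.le_opNorm _ _).trans
      (mul_le_mul_of_nonneg_right (hB _ h2) (norm_nonneg _))
  have hki : Integrable k (μ.prod μ) := by
    have h1 : Integrable (fun z : ℝ × ℝ => M * (B * ‖G z.2‖)) (μ.prod μ) :=
      ((Integrable.comp_snd hG.norm μ).const_mul B).const_mul M
    exact h1.mono' hkm hkb
  have h1 : ∀ t ∈ Icc 0 T, inner ℂ (H t) (duh K G t) = ∫ s, k (t, s) ∂μ := by
    intro t ht
    have hint : Integrable ((Iic t).indicator fun s => K (t - s) (G s)) μ := by
      rw [integrable_indicator_iff measurableSet_Iic]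
      have h2 := integrable_duh hK (hG.mono_set (Icc_subset_Icc_right ht.2))
      rw [hμ, IntegrableOn, Measure.restrict_restrict measurableSet_Iic]
      exact h2.mono_set fun s hs => ⟨hs.2.1, hs.1⟩
    rw [duh_eq ht]
    refine (integral_inner (𝕜 := ℂ) hint (H t)).symm.trans ?_
    refine integral_congr_ae (ae_of_all _ fun s => ?_)
    by_cases hs : s ≤ t
    · simp [hk, indicator, hs]
    · simp [hk, indicator, hs]
  have h2 : ∀ s ∈ Icc 0 T, ∫ t, k (t, s) ∂μ = inner ℂ (∫ t in Icc s T, K (t - s) (H t)) (G s) := by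
    intro s hs
    have e1 : ∀ t, k (t, s) = (Ici s).indicator
        (fun t => inner ℂ (K (t - s) (H t)) (G s)) t := by
      intro t
      by_cases h : s ≤ t
      · simp [hk, indicator, h, hKs]
      · simp [hk, indicator, h]
    have hsub : Icc s T ⊆ Icc 0 T := Icc_subset_Icc_left hs.1
    have e2 : Ici s ∩ Icc 0 T = Icc s T := by
      ext t
      simp only [mem_inter_iff, mem_Ici, mem_Icc]
      exact ⟨fun h => ⟨h.1, h.2.2⟩, fun h => ⟨h.1, hs.1.trans h.1, h.2⟩⟩
    simp only [e1]
    rw [integral_indicator measurableSet_Ici, hμ, Measure.restrict_restrict measurableSet_Ici, e2]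
    exact integral_inner_left (integrableOn_strong_family hK hsub
      (hHm.mono_measure (Measure.restrict_mono_set _ hsub)) hHM measurableSet_Icc s) _
  have h3 : ∫ t in Icc 0 T, inner ℂ (H t) (duh K G t) = ∫ s, ∫ t, k (t, s) ∂μ ∂μ := by
    rw [integral_integral_swap (f := fun s t => k (t, s)) hki.swap]
    exact setIntegral_congr_fun measurableSet_Icc h1
  rw [h3]
  exact setIntegral_congr_fun measurableSet_Icc h2

/-- The forcing is measured in `L¹_t`, so a bound on the adjoint evolution uniform in the starting
time `s` is enough; the retarded integral needs no Christ–Kiselev lemma. -/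
theorem norm_integral_inner_duh_le {T M D : ℝ} {H G : ℝ → L2}
    {K : ℝ → L2 →L[ℂ] L2} (hK : ∀ x, Continuous fun t => K t x)
    (hKs : ∀ t f g, inner ℂ f (K t g) = inner ℂ (K t f) g)
    (hHm : AEStronglyMeasurable H (volume.restrict (Icc 0 T))) (hHM : ∀ t, ‖H t‖ ≤ M)
    (hG : IntegrableOn G (Icc 0 T))
    (hD : ∀ s ∈ Icc 0 T, ‖∫ t in Icc s T, K (t - s) (H t)‖ ≤ D) :
    ‖∫ t in Icc 0 T, inner ℂ (H t) (duh K G t)‖ ≤ D * ∫ s in Icc 0 T, ‖G s‖ := by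
  rw [integral_inner_duh_eq hK hKs hHm hHM hG, ← integral_const_mul]
  refine norm_integral_le_of_norm_le (hG.norm.const_mul D) ?_
  filter_upwards [ae_restrict_mem measurableSet_Icc] with s hs
  exact (norm_inner_le_norm _ _).trans (mul_le_mul_of_nonneg_right (hD s hs) (norm_nonneg _))

section

variable (p : ℝ) [hp : Fact (3 < p)]

/-- The energy-type quantity controlling the linear evolution. -/
def energy (T : ℝ) (v₁ : H1) (v₂ : L2) (G : ℝ → L2) : ℝ :=
  ‖absD v₁‖ + ‖v₂‖ + ∫ s in Icc 0 T, ‖G s‖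

theorem energy_nonneg (T : ℝ) (v₁ : H1) (v₂ : L2) (G : ℝ → L2) : 0 ≤ energy T v₁ v₂ G :=
  add_nonneg (add_nonneg (norm_nonneg _) (norm_nonneg _)) (integral_nonneg fun _ => norm_nonneg _)

theorem norm_integral_inner_linV_le {T M D : ℝ} (hT : 0 ≤ T) (n : ℕ) {H G : ℝ → L2}
    (v₁ : H1) (v₂ : L2)
    (hHm : AEStronglyMeasurable H (volume.restrict (Icc 0 T))) (hHM : ∀ t, ‖H t‖ ≤ M)
    (hG : IntegrableOn G (Icc 0 T))
    (hD : ∀ s ∈ Icc 0 T, ‖∫ t in Icc s T, fmul (bcSymb n (t - s)) (H t)‖ ≤ D ∧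
      ‖∫ t in Icc s T, fmul (bsSymb n (t - s)) (H t)‖ ≤ D) :
    ‖∫ t in Icc 0 T, inner ℂ (H t) (fmul (band n) (toL2 (linV v₁ v₂ G t)))‖ ≤
      D * energy T v₁ v₂ G := by
  have hx := integrableOn_strong_family (continuous_fmul_bc n) subset_rfl hHm hHM
    measurableSet_Icc 0
  have hy := integrableOn_strong_family (continuous_fmul_bs n) subset_rfl hHm hHM
    measurableSet_Icc 0
  have h0 := hD 0 ⟨le_rfl, hT⟩
  simp only [sub_zero] at hx hy h0
  have hdc : ContinuousOn (duh (fun τ => fmul (bsSymb n τ)) G) (Icc 0 T) :=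
    continuousOn_duh (continuous_fmul_bs n) hG
  have hz : IntegrableOn (fun t => inner ℂ (H t) (duh (fun τ => fmul (bsSymb n τ)) G t))
      (Icc 0 T) := by
    obtain ⟨B, hB⟩ := isCompact_Icc.exists_bound_of_continuousOn hdc
    refine IntegrableOn.of_bound measure_Icc_lt_top
      (hHm.inner (hdc.aestronglyMeasurable measurableSet_Icc)) (M * B) ?_
    filter_upwards [ae_restrict_mem measurableSet_Icc] with t ht
    exact (norm_inner_le_norm _ _).trans (mul_le_mul (hHM t) (hB t ht) (norm_nonneg _)
      ((norm_nonneg _).trans (hHM 0)))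
  have e : ∫ t in Icc 0 T, inner ℂ (H t) (fmul (band n) (toL2 (linV v₁ v₂ G t))) =
      (∫ t in Icc 0 T, inner ℂ (fmul (bcSymb n t) (H t)) (absD v₁)) +
      (∫ t in Icc 0 T, inner ℂ (fmul (bsSymb n t) (H t)) v₂) -
      ∫ t in Icc 0 T, inner ℂ (H t) (duh (fun τ => fmul (bsSymb n τ)) G t) := by
    have hxy : IntegrableOn (fun t => inner ℂ (fmul (bcSymb n t) (H t)) (absD v₁) +
        inner ℂ (fmul (bsSymb n t) (H t)) v₂) (Icc 0 T) :=
      (integrableOn_inner_left hx _).add (integrableOn_inner_left hy _)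
    rw [← integral_add (integrableOn_inner_left hx _) (integrableOn_inner_left hy _),
      ← integral_sub hxy hz]
    refine setIntegral_congr_fun measurableSet_Icc fun t ht => ?_
    beta_reduce
    rw [fmul_band_linV n v₁ v₂ (hG.mono_set (Icc_subset_Icc_right ht.2)), inner_sub_right,
      inner_add_right, inner_fmul_bc, inner_fmul_bs]
  rw [e]
  have b1 := (norm_integral_inner_le hx (absD v₁)).trans
    (mul_le_mul_of_nonneg_right h0.1 (norm_nonneg _))
  have b2 := (norm_integral_inner_le hy v₂).trans
    (mul_le_mul_of_nonneg_right h0.2 (norm_nonneg _))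
  have b3 := norm_integral_inner_duh_le (continuous_fmul_bs n) (inner_fmul_bs n) hHm hHM hG
    fun s hs => (hD s hs).2
  refine (norm_sub_le _ _).trans ?_
  refine (add_le_add_left (norm_add_le _ _) _).trans ?_
  unfold energy
  linarith

end

end ForcedNLW

end

/-! ### Strichartz on a band by duality in space and time -/

noncomputable section

namespace ForcedNLW

open Filter Topology FourierTransform

/-- The absorption at the end of the duality argument: a finite nonzero `I` is divided by `I^{1/a}`,
which leaves `I^{1/q}`. -/
theorem le_rpow_of_le_mul_rpow {I B a q : ℝ} (hI : 0 ≤ I) (hB : 0 ≤ B) (hq : 1 < q)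
    (haq : 1 / a = 1 - 1 / q) (h : I ≤ B * I ^ (1 / a)) : I ≤ B ^ q := by
  rcases hI.eq_or_lt with h0 | h0
  · rw [← h0]; positivity
  · have h1 : I ^ (1 / q) ≤ B := by
      have e : I ^ (1 / q) * I ^ (1 / a) = I := by
        rw [← Real.rpow_add h0, haq]
        simp
      exact le_of_mul_le_mul_right (e.le.trans h) (Real.rpow_pos_of_pos h0 _)
    calc I = (I ^ (1 / q)) ^ q := by
          rw [← Real.rpow_mul hI, one_div, inv_mul_cancel₀ (by linarith), Real.rpow_one]
      _ ≤ B ^ q := Real.rpow_le_rpow (by positivity) h1 (by linarith)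

theorem le_of_sq_add_sq_le {x y K I a : ℝ} (hI : 0 ≤ I) (hK : 0 ≤ K)
    (h : x ^ 2 + y ^ 2 ≤ K * I ^ (2 / a)) : x ≤ √K * I ^ (1 / a) := by
  have e : (√K * I ^ (1 / a)) ^ 2 = K * I ^ (2 / a) := by
    rw [mul_pow, Real.sq_sqrt hK, ← Real.rpow_natCast, ← Real.rpow_mul hI]
    congr 2
    push_cast
    ring
  refine (le_abs_self x).trans (abs_le_of_sq_le_sq ?_ (by positivity))
  rw [e]
  nlinarith [sq_nonneg y]

theorem nice_smul {c : ℂ} {g : L2} (hg : Nice g) : Nice (c • g) := by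
  obtain ⟨h1, M, hM⟩ := hg
  refine ⟨(h1.smul c).congr (Lp.coeFn_smul c g).symm, ‖c‖ * M, ?_⟩
  filter_upwards [Lp.coeFn_smul c g, hM] with x h2 h3
  rw [h2, Pi.smul_apply, norm_smul]
  exact mul_le_mul_of_nonneg_left h3 (norm_nonneg _)

theorem integral_norm_smul (c : ℂ) (g : L2) : ∫ x, ‖(c • g : L2) x‖ = ‖c‖ * ∫ x, ‖g x‖ := by
  rw [← integral_const_mul]
  refine integral_congr_ae ?_
  filter_upwards [Lp.coeFn_smul c g] with x h
  rw [h, Pi.smul_apply, norm_smul]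

theorem lintegral_rpow_smul (c : ℂ) (g : L2) {b : ℝ} (hb : 0 < b) :
    (∫⁻ x, ‖(c • g : L2) x‖ₑ ^ b) ^ (1 / b) = ‖c‖ₑ * (∫⁻ x, ‖g x‖ₑ ^ b) ^ (1 / b) := by
  have h1 : ∫⁻ x, ‖(c • g : L2) x‖ₑ ^ b = ‖c‖ₑ ^ b * ∫⁻ x, ‖g x‖ₑ ^ b := by
    rw [← lintegral_const_mul'' _ ((Lp.aestronglyMeasurable g).enorm.pow_const _)]
    refine lintegral_congr_ae ?_
    filter_upwards [Lp.coeFn_smul c g] with x h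
    rw [h, Pi.smul_apply, enorm_smul, ENNReal.mul_rpow_of_nonneg _ _ hb.le]
  rw [h1, ENNReal.mul_rpow_of_nonneg _ _ (by positivity), ← ENNReal.rpow_mul,
    mul_one_div_cancel hb.ne', ENNReal.rpow_one]

/-- The band-limited solution is paired with its own dual function `H = y^{q-2p} |PU|^{2p-2} PU`,
where `y` is its `L^{2p}` norm. The pairing is `I = ∫ y^q`, while the `L^{(2p)'}` norm of `H` is
`y^{q-1}`, whose `L^a` norm is `I^{1/a}` because `(q-1)a = q`. The dual estimate gives `I ≤ √K₀ ·
I^{1/a} · energy`, and `I^{1/a}` is absorbed. -/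
theorem strichartz_band_cutoff (p : ℝ) [hp : Fact (3 < p)] :
    ∃ K : ℝ, 0 ≤ K ∧ ∀ (T : ℝ), 0 ≤ T → ∀ (v₁ : H1) (v₂ : L2) (G U : ℝ → L2),
      IntegrableOn G (Icc 0 T) → Continuous U → (∀ t ∈ Icc 0 T, U t = toL2 (linV v₁ v₂ G t)) →
      ∀ R : ℝ, (∀ t, ‖U t‖ ≤ R) → ∀ (n : ℕ) (ε : ℝ), 0 < ε →
      ∫ t in Icc 0 T, {t | ε ≤ ‖bandX p n (U t)‖}.indicator
          (fun t => ‖bandX p n (U t)‖ ^ (2 * p / (p - 3))) t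
        ≤ (K * energy T v₁ v₂ G) ^ (2 * p / (p - 3)) := by
  have hp3 := hp.out
  set r : ℝ := 2 * p with hr
  set q : ℝ := 2 * p / (p - 3) with hq
  set b : ℝ := r / (r - 1) with hb
  set l : ℝ := 1 - 6 / r with hl
  set a : ℝ := 2 / (2 - l) with ha
  have hp30 : 0 < p - 3 := by linarith
  have hq2 : 2 < q := by rw [hq, lt_div_iff₀ hp30]; linarith
  have hb0 : 0 < b := div_pos (by linarith) (by linarith)
  have ha' : a = 2 * p / (p + 3) := by
    rw [ha, hl, hr]
    have : 2 - (1 - 6 / (2 * p)) = (p + 3) / p := by field_simp; ring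
    rw [this]
    field_simp
  have ha0 : 0 < a := by rw [ha']; positivity
  have haq : 1 / a = 1 - 1 / q := by
    rw [ha', hq]
    field_simp
    ring
  have hqa : (q - 1) * a = q := by
    rw [ha', hq]
    field_simp
    ring
  obtain ⟨K₀, hK₀, hdual⟩ := dual_estimate (r := r) (by linarith) hb hl ha
  refine ⟨√K₀, Real.sqrt_nonneg _, ?_⟩
  intro T hT v₁ v₂ G U hG hU hUe R hR n ε hε
  have hy : Continuous fun t => ‖bandX p n (U t)‖ :=
    ((ContinuousLinearMap.continuous _).comp hU).norm
  set y : ℝ → ℝ := fun t => ‖bandX p n (U t)‖ with hydef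
  have hy0 : ∀ t, 0 ≤ y t := fun t => norm_nonneg _
  set Y : ℝ := ‖bandX p n‖ * R with hY
  have hyY : ∀ t, y t ≤ Y := fun t => (ContinuousLinearMap.le_opNorm _ _).trans
    (mul_le_mul_of_nonneg_left (hR t) (norm_nonneg _))
  have hY0 : 0 ≤ Y := (hy0 0).trans (hyY 0)
  set E : Set ℝ := {t | ε ≤ y t} with hE
  have hEm : MeasurableSet E := measurableSet_le measurable_const hy.measurable
  -- For `p > 4` the exponent `q - 2p` is negative; the restriction to `y ≥ ε` keeps the weight
  -- bounded.
  set m : ℝ → ℝ := E.indicator fun t => y t ^ (q - r) with hm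
  have hm0 : ∀ t, 0 ≤ m t := fun t => indicator_nonneg (fun t _ => by have := hy0 t; positivity) t
  have hmm : Measurable m := (hy.measurable.pow_const _).indicator hEm
  have hmb : ∀ t, m t ≤ ε ^ (q - r) + Y ^ (q - r) := by
    intro t
    have h1 : 0 ≤ ε ^ (q - r) := by positivity
    have h2 : 0 ≤ Y ^ (q - r) := by positivity
    refine indicator_apply_le' (fun ht => ?_) fun _ => by linarith
    rcases le_total 0 (q - r) with h | h
    · have := Real.rpow_le_rpow (hy0 t) (hyY t) h
      linarith
    · have := Real.rpow_le_rpow_of_nonpos hε ht h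
      linarith
  obtain ⟨M₀, hM₀, hM⟩ := exists_bound_dualMap p n R
  set H : ℝ → L2 := fun t => ((m t : ℝ) : ℂ) • dualMap p n (U t) with hH
  set M : ℝ := (ε ^ (q - r) + Y ^ (q - r)) * M₀ with hMdef
  have hnm : ∀ t, ‖((m t : ℝ) : ℂ)‖ = m t := fun t => by
    rw [Complex.norm_real, Real.norm_of_nonneg (hm0 t)]
  have hHm : AEStronglyMeasurable H (volume.restrict (Icc 0 T)) := by
    refine AEStronglyMeasurable.smul (𝕜 := ℂ) ?_
      ((continuous_dualMap p n).comp hU).aestronglyMeasurable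
    exact (Complex.measurable_ofReal.comp hmm).aestronglyMeasurable
  have hHM : ∀ t, ‖H t‖ ≤ M := by
    intro t
    rw [hH, norm_smul, hnm]
    exact mul_le_mul (hmb t) (hM _ (hR t)).1 (norm_nonneg _) ((hm0 t).trans (hmb t))
  have hHI : ∀ t, ∫ x, ‖H t x‖ ≤ M := by
    intro t
    rw [hH]
    beta_reduce
    rw [integral_norm_smul, hnm]
    exact mul_le_mul (hmb t) (hM _ (hR t)).2 (integral_nonneg fun _ => norm_nonneg _)
      ((hm0 t).trans (hmb t))
  have hHn : ∀ t, Nice (H t) := fun t => nice_smul (nice_dualMap p n _)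
  set w : ℝ → ℝ := E.indicator fun t => y t ^ q with hw
  have hw0 : ∀ t, 0 ≤ w t := fun t => indicator_nonneg (fun t _ => by have := hy0 t; positivity) t
  have hwm : Measurable w := (hy.measurable.pow_const _).indicator hEm
  have hwi : IntegrableOn w (Icc 0 T) := by
    refine IntegrableOn.of_bound measure_Icc_lt_top hwm.aestronglyMeasurable (Y ^ q)
      (ae_of_all _ fun t => ?_)
    rw [Real.norm_of_nonneg (hw0 t)]
    exact indicator_apply_le' (fun ht => Real.rpow_le_rpow (hy0 t) (hyY t) (by linarith))
      fun _ => by positivity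
  -- The time profile `y^{q-1}` of `H`, extended by zero because the Hardy–Littlewood–Sobolev
  -- inequality is on the whole line.
  set z : ℝ → ℝ≥0∞ := (Icc 0 T ∩ E).indicator fun t => ENNReal.ofReal (y t ^ (q - 1)) with hz
  have hzm : Measurable z :=
    (hy.measurable.pow_const _).ennreal_ofReal.indicator (measurableSet_Icc.inter hEm)
  have hzf : ∀ t, z t ≠ ⊤ := by
    intro t
    by_cases h : t ∈ Icc 0 T ∩ E
    · rw [hz, indicator_of_mem h]; exact ENNReal.ofReal_ne_top
    · rw [hz, indicator_of_notMem h]; exact ENNReal.zero_ne_top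
  set I : ℝ := ∫ t in Icc 0 T, w t with hI
  have hI0 : 0 ≤ I := integral_nonneg hw0
  have hzI : ∫⁻ t, z t ^ a = ENNReal.ofReal I := by
    rw [hI, ofReal_integral_eq_lintegral_ofReal hwi (ae_of_all _ hw0),
      ← lintegral_indicator measurableSet_Icc]
    refine lintegral_congr fun t => ?_
    by_cases h1 : t ∈ Icc 0 T
    · by_cases h2 : t ∈ E
      · rw [hz, indicator_of_mem (show t ∈ Icc 0 T ∩ E from ⟨h1, h2⟩), indicator_of_mem h1, hw, indicator_of_mem h2,
          ENNReal.ofReal_rpow_of_nonneg (by have := hy0 t; positivity) ha0.le,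
          ← Real.rpow_mul (hy0 t), hqa]
      · rw [hz, indicator_of_notMem (fun h => h2 h.2), indicator_of_mem h1, hw,
          indicator_of_notMem h2, ENNReal.zero_rpow_of_pos ha0, ENNReal.ofReal_zero]
    · rw [hz, indicator_of_notMem (fun h => h1 h.1), indicator_of_notMem h1,
        ENNReal.zero_rpow_of_pos ha0]
  have hHz : ∀ t ∈ Icc 0 T, (∫⁻ x, ‖H t x‖ₑ ^ b) ^ (1 / b) ≤ z t := by
    intro t ht
    rw [hH]
    beta_reduce
    rw [lintegral_rpow_smul _ _ hb0, lintegral_dualMap_rpow p n (U t) hb, ← ofReal_norm, hnm,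
      ← ofReal_norm]
    by_cases h2 : t ∈ E
    · have hyt : 0 < y t := lt_of_lt_of_le hε h2
      rw [hm, indicator_of_mem h2, hz, indicator_of_mem (show t ∈ Icc 0 T ∩ E from ⟨ht, h2⟩),
        ENNReal.ofReal_rpow_of_nonneg (norm_nonneg _) (by linarith),
        ← ENNReal.ofReal_mul (by positivity)]
      refine ENNReal.ofReal_le_ofReal (le_of_eq ?_)
      change y t ^ (q - r) * y t ^ (2 * p - 1) = _
      rw [← Real.rpow_add hyt]
      congr 1
      rw [hr]
      ring
    · rw [hm, indicator_of_notMem h2, ENNReal.ofReal_zero, zero_mul]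
      exact zero_le
  have hpair : ∫ t in Icc 0 T, inner ℂ (H t) (fmul (band n) (toL2 (linV v₁ v₂ G t))) =
      ((I : ℝ) : ℂ) := by
    rw [hI, ← integral_complex_ofReal]
    refine setIntegral_congr_fun measurableSet_Icc fun t ht => ?_
    beta_reduce
    rw [← hUe t ht, hH]
    beta_reduce
    rw [inner_smul_left, inner_dualMap, Complex.conj_ofReal, ← Complex.ofReal_mul]
    congr 1
    change m t * y t ^ (2 * p) = w t
    by_cases h2 : t ∈ E
    · have hyt : 0 < y t := lt_of_lt_of_le hε h2
      rw [hm, hw, indicator_of_mem h2, indicator_of_mem h2, ← Real.rpow_add hyt]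
      congr 1
      rw [hr]
      ring
    · rw [hm, hw, indicator_of_notMem h2, indicator_of_notMem h2, zero_mul]
  have hD : ∀ s ∈ Icc 0 T, ‖∫ t in Icc s T, fmul (bcSymb n (t - s)) (H t)‖ ≤ √K₀ * I ^ (1 / a) ∧
      ‖∫ t in Icc s T, fmul (bsSymb n (t - s)) (H t)‖ ≤ √K₀ * I ^ (1 / a) := by
    intro s hs
    have hsub : Icc s T ⊆ Icc 0 T := Icc_subset_Icc_left hs.1
    -- The dual estimate on `[s, T]` with base time `s`; the full integral of `z` bounds every such
    -- piece with the same constant.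
    have h1 := hdual T (Icc s T) measurableSet_Icc hsub H M
      (hHm.mono_measure (Measure.restrict_mono_set _ hsub)) hHM hHn hHI z hzm hzf
      (by rw [hzI]; exact ENNReal.ofReal_ne_top) (fun t ht => hHz t (hsub ht)) n s
    rw [hzI, ENNReal.toReal_ofReal hI0] at h1
    refine ⟨le_of_sq_add_sq_le hI0 hK₀ h1,
      le_of_sq_add_sq_le hI0 hK₀ ((add_comm _ _).trans_le h1)⟩
  have hfin := norm_integral_inner_linV_le hT n v₁ v₂ hHm hHM hG hD
  rw [hpair, Complex.norm_real, Real.norm_of_nonneg hI0] at hfin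
  refine le_rpow_of_le_mul_rpow hI0 (mul_nonneg (Real.sqrt_nonneg _) (energy_nonneg _ _ _ _))
    (by linarith) haq (hfin.trans_eq (by ring))

/-- The times with `y < ε` contribute at most `T ε^q`, so the lower cutoff is removed by letting `ε
→ 0`. -/
theorem strichartz_band (p : ℝ) [hp : Fact (3 < p)] :
    ∃ K : ℝ, 0 ≤ K ∧ ∀ (T : ℝ), 0 ≤ T → ∀ (v₁ : H1) (v₂ : L2) (G U : ℝ → L2),
      IntegrableOn G (Icc 0 T) → Continuous U → (∀ t ∈ Icc 0 T, U t = toL2 (linV v₁ v₂ G t)) →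
      ∀ R : ℝ, (∀ t, ‖U t‖ ≤ R) → ∀ (n : ℕ),
      eLpNorm (fun t => bandX p n (U t)) (tExp p) (volume.restrict (Icc 0 T)) ≤
        ENNReal.ofReal (K * energy T v₁ v₂ G) := by
  obtain ⟨K, hK, h⟩ := strichartz_band_cutoff p
  have hp3 := hp.out
  refine ⟨K, hK, ?_⟩
  intro T hT v₁ v₂ G U hG hU hUe R hR n
  set q : ℝ := 2 * p / (p - 3) with hq
  have hp30 : 0 < p - 3 := by linarith
  have hq0 : 0 < q := by positivity
  set B : ℝ := K * energy T v₁ v₂ G with hB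
  have hB0 : 0 ≤ B := mul_nonneg hK (energy_nonneg _ _ _ _)
  have hy : Continuous fun t => ‖bandX p n (U t)‖ :=
    ((ContinuousLinearMap.continuous _).comp hU).norm
  have hyq : Continuous fun t => ‖bandX p n (U t)‖ ^ q :=
    hy.rpow_const fun _ => Or.inr hq0.le
  have key : ∀ ε : ℝ, 0 < ε →
      ∫ t in Icc 0 T, ‖bandX p n (U t)‖ ^ q ≤ B ^ q + T * ε ^ q := by
    intro ε hε
    set E : Set ℝ := {t | ε ≤ ‖bandX p n (U t)‖} with hE
    have hEm : MeasurableSet E := measurableSet_le measurable_const hy.measurable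
    have hi := (hyq.integrableOn_Icc (μ := volume) (a := 0) (b := T)).indicator hEm
    have h1 : ∫ t in Icc 0 T, ‖bandX p n (U t)‖ ^ q ≤
        ∫ t in Icc 0 T, (E.indicator (fun t => ‖bandX p n (U t)‖ ^ q) t + ε ^ q) := by
      refine integral_mono hyq.integrableOn_Icc (hi.add (integrable_const _)) fun t => ?_
      beta_reduce
      by_cases ht : t ∈ E
      · rw [indicator_of_mem ht]
        have : 0 ≤ ε ^ q := by positivity
        linarith
      · rw [indicator_of_notMem ht, zero_add]
        exact Real.rpow_le_rpow (norm_nonneg _) (le_of_not_ge ht) hq0.le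
    rw [integral_add hi (integrable_const _)] at h1
    have h2 := h T hT v₁ v₂ G U hG hU hUe R hR n ε hε
    have h3 : ∫ _ in Icc 0 T, ε ^ q = T * ε ^ q := by
      simp [hT]
    linarith
  have hfin : ∫ t in Icc 0 T, ‖bandX p n (U t)‖ ^ q ≤ B ^ q := by
    have ht : Tendsto (fun ε : ℝ => B ^ q + T * ε ^ q) (𝓝[>] 0) (𝓝 (B ^ q + T * 0 ^ q)) := by
      have : Continuous fun ε : ℝ => B ^ q + T * ε ^ q :=
        continuous_const.add (continuous_const.mul (continuous_id.rpow_const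
          fun _ => Or.inr hq0.le))
      exact (this.tendsto 0).mono_left nhdsWithin_le_nhds
    rw [Real.zero_rpow hq0.ne', mul_zero, add_zero] at ht
    refine ge_of_tendsto ht ?_
    filter_upwards [self_mem_nhdsWithin] with ε hε using key ε hε
  rw [eLpNorm_eq_lintegral_rpow_enorm_toReal (ENNReal.ofReal_pos.2 hq0).ne' ENNReal.ofReal_ne_top,
    ENNReal.toReal_ofReal hq0.le, one_div, ENNReal.rpow_inv_le_iff hq0,
    ENNReal.ofReal_rpow_of_nonneg hB0 hq0.le]
  have e : ∀ t, ‖bandX p n (U t)‖ₑ ^ q = ENNReal.ofReal (‖bandX p n (U t)‖ ^ q) := fun t => by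
    rw [← ofReal_norm, ENNReal.ofReal_rpow_of_nonneg (norm_nonneg _) hq0.le]
  simp only [e]
  rw [← ofReal_integral_eq_lintegral_ofReal hyq.integrableOn_Icc
    (ae_of_all _ fun t => by positivity)]
  exact ENNReal.ofReal_le_ofReal hfin

end ForcedNLW

end

noncomputable section

namespace ForcedNLW

open Filter Topology FourierTransform

/-! ### The Strichartz estimate -/

/-- The high- and low-frequency remainder of a band. -/
def cobandSymb (n : ℕ) (ξ : E3) : ℂ := 1 - band n ξ

theorem symb_one : Symb (fun _ : E3 => (1 : ℂ)) := ⟨measurable_const, 1, fun _ => by simp⟩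

theorem norm_coband_le (n : ℕ) (ξ : E3) : ‖cobandSymb n ξ‖ ≤ 1 := by
  unfold cobandSymb
  by_cases h : ξ ∈ bandSet n
  · simp [band_of_mem h]
  · simp [band_of_notMem h]

theorem symb_coband (n : ℕ) : Symb (cobandSymb n) :=
  ⟨measurable_const.sub (measurable_band n), 1, norm_coband_le n⟩

theorem fmul_coband (n : ℕ) (f : L2) : fmul (cobandSymb n) f = f - fmul (band n) f := by
  have := fmul_sub_symb symb_one (symb_band n) f
  rw [fmul_one] at this
  exact this

theorem tendsto_fmul_coband (f : L2) : Tendsto (fun n => fmul (cobandSymb n) f) atTop (𝓝 0) := by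
  simp only [fmul_coband]
  simpa using (tendsto_const_nhds (x := f)).sub (tendsto_fmul_band f)

theorem norm_fmul_coband_le (n : ℕ) (f : L2) : ‖fmul (cobandSymb n) f‖ ≤ ‖f‖ := by
  have := norm_fmul_le (symb_coband n).1 (norm_coband_le n) f
  rwa [one_mul] at this

/-- Fourier multipliers on `H¹`. -/
def fmulH1 (m : E3 → ℂ) (hm : Symb m) : H1 →L[ℂ] H1 :=
  (pairL (fmul m ∘L toL2L) fun j => fmul m ∘L gradL j).codRestrict H1
    (by
      intro u
      rw [mem_H1_iff]
      intro j
      rw [pairL_snd, pairL_fst]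
      filter_upwards [fmul_ae hm (gradL j u), fmul_ae hm (toL2 u), fourier_gradL j u]
        with ξ h1 h2 h3
      simp only [ContinuousLinearMap.comp_apply, toL2L_apply]
      rw [h1, h2, h3]
      ring)

theorem toL2_fmulH1 {m : E3 → ℂ} (hm : Symb m) (u : H1) :
    toL2 (fmulH1 m hm u) = fmul m (toL2 u) := rfl

theorem gradL_fmulH1 {m : E3 → ℂ} (hm : Symb m) (j : Fin 3) (u : H1) :
    gradL j (fmulH1 m hm u) = fmul m (gradL j u) := rfl

theorem absD_fmulH1 {m : E3 → ℂ} (hm : Symb m) (u : H1) :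
    absD (fmulH1 m hm u) = fmul m (absD u) := by
  unfold absD
  simp only [sum_apply, ContinuousLinearMap.comp_apply, map_sum, gradL_fmulH1]
  exact Finset.sum_congr rfl fun j _ => fmul_comm (symb_riesz j) hm _

/-- All the propagators are Fourier multipliers, so filtering the solution is the same as filtering
the data and the forcing. -/
theorem toL2_linV_fmul {m : E3 → ℂ} (hm : Symb m) (v₁ : H1) (v₂ : L2) {G : ℝ → L2} {t : ℝ}
    (hG : IntegrableOn G (Icc 0 t)) :
    toL2 (linV (fmulH1 m hm v₁) (fmul m v₂) (fun s => fmul m (G s)) t) =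
      fmul m (toL2 (linV v₁ v₂ G t)) := by
  rw [toL2_linV v₁ v₂ hG, toL2_linV _ _ ((fmul m).integrable_comp hG), toL2_fmulH1, map_sub,
    map_add, fmul_comm (symb_cos t) hm, fmul_comm (symb_sin t) hm,
    duh_map continuous_fmul_sin (fmul m) hG]
  congr 1
  unfold duh
  exact integral_congr_ae (ae_of_all _ fun s => fmul_comm (symb_sin _) hm _)

theorem tendsto_energy_coband {T : ℝ} (v₁ : H1) (v₂ : L2) {G : ℝ → L2}
    (hG : IntegrableOn G (Icc 0 T)) :
    Tendsto (fun n => energy T (fmulH1 (cobandSymb n) (symb_coband n) v₁)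
      (fmul (cobandSymb n) v₂) (fun s => fmul (cobandSymb n) (G s))) atTop (𝓝 0) := by
  unfold energy
  simp only [absD_fmulH1]
  have h3 : Tendsto (fun n => ∫ s in Icc 0 T, ‖fmul (cobandSymb n) (G s)‖) atTop
      (𝓝 (∫ _ in Icc 0 T, (0 : ℝ))) := by
    refine tendsto_integral_of_dominated_convergence (fun s => ‖G s‖) (fun n => ?_) hG.norm
      (fun n => ae_of_all _ fun s => ?_) (ae_of_all _ fun s => ?_)
    · exact ((fmul (cobandSymb n)).integrable_comp hG).norm.aestronglyMeasurable
    · rw [norm_norm]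
      exact norm_fmul_coband_le n _
    · simpa using (tendsto_fmul_coband (G s)).norm
  rw [integral_zero] at h3
  have h1 := (tendsto_fmul_coband (absD v₁)).norm
  have h2 := (tendsto_fmul_coband v₂).norm
  simpa using (h1.add h2).add h3

/-- Convergence in either Lebesgue space implies convergence in measure, whose limit is unique
almost everywhere. -/
theorem ae_eq_of_tendsto_Lp {p q : ℝ≥0∞} [Fact (1 ≤ p)] [Fact (1 ≤ q)] {f : ℕ → LpX p} {g : ℕ → LpX q}
    {f₀ : LpX p} {g₀ : LpX q} (hfg : ∀ n, (f n : E3 → ℂ) =ᵐ[volume] (g n : E3 → ℂ))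
    (hf : Tendsto f atTop (𝓝 f₀)) (hg : Tendsto g atTop (𝓝 g₀)) :
    (f₀ : E3 → ℂ) =ᵐ[volume] (g₀ : E3 → ℂ) :=
  tendstoInMeasure_ae_unique
    ((tendstoInMeasure_of_tendsto_Lp hf).congr_left hfg) (tendstoInMeasure_of_tendsto_Lp hg)

instance tExp_fact (p : ℝ) [hp : Fact (3 < p)] : Fact (1 ≤ tExp p) :=
  ⟨by
    have h := hp.out
    rw [← ENNReal.ofReal_one]
    refine ENNReal.ofReal_le_ofReal ?_
    rw [le_div_iff₀ (by linarith)]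
    linarith⟩

/-- The projections of the solution onto growing bands are Cauchy in the mixed space: the difference
of two of them is a band projection of the solution with data filtered by `1 - P_m`, and the energy
of those data tends to zero. The limit is identified with the solution at almost every time along a
subsequence. -/
theorem strichartz (p : ℝ) [hp : Fact (3 < p)] :
    ∃ K : ℝ, 0 ≤ K ∧ ∀ (T : ℝ), 0 ≤ T → ∀ (v₁ : H1) (v₂ : L2) (G : ℝ → L2),
      IntegrableOn G (Icc 0 T) →
      ∃ V : Lp (LpX (xExp p)) (tExp p) (volume.restrict (Icc 0 T)),
        ‖V‖ ≤ K * energy T v₁ v₂ G ∧ ∀ᵐ t ∂(volume.restrict (Icc 0 T)),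
          (V t : E3 → ℂ) =ᵐ[volume] (toL2 (linV v₁ v₂ G t) : E3 → ℂ) := by
  obtain ⟨K, hK, h⟩ := strichartz_band p
  refine ⟨K, hK, ?_⟩
  intro T hT v₁ v₂ G hG
  set μ : Measure ℝ := volume.restrict (Icc 0 T) with hμ
  -- Clamping time to `[0, T]` gives a curve that is continuous and bounded on the whole line.
  set U : ℝ → L2 := fun t => toL2 (linV v₁ v₂ G (projIcc 0 T hT t)) with hU
  have hUc : Continuous U := by
    refine toL2L.continuous.comp (f := fun t => linV v₁ v₂ G (projIcc 0 T hT t)) ?_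
    exact (continuousOn_linV v₁ v₂ hG).comp_continuous
      (continuous_subtype_val.comp continuous_projIcc) fun t => (projIcc 0 T hT t).2
  have hUe : ∀ t ∈ Icc 0 T, U t = toL2 (linV v₁ v₂ G t) := fun t ht => by
    rw [hU]
    simp only [projIcc_of_mem hT ht]
  obtain ⟨R, hR⟩ := isCompact_Icc.exists_bound_of_continuousOn (hUc.continuousOn (s := Icc 0 T))
  have hUR : ∀ t, ‖U t‖ ≤ R := fun t => by
    have := hR _ (projIcc 0 T hT t).2
    rwa [hUe _ (projIcc 0 T hT t).2] at this
  have hB := h T hT v₁ v₂ G U hG hUc hUe R hUR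
  have hmem : ∀ n, MemLp (fun t => bandX p n (U t)) (tExp p) μ := fun n =>
    ⟨((ContinuousLinearMap.continuous _).comp hUc).aestronglyMeasurable,
      (hB n).trans_lt ENNReal.ofReal_lt_top⟩
  set f : ℕ → Lp (LpX (xExp p)) (tExp p) μ := fun n => (hmem n).toLp _ with hf
  have hfn : ∀ n, ‖f n‖ ≤ K * energy T v₁ v₂ G := fun n => by
    rw [hf, Lp.norm_toLp]
    exact ENNReal.toReal_le_of_le_ofReal (mul_nonneg hK (energy_nonneg _ _ _ _)) (hB n)
  have hcauchy : CauchySeq f := by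
    refine cauchySeq_of_le_tendsto_0' (fun m => K * energy T
      (fmulH1 (cobandSymb m) (symb_coband m) v₁) (fmul (cobandSymb m) v₂)
      (fun s => fmul (cobandSymb m) (G s))) (fun m n hmn => ?_) ?_
    · have h1 := h T hT (fmulH1 (cobandSymb m) (symb_coband m) v₁) (fmul (cobandSymb m) v₂)
        (fun s => fmul (cobandSymb m) (G s)) (fun t => fmul (cobandSymb m) (U t))
        ((fmul (cobandSymb m)).integrable_comp hG)
        ((ContinuousLinearMap.continuous _).comp hUc)
        (fun t ht => by
          rw [toL2_linV_fmul (symb_coband m) v₁ v₂ (hG.mono_set (Icc_subset_Icc_right ht.2)),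
            hUe t ht]) R (fun t => (norm_fmul_coband_le m _).trans (hUR t)) n
      -- For `m ≤ n` the bands are nested, so `P_n (1 - P_m) = P_n - P_m`.
      have e : ∀ t, bandX p n (fmul (cobandSymb m) (U t)) = bandX p n (U t) - bandX p m (U t) := by
        intro t
        rw [fmul_coband, map_sub]
        congr 1
        refine Lp.ext ?_
        filter_upwards [bandX_ae p n (fmul (band m) (U t)), bandX_ae p m (U t)] with x h1 h2
        have hnm : (fun ξ => band n ξ * band m ξ) = band m := by
          ext ξ
          rw [mul_comm, band_mul_band hmn]
        rw [h1, h2, fmul_fmul (symb_band n) (symb_band m), hnm]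
      simp only [e] at h1
      rw [dist_comm, dist_eq_norm, hf]
      beta_reduce
      rw [← MemLp.toLp_sub, Lp.norm_toLp]
      exact ENNReal.toReal_le_of_le_ofReal (mul_nonneg hK (energy_nonneg _ _ _ _)) h1
    · simpa using (tendsto_energy_coband v₁ v₂ hG).const_mul K
  obtain ⟨V, hV⟩ := cauchySeq_tendsto_of_complete hcauchy
  refine ⟨V, le_of_tendsto hV.norm (Eventually.of_forall hfn), ?_⟩
  obtain ⟨ns, hns, hae⟩ := (tendstoInMeasure_of_tendsto_Lp hV).exists_seq_tendsto_ae
  have hco : ∀ᵐ t ∂μ, ∀ n, f n t = bandX p n (U t) := ae_all_iff.2 fun n => (hmem n).coeFn_toLp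
  filter_upwards [hae, hco, ae_restrict_mem measurableSet_Icc] with t h1 h2 ht
  rw [← hUe t ht]
  refine ae_eq_of_tendsto_Lp (f := fun k => bandX p (ns k) (U t))
    (g := fun k => fmul (band (ns k)) (U t)) (fun k => bandX_ae p _ _) ?_
    ((tendsto_fmul_band (U t)).comp hns.tendsto_atTop)
  simpa only [h2] using h1

end ForcedNLW

end

noncomputable section

namespace ForcedNLW

open Filter Topology FourierTransform

/-! ### Time slices of test functions -/

/-- Smooth, compactly supported functions of `(t, x)`. -/
structure IsBump (φ : ℝ × E3 → ℂ) : Prop where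
  smooth : ContDiff ℝ ∞ φ
  compact : HasCompactSupport φ

/-- The directional derivative `∂ᵥ φ` on space-time. -/
def dir (v : ℝ × E3) (φ : ℝ × E3 → ℂ) (z : ℝ × E3) : ℂ := fderiv ℝ φ z v

/-- The time direction. -/
def eT : ℝ × E3 := (1, 0)

/-- The spatial coordinate directions. -/
def eX (j : Fin 3) : ℝ × E3 := (0, EuclideanSpace.single j 1)

theorem IsBump.dir {φ : ℝ × E3 → ℂ} (hφ : IsBump φ) (v : ℝ × E3) : IsBump (dir v φ) :=
  ⟨(hφ.smooth.fderiv_right (m := ∞) (by simp)).clm_apply contDiff_const,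
    hφ.compact.fderiv_apply (𝕜 := ℝ) v⟩

theorem IsBump.add {φ ψ : ℝ × E3 → ℂ} (hφ : IsBump φ) (hψ : IsBump ψ) :
    IsBump (fun z => φ z + ψ z) :=
  ⟨hφ.smooth.add hψ.smooth, hφ.compact.add hψ.compact⟩

theorem IsBump.neg {φ : ℝ × E3 → ℂ} (hφ : IsBump φ) : IsBump (fun z => -φ z) :=
  ⟨hφ.smooth.neg, hφ.compact.comp_left neg_zero⟩

theorem IsBump.hasDerivAt_time {φ : ℝ × E3 → ℂ} (hφ : IsBump φ) (t : ℝ) (x : E3) :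
    HasDerivAt (fun s => φ (s, x)) (ForcedNLW.dir eT φ (t, x)) t := by
  have h1 : HasFDerivAt φ (fderiv ℝ φ (t, x)) (t, x) :=
    (hφ.smooth.differentiable (by simp) _).hasFDerivAt
  have h2 : HasDerivAt (fun s : ℝ => (s, x)) ((1 : ℝ), (0 : E3)) t :=
    (hasDerivAt_id t).prodMk (hasDerivAt_const t x)
  exact h1.comp_hasDerivAt t h2

theorem IsBump.hasCompactSupport_slice {φ : ℝ × E3 → ℂ} (hφ : IsBump φ) (t : ℝ) :
    HasCompactSupport fun x => φ (t, x) := by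
  refine HasCompactSupport.intro (hφ.compact.isCompact.image continuous_snd) fun x hx => ?_
  by_contra h
  exact hx ⟨(t, x), subset_tsupport _ h, rfl⟩

theorem IsBump.contDiff_slice {φ : ℝ × E3 → ℂ} (hφ : IsBump φ) (t : ℝ) :
    ContDiff ℝ ∞ fun x => φ (t, x) :=
  hφ.smooth.comp (contDiff_const.prodMk contDiff_id)

theorem IsBump.memLp_slice {φ : ℝ × E3 → ℂ} (hφ : IsBump φ) (t : ℝ) :
    MemLp (fun x => φ (t, x)) 2 (volume : Measure E3) :=
  (hφ.contDiff_slice t).continuous.memLp_of_hasCompactSupport (hφ.hasCompactSupport_slice t)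

open Classical in
/-- The time slice of a function of `(t, x)` as an element of `L²`. -/
def slice (φ : ℝ × E3 → ℂ) (t : ℝ) : L2 :=
  if h : MemLp (fun x => φ (t, x)) 2 (volume : Measure E3) then h.toLp _ else 0

theorem IsBump.slice_ae {φ : ℝ × E3 → ℂ} (hφ : IsBump φ) (t : ℝ) :
    (slice φ t : E3 → ℂ) =ᵐ[volume] fun x => φ (t, x) := by
  rw [slice, dif_pos (hφ.memLp_slice t)]
  exact MemLp.coeFn_toLp _

theorem IsBump.exists_bound {φ : ℝ × E3 → ℂ} (hφ : IsBump φ) : ∃ C : ℝ, ∀ z, ‖φ z‖ ≤ C :=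
  hφ.smooth.continuous.bounded_above_of_compact_support hφ.compact

theorem IsBump.norm_sub_le {φ : ℝ × E3 → ℂ} (hφ : IsBump φ) {C : ℝ}
    (hC : ∀ z, ‖ForcedNLW.dir eT φ z‖ ≤ C) (s t : ℝ) (x : E3) :
    ‖φ (s, x) - φ (t, x)‖ ≤ C * |s - t| :=
  (convex_univ).norm_image_sub_le_of_norm_hasDerivWithin_le (f := fun s => φ (s, x))
    (fun s _ => (hφ.hasDerivAt_time s x).hasDerivWithinAt) (fun s _ => hC (s, x))
    (mem_univ t) (mem_univ s)

theorem IsBump.norm_taylor_le {φ : ℝ × E3 → ℂ} (hφ : IsBump φ) {C : ℝ}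
    (hC : ∀ z, ‖ForcedNLW.dir eT (ForcedNLW.dir eT φ) z‖ ≤ C) (s t : ℝ) (x : E3) :
    ‖φ (s, x) - φ (t, x) - (s - t) • ForcedNLW.dir eT φ (t, x)‖ ≤ C * |s - t| * |s - t| := by
  have hC0 : 0 ≤ C := (norm_nonneg _).trans (hC 0)
  have h := (convex_uIcc t s).norm_image_sub_le_of_norm_hasDerivWithin_le
    (f := fun s => φ (s, x) - s • ForcedNLW.dir eT φ (t, x))
    (f' := fun s => ForcedNLW.dir eT φ (s, x) - ForcedNLW.dir eT φ (t, x)) (C := C * |s - t|)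
    (fun σ _ => by
      have h1 := (hasDerivAt_id σ).smul_const (ForcedNLW.dir eT φ (t, x))
      rw [one_smul] at h1
      exact ((hφ.hasDerivAt_time σ x).sub h1).hasDerivWithinAt)
    (fun σ hσ => ((hφ.dir eT).norm_sub_le hC σ t x).trans
      (mul_le_mul_of_nonneg_left (abs_sub_left_of_mem_uIcc hσ) hC0))
    left_mem_uIcc right_mem_uIcc
  rw [Real.norm_eq_abs] at h
  refine le_trans (le_of_eq ?_) h
  congr 1
  rw [sub_smul]
  abel

theorem norm_le_of_ae_le_indicator {K : Set E3} (hK : IsCompact K) {f : L2} {M : ℝ} (hM : 0 ≤ M)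
    (h : ∀ᵐ x, ‖f x‖ ≤ K.indicator (fun _ => M) x) : ‖f‖ ≤ M * (volume K).toReal ^ (1 / 2 : ℝ) := by
  have h1 : eLpNorm f 2 volume ≤ eLpNorm (K.indicator fun _ => M) 2 volume := by
    refine eLpNorm_mono_ae ?_
    filter_upwards [h] with x hx using hx.trans (le_abs_self _)
  rw [eLpNorm_indicator_const hK.measurableSet (by norm_num) (by norm_num)] at h1
  rw [Lp.norm_def]
  refine (ENNReal.toReal_mono (ENNReal.mul_ne_top enorm_ne_top
    (ENNReal.rpow_ne_top_of_nonneg (by norm_num) hK.measure_lt_top.ne)) h1).trans_eq ?_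
  rw [ENNReal.toReal_mul, ← ENNReal.toReal_rpow, toReal_enorm, Real.norm_of_nonneg hM]
  norm_num

/-- The Taylor remainder is uniform in `x` and all slices are supported in one compact set, so the
pointwise quadratic bound becomes an `L²` bound. -/
theorem IsBump.hasDerivAt_slice {φ : ℝ × E3 → ℂ} (hφ : IsBump φ) (t : ℝ) :
    HasDerivAt (slice φ) (slice (ForcedNLW.dir eT φ) t) t := by
  obtain ⟨C, hC⟩ := ((hφ.dir eT).dir eT).exists_bound
  have hC0 : 0 ≤ C := (norm_nonneg _).trans (hC 0)
  set K : Set E3 := Prod.snd '' tsupport φ with hK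
  have hKc : IsCompact K := hφ.compact.isCompact.image continuous_snd
  have hz : ∀ s x, x ∉ K → (s, x) ∉ tsupport φ := fun s x hx h => hx ⟨(s, x), h, rfl⟩
  set A : ℝ := (volume K).toReal ^ (1 / 2 : ℝ) with hA
  have hb : ∀ s, ‖slice φ s - slice φ t - (s - t) • slice (ForcedNLW.dir eT φ) t‖ ≤
      C * |s - t| * |s - t| * A := by
    intro s
    refine norm_le_of_ae_le_indicator hKc (by positivity) ?_
    filter_upwards [Lp.coeFn_sub (slice φ s - slice φ t) ((s - t) • slice (ForcedNLW.dir eT φ) t),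
      Lp.coeFn_sub (slice φ s) (slice φ t), Lp.coeFn_smul (s - t) (slice (ForcedNLW.dir eT φ) t),
      hφ.slice_ae s, hφ.slice_ae t, (hφ.dir eT).slice_ae t] with x h1 h2 h3 h4 h5 h6
    rw [h1, Pi.sub_apply, h2, Pi.sub_apply, h3, Pi.smul_apply, h4, h5, h6]
    by_cases hx : x ∈ K
    · rw [indicator_of_mem hx]
      exact hφ.norm_taylor_le hC s t x
    · have e1 : ∀ s, φ (s, x) = 0 := fun s => image_eq_zero_of_notMem_tsupport (hz s x hx)
      have e2 : ForcedNLW.dir eT φ (t, x) = 0 := by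
        unfold ForcedNLW.dir
        rw [image_eq_zero_of_notMem_tsupport
          (fun h => hz t x hx (tsupport_fderiv_subset ℝ h))]
        rfl
      rw [indicator_of_notMem hx, e1, e1, e2]
      simp
  rw [hasDerivAt_iff_isLittleO]
  refine (Asymptotics.IsBigO.of_bound (C * A) (Eventually.of_forall fun s => ?_)).trans_isLittleO
    (Asymptotics.isLittleO_pow_sub_sub t one_lt_two)
  refine (hb s).trans_eq ?_
  rw [norm_pow, norm_norm, Real.norm_eq_abs]
  ring

theorem IsBump.continuous_slice {φ : ℝ × E3 → ℂ} (hφ : IsBump φ) : Continuous (slice φ) :=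
  continuous_iff_continuousAt.2 fun t => (hφ.hasDerivAt_slice t).continuousAt

theorem IsBump.fourier_slice_dir {φ : ℝ × E3 → ℂ} (hφ : IsBump φ) (j : Fin 3) (t : ℝ) :
    ((𝓕 (slice (ForcedNLW.dir (eX j) φ) t) : L2) : E3 → ℂ) =ᵐ[volume]
      fun ξ => gradSymb j ξ * (𝓕 (slice φ t) : L2) ξ := by
  set ψ : 𝓢(E3, ℂ) := (hφ.hasCompactSupport_slice t).toSchwartzMap (hφ.contDiff_slice t) with hψ
  set e : E3 := EuclideanSpace.single j 1 with he
  have h1 : slice φ t = ψ.toLp 2 := by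
    refine Lp.ext ?_
    filter_upwards [hφ.slice_ae t, ψ.coeFn_toLp 2 volume] with x h1 h2
    rw [h1, h2]
    rfl
  have h2 : slice (ForcedNLW.dir (eX j) φ) t = (∂_{e} ψ : 𝓢(E3, ℂ)).toLp 2 := by
    refine Lp.ext ?_
    filter_upwards [(hφ.dir (eX j)).slice_ae t, (∂_{e} ψ : 𝓢(E3, ℂ)).coeFn_toLp 2 volume]
      with x h1 h2
    rw [h1, h2, SchwartzMap.lineDerivOp_apply_eq_fderiv]
    have h3 : HasFDerivAt φ (fderiv ℝ φ (t, x)) (t, x) :=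
      (hφ.smooth.differentiable (by simp) _).hasFDerivAt
    have h4 : HasFDerivAt (fun y : E3 => (t, y)) (ContinuousLinearMap.inr ℝ ℝ E3) x :=
      hasFDerivAt_prodMk_right t x
    have h5 : fderiv ℝ (fun y => φ (t, y)) x = _ := (h3.comp x h4).fderiv
    change _ = fderiv ℝ (fun y => φ (t, y)) x e
    rw [h5]
    rfl
  have hg : (inner ℝ · (EuclideanSpace.single j (1 : ℝ) : E3) : E3 → ℝ).HasTemperateGrowth := by
    fun_prop
  rw [h1, h2, SchwartzMap.toLp_fourier_eq, SchwartzMap.toLp_fourier_eq]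
  filter_upwards [(𝓕 ψ : 𝓢(E3, ℂ)).coeFn_toLp 2 volume,
    (𝓕 (∂_{e} ψ : 𝓢(E3, ℂ)) : 𝓢(E3, ℂ)).coeFn_toLp 2 volume] with ξ h3 h4
  rw [h3, h4, SchwartzMap.fourier_lineDerivOp_eq]
  simp only [smul_apply, smul_eq_mul]
  rw [SchwartzMap.smulLeftCLM_apply_apply hg]
  simp [gradSymb, EuclideanSpace.inner_single_right]
  ring

end ForcedNLW

end

noncomputable section

namespace ForcedNLW

open Filter Topology FourierTransform

/-! ### The wave operator on test functions -/

/-- The spatial Laplacian of a function of `(t, x)`. -/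
def lapFn (φ : ℝ × E3 → ℂ) (z : ℝ × E3) : ℂ := ∑ j, dir (eX j) (dir (eX j) φ) z

/-- The wave operator as a function of `(t, x)`. -/
def waveFn (φ : ℝ × E3 → ℂ) (z : ℝ × E3) : ℂ := -dir eT (dir eT φ) z + lapFn φ z

theorem isBump_lapFn {φ : ℝ × E3 → ℂ} (hφ : IsBump φ) : IsBump (lapFn φ) := by
  have e : lapFn φ = fun z => dir (eX 0) (dir (eX 0) φ) z + dir (eX 1) (dir (eX 1) φ) z +
      dir (eX 2) (dir (eX 2) φ) z := by
    ext z
    rw [lapFn, Fin.sum_univ_three]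
  rw [e]
  exact (((hφ.dir _).dir _).add ((hφ.dir _).dir _)).add ((hφ.dir _).dir _)

theorem isBump_waveFn {φ : ℝ × E3 → ℂ} (hφ : IsBump φ) : IsBump (waveFn φ) :=
  ((hφ.dir _).dir _).neg.add (isBump_lapFn hφ)

theorem fderiv_slice {φ : ℝ × E3 → ℂ} (hφ : IsBump φ) (t : ℝ) (x : E3) (j : Fin 3) :
    fderiv ℝ (fun y => φ (t, y)) x (EuclideanSpace.single j 1) = dir (eX j) φ (t, x) := by
  have h3 : HasFDerivAt φ (fderiv ℝ φ (t, x)) (t, x) :=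
    (hφ.smooth.differentiable (by simp) _).hasFDerivAt
  have h4 : HasFDerivAt (fun y : E3 => (t, y)) (ContinuousLinearMap.inr ℝ ℝ E3) x :=
    hasFDerivAt_prodMk_right t x
  have h5 : fderiv ℝ (fun y => φ (t, y)) x = _ := (h3.comp x h4).fderiv
  rw [h5]
  rfl

theorem waveOp_eq {φ : ℝ × E3 → ℂ} (hφ : IsBump φ) (t : ℝ) (x : E3) :
    waveOp φ t x = waveFn φ (t, x) := by
  unfold waveOp waveFn
  congr 1
  · congr 1
    rw [iteratedDeriv_succ, iteratedDeriv_one]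
    have e : deriv (fun s => φ (s, x)) = fun s => dir eT φ (s, x) :=
      funext fun s => (hφ.hasDerivAt_time s x).deriv
    rw [e]
    exact ((hφ.dir eT).hasDerivAt_time t x).deriv
  · rw [InnerProductSpace.laplacian_eq_iteratedFDeriv_orthonormalBasis _
      (EuclideanSpace.basisFun (Fin 3) ℝ)]
    refine Finset.sum_congr rfl fun j _ => ?_
    rw [iteratedFDeriv_two_apply]
    simp only [EuclideanSpace.basisFun_apply, Matrix.cons_val_zero, Matrix.cons_val_one]
    have hd : DifferentiableAt ℝ (fderiv ℝ fun y => φ (t, y)) x :=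
      ((hφ.contDiff_slice t).fderiv_right (m := ∞) (by simp)).differentiable (by simp) x
    have e : fderiv ℝ (fun y => fderiv ℝ (fun y => φ (t, y)) y (EuclideanSpace.single j 1)) x
        (EuclideanSpace.single j 1) = fderiv ℝ (fderiv ℝ fun y => φ (t, y)) x
          (EuclideanSpace.single j 1) (EuclideanSpace.single j 1) := by
      rw [fderiv_clm_apply hd (differentiableAt_const _)]
      simp
    rw [← e, ← fderiv_slice (hφ.dir (eX j))]
    simp only [fderiv_slice hφ]

theorem slice_lapFn {φ : ℝ × E3 → ℂ} (hφ : IsBump φ) (t : ℝ) :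
    slice (lapFn φ) t = ∑ j, slice (dir (eX j) (dir (eX j) φ)) t := by
  refine Lp.ext ?_
  have h : ∀ᵐ x, ∀ j, slice (dir (eX j) (dir (eX j) φ)) t x =
      dir (eX j) (dir (eX j) φ) (t, x) :=
    ae_all_iff.2 fun j => ((hφ.dir _).dir _).slice_ae t
  filter_upwards [(isBump_lapFn hφ).slice_ae t, h,
    coeFn_sum3 fun j => slice (dir (eX j) (dir (eX j) φ)) t] with x h1 h2 h3
  rw [h1, h3]
  exact Finset.sum_congr rfl fun j _ => (h2 j).symm

theorem slice_waveFn {φ : ℝ × E3 → ℂ} (hφ : IsBump φ) (t : ℝ) :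
    slice (waveFn φ) t = -slice (dir eT (dir eT φ)) t + slice (lapFn φ) t := by
  refine Lp.ext ?_
  filter_upwards [(isBump_waveFn hφ).slice_ae t, ((hφ.dir eT).dir eT).slice_ae t,
    (isBump_lapFn hφ).slice_ae t, Lp.coeFn_neg (slice (dir eT (dir eT φ)) t),
    Lp.coeFn_add (-slice (dir eT (dir eT φ)) t) (slice (lapFn φ) t)] with x h1 h2 h3 h4 h5
  rw [h5, Pi.add_apply, h4, Pi.neg_apply, h1, h2, h3]
  rfl

theorem sum_gradSymb_sq (ξ : E3) : ∑ j, gradSymb j ξ * gradSymb j ξ = -(kap ξ : ℂ) ^ 2 := by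
  have h : ∀ j, gradSymb j ξ * gradSymb j ξ = -(2 * Real.pi) ^ 2 * (((ξ j) ^ 2 : ℝ) : ℂ) := by
    intro j
    unfold gradSymb
    push_cast
    linear_combination (4 * (Real.pi : ℂ) ^ 2 * (ξ j : ℂ) ^ 2) * Complex.I_sq
  simp only [h]
  rw [← Finset.mul_sum, ← Complex.ofReal_sum, sum_sq_eq]
  unfold kap
  push_cast
  ring

theorem fourier_slice_lapFn {φ : ℝ × E3 → ℂ} (hφ : IsBump φ) (t : ℝ) :
    ((𝓕 (slice (lapFn φ) t) : L2) : E3 → ℂ) =ᵐ[volume]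
      fun ξ => -(kap ξ : ℂ) ^ 2 * (𝓕 (slice φ t) : L2) ξ := by
  rw [slice_lapFn hφ, fourier_sum]
  have h : ∀ᵐ ξ : E3, ∀ j, (𝓕 (slice (dir (eX j) (dir (eX j) φ)) t) : L2) ξ =
      gradSymb j ξ * (gradSymb j ξ * (𝓕 (slice φ t) : L2) ξ) := by
    refine ae_all_iff.2 fun j => ?_
    filter_upwards [(hφ.dir (eX j)).fourier_slice_dir j t, hφ.fourier_slice_dir j t] with ξ h1 h2
    rw [h1, h2]
  filter_upwards [h, coeFn_sum3 fun j => 𝓕 (slice (dir (eX j) (dir (eX j) φ)) t)] with ξ h1 h2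
  rw [h2, ← sum_gradSymb_sq, Finset.sum_mul]
  exact Finset.sum_congr rfl fun j _ => by rw [h1 j, mul_assoc]

/-- The time slice of a test function as an element of `H¹`. -/
def sliceH1 {φ : ℝ × E3 → ℂ} (hφ : IsBump φ) (t : ℝ) : H1 :=
  ⟨WithLp.toLp 2 (slice φ t, WithLp.toLp 2 fun j => slice (dir (eX j) φ) t), by
    rw [mem_H1_iff]
    exact fun j => hφ.fourier_slice_dir j t⟩

theorem toL2_sliceH1 {φ : ℝ × E3 → ℂ} (hφ : IsBump φ) (t : ℝ) :
    toL2 (sliceH1 hφ t) = slice φ t := rfl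

theorem hasDerivAt_fmul_cos_slice {φ : ℝ × E3 → ℂ} (hφ : IsBump φ) (t τ : ℝ) :
    HasDerivAt (fun τ => fmul (cosSymb τ) (slice φ t)) (fmul (sinSymb τ) (slice (lapFn φ) t)) τ := by
  have h := hasDerivAt_fmul_cos_toL2 τ (sliceH1 hφ t)
  rw [toL2_sliceH1] at h
  refine h.congr_deriv ?_
  have hneg : Symb (fun ξ => (-1 : ℂ) * sineSymb τ ξ) :=
    Symb.mul (m := fun _ => (-1 : ℂ)) ⟨measurable_const, 1, fun _ => by simp⟩ (symb_sine τ)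
  rw [velH1_eq, ← neg_one_smul ℂ, ← fmul_const_mul_symb (symb_sine τ)]
  apply L2_ext_fourier
  filter_upwards [fmul_ae hneg (absD (sliceH1 hφ t)), fourier_absD (sliceH1 hφ t),
    fmul_ae (symb_sin τ) (slice (lapFn φ) t), fourier_slice_lapFn hφ t] with ξ h1 h2 h3 h4
  rw [h1, h2, h3, h4, toL2_sliceH1]
  have := kap_mul_sinSymb τ ξ
  unfold sineSymb
  rw [← this]
  ring

/-- The product rule for a strongly continuous family: joint continuity handles the term in which
the difference quotient of `Ψ` is acted on by a moving operator. -/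
theorem hasDerivAt_family {K : ℝ → L2 →L[ℂ] L2} (hK : ∀ x, Continuous fun t => K t x)
    {Ψ : ℝ → L2} {D Ψ' : L2} {t₀ : ℝ} (h1 : HasDerivAt (fun t => K t (Ψ t₀)) D t₀)
    (h2 : HasDerivAt Ψ Ψ' t₀) : HasDerivAt (fun t => K t (Ψ t)) (D + K t₀ Ψ') t₀ := by
  rw [hasDerivAt_iff_tendsto_slope] at h1 h2 ⊢
  have h3 : Tendsto (fun t => K t (slope Ψ t₀ t)) (𝓝[≠] t₀) (𝓝 (K t₀ Ψ')) := by
    have h4 : Tendsto (fun t : ℝ => (t, slope Ψ t₀ t)) (𝓝[≠] t₀) (𝓝 (t₀, Ψ')) :=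
      (tendsto_id.mono_left nhdsWithin_le_nhds).prodMk_nhds h2
    exact ((continuous_uncurry_of_strongly_continuous hK).tendsto (t₀, Ψ')).comp h4
  refine (h1.add h3).congr fun t => ?_
  simp only [slope_def_module, ContinuousLinearMap.map_smul_of_tower, map_sub]
  rw [← smul_add]
  congr 1
  abel

/-- The two first-order cross terms cancel, leaving the sine propagator applied to the wave
operator. This exhibits a primitive, so the adjoint Duhamel integrals of a test function are
boundary terms. -/
theorem hasDerivAt_cos_sub_sin {φ : ℝ × E3 → ℂ} (hφ : IsBump φ) (s t : ℝ) :
    HasDerivAt (fun t => fmul (cosSymb (t - s)) (slice φ t) -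
        fmul (sinSymb (t - s)) (slice (dir eT φ) t))
      (fmul (sinSymb (t - s)) (slice (waveFn φ) t)) t := by
  have hc : ∀ x, Continuous fun t => fmul (cosSymb (t - s)) x := fun x =>
    (continuous_fmul_cos x).comp (continuous_id.sub continuous_const)
  have hs : ∀ x, Continuous fun t => fmul (sinSymb (t - s)) x := fun x =>
    (continuous_fmul_sin x).comp (continuous_id.sub continuous_const)
  have h1 := hasDerivAt_family (K := fun t => fmul (cosSymb (t - s))) hc
    ((hasDerivAt_fmul_cos_slice hφ t (t - s)).comp_sub_const t s) (hφ.hasDerivAt_slice t)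
  have h2 := hasDerivAt_family (K := fun t => fmul (sinSymb (t - s))) hs
    ((hasDerivAt_fmul_sin (t - s) (slice (dir eT φ) t)).comp_sub_const t s)
    ((hφ.dir eT).hasDerivAt_slice t)
  refine (h1.sub h2).congr_deriv ?_
  rw [slice_waveFn hφ, map_add, map_neg]
  abel

end ForcedNLW

end

noncomputable section

namespace ForcedNLW

open Filter Topology FourierTransform

/-! ### The equation in the sense of distributions -/

theorem slice_eq_zero {φ : ℝ × E3 → ℂ} {t : ℝ} (h : ∀ x, φ (t, x) = 0) : slice φ t = 0 := by
  have h0 : MemLp (fun x => φ (t, x)) 2 (volume : Measure E3) := by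
    simp only [h]
    exact MemLp.zero
  rw [slice, dif_pos h0]
  refine Lp.ext ?_
  filter_upwards [h0.coeFn_toLp, Lp.coeFn_zero ℂ 2 (volume : Measure E3)] with x h1 h2
  rw [h1, h2, h]
  rfl

theorem slice_eq_zero_of_notMem {T : ℝ} {φ : ℝ × E3 → ℂ}
    (hs : tsupport φ ⊆ Ioo 0 T ×ˢ univ) {t : ℝ} (ht : t ∉ Ioo 0 T) : slice φ t = 0 :=
  slice_eq_zero fun _ => image_eq_zero_of_notMem_tsupport fun h => ht (hs h).1

theorem tsupport_dir_subset (v : ℝ × E3) (φ : ℝ × E3 → ℂ) : tsupport (dir v φ) ⊆ tsupport φ :=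
  tsupport_fderiv_apply_subset ℝ v

theorem continuous_sin_slice {φ : ℝ × E3 → ℂ} (hφ : IsBump φ) (s : ℝ) :
    Continuous fun t => fmul (sinSymb (t - s)) (slice φ t) := by
  have h : Continuous fun z : ℝ × L2 => fmul (sinSymb z.1) z.2 :=
    continuous_uncurry_of_strongly_continuous continuous_fmul_sin
  have h2 : Continuous fun t : ℝ => (t - s, slice φ t) :=
    (continuous_id.sub continuous_const).prodMk hφ.continuous_slice
  have h3 := h.comp h2
  simpa only [Function.comp_def] using h3

theorem continuous_cos_slice {φ : ℝ × E3 → ℂ} (hφ : IsBump φ) (s : ℝ) :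
    Continuous fun t => fmul (cosSymb (t - s)) (slice φ t) := by
  have h : Continuous fun z : ℝ × L2 => fmul (cosSymb z.1) z.2 :=
    continuous_uncurry_of_strongly_continuous continuous_fmul_cos
  have h2 : Continuous fun t : ℝ => (t - s, slice φ t) :=
    (continuous_id.sub continuous_const).prodMk hφ.continuous_slice
  have h3 := h.comp h2
  simpa only [Function.comp_def] using h3

theorem integral_sin_waveFn {φ : ℝ × E3 → ℂ} (hφ : IsBump φ) (s : ℝ) {a b : ℝ} (hab : a ≤ b) :
    ∫ t in Icc a b, fmul (sinSymb (t - s)) (slice (waveFn φ) t) =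
      (fmul (cosSymb (b - s)) (slice φ b) - fmul (sinSymb (b - s)) (slice (dir eT φ) b)) -
      (fmul (cosSymb (a - s)) (slice φ a) - fmul (sinSymb (a - s)) (slice (dir eT φ) a)) := by
  rw [integral_Icc_eq_integral_Ioc, ← intervalIntegral.integral_of_le hab]
  exact intervalIntegral.integral_eq_sub_of_hasDerivAt
    (fun t _ => hasDerivAt_cos_sub_sin hφ s t)
    ((continuous_sin_slice (isBump_waveFn hφ) s).intervalIntegrable _ _)

theorem sinSymb_sub (t s : ℝ) (ξ : E3) :
    sinSymb (t - s) ξ = sinSymb t ξ * cosSymb s ξ - cosSymb t ξ * sinSymb s ξ := by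
  by_cases h : kap ξ = 0
  · simp [sinSymb, cosSymb, h]
  · have hk : (kap ξ : ℂ) ≠ 0 := by exact_mod_cast h
    apply mul_left_cancel₀ hk
    have e := fun t => kap_mul_sinSymb t ξ
    rw [mul_sub, ← mul_assoc, e, mul_left_comm, e, e]
    unfold cosSymb
    rw [sub_mul, Real.sin_sub]
    push_cast
    ring

theorem fmul_sin_sub (t s : ℝ) (f : L2) : fmul (sinSymb (t - s)) f =
    fmul (cosSymb s) (fmul (sinSymb t) f) - fmul (sinSymb s) (fmul (cosSymb t) f) := by
  rw [fmul_fmul (symb_cos s) (symb_sin t), fmul_fmul (symb_sin s) (symb_cos t),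
    ← fmul_sub_symb ((symb_cos s).mul (symb_sin t)) ((symb_sin s).mul (symb_cos t))]
  congr 2
  ext ξ
  rw [sinSymb_sub]
  ring

/-- The sine integrals vanish for every base time `s`. Expanding `sin((t-s)κ)` shows that the sine
propagator annihilates this integral at every time `s`, and the derivative at `s = 0` is the
integral itself. -/
theorem integral_cos_waveFn {T : ℝ} (hT : 0 ≤ T) {φ : ℝ × E3 → ℂ} (hφ : IsBump φ)
    (hs : tsupport φ ⊆ Ioo 0 T ×ˢ univ) :
    ∫ t in Icc 0 T, fmul (cosSymb t) (slice (waveFn φ) t) = 0 := by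
  set Y : L2 := ∫ t in Icc 0 T, fmul (cosSymb t) (slice (waveFn φ) t) with hY
  have hd := (tsupport_dir_subset eT φ).trans hs
  have h0 : (0 : ℝ) ∉ Ioo 0 T := fun h => lt_irrefl _ h.1
  have h1 : T ∉ Ioo 0 T := fun h => lt_irrefl _ h.2
  have hX : ∀ s, ∫ t in Icc 0 T, fmul (sinSymb (t - s)) (slice (waveFn φ) t) = 0 := by
    intro s
    rw [integral_sin_waveFn hφ s hT, slice_eq_zero_of_notMem hs h0, slice_eq_zero_of_notMem hs h1,
      slice_eq_zero_of_notMem hd h0, slice_eq_zero_of_notMem hd h1]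
    simp
  have hci : IntegrableOn (fun t => fmul (cosSymb t) (slice (waveFn φ) t)) (Icc 0 T) := by
    have := continuous_cos_slice (isBump_waveFn hφ) 0
    simp only [sub_zero] at this
    exact this.integrableOn_Icc
  have hsi : IntegrableOn (fun t => fmul (sinSymb t) (slice (waveFn φ) t)) (Icc 0 T) := by
    have := continuous_sin_slice (isBump_waveFn hφ) 0
    simp only [sub_zero] at this
    exact this.integrableOn_Icc
  have hSY : ∀ s, fmul (sinSymb s) Y = 0 := by
    intro s
    have h2 := hX s
    simp only [fmul_sin_sub] at h2
    rw [integral_sub ((fmul (cosSymb s)).integrable_comp hsi)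
      ((fmul (sinSymb s)).integrable_comp hci), ContinuousLinearMap.integral_comp_comm _ hsi,
      ContinuousLinearMap.integral_comp_comm _ hci, ← hY] at h2
    have h3 := hX 0
    simp only [sub_zero] at h3
    rw [h3, map_zero, zero_sub, neg_eq_zero] at h2
    exact h2
  have hder := hasDerivAt_fmul_sin 0 Y
  simp only [hSY] at hder
  rw [cosSymb_zero] at hder
  exact hder.unique (hasDerivAt_const _ _)

theorem inner_fmul_cos (t : ℝ) (f g : L2) :
    inner ℂ f (fmul (cosSymb t) g) = inner ℂ (fmul (cosSymb t) f) g := by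
  rw [inner_fmul_left (symb_cos t), show (fun ξ => (starRingEnd ℂ) (cosSymb t ξ)) = cosSymb t
    from funext fun ξ => Complex.conj_ofReal _]

theorem inner_fmul_sin (t : ℝ) (f g : L2) :
    inner ℂ f (fmul (sinSymb t) g) = inner ℂ (fmul (sinSymb t) f) g := by
  rw [inner_fmul_left (symb_sin t), show (fun ξ => (starRingEnd ℂ) (sinSymb t ξ)) = sinSymb t
    from funext fun ξ => Complex.conj_ofReal _]

theorem exists_bound_slice {φ : ℝ × E3 → ℂ} (hφ : IsBump φ) : ∃ M : ℝ, ∀ t, ‖slice φ t‖ ≤ M := by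
  refine hφ.continuous_slice.bounded_above_of_compact_support ?_
  refine HasCompactSupport.intro (hφ.compact.isCompact.image continuous_fst) fun t ht => ?_
  exact slice_eq_zero fun x => by
    by_contra h
    exact ht ⟨(t, x), subset_tsupport _ h, rfl⟩

/-- Every propagator is moved onto the wave operator of the test function. The two free terms vanish
because the test function is supported in the open time interval. The adjoint Duhamel integral
started at `s` reduces to its lower endpoint, `-φ(s)`, which cancels the minus sign of the Duhamel
term. -/
theorem weak_linV {T : ℝ} (hT : 0 ≤ T) {φ : ℝ × E3 → ℂ} (hφ : IsBump φ)
    (hs : tsupport φ ⊆ Ioo 0 T ×ˢ univ) (v₁ : H1) (v₂ : L2) {G : ℝ → L2}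
    (hG : IntegrableOn G (Icc 0 T)) :
    ∫ t in Icc 0 T, inner ℂ (slice (waveFn φ) t) (toL2 (linV v₁ v₂ G t)) =
      ∫ t in Icc 0 T, inner ℂ (slice φ t) (G t) := by
  set H : ℝ → L2 := slice (waveFn φ) with hH
  have hHc : Continuous H := (isBump_waveFn hφ).continuous_slice
  obtain ⟨M, hM⟩ := exists_bound_slice (isBump_waveFn hφ)
  have hd := (tsupport_dir_subset eT φ).trans hs
  have h0 : (0 : ℝ) ∉ Ioo 0 T := fun h => lt_irrefl _ h.1
  have h1 : T ∉ Ioo 0 T := fun h => lt_irrefl _ h.2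
  have hci : IntegrableOn (fun t => fmul (cosSymb t) (H t)) (Icc 0 T) := by
    have := continuous_cos_slice (isBump_waveFn hφ) 0
    simp only [sub_zero] at this
    exact this.integrableOn_Icc
  have hsi : IntegrableOn (fun t => fmul (sinSymb t) (H t)) (Icc 0 T) := by
    have := continuous_sin_slice (isBump_waveFn hφ) 0
    simp only [sub_zero] at this
    exact this.integrableOn_Icc
  have hX : ∀ s ∈ Icc 0 T, ∫ t in Icc s T, fmul (sinSymb (t - s)) (H t) = -slice φ s := by
    intro s hst
    rw [hH, integral_sin_waveFn hφ s hst.2, slice_eq_zero_of_notMem hs h1,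
      slice_eq_zero_of_notMem hd h1, sub_self, cosSymb_zero, sinSymb_zero]
    simp
  have hdc : ContinuousOn (duh (fun τ => fmul (sinSymb τ)) G) (Icc 0 T) :=
    continuousOn_duh continuous_fmul_sin hG
  have hz : IntegrableOn (fun t => inner ℂ (H t) (duh (fun τ => fmul (sinSymb τ)) G t))
      (Icc 0 T) :=
    (hHc.continuousOn.inner hdc).integrableOn_compact isCompact_Icc
  have hxy : IntegrableOn (fun t => inner ℂ (fmul (cosSymb t) (H t)) (toL2 v₁) +
      inner ℂ (fmul (sinSymb t) (H t)) v₂) (Icc 0 T) :=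
    (integrableOn_inner_left hci _).add (integrableOn_inner_left hsi _)
  have e : ∫ t in Icc 0 T, inner ℂ (H t) (toL2 (linV v₁ v₂ G t)) =
      (∫ t in Icc 0 T, inner ℂ (fmul (cosSymb t) (H t)) (toL2 v₁)) +
      (∫ t in Icc 0 T, inner ℂ (fmul (sinSymb t) (H t)) v₂) -
      ∫ t in Icc 0 T, inner ℂ (H t) (duh (fun τ => fmul (sinSymb τ)) G t) := by
    rw [← integral_add (integrableOn_inner_left hci _) (integrableOn_inner_left hsi _),
      ← integral_sub hxy hz]
    refine setIntegral_congr_fun measurableSet_Icc fun t ht => ?_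
    beta_reduce
    rw [toL2_linV v₁ v₂ (hG.mono_set (Icc_subset_Icc_right ht.2)), inner_sub_right,
      inner_add_right, inner_fmul_cos, inner_fmul_sin]
  have hX0 := hX 0 ⟨le_rfl, hT⟩
  simp only [sub_zero] at hX0
  rw [e, integral_inner_left hci, integral_inner_left hsi, integral_cos_waveFn hT hφ hs, hX0,
    slice_eq_zero_of_notMem hs h0, integral_inner_duh_eq continuous_fmul_sin inner_fmul_sin
      hHc.aestronglyMeasurable hM hG, neg_zero, inner_zero_left, inner_zero_left, add_zero,
    zero_sub, ← integral_neg]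
  refine setIntegral_congr_fun measurableSet_Icc fun t ht => ?_
  beta_reduce
  rw [hX t ht, inner_neg_left, neg_neg]

end ForcedNLW

end

noncomputable section

namespace ForcedNLW

open Filter Topology FourierTransform

/-! ### Distributional identities on the Fourier side -/

theorem ae_eq_zero_of_fourierInv_eq_zero {m : E3 → ℂ} (hm : Integrable m)
    (h : ∀ a, 𝓕⁻ m a = 0) : m =ᵐ[volume] 0 := by
  refine ae_eq_zero_of_integral_contDiff_smul_eq_zero hm.locallyIntegrable ?_
  intro φ h1 h2
  have hg₁ : HasCompactSupport (Complex.ofRealCLM ∘ φ) := h2.comp_left rfl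
  have hg₂ : ContDiff ℝ ∞ (Complex.ofRealCLM ∘ φ) := by fun_prop
  set ψ := hg₁.toSchwartzMap hg₂ with hψ
  have e := VectorFourier.integral_fourierIntegral_smul_eq_flip (L := -innerₗ E3)
    (μ := volume) (ν := volume) Real.continuous_fourierChar
    (continuous_inner (𝕜 := ℝ) (E := E3)).neg (𝓕 ψ : 𝓢(E3, ℂ)).integrable hm
  have hflip : (-innerₗ E3).flip = -innerₗ E3 := by
    ext x y
    simp [real_inner_comm]
  rw [hflip] at e
  have e1 : ∀ x, VectorFourier.fourierIntegral 𝐞 volume (-innerₗ E3) (𝓕 ψ : 𝓢(E3, ℂ)) x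
      = ψ x := by
    intro x
    have h3 := congrArg (fun f : 𝓢(E3, ℂ) => f x) (FourierTransform.fourierInv_fourier_eq (F := 𝓢(E3, ℂ)) ψ)
    rw [← h3, SchwartzMap.fourierInv_coe]
    rfl
  have e2 : ∀ x, VectorFourier.fourierIntegral 𝐞 volume (-innerₗ E3) m x = 0 := h
  simp only [e1, e2, smul_zero, integral_zero] at e
  simpa [hψ] using e

theorem fourier_translate (ρ : E3 → ℂ) (a ξ : E3) :
    𝓕 (fun x => ρ (x - a)) ξ = Real.fourierChar (-inner ℝ a ξ) • 𝓕 ρ ξ := by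
  have h := congrFun (VectorFourier.fourierIntegral_comp_add_right Real.fourierChar
    (volume : Measure E3) (innerₗ E3) ρ (-a)) ξ
  have h2 : (innerₗ E3) (-a) ξ = -inner ℝ a ξ := by simp
  rw [h2] at h
  have h3 : (ρ ∘ fun v => v + -a) = fun x => ρ (x - a) := by
    ext x
    simp [sub_eq_add_neg]
  rw [h3] at h
  exact h

/-- Normalized bumps concentrate at the origin, so their transforms at a fixed `ξ` tend to 1. -/
theorem exists_bump_fourier_ne_zero (ξ : E3) (b : ℕ → ContDiffBump (0 : E3))
    (hb : Tendsto (fun n => (b n).rOut) atTop (𝓝 0)) :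
    ∃ n, 𝓕 (fun x => (((b n).normed volume x : ℝ) : ℂ)) ξ ≠ 0 := by
  have hg : Continuous fun y : E3 => (Real.fourierChar (inner ℝ y ξ) : ℂ) :=
    (continuous_subtype_val.comp Real.continuous_fourierChar).comp
      (continuous_id.inner continuous_const)
  have h := ContDiffBump.convolution_tendsto_right_of_continuous (μ := volume) hb hg 0
  have e : ∀ n, convolution ((b n).normed volume) (fun y : E3 => (Real.fourierChar (inner ℝ y ξ) : ℂ))
      (ContinuousLinearMap.lsmul ℝ ℝ) volume 0 =
      𝓕 (fun x => (((b n).normed volume x : ℝ) : ℂ)) ξ := by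
    intro n
    rw [Real.fourier_eq]
    unfold MeasureTheory.convolution
    refine integral_congr_ae (ae_of_all _ fun x => ?_)
    simp only [ContinuousLinearMap.lsmul_apply, zero_sub, inner_neg_left, Circle.smul_def,
      smul_eq_mul, Complex.real_smul]
    ring
  simp only [e, inner_zero_left, AddChar.map_zero_eq_one] at h
  have h1 : ∀ᶠ n in atTop, 𝓕 (fun x => (((b n).normed volume x : ℝ) : ℂ)) ξ ≠ 0 :=
    h.eventually_ne (by simp)
  exact h1.exists

/-- It is not known beforehand that `κ² Û` is square integrable. For a test function `ρ`, the
product of the conjugate of `ρ̂` with `Ŵ + κ² Û` is integrable, and testing against all translates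
of `ρ` shows that its inverse transform vanishes. A sequence of bumps whose transforms have no
common zero then removes the factor. -/
theorem fourier_eq_of_weak {U W : L2}
    (h : ∀ ρ : E3 → ℂ, ContDiff ℝ ∞ ρ → HasCompactSupport ρ → ∃ P L : L2,
      (P : E3 → ℂ) =ᵐ[volume] ρ ∧
      ((𝓕 L : L2) : E3 → ℂ) =ᵐ[volume] (fun ξ => -(kap ξ : ℂ) ^ 2 * (𝓕 P : L2) ξ) ∧
      inner ℂ P W = inner ℂ L U) :
    ((𝓕 W : L2) : E3 → ℂ) =ᵐ[volume] fun ξ => -(kap ξ : ℂ) ^ 2 * (𝓕 U : L2) ξ := by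
  have key : ∀ ρ : E3 → ℂ, ContDiff ℝ ∞ ρ → HasCompactSupport ρ →
      ∀ᵐ ξ, (starRingEnd ℂ) (𝓕 ρ ξ) * ((𝓕 W : L2) ξ + (kap ξ : ℂ) ^ 2 * (𝓕 U : L2) ξ) = 0 := by
    intro ρ h1 h2
    set m : E3 → ℂ := fun ξ =>
      (starRingEnd ℂ) (𝓕 ρ ξ) * ((𝓕 W : L2) ξ + (kap ξ : ℂ) ^ 2 * (𝓕 U : L2) ξ) with hm
    have htr : ∀ a : E3, Integrable (fun ξ => (Real.fourierChar (inner ℝ ξ a) : ℂ) * m ξ) ∧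
        ∫ ξ, (Real.fourierChar (inner ℝ ξ a) : ℂ) * m ξ = 0 := by
      intro a
      have hs1 : ContDiff ℝ ∞ fun x => ρ (x - a) := h1.comp (contDiff_id.sub contDiff_const)
      have hs2 : HasCompactSupport fun x => ρ (x - a) :=
        h2.comp_homeomorph (Homeomorph.subRight a)
      obtain ⟨P, L, hP, hL, hPL⟩ := h _ hs1 hs2
      have hPi : Integrable (P : E3 → ℂ) :=
        (hs1.continuous.integrable_of_hasCompactSupport hs2).congr hP.symm
      have hF : ((𝓕 P : L2) : E3 → ℂ) =ᵐ[volume]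
          fun ξ => Real.fourierChar (-inner ℝ a ξ) • 𝓕 ρ ξ := by
        filter_upwards [fourier_L2_eq_of_integrable hPi] with ξ h3
        rw [h3, ← fourier_translate, Real.fourier_eq, Real.fourier_eq]
        refine integral_congr_ae ?_
        filter_upwards [hP] with x hx
        rw [hx]
      have hi1 := L2.integrable_inner (𝕜 := ℂ) (𝓕 P : L2) (𝓕 W)
      have hi2 := L2.integrable_inner (𝕜 := ℂ) (𝓕 L : L2) (𝓕 U)
      have e : (fun ξ => (Real.fourierChar (inner ℝ ξ a) : ℂ) * m ξ) =ᵐ[volume]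
          fun ξ => inner ℂ ((𝓕 P : L2) ξ) ((𝓕 W : L2) ξ) -
            inner ℂ ((𝓕 L : L2) ξ) ((𝓕 U : L2) ξ) := by
        filter_upwards [hF, hL] with ξ h3 h4
        rw [h4, h3, hm]
        simp only [RCLike.inner_apply, Circle.smul_def, smul_eq_mul, map_mul, map_neg, map_pow,
          Complex.conj_ofReal]
        have h5 : (starRingEnd ℂ) (Real.fourierChar (-inner ℝ a ξ) : ℂ) =
            (Real.fourierChar (inner ℝ ξ a) : ℂ) := by
          rw [real_inner_comm a ξ, AddChar.map_neg_eq_inv, Circle.coe_inv_eq_conj,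
            Complex.conj_conj]
        rw [h5]
        ring
      refine ⟨(hi1.sub hi2).congr e.symm, ?_⟩
      rw [integral_congr_ae e, integral_sub hi1 hi2, sub_eq_zero]
      have h6 := hPL
      rw [← Lp.inner_fourier_eq P W, ← Lp.inner_fourier_eq L U] at h6
      exact h6
    have hmi : Integrable m := by
      have := (htr 0).1
      simpa using this
    refine ae_eq_zero_of_fourierInv_eq_zero hmi fun a => ?_
    rw [Real.fourierInv_eq]
    exact (htr a).2
  set b : ℕ → ContDiffBump (0 : E3) := fun n =>
    ⟨1 / ((n : ℝ) + 1) / 2, 1 / ((n : ℝ) + 1), by positivity, half_lt_self (by positivity)⟩ with hb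
  have hbt : Tendsto (fun n => (b n).rOut) atTop (𝓝 0) := tendsto_one_div_add_atTop_nhds_zero_nat
  have hall : ∀ᵐ ξ, ∀ n, (starRingEnd ℂ) (𝓕 (fun x => (((b n).normed volume x : ℝ) : ℂ)) ξ) *
      ((𝓕 W : L2) ξ + (kap ξ : ℂ) ^ 2 * (𝓕 U : L2) ξ) = 0 := by
    refine ae_all_iff.2 fun n => key _ ?_ ?_
    · exact Complex.ofRealCLM.contDiff.comp (b n).contDiff_normed
    · exact (b n).hasCompactSupport_normed.comp_left Complex.ofReal_zero
  filter_upwards [hall] with ξ hξ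
  obtain ⟨n, hn⟩ := exists_bump_fourier_ne_zero ξ b hbt
  have := (mul_eq_zero.1 (hξ n)).resolve_left (by simpa using hn)
  linear_combination this

end ForcedNLW

end

noncomputable section

namespace ForcedNLW

open Filter Topology FourierTransform

/-! ### Uniqueness of weak solutions -/

/-- The lemma of du Bois-Reymond on an interval, normalized at the left endpoint. -/
theorem eqOn_zero_of_integral_deriv_smul {T : ℝ} (hT : 0 < T) {k : ℝ → L2}
    (hk : ContinuousOn k (Icc 0 T)) (h0 : k 0 = 0)
    (h : ∀ χ : ℝ → ℝ, ContDiff ℝ ∞ χ → HasCompactSupport χ → tsupport χ ⊆ Ioo 0 T →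
      ∫ t in Icc 0 T, deriv χ t • k t = 0) : ∀ t ∈ Icc 0 T, k t = 0 := by
  set b : ContDiffBump (T / 2) := ⟨T / 8, T / 4, by positivity, by linarith⟩ with hb
  set η₀ : ℝ → ℝ := b.normed volume with hη₀
  have hη₀c : ContDiff ℝ ∞ η₀ := b.contDiff_normed
  have hη₀s : HasCompactSupport η₀ := b.hasCompactSupport_normed
  have hη₀t : tsupport η₀ ⊆ Ioo 0 T := by
    rw [hη₀, b.tsupport_normed_eq, Real.closedBall_eq_Icc]
    intro x hx
    have h1 : T / 2 - T / 4 ≤ x := hx.1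
    have h2 : x ≤ T / 2 + T / 4 := hx.2
    exact ⟨by linarith, by linarith⟩
  have hη₀i : ∫ x, η₀ x = 1 := b.integral_normed
  set c : L2 := ∫ t in Icc 0 T, η₀ t • k t with hc
  have hki : ∀ η : ℝ → ℝ, Continuous η → IntegrableOn (fun t => η t • k t) (Icc 0 T) :=
    fun η hη => (hη.continuousOn.smul hk).integrableOn_compact isCompact_Icc
  have hIcc : ∀ η : ℝ → ℝ, tsupport η ⊆ Ioo 0 T → ∫ t in Icc 0 T, η t = ∫ t, η t := by
    intro η hη
    refine setIntegral_eq_integral_of_forall_compl_eq_zero fun t ht => ?_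
    exact image_eq_zero_of_notMem_tsupport fun h => ht (Ioo_subset_Icc_self (hη h))
  have key : ∀ η : ℝ → ℝ, ContDiff ℝ ∞ η → HasCompactSupport η → tsupport η ⊆ Ioo 0 T →
      ∫ t in Icc 0 T, η t • k t = (∫ t, η t) • c := by
    intro η h1 h2 h3
    -- Subtracting `I η₀` makes the integral zero, so that the primitive has compact support and is
    -- an admissible `χ`.
    set I : ℝ := ∫ t, η t with hI
    set η₁ : ℝ → ℝ := fun t => η t - I * η₀ t with hη₁
    have hη₁c : ContDiff ℝ ∞ η₁ := h1.sub (contDiff_const.mul hη₀c)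
    set χ : ℝ → ℝ := fun t => ∫ s in (0 : ℝ)..t, η₁ s with hχ
    have hχd : ∀ t, HasDerivAt χ (η₁ t) t := fun t =>
      (hη₁c.continuous.integral_hasStrictDerivAt 0 t).hasDerivAt
    have hχd' : deriv χ = η₁ := funext fun t => (hχd t).deriv
    have hχc : ContDiff ℝ ∞ χ := by
      rw [contDiff_infty_iff_deriv]
      exact ⟨fun t => (hχd t).differentiableAt, by rw [hχd']; exact hη₁c⟩
    set K : Set ℝ := tsupport η ∪ tsupport η₀ with hK
    have hKc : IsCompact K := h2.isCompact.union hη₀s.isCompact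
    have hKn : K.Nonempty := by
      refine Nonempty.inr ?_
      rw [hη₀, b.tsupport_normed_eq]
      exact ⟨T / 2, Metric.mem_closedBall_self (by positivity)⟩
    have hKT : K ⊆ Ioo 0 T := union_subset h3 hη₀t
    obtain ⟨a₁, ha₁, ha₁'⟩ := hKc.exists_isLeast hKn
    obtain ⟨b₁, hb₁, hb₁'⟩ := hKc.exists_isGreatest hKn
    have hzero : ∀ s, s ∉ K → η₁ s = 0 := by
      intro s hs
      rw [hη₁]
      simp only
      rw [image_eq_zero_of_notMem_tsupport fun h => hs (Or.inl h),
        image_eq_zero_of_notMem_tsupport fun h => hs (Or.inr h)]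
      ring
    have hη₁I : ∫ s, η₁ s = 0 := by
      rw [hη₁, integral_sub (h1.continuous.integrable_of_hasCompactSupport h2)
        ((hη₀c.continuous.integrable_of_hasCompactSupport hη₀s).const_mul I),
        integral_const_mul, hη₀i, mul_one, sub_self]
    have hχz : ∀ t, t ∉ Icc a₁ b₁ → χ t = 0 := by
      intro t ht
      by_cases hta : t < a₁
      · rw [hχ]
        simp only
        rw [intervalIntegral.integral_congr (g := fun _ => 0), intervalIntegral.integral_zero]
        intro s hs
        refine hzero s fun hsK => ?_
        have h4 := ha₁' hsK
        have h5 := (hKT ha₁).1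
        rcases le_total 0 t with h6 | h6
        · rw [uIcc_of_le h6] at hs
          linarith [hs.2]
        · rw [uIcc_of_ge h6] at hs
          linarith [hs.2]
      · have htb : b₁ < t := by
          by_contra h4
          exact ht ⟨not_lt.1 hta, not_lt.1 h4⟩
        rw [hχ]
        simp only
        rw [intervalIntegral.integral_eq_integral_of_support_subset, hη₁I]
        intro s hs
        have hsK : s ∈ K := by
          by_contra h4
          exact hs (hzero s h4)
        exact ⟨(hKT hsK).1, (hb₁' hsK).trans htb.le⟩
    have hts : tsupport χ ⊆ Icc a₁ b₁ := closure_minimal (fun t ht => by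
      by_contra h4
      exact ht (hχz t h4)) isClosed_Icc
    have h5 := h χ hχc (HasCompactSupport.of_support_subset_isCompact isCompact_Icc
      (subset_closure.trans hts)) (hts.trans fun t ht =>
        ⟨(hKT ha₁).1.trans_le ht.1, ht.2.trans_lt (hKT hb₁).2⟩)
    rw [hχd'] at h5
    have e : ∀ t, η₁ t • k t = η t • k t - I • η₀ t • k t := by
      intro t
      rw [hη₁, sub_smul, mul_smul]
    simp only [e] at h5
    have hkI : IntegrableOn (fun t => I • η₀ t • k t) (Icc 0 T) :=
      (hki η₀ hη₀c.continuous).smul I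
    rw [integral_sub (hki η h1.continuous) hkI, integral_smul,
      sub_eq_zero] at h5
    exact h5
  have hae : ∀ᵐ t, t ∈ Ioo 0 T → k t - c = 0 := by
    refine isOpen_Ioo.ae_eq_zero_of_integral_contDiff_smul_eq_zero ?_ ?_
    · exact ((hk.mono Ioo_subset_Icc_self).sub continuousOn_const).locallyIntegrableOn
        measurableSet_Ioo
    · intro η h1 h2 h3
      have e : ∫ t, η t • (k t - c) = ∫ t in Icc 0 T, η t • (k t - c) := by
        refine (setIntegral_eq_integral_of_forall_compl_eq_zero fun t ht => ?_).symm
        rw [image_eq_zero_of_notMem_tsupport fun h => ht (Ioo_subset_Icc_self (h3 h)), zero_smul]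
      rw [e]
      simp only [smul_sub]
      have h4 : IntegrableOn (fun t => η t • c) (Icc 0 T) :=
        (h1.continuous.smul continuous_const).integrableOn_Icc
      rw [integral_sub (hki η h1.continuous) h4, key η h1 h2 h3, integral_smul_const,
        hIcc η h3, sub_self]
  have hEq : EqOn k (fun _ => c) (Icc 0 T) := by
    refine Measure.eqOn_Icc_of_ae_eq volume hT.ne ?_ hk continuousOn_const
    rw [← restrict_Ioo_eq_restrict_Icc]
    refine (ae_restrict_iff' measurableSet_Ioo).2 ?_
    filter_upwards [hae] with t ht h1
    exact sub_eq_zero.1 (ht h1)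
  have hc0 : c = 0 := by rw [← h0, hEq ⟨le_rfl, hT.le⟩]
  intro t ht
  rw [hEq ht, hc0]

/-- The product of a function of time and a function of space. -/
def prodFn (χ : ℝ → ℝ) (ρ : E3 → ℂ) (z : ℝ × E3) : ℂ := (χ z.1 : ℂ) * ρ z.2

theorem isBump_prodFn {χ : ℝ → ℝ} {ρ : E3 → ℂ} (h1 : ContDiff ℝ ∞ χ) (h2 : HasCompactSupport χ)
    (h3 : ContDiff ℝ ∞ ρ) (h4 : HasCompactSupport ρ) : IsBump (prodFn χ ρ) := by
  refine ⟨(Complex.ofRealCLM.contDiff.comp (h1.comp contDiff_fst)).mul (h3.comp contDiff_snd), ?_⟩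
  refine HasCompactSupport.intro (h2.isCompact.prod h4.isCompact) fun z hz => ?_
  unfold prodFn
  by_cases h : z.1 ∈ tsupport χ
  · rw [image_eq_zero_of_notMem_tsupport (f := ρ) fun h5 => hz ⟨h, h5⟩, mul_zero]
  · rw [image_eq_zero_of_notMem_tsupport h, Complex.ofReal_zero, zero_mul]

theorem tsupport_prodFn_subset {χ : ℝ → ℝ} {ρ : E3 → ℂ} {S : Set ℝ} (h : tsupport χ ⊆ S) :
    tsupport (prodFn χ ρ) ⊆ S ×ˢ univ := by
  refine (closure_minimal (t := tsupport χ ×ˢ univ) (fun z hz => ?_)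
    ((isClosed_tsupport χ).prod isClosed_univ)).trans (prod_mono h subset_rfl)
  refine ⟨?_, mem_univ _⟩
  by_contra h1
  refine hz ?_
  unfold prodFn
  rw [image_eq_zero_of_notMem_tsupport h1, Complex.ofReal_zero, zero_mul]

theorem dir_eT_prodFn {χ : ℝ → ℝ} {ρ : E3 → ℂ} (h1 : ContDiff ℝ ∞ χ) (h : IsBump (prodFn χ ρ)) :
    dir eT (prodFn χ ρ) = prodFn (deriv χ) ρ := by
  ext ⟨t, x⟩
  have e := h.hasDerivAt_time t x
  have e2 : HasDerivAt (fun s => prodFn χ ρ (s, x)) (prodFn (deriv χ) ρ (t, x)) t :=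
    ((h1.differentiable (by simp) t).hasDerivAt.ofReal_comp).mul_const (ρ x)
  exact e.unique e2

theorem dir_eX_prodFn {χ : ℝ → ℝ} {ρ : E3 → ℂ} (h3 : ContDiff ℝ ∞ ρ) (h : IsBump (prodFn χ ρ))
    (j : Fin 3) : dir (eX j) (prodFn χ ρ) =
      prodFn χ fun x => fderiv ℝ ρ x (EuclideanSpace.single j 1) := by
  ext ⟨t, x⟩
  rw [← fderiv_slice h]
  change fderiv ℝ (fun y => (χ t : ℂ) * ρ y) x _ = _
  rw [fderiv_const_mul (h3.differentiable (by simp) x)]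
  rfl

theorem lapFn_prodFn {χ : ℝ → ℝ} {ρ : E3 → ℂ} (h1 : ContDiff ℝ ∞ χ) (h2 : HasCompactSupport χ)
    (h3 : ContDiff ℝ ∞ ρ) (h4 : HasCompactSupport ρ) :
    lapFn (prodFn χ ρ) = prodFn χ fun x => ∑ j, fderiv ℝ (fun y => fderiv ℝ ρ y
      (EuclideanSpace.single j 1)) x (EuclideanSpace.single j 1) := by
  ext z
  have h5 : ∀ j : Fin 3, ContDiff ℝ ∞ fun y => fderiv ℝ ρ y (EuclideanSpace.single j 1) :=
    fun j => (h3.fderiv_right (m := ∞) (by simp)).clm_apply contDiff_const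
  have h6 : ∀ j : Fin 3, HasCompactSupport fun y => fderiv ℝ ρ y (EuclideanSpace.single j 1) :=
    fun j => h4.fderiv_apply (𝕜 := ℝ) _
  have h7 : ∀ j, dir (eX j) (dir (eX j) (prodFn χ ρ)) z = (χ z.1 : ℂ) * fderiv ℝ (fun y =>
      fderiv ℝ ρ y (EuclideanSpace.single j 1)) z.2 (EuclideanSpace.single j 1) := by
    intro j
    rw [dir_eX_prodFn h3 (isBump_prodFn h1 h2 h3 h4),
      dir_eX_prodFn (h5 j) (isBump_prodFn h1 h2 (h5 j) (h6 j))]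
    rfl
  unfold lapFn
  simp only [h7]
  rw [← Finset.mul_sum]
  rfl

theorem slice_prodFn {χ χ₀ : ℝ → ℝ} {ρ : E3 → ℂ} (h : IsBump (prodFn χ ρ))
    (h₀ : IsBump (prodFn χ₀ ρ)) {t₀ : ℝ} (ht₀ : χ₀ t₀ = 1) (t : ℝ) :
    slice (prodFn χ ρ) t = χ t • slice (prodFn χ₀ ρ) t₀ := by
  refine Lp.ext ?_
  filter_upwards [h.slice_ae t, h₀.slice_ae t₀, Lp.coeFn_smul (χ t) (slice (prodFn χ₀ ρ) t₀)]
    with x h1 h2 h3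
  rw [h1, h3, Pi.smul_apply, h2]
  simp [prodFn, ht₀]

theorem integral_inner_real_smul {T : ℝ} {χ : ℝ → ℝ} (P : L2) {u : ℝ → L2}
    (hu : IntegrableOn (fun t => χ t • u t) (Icc 0 T)) :
    ∫ t in Icc 0 T, inner ℂ (χ t • P) (u t) = inner ℂ P (∫ t in Icc 0 T, χ t • u t) := by
  rw [← integral_inner hu]
  refine integral_congr_ae (ae_of_all _ fun t => ?_)
  beta_reduce
  rw [inner_smul_left_eq_smul, inner_smul_right_eq_smul]

/-- The symbol `κ²` on a band. -/
def bandLap (n : ℕ) (ξ : E3) : ℂ := band n ξ * (kap ξ : ℂ) ^ 2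

theorem symb_bandLap (n : ℕ) : Symb (bandLap n) := by
  refine ⟨?_, ((n : ℝ) + 1) ^ 2, fun ξ => ?_⟩
  · have := continuous_kap.measurable
    have := measurable_band n
    unfold bandLap
    fun_prop
  · unfold bandLap
    by_cases h : ξ ∈ bandSet n
    · rw [band_of_mem h, one_mul, norm_pow, Complex.norm_real, Real.norm_of_nonneg (kap_nonneg ξ)]
      exact pow_le_pow_left₀ (kap_nonneg ξ) h.2 2
    · rw [band_of_notMem h, zero_mul, norm_zero]
      positivity

/-- Test functions `χ(t)ρ(x)` separate the variables: the time integrals `U` of `χ u` and `W` of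
`χ'' u` satisfy `W = ΔU` weakly in space, hence on the Fourier side. -/
theorem weak_time_equation {T : ℝ} {u : ℝ → L2} (hu : ContinuousOn u (Icc 0 T))
    (hw : ∀ φ, IsBump φ → tsupport φ ⊆ Ioo 0 T ×ˢ univ →
      ∫ t in Icc 0 T, inner ℂ (slice (waveFn φ) t) (u t) = 0)
    {χ : ℝ → ℝ} (h1 : ContDiff ℝ ∞ χ) (h2 : HasCompactSupport χ) (h3 : tsupport χ ⊆ Ioo 0 T)
    (n : ℕ) : fmul (band n) (∫ t in Icc 0 T, deriv (deriv χ) t • u t) +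
      fmul (bandLap n) (∫ t in Icc 0 T, χ t • u t) = 0 := by
  set U : L2 := ∫ t in Icc 0 T, χ t • u t with hU
  set W : L2 := ∫ t in Icc 0 T, deriv (deriv χ) t • u t with hW
  have hχ' : ContDiff ℝ ∞ (deriv χ) := (contDiff_infty_iff_deriv.1 h1).2
  have hχ'' : ContDiff ℝ ∞ (deriv (deriv χ)) := (contDiff_infty_iff_deriv.1 hχ').2
  have hui : IntegrableOn (fun t => χ t • u t) (Icc 0 T) :=
    (h1.continuous.continuousOn.smul hu).integrableOn_compact isCompact_Icc
  have hwi : IntegrableOn (fun t => deriv (deriv χ) t • u t) (Icc 0 T) :=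
    (hχ''.continuous.continuousOn.smul hu).integrableOn_compact isCompact_Icc
  -- A bump equal to 1 at time `0` presents the spatial function `ρ` as a time slice, so the results
  -- on slices apply to it.
  set b : ContDiffBump (0 : ℝ) := ⟨1, 2, by norm_num, by norm_num⟩ with hb
  have hb1 : b 0 = 1 := b.one_of_mem_closedBall (Metric.mem_closedBall_self (by norm_num))
  have hF : ((𝓕 W : L2) : E3 → ℂ) =ᵐ[volume] fun ξ => -(kap ξ : ℂ) ^ 2 * (𝓕 U : L2) ξ := by
    refine fourier_eq_of_weak fun ρ hρ1 hρ2 => ?_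
    have hB0 := isBump_prodFn b.contDiff b.hasCompactSupport hρ1 hρ2
    have hB := isBump_prodFn h1 h2 hρ1 hρ2
    refine ⟨slice (prodFn b ρ) 0, slice (lapFn (prodFn b ρ)) 0, ?_, fourier_slice_lapFn hB0 0, ?_⟩
    · filter_upwards [hB0.slice_ae 0] with x hx
      rw [hx]
      simp [prodFn, hb1]
    · have h5 := hw _ hB (tsupport_prodFn_subset h3)
      have e1 : ∀ t, slice (dir eT (dir eT (prodFn χ ρ))) t =
          deriv (deriv χ) t • slice (prodFn b ρ) 0 := by
        intro t
        have h6 : IsBump (prodFn (deriv χ) ρ) := isBump_prodFn hχ' h2.deriv hρ1 hρ2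
        rw [dir_eT_prodFn h1 hB, dir_eT_prodFn hχ' h6]
        exact slice_prodFn (isBump_prodFn hχ'' h2.deriv.deriv hρ1 hρ2) hB0 hb1 t
      have e2 : ∀ t, slice (lapFn (prodFn χ ρ)) t = χ t • slice (lapFn (prodFn b ρ)) 0 := by
        intro t
        have h6 := isBump_lapFn hB
        have h7 := isBump_lapFn hB0
        rw [lapFn_prodFn h1 h2 hρ1 hρ2] at h6 ⊢
        rw [lapFn_prodFn b.contDiff b.hasCompactSupport hρ1 hρ2] at h7 ⊢
        exact slice_prodFn h6 h7 hb1 t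
      have hi1 : IntegrableOn (fun t => inner ℂ (deriv (deriv χ) t • slice (prodFn b ρ) 0) (u t))
          (Icc 0 T) :=
        ((hχ''.continuous.smul continuous_const).continuousOn.inner hu).integrableOn_compact
          isCompact_Icc
      have hi2 : IntegrableOn (fun t => inner ℂ (χ t • slice (lapFn (prodFn b ρ)) 0) (u t))
          (Icc 0 T) :=
        ((h1.continuous.smul continuous_const).continuousOn.inner hu).integrableOn_compact
          isCompact_Icc
      simp only [slice_waveFn hB, e1, e2, inner_add_left, inner_neg_left] at h5
      have hi1n : IntegrableOn (fun t => -inner ℂ (deriv (deriv χ) t • slice (prodFn b ρ) 0) (u t))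
          (Icc 0 T) := hi1.neg
      rw [integral_add hi1n hi2, integral_neg, integral_inner_real_smul _ hwi,
        integral_inner_real_smul _ hui, neg_add_eq_zero] at h5
      exact h5
  have e : fmul (band n) W = fmul (fun ξ => (-1 : ℂ) * bandLap n ξ) U := by
    have hneg : Symb (fun ξ => (-1 : ℂ) * bandLap n ξ) :=
      Symb.mul (m := fun _ => (-1 : ℂ)) ⟨measurable_const, 1, fun _ => by simp⟩ (symb_bandLap n)
    apply L2_ext_fourier
    filter_upwards [fmul_ae (symb_band n) W, fmul_ae hneg U, hF] with ξ h6 h7 h8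
    rw [h6, h7, h8]
    unfold bandLap
    ring
  rw [e, fmul_const_mul_symb (symb_bandLap n), neg_one_smul, neg_add_cancel]

theorem fmul_bandLap_band (n : ℕ) (f : L2) :
    fmul (bandLap n) (fmul (band n) f) = fmul (bandLap n) f := by
  rw [fmul_fmul (symb_bandLap n) (symb_band n)]
  congr 2
  ext ξ
  have := band_mul_band (le_refl n) ξ
  unfold bandLap
  linear_combination (kap ξ : ℂ) ^ 2 * this

/-- After projection to a band, `-Δ` becomes a bounded operator `A` and the weak equation is `y'' =
-A y` in distributions. Du Bois-Reymond turns this into `y' = -∫₀ᵗ A y` pointwise, and Grönwall with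
zero data gives `y = 0`. Letting the band grow gives `u = 0`. -/
theorem weak_unique {T : ℝ} (hT : 0 < T) {u z : ℝ → L2} (hu : ContinuousOn u (Icc 0 T))
    (hz : ContinuousOn z (Icc 0 T))
    (hd : ∀ t ∈ Icc 0 T, HasDerivWithinAt u (z t) (Icc 0 T) t) (hu0 : u 0 = 0) (hz0 : z 0 = 0)
    (hw : ∀ φ, IsBump φ → tsupport φ ⊆ Ioo 0 T ×ˢ univ →
      ∫ t in Icc 0 T, inner ℂ (slice (waveFn φ) t) (u t) = 0) :
    ∀ t ∈ Icc 0 T, u t = 0 := by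
  suffices h : ∀ n, ∀ t ∈ Icc 0 T, fmul (band n) (u t) = 0 by
    intro t ht
    have h1 := tendsto_fmul_band (u t)
    simp only [fun n => h n t ht] at h1
    exact tendsto_nhds_unique h1 tendsto_const_nhds |>.symm ▸ rfl
  intro n
  set A : L2 →L[ℂ] L2 := fmul (bandLap n) with hA
  set y : ℝ → L2 := fun t => fmul (band n) (u t) with hy
  set y' : ℝ → L2 := fun t => fmul (band n) (z t) with hy'
  have hyc : ContinuousOn y (Icc 0 T) := (fmul (band n)).continuous.comp_continuousOn hu
  have hy'c : ContinuousOn y' (Icc 0 T) := (fmul (band n)).continuous.comp_continuousOn hz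
  have hyd : ∀ t ∈ Icc 0 T, HasDerivWithinAt y (y' t) (Icc 0 T) t := fun t ht =>
    ((fmul (band n)).restrictScalars ℝ).hasFDerivAt.comp_hasDerivWithinAt t (hd t ht)
  have hAyc : ContinuousOn (fun t => A (y t)) (Icc 0 T) := A.continuous.comp_continuousOn hyc
  set E : ℝ → L2 := fun t => ∫ s in (0 : ℝ)..t, A (y s) with hE
  have hAyi : IntervalIntegrable (fun t => A (y t)) volume 0 T :=
    ContinuousOn.intervalIntegrable (by rwa [uIcc_of_le hT.le])
  have hEd : ∀ t ∈ Icc 0 T, HasDerivWithinAt E (A (y t)) (Icc 0 T) t := by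
    intro t ht
    have : Fact (t ∈ Icc 0 T) := ⟨ht⟩
    refine intervalIntegral.integral_hasDerivWithinAt_right ?_ ?_ (hAyc t ht)
    · refine hAyi.mono_set ?_
      rw [uIcc_of_le hT.le, uIcc_of_le ht.1]
      exact Icc_subset_Icc_right ht.2
    · exact hAyc.stronglyMeasurableAtFilter_nhdsWithin measurableSet_Icc t
  have hEc : ContinuousOn E (Icc 0 T) := fun t ht => (hEd t ht).continuousWithinAt
  have hk0 : y' 0 + E 0 = 0 := by
    simp [hy', hE, hz0]
  have hk := eqOn_zero_of_integral_deriv_smul hT (k := fun t => y' t + E t) (hy'c.add hEc) hk0 ?_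
  · have hmem : ∀ t ∈ Ico 0 T, Icc 0 T ∈ 𝓝[Ici t] t := fun t ht => Icc_mem_nhdsGE_of_mem ht
    have hyz : ∀ t ∈ Icc 0 T, y' t = -E t := fun t ht => eq_neg_of_add_eq_zero_left (hk t ht)
    -- The second-order equation as a first-order system for `(y, y') = (y, -E)`; the norm of its
    -- derivative is at most `1 + ‖A‖` times its norm.
    have hpair := eq_zero_of_abs_deriv_le_mul_abs_self_of_eq_zero_right
      (f := fun t => (y t, -E t)) (f' := fun t => (-E t, -A (y t))) (K := 1 + ‖A‖) (a := 0) (b := T)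
      (hyc.prodMk hEc.neg) (fun t ht => by
        have ht' := Ico_subset_Icc_self ht
        have h1 := hyd t ht'
        rw [hyz t ht'] at h1
        exact (h1.prodMk (hEd t ht').neg).mono_of_mem_nhdsWithin (hmem t ht))
      (by simp [hy, hE, hu0]) (fun t _ => by
        rw [Prod.norm_def, Prod.norm_def]
        have h0 : 0 ≤ ‖A‖ := norm_nonneg _
        have h1 := le_max_left ‖y t‖ ‖-E t‖
        have h2 := le_max_right ‖y t‖ ‖-E t‖
        have h3 := A.le_opNorm (y t)
        refine max_le ?_ ?_
        · simp only
          nlinarith [norm_nonneg (-E t)]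
        · simp only
          rw [norm_neg]
          nlinarith [norm_nonneg (y t), norm_nonneg (-E t)])
    intro t ht
    exact congrArg Prod.fst (hpair t ht)
  · intro χ h1 h2 h3
    have hχ' : ContDiff ℝ ∞ (deriv χ) := (contDiff_infty_iff_deriv.1 h1).2
    have hχ'' : ContDiff ℝ ∞ (deriv (deriv χ)) := (contDiff_infty_iff_deriv.1 hχ').2
    have h5 := weak_time_equation hu hw h1 h2 h3 n
    have hui : IntegrableOn (fun t => χ t • u t) (Icc 0 T) :=
      (h1.continuous.continuousOn.smul hu).integrableOn_compact isCompact_Icc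
    have hwi : IntegrableOn (fun t => deriv (deriv χ) t • u t) (Icc 0 T) :=
      (hχ''.continuous.continuousOn.smul hu).integrableOn_compact isCompact_Icc
    have e1 : ∀ t, (fmul (band n)) (deriv (deriv χ) t • u t) = deriv (deriv χ) t • y t := fun t =>
      ContinuousLinearMap.map_smul_of_tower _ _ _
    have e2 : ∀ t, A (χ t • u t) = χ t • A (y t) := fun t => by
      rw [ContinuousLinearMap.map_smul_of_tower, hy, hA]
      beta_reduce
      rw [fmul_bandLap_band]
    rw [← ContinuousLinearMap.integral_comp_comm _ hwi, ← ContinuousLinearMap.integral_comp_comm _ hui]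
      at h5
    simp only [← hA, e1, e2] at h5
    have hi1 : IntegrableOn (fun t => deriv (deriv χ) t • y t) (Icc 0 T) :=
      (hχ''.continuous.continuousOn.smul hyc).integrableOn_compact isCompact_Icc
    have hi2 : IntegrableOn (fun t => χ t • A (y t)) (Icc 0 T) :=
      (h1.continuous.continuousOn.smul hAyc).integrableOn_compact isCompact_Icc
    have hi3 : IntegrableOn (fun t => deriv χ t • (y' t + E t)) (Icc 0 T) :=
      (hχ'.continuous.continuousOn.smul (hy'c.add hEc)).integrableOn_compact isCompact_Icc
    have hi4 : IntegrableOn (fun t => (deriv (deriv χ) t • y t + χ t • A (y t)) +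
        deriv χ t • (y' t + E t)) (Icc 0 T) := (hi1.add hi2).add hi3
    have hi12 : IntegrableOn (fun t => deriv (deriv χ) t • y t + χ t • A (y t)) (Icc 0 T) :=
      hi1.add hi2
    -- The integrand is the derivative of `χ' y + χ E`, which vanishes at both endpoints. Two of its
    -- terms cancel by the weak equation, and the rest is the identity required by du Bois-Reymond.
    have h6 : ∫ t in Icc 0 T, ((deriv (deriv χ) t • y t + χ t • A (y t)) +
        deriv χ t • (y' t + E t)) = 0 := by
      have hz1 : ∀ t, t ∉ Ioo 0 T → χ t = 0 := fun t ht =>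
        image_eq_zero_of_notMem_tsupport fun h => ht (h3 h)
      have hz2 : ∀ t, t ∉ Ioo 0 T → deriv χ t = 0 := fun t ht =>
        image_eq_zero_of_notMem_tsupport fun h => ht (h3 (tsupport_deriv_subset h))
      have hn0 : (0 : ℝ) ∉ Ioo 0 T := fun h => lt_irrefl _ h.1
      have hnT : T ∉ Ioo 0 T := fun h => lt_irrefl _ h.2
      rw [integral_Icc_eq_integral_Ioc, ← intervalIntegral.integral_of_le hT.le]
      rw [intervalIntegral.integral_eq_sub_of_hasDerivAt_of_le (f := fun t =>
        deriv χ t • y t + χ t • E t) hT.le]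
      · rw [hz1 0 hn0, hz1 T hnT, hz2 0 hn0, hz2 T hnT]
        simp
      · exact (hχ'.continuous.continuousOn.smul hyc).add (h1.continuous.continuousOn.smul hEc)
      · intro t ht
        have hnt : Icc 0 T ∈ 𝓝 t := Icc_mem_nhds ht.1 ht.2
        have ht' := Ioo_subset_Icc_self ht
        have d1 := (hχ'.differentiable (by simp) t).hasDerivAt.smul ((hyd t ht').hasDerivAt hnt)
        have d2 := (h1.differentiable (by simp) t).hasDerivAt.smul ((hEd t ht').hasDerivAt hnt)
        refine (d1.add d2).congr_deriv ?_
        rw [smul_add]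
        abel
      · rw [intervalIntegrable_iff_integrableOn_Icc_of_le hT.le]
        exact hi4
    rw [integral_add hi12 hi3, integral_add hi1 hi2, h5, zero_add] at h6
    exact h6

end ForcedNLW

end

/-! ### The distributional equation as an identity of `L²` pairings -/

noncomputable section

namespace ForcedNLW

open Filter Topology FourierTransform

/-- The complex conjugate of a function on space-time. -/
def conjFn (φ : ℝ × E3 → ℂ) (z : ℝ × E3) : ℂ := starRingEnd ℂ (φ z)

theorem conjFn_conjFn (φ : ℝ × E3 → ℂ) : conjFn (conjFn φ) = φ := by
  ext z
  simp [conjFn]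

theorem IsBump.conj {φ : ℝ × E3 → ℂ} (hφ : IsBump φ) : IsBump (conjFn φ) :=
  ⟨Complex.conjCLE.contDiff.comp hφ.smooth, hφ.compact.comp_left (map_zero _)⟩

theorem tsupport_conjFn (φ : ℝ × E3 → ℂ) : tsupport (conjFn φ) = tsupport φ := by
  unfold tsupport
  congr 1
  ext z
  simp [conjFn]

theorem dir_conjFn (v : ℝ × E3) (φ : ℝ × E3 → ℂ) : dir v (conjFn φ) = conjFn (dir v φ) := by
  ext z
  have h := Complex.conjCLE.comp_fderiv (f := φ) (x := z)
  have h2 : fderiv ℝ (conjFn φ) z =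
      (Complex.conjCLE : ℂ →L[ℝ] ℂ).comp (fderiv ℝ φ z) := h
  simp only [dir, conjFn] at h2 ⊢
  rw [h2]
  rfl

theorem waveFn_conjFn (φ : ℝ × E3 → ℂ) : waveFn (conjFn φ) = conjFn (waveFn φ) := by
  ext z
  simp only [waveFn, lapFn, dir_conjFn]
  simp [conjFn, waveFn, lapFn]

theorem integral_mul_bump {φ : ℝ × E3 → ℂ} (hφ : IsBump φ) (t : ℝ) (u : L2) :
    ∫ x : E3, u x * φ (t, x) = inner ℂ (slice (conjFn φ) t) u := by
  rw [inner_L2_eq]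
  refine integral_congr_ae ?_
  filter_upwards [hφ.conj.slice_ae t] with x hx
  rw [hx, conjFn, Complex.conj_conj, mul_comm]

theorem integral_mul_waveOp {φ : ℝ × E3 → ℂ} (hφ : IsBump φ) (t : ℝ) (u : L2) :
    ∫ x : E3, u x * waveOp φ t x = inner ℂ (slice (waveFn (conjFn φ)) t) u := by
  simp_rw [waveOp_eq hφ]
  rw [integral_mul_bump (isBump_waveFn hφ), waveFn_conjFn]

/-- The distributional pairing is bilinear and the inner product conjugates its first entry;
conjugation is a bijection of the test functions commuting with the real operator `-∂ₜ² + Δ`. The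
representative `V` in `L^{2p}` places the nonlinear term in `L²`. -/
theorem weak_equation_iff {p : ℝ} [Fact (3 < p)] {T : ℝ} {F V : ℝ → LpX (xExp p)} {u : ℝ → L2}
    (hV : ∀ᵐ t ∂(volume.restrict (Icc 0 T)), (V t : E3 → ℂ) =ᵐ[volume] (u t : E3 → ℂ)) :
    (∀ φ : ℝ × E3 → ℂ, IsTest T φ →
      ∫ t in Ioo 0 T, ∫ x : E3, (u t : E3 → ℂ) x * waveOp φ t x =
        ∫ t in Ioo 0 T, ∫ x : E3, nonlin p ((F t : E3 → ℂ) x + (u t : E3 → ℂ) x) * φ (t, x)) ↔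
    ∀ ψ : ℝ × E3 → ℂ, IsBump ψ → tsupport ψ ⊆ Ioo 0 T ×ˢ univ →
      ∫ t in Icc 0 T, inner ℂ (slice (waveFn ψ) t) (u t) =
        ∫ t in Icc 0 T, inner ℂ (slice ψ t) (Nl p (F t + V t)) := by
  have key : ∀ φ : ℝ × E3 → ℂ, IsBump φ →
      (∫ t in Ioo 0 T, ∫ x : E3, (u t : E3 → ℂ) x * waveOp φ t x) =
        ∫ t in Icc 0 T, inner ℂ (slice (waveFn (conjFn φ)) t) (u t) := by
    intro φ hφ
    rw [integral_Icc_eq_integral_Ioo]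
    simp_rw [integral_mul_waveOp hφ]
  have key2 : ∀ φ : ℝ × E3 → ℂ, IsBump φ →
      (∫ t in Ioo 0 T, ∫ x : E3, nonlin p ((F t : E3 → ℂ) x + (u t : E3 → ℂ) x) * φ (t, x)) =
        ∫ t in Icc 0 T, inner ℂ (slice (conjFn φ) t) (Nl p (F t + V t)) := by
    intro φ hφ
    rw [← integral_Icc_eq_integral_Ioo]
    refine integral_congr_ae ?_
    filter_upwards [hV] with t ht
    rw [← integral_mul_bump hφ]
    refine integral_congr_ae ?_
    filter_upwards [ht, Nl_ae p (F t + V t), Lp.coeFn_add (F t) (V t)] with x h1 h2 h3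
    rw [h2, h3, Pi.add_apply, h1]
  constructor
  · intro h ψ hψ hs
    have h1 := h (conjFn ψ) ⟨hψ.conj.smooth, hψ.conj.compact, by rwa [tsupport_conjFn]⟩
    rwa [key _ hψ.conj, key2 _ hψ.conj, conjFn_conjFn] at h1
  · intro h φ hφ
    have hb : IsBump φ := ⟨hφ.smooth, hφ.compact⟩
    rw [key φ hb, key2 φ hb]
    exact h _ hb.conj (by rw [tsupport_conjFn]; exact hφ.supp)

end ForcedNLW

end

/-! ### Hölder in time for the nonlinearity -/

noncomputable section

namespace ForcedNLW

open Filter Topology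

section Holder

variable {α : Type*} [MeasurableSpace α] {μ : Measure α} {E₁ E₂ : Type*} [NormedAddCommGroup E₁]
  [NormedAddCommGroup E₂]

/-- Hölder with exponents `p/(p-1)` and `p`, followed by the inclusion of `L^q` in `L^p`. The latter
is used with total power `p` and costs `μ(univ)^{1/p - 1/q}` each time. -/
theorem lintegral_rpow_mul_le {p q : ℝ} (hp : 1 < p) (hpq : p ≤ q) {f : α → E₁} {g : α → E₂}
    (hf : AEStronglyMeasurable f μ) (hg : AEStronglyMeasurable g μ) :
    ∫⁻ a, ‖f a‖ₑ ^ (p - 1) * ‖g a‖ₑ ∂μ ≤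
      μ univ ^ (1 - p / q) *
        (eLpNorm f (ENNReal.ofReal q) μ ^ (p - 1) * eLpNorm g (ENNReal.ofReal q) μ) := by
  have hp0 : 0 < p := by linarith
  have hq0 : 0 < q := by linarith
  have hp1 : 0 < p - 1 := by linarith
  have hof : ENNReal.ofReal p ≠ 0 := by simpa using hp0
  have hconj : (p / (p - 1)).HolderConjugate p :=
    (Real.HolderConjugate.conjExponent hp).symm
  have h1 := ENNReal.lintegral_mul_le_Lp_mul_Lq μ hconj (hf.enorm.pow_const (p - 1)) hg.enorm
  have e1 : (∫⁻ a, (‖f a‖ₑ ^ (p - 1)) ^ (p / (p - 1)) ∂μ) ^ (1 / (p / (p - 1))) =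
      eLpNorm f (ENNReal.ofReal p) μ ^ (p - 1) := by
    rw [eLpNorm_eq_lintegral_rpow_enorm_toReal hof ENNReal.ofReal_ne_top,
      ENNReal.toReal_ofReal hp0.le, ← ENNReal.rpow_mul]
    simp_rw [← ENNReal.rpow_mul]
    rw [mul_div_cancel₀ p hp1.ne', one_div_div, one_div, inv_mul_eq_div]
  have e2 : (∫⁻ a, ‖g a‖ₑ ^ p ∂μ) ^ (1 / p) = eLpNorm g (ENNReal.ofReal p) μ := by
    rw [eLpNorm_eq_lintegral_rpow_enorm_toReal hof ENNReal.ofReal_ne_top,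
      ENNReal.toReal_ofReal hp0.le]
  have hle : ENNReal.ofReal p ≤ ENNReal.ofReal q := ENNReal.ofReal_le_ofReal hpq
  have hf2 := eLpNorm_le_eLpNorm_mul_rpow_measure_univ hle hf
  have hg2 := eLpNorm_le_eLpNorm_mul_rpow_measure_univ hle hg
  rw [ENNReal.toReal_ofReal hp0.le, ENNReal.toReal_ofReal hq0.le] at hf2 hg2
  have hexp : 0 ≤ 1 / p - 1 / q := sub_nonneg.2 (one_div_le_one_div_of_le hp0 hpq)
  calc ∫⁻ a, ‖f a‖ₑ ^ (p - 1) * ‖g a‖ₑ ∂μ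
      ≤ eLpNorm f (ENNReal.ofReal p) μ ^ (p - 1) * eLpNorm g (ENNReal.ofReal p) μ := by
        rw [← e1, ← e2]
        exact h1
    _ ≤ (eLpNorm f (ENNReal.ofReal q) μ * μ univ ^ (1 / p - 1 / q)) ^ (p - 1) *
        (eLpNorm g (ENNReal.ofReal q) μ * μ univ ^ (1 / p - 1 / q)) := by
        gcongr
    _ = μ univ ^ (1 - p / q) *
        (eLpNorm f (ENNReal.ofReal q) μ ^ (p - 1) * eLpNorm g (ENNReal.ofReal q) μ) := by
        rw [ENNReal.mul_rpow_of_nonneg _ _ hp1.le, ← ENNReal.rpow_mul]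
        have e3 : (1 : ℝ) - p / q = (1 / p - 1 / q) * (p - 1) + (1 / p - 1 / q) := by
          field_simp
          ring
        rw [e3, ENNReal.rpow_add_of_nonneg _ _ (mul_nonneg hexp hp1.le) hexp]
        ring

theorem integrable_and_integral_le_of_rpow_mul [IsFiniteMeasure μ] {E₃ : Type*}
    [NormedAddCommGroup E₃] {p q : ℝ} (hp : 1 < p) (hpq : p ≤ q) {f : α → E₁} {g : α → E₂}
    {h : α → E₃} {A : ℝ} (hA : 0 ≤ A)
    (hf : MemLp f (ENNReal.ofReal q) μ) (hg : MemLp g (ENNReal.ofReal q) μ)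
    (hh : AEStronglyMeasurable h μ)
    (hle : ∀ a, ‖h a‖ ≤ A * (‖f a‖ ^ (p - 1) * ‖g a‖)) :
    Integrable h μ ∧ ∫ a, ‖h a‖ ∂μ ≤ A * (μ.real univ ^ (1 - p / q) *
      ((eLpNorm f (ENNReal.ofReal q) μ).toReal ^ (p - 1) *
        (eLpNorm g (ENNReal.ofReal q) μ).toReal)) := by
  have hp1 : 0 ≤ p - 1 := by linarith
  have hexp : 0 ≤ 1 - p / q := sub_nonneg.2 ((div_le_one (by linarith)).2 hpq)
  have h1 : ∫⁻ a, ‖h a‖ₑ ∂μ ≤ ENNReal.ofReal A * (μ univ ^ (1 - p / q) *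
      (eLpNorm f (ENNReal.ofReal q) μ ^ (p - 1) * eLpNorm g (ENNReal.ofReal q) μ)) := by
    refine le_trans ?_ (mul_le_mul_right (lintegral_rpow_mul_le hp hpq hf.1 hg.1) _)
    rw [← lintegral_const_mul' _ _ ENNReal.ofReal_ne_top]
    refine lintegral_mono fun a => ?_
    rw [← ofReal_norm, ← ofReal_norm, ← ofReal_norm,
      ENNReal.ofReal_rpow_of_nonneg (norm_nonneg _) hp1,
      ← ENNReal.ofReal_mul (Real.rpow_nonneg (norm_nonneg _) _), ← ENNReal.ofReal_mul hA]
    exact ENNReal.ofReal_le_ofReal (hle a)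
  have hfin : ENNReal.ofReal A * (μ univ ^ (1 - p / q) *
      (eLpNorm f (ENNReal.ofReal q) μ ^ (p - 1) * eLpNorm g (ENNReal.ofReal q) μ)) ≠ ⊤ :=
    ENNReal.mul_ne_top ENNReal.ofReal_ne_top (ENNReal.mul_ne_top
      (ENNReal.rpow_ne_top_of_nonneg hexp (measure_ne_top _ _))
      (ENNReal.mul_ne_top (ENNReal.rpow_ne_top_of_nonneg hp1 hf.2.ne) hg.2.ne))
  refine ⟨⟨hh, lt_of_le_of_lt h1 hfin.lt_top⟩, ?_⟩
  rw [integral_norm_eq_lintegral_enorm hh]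
  refine (ENNReal.toReal_mono hfin h1).trans_eq ?_
  rw [ENNReal.toReal_mul, ENNReal.toReal_mul, ENNReal.toReal_mul, ENNReal.toReal_ofReal hA,
    ← ENNReal.toReal_rpow, ← ENNReal.toReal_rpow, Measure.real]

end Holder

/-- Subcriticality: `p ≤ q` amounts to `p ≤ 5`, so the time integrability available covers what the
power `p` needs. -/
theorem le_div_of_lt_five {p : ℝ} (h3 : 3 < p) (h5 : p < 5) : p ≤ 2 * p / (p - 3) := by
  rw [le_div_iff₀ (by linarith)]
  nlinarith

theorem one_sub_div_eq {p : ℝ} (h3 : 3 < p) : 1 - p / (2 * p / (p - 3)) = (5 - p) / 2 := by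
  have h : p ≠ 0 := by linarith
  have h' : p - 3 ≠ 0 := by linarith
  field_simp
  ring

section Nonlinear

variable {p : ℝ} [hp : Fact (3 < p)] {μ : Measure ℝ}

theorem aestronglyMeasurable_Nl {H : ℝ → LpX (xExp p)} (hH : AEStronglyMeasurable H μ) :
    AEStronglyMeasurable (fun t => Nl p (H t)) μ :=
  (continuous_Nl p).comp_aestronglyMeasurable hH

theorem integrable_Nl [IsFiniteMeasure μ] (hp5 : p < 5) {H : ℝ → LpX (xExp p)} (hH : MemLp H (tExp p) μ) :
    Integrable (fun t => Nl p (H t)) μ ∧ ∫ t, ‖Nl p (H t)‖ ∂μ ≤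
      μ.real univ ^ ((5 - p) / 2) * (eLpNorm H (tExp p) μ).toReal ^ p := by
  have h3 := hp.out
  have h := integrable_and_integral_le_of_rpow_mul (by linarith) (le_div_of_lt_five h3 hp5)
    zero_le_one hH hH (aestronglyMeasurable_Nl hH.1) fun a => by
      rw [norm_Nl, one_mul]
      refine le_of_eq ?_
      rw [← Real.rpow_add_one' (norm_nonneg _) (by linarith)]
      congr 1
      ring
  refine ⟨h.1, h.2.trans_eq ?_⟩
  rw [one_mul, one_sub_div_eq h3, ← Real.rpow_add_one' ENNReal.toReal_nonneg (by linarith)]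
  congr 2
  ring

theorem integral_norm_Nl_sub_le [IsFiniteMeasure μ] (hp5 : p < 5) {H₁ H₂ : ℝ → LpX (xExp p)}
    (hH₁ : MemLp H₁ (tExp p) μ) (hH₂ : MemLp H₂ (tExp p) μ) :
    ∫ t, ‖Nl p (H₁ t) - Nl p (H₂ t)‖ ∂μ ≤
      p * (μ.real univ ^ ((5 - p) / 2) *
        (((eLpNorm H₁ (tExp p) μ).toReal + (eLpNorm H₂ (tExp p) μ).toReal) ^ (p - 1) *
          (eLpNorm (H₁ - H₂) (tExp p) μ).toReal)) := by
  have h3 := hp.out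
  have hsum : MemLp (fun t => ‖H₁ t‖ + ‖H₂ t‖) (tExp p) μ := hH₁.norm.add hH₂.norm
  have h := (integrable_and_integral_le_of_rpow_mul (by linarith) (le_div_of_lt_five h3 hp5)
    (by linarith : (0 : ℝ) ≤ p) hsum (hH₁.sub hH₂)
    ((aestronglyMeasurable_Nl hH₁.1).sub (aestronglyMeasurable_Nl hH₂.1)) fun a => by
      have h1 := norm_Nl_sub_le p (H₁ a) (H₂ a)
      rwa [Real.norm_of_nonneg (add_nonneg (norm_nonneg _) (norm_nonneg _))]).2
  refine h.trans ?_
  rw [one_sub_div_eq h3]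
  have hle : (eLpNorm (fun t => ‖H₁ t‖ + ‖H₂ t‖) (tExp p) μ).toReal ≤
      (eLpNorm H₁ (tExp p) μ).toReal + (eLpNorm H₂ (tExp p) μ).toReal := by
    rw [← ENNReal.toReal_add hH₁.2.ne hH₂.2.ne]
    refine ENNReal.toReal_mono (ENNReal.add_ne_top.2 ⟨hH₁.2.ne, hH₂.2.ne⟩) ?_
    have h5 := eLpNorm_add_le hH₁.norm.1 hH₂.norm.1 (tExp_fact p).out
    rwa [eLpNorm_norm, eLpNorm_norm] at h5
  have h0 : 0 ≤ p := by linarith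
  have h01 : 0 ≤ p - 1 := by linarith
  gcongr

end Nonlinear

end ForcedNLW

end

/-! ### Mild solutions: existence by contraction and uniqueness -/

noncomputable section

namespace ForcedNLW

open Filter Topology

theorem duh_congr {K : ℝ → L2 →L[ℂ] L2} {G G' : ℝ → L2} {T t : ℝ} (ht : t ∈ Icc 0 T)
    (h : ∀ᵐ s ∂(volume.restrict (Icc 0 T)), G s = G' s) : duh K G t = duh K G' t := by
  have h2 : ∀ᵐ s ∂(volume.restrict (Icc 0 t)), G s = G' s :=
    ae_restrict_of_ae_restrict_of_subset (Icc_subset_Icc_right ht.2) h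
  refine integral_congr_ae ?_
  filter_upwards [h2] with s hs
  rw [hs]

theorem duh_sub {K : ℝ → L2 →L[ℂ] L2} (hK : ∀ x, Continuous fun t => K t x) {G G' : ℝ → L2}
    {t : ℝ} (hG : IntegrableOn G (Icc 0 t)) (hG' : IntegrableOn G' (Icc 0 t)) :
    duh K (fun s => G s - G' s) t = duh K G t - duh K G' t := by
  unfold duh
  simp only [map_sub]
  exact integral_sub (integrable_duh hK hG) (integrable_duh hK hG')

theorem toL2_linV_congr (v₁ : H1) (v₂ : L2) {G G' : ℝ → L2} {T t : ℝ} (ht : t ∈ Icc 0 T)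
    (hG : IntegrableOn G (Icc 0 T)) (h : ∀ᵐ s ∂(volume.restrict (Icc 0 T)), G s = G' s) :
    toL2 (linV v₁ v₂ G t) = toL2 (linV v₁ v₂ G' t) := by
  have hs : Icc 0 t ⊆ Icc 0 T := Icc_subset_Icc_right ht.2
  have hG' : IntegrableOn G' (Icc 0 T) := hG.congr h
  rw [toL2_linV v₁ v₂ (hG.mono_set hs), toL2_linV v₁ v₂ (hG'.mono_set hs), duh_congr ht h]

theorem toL2_linV_sub (v₁ : H1) (v₂ : L2) {G G' : ℝ → L2} {t : ℝ}
    (hG : IntegrableOn G (Icc 0 t)) (hG' : IntegrableOn G' (Icc 0 t)) :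
    toL2 (linV 0 0 (fun s => G s - G' s) t) =
      toL2 (linV v₁ v₂ G t) - toL2 (linV v₁ v₂ G' t) := by
  have hz : toL2 (0 : H1) = 0 := rfl
  have hi : IntegrableOn (fun s => G s - G' s) (Icc 0 t) := hG.sub hG'
  rw [toL2_linV v₁ v₂ hG, toL2_linV v₁ v₂ hG', toL2_linV 0 0 hi, duh_sub continuous_fmul_sin hG hG',
    hz, map_zero, map_zero]
  abel

/-- The curve `V` in `L^{2p}` represents the curve `u` in `L²` on `[0, T]`. -/
def Represents {p : ℝ} (T : ℝ) (V : ℝ → LpX (xExp p)) (u : ℝ → L2) : Prop :=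
  ∀ᵐ t ∂(volume.restrict (Icc 0 T)), (V t : E3 → ℂ) =ᵐ[volume] (u t : E3 → ℂ)

theorem Represents.mono {p T τ : ℝ} {V : ℝ → LpX (xExp p)} {u : ℝ → L2} (h : Represents T V u)
    (hτ : τ ≤ T) : Represents τ V u :=
  ae_restrict_of_ae_restrict_of_subset (Icc_subset_Icc_right hτ) h

theorem Represents.ae_eq {p T : ℝ} {V V' : ℝ → LpX (xExp p)} {u : ℝ → L2}
    (h : Represents T V u) (h' : Represents T V' u) : V =ᵐ[volume.restrict (Icc 0 T)] V' := by
  filter_upwards [h, h'] with t h1 h2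
  exact Lp.ext (h1.trans h2.symm)

theorem Represents.sub {p T : ℝ} {V V' : ℝ → LpX (xExp p)} {u u' : ℝ → L2}
    (h : Represents T V u) (h' : Represents T V' u') :
    Represents T (V - V') (fun t => u t - u' t) := by
  filter_upwards [h, h'] with t h1 h2
  refine (Lp.coeFn_sub (V t) (V' t)).trans ?_
  filter_upwards [h1, h2, Lp.coeFn_sub (u t) (u' t)] with x h3 h4 h5
  rw [h5, Pi.sub_apply, Pi.sub_apply, h3, h4]

theorem Represents.congr {p T : ℝ} {V : ℝ → LpX (xExp p)} {u u' : ℝ → L2}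
    (h : Represents T V u) (hu : ∀ t ∈ Icc 0 T, u t = u' t) : Represents T V u' := by
  filter_upwards [h, ae_restrict_mem measurableSet_Icc] with t h1 h2
  rwa [← hu t h2]

/-- The Strichartz estimate for the linear inhomogeneous wave equation holds with constant `K`. -/
structure StrichartzBound (p : ℝ) [Fact (3 < p)] (K : ℝ) : Prop where
  nonneg : 0 ≤ K
  bound : ∀ T, 0 ≤ T → ∀ v₁ v₂ (G : ℝ → L2), IntegrableOn G (Icc 0 T) →
    ∃ V : Lp (LpX (xExp p)) (tExp p) (volume.restrict (Icc 0 T)),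
      ‖V‖ ≤ K * energy T v₁ v₂ G ∧ Represents T V fun t => toL2 (linV v₁ v₂ G t)

theorem exists_strichartzBound (p : ℝ) [Fact (3 < p)] : ∃ K, StrichartzBound p K := by
  obtain ⟨K, h0, h⟩ := strichartz p
  exact ⟨K, h0, h⟩

theorem energy_zero (T : ℝ) (G : ℝ → L2) : energy T 0 0 G = ∫ s in Icc 0 T, ‖G s‖ := by
  simp [energy]

/-- The data cancel in the difference, so only the forcing part of the Strichartz estimate remains.
-/
theorem StrichartzBound.toReal_eLpNorm_sub_le {p : ℝ} [Fact (3 < p)] {K : ℝ}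
    (hK : StrichartzBound p K) {T : ℝ} (hT : 0 ≤ T) {v₁ : H1} {v₂ : L2} {G G' : ℝ → L2}
    (hG : IntegrableOn G (Icc 0 T)) (hG' : IntegrableOn G' (Icc 0 T)) {V V' : ℝ → LpX (xExp p)}
    (hV : Represents T V fun t => toL2 (linV v₁ v₂ G t))
    (hV' : Represents T V' fun t => toL2 (linV v₁ v₂ G' t)) :
    (eLpNorm (V - V') (tExp p) (volume.restrict (Icc 0 T))).toReal ≤
      K * ∫ s in Icc 0 T, ‖G s - G' s‖ := by
  obtain ⟨D, hD1, hD2⟩ := hK.bound T hT 0 0 (fun s => G s - G' s) (hG.sub hG')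
  have h1 : Represents T D fun t => toL2 (linV v₁ v₂ G t) - toL2 (linV v₁ v₂ G' t) :=
    hD2.congr fun t ht => toL2_linV_sub v₁ v₂ (hG.mono_set (Icc_subset_Icc_right ht.2))
      (hG'.mono_set (Icc_subset_Icc_right ht.2))
  rw [eLpNorm_congr_ae ((hV.sub hV').ae_eq h1), ← Lp.norm_def]
  rwa [energy_zero] at hD1

section FixedPoint

variable {p : ℝ} [hp : Fact (3 < p)]

/-- The curve `V` solves the Duhamel equation for the forced nonlinear wave equation. -/
def IsMild (T : ℝ) (F : ℝ → LpX (xExp p)) (v₁ : H1) (v₂ : L2) (V : ℝ → LpX (xExp p)) : Prop :=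
  Represents T V fun t => toL2 (linV v₁ v₂ (fun s => Nl p (F s + V s)) t)

theorem MemMixed.mono {T τ : ℝ} {V : ℝ → LpX (xExp p)} (h : MemMixed p T V) (hτ : τ ≤ T) :
    MemMixed p τ V :=
  MemLp.mono_measure (Measure.restrict_mono (Icc_subset_Icc_right hτ) le_rfl) h

theorem integrableOn_Nl (hp5 : p < 5) {T : ℝ} {F V : ℝ → LpX (xExp p)} (hF : MemMixed p T F)
    (hV : MemMixed p T V) : IntegrableOn (fun s => Nl p (F s + V s)) (Icc 0 T) :=
  (integrable_Nl hp5 (MemLp.add hF hV)).1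

theorem real_restrict_Icc_univ {T : ℝ} (hT : 0 ≤ T) :
    (volume.restrict (Icc 0 T)).real univ = T := by
  simp [Measure.real, hT]

theorem exists_fixedPoint_of_dist_le_half {X : Type*} [NormedAddCommGroup X] [CompleteSpace X]
    {Φ : X → X} {ρ : ℝ} (hρ : 0 ≤ ρ)
    (hmaps : MapsTo Φ (Metric.closedBall 0 ρ) (Metric.closedBall 0 ρ))
    (hlip : ∀ x ∈ Metric.closedBall (0 : X) ρ, ∀ y ∈ Metric.closedBall (0 : X) ρ,
      dist (Φ x) (Φ y) ≤ 1 / 2 * dist x y) : ∃ x, Φ x = x := by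
  have hcon : ContractingWith (1 / 2 : NNReal) (hmaps.restrict Φ _ _) := by
    refine ⟨by rw [div_lt_one (by norm_num)]; norm_num, LipschitzWith.of_dist_le_mul fun x y => ?_⟩
    have h := hlip x x.2 y y.2
    rw [Subtype.dist_eq, Subtype.dist_eq]
    simpa using h
  obtain ⟨x, -, hx, -⟩ := ContractingWith.exists_fixedPoint'
    (Metric.isClosed_closedBall (x := (0 : X)) (ε := ρ)).isComplete hmaps hcon
    (Metric.mem_closedBall_self hρ) (edist_ne_top _ _)
  exact ⟨x, hx⟩

theorem StrichartzBound.toReal_eLpNorm_sub_le_mul (hp5 : p < 5) {K : ℝ}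
    (hK : StrichartzBound p K) {T : ℝ} (hT : 0 ≤ T) {F : ℝ → LpX (xExp p)}
    (hF : MemMixed p T F) {v₁ : H1} {v₂ : L2} {R : ℝ} {V W ΦV ΦW : ℝ → LpX (xExp p)}
    (hV : MemMixed p T V) (hW : MemMixed p T W)
    (hVR : mixedNorm p T (fun s => F s + V s) ≤ R) (hWR : mixedNorm p T (fun s => F s + W s) ≤ R)
    (hΦV : Represents T ΦV fun t => toL2 (linV v₁ v₂ (fun s => Nl p (F s + V s)) t))
    (hΦW : Represents T ΦW fun t => toL2 (linV v₁ v₂ (fun s => Nl p (F s + W s)) t)) :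
    mixedNorm p T (ΦV - ΦW) ≤
      K * (p * (T ^ ((5 - p) / 2) * (2 * R) ^ (p - 1))) * mixedNorm p T (V - W) := by
  have h3 := hp.out
  have hp0 : 0 ≤ p := by linarith
  have hp1 : 0 ≤ p - 1 := by linarith
  have h4 := hK.toReal_eLpNorm_sub_le hT (integrableOn_Nl hp5 hF hV)
    (integrableOn_Nl hp5 hF hW) hΦV hΦW
  have h5 := integral_norm_Nl_sub_le hp5 (MemLp.add hF hV) (MemLp.add hF hW)
  have e : F + V - (F + W) = V - W := by abel
  rw [e, real_restrict_Icc_univ hT] at h5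
  refine h4.trans ((mul_le_mul_of_nonneg_left h5 hK.nonneg).trans ?_)
  have hab := add_le_add hVR hWR
  set a := mixedNorm p T (fun s => F s + V s) with ha
  set b := mixedNorm p T (fun s => F s + W s) with hb
  have ha0 : 0 ≤ a := ENNReal.toReal_nonneg
  have hb0 : 0 ≤ b := ENNReal.toReal_nonneg
  have hy0 : 0 ≤ mixedNorm p T (V - W) := ENNReal.toReal_nonneg
  have hK0 := hK.nonneg
  calc K * (p * (T ^ ((5 - p) / 2) * ((a + b) ^ (p - 1) * mixedNorm p T (V - W))))
      = K * (p * (T ^ ((5 - p) / 2) * (a + b) ^ (p - 1))) * mixedNorm p T (V - W) := by ring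
    _ ≤ _ := by
      refine mul_le_mul_of_nonneg_right ?_ hy0
      gcongr
      linarith

/-- The first smallness condition makes the Duhamel map preserve the ball of radius `ρ`; the second
makes it contract by `1/2` there. The map acts on the mixed space itself, and its values are the
representatives supplied by the Strichartz estimate. -/
theorem exists_mild (hp5 : p < 5) {K : ℝ} (hK : StrichartzBound p K) {T : ℝ} (hT : 0 ≤ T)
    {F : ℝ → LpX (xExp p)} (hF : MemMixed p T F) {v₁ : H1} {v₂ : L2} {M ρ : ℝ}
    (hM : mixedNorm p T F ≤ M) (hρ : 0 ≤ ρ)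
    (h1 : K * (‖absD v₁‖ + ‖v₂‖) + K * (T ^ ((5 - p) / 2) * (M + ρ) ^ p) ≤ ρ)
    (h2 : K * (p * (T ^ ((5 - p) / 2) * (2 * (M + ρ)) ^ (p - 1))) ≤ 1 / 2) :
    ∃ V, MemMixed p T V ∧ IsMild T F v₁ v₂ V := by
  have h3 := hp.out
  have hp0 : 0 ≤ p := by linarith
  have hp1 : 0 ≤ p - 1 := by linarith
  have hM0 : 0 ≤ M := ENNReal.toReal_nonneg.trans hM
  set X := Lp (LpX (xExp p)) (tExp p) (volume.restrict (Icc 0 T)) with hX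
  have hmem : ∀ V : X, MemMixed p T (V : ℝ → LpX (xExp p)) := fun V => Lp.memLp V
  have hadd : ∀ V : X, MemLp (fun s => F s + V s) (tExp p) (volume.restrict (Icc 0 T)) :=
    fun V => MemLp.add hF (hmem V)
  have hnorm : ∀ V : X, ‖V‖ ≤ ρ → (eLpNorm (fun s => F s + V s) (tExp p)
      (volume.restrict (Icc 0 T))).toReal ≤ M + ρ := by
    intro V hV
    have h := eLpNorm_add_le hF.1 (hmem V).1 (tExp_fact p).out
    refine (ENNReal.toReal_mono (ENNReal.add_ne_top.2 ⟨hF.2.ne, (hmem V).2.ne⟩) h).trans ?_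
    rw [ENNReal.toReal_add hF.2.ne (hmem V).2.ne]
    refine add_le_add hM ?_
    rwa [← Lp.norm_def]
  choose Φ hΦ1 hΦ2 using fun V : X => hK.bound T hT v₁ v₂ (fun s => Nl p (F s + V s))
    (integrableOn_Nl hp5 hF (hmem V))
  have hmaps : MapsTo Φ (Metric.closedBall 0 ρ) (Metric.closedBall 0 ρ) := by
    intro V hV
    rw [mem_closedBall_zero_iff] at hV ⊢
    refine (hΦ1 V).trans (le_trans ?_ h1)
    rw [energy, mul_add]
    refine add_le_add le_rfl (mul_le_mul_of_nonneg_left ?_ hK.nonneg)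
    refine (integrable_Nl hp5 (hadd V)).2.trans ?_
    rw [real_restrict_Icc_univ hT]
    have := hnorm V hV
    gcongr
  have hlip : ∀ V ∈ Metric.closedBall (0 : X) ρ, ∀ W ∈ Metric.closedBall (0 : X) ρ,
      dist (Φ V) (Φ W) ≤ 1 / 2 * dist V W := by
    intro V hV W hW
    rw [mem_closedBall_zero_iff] at hV hW
    rw [dist_eq_norm, dist_eq_norm, Lp.norm_def, Lp.norm_def,
      eLpNorm_congr_ae (Lp.coeFn_sub (Φ V) (Φ W)), eLpNorm_congr_ae (Lp.coeFn_sub V W)]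
    exact (hK.toReal_eLpNorm_sub_le_mul hp5 hT hF (hmem V) (hmem W) (hnorm V hV) (hnorm W hW)
      (hΦ2 V) (hΦ2 W)).trans (mul_le_mul_of_nonneg_right h2 ENNReal.toReal_nonneg)
  obtain ⟨V, hV⟩ := exists_fixedPoint_of_dist_le_half hρ hmaps hlip
  refine ⟨V, hmem V, ?_⟩
  have h6 := hΦ2 V
  rwa [hV] at h6

/-- Two solutions agreeing up to time `a` have equal forcing there, so on `[0, b]` only `(a, b]`
contributes to their difference. Their global norms fix a step `δ` for which the estimate reads `Y ≤
Y/2`, and finitely many steps cover `[0, T]`. -/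
theorem IsMild.ae_eq (hp5 : p < 5) {T : ℝ} (hT : 0 ≤ T) {F V V' : ℝ → LpX (xExp p)} {v₁ : H1}
    {v₂ : L2} (hF : MemMixed p T F) (hV : MemMixed p T V) (hV' : MemMixed p T V')
    (h : IsMild T F v₁ v₂ V) (h' : IsMild T F v₁ v₂ V') :
    V =ᵐ[volume.restrict (Icc 0 T)] V' := by
  obtain ⟨K, hK⟩ := exists_strichartzBound p
  have hp3 := hp.out
  have hp0 : 0 ≤ p := by linarith
  have hp1 : 0 ≤ p - 1 := by linarith
  have hK0 := hK.nonneg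
  set H : ℝ → LpX (xExp p) := fun s => F s + V s with hH
  set H' : ℝ → LpX (xExp p) := fun s => F s + V' s with hH'
  have hHm : MemMixed p T H := MemLp.add hF hV
  have hHm' : MemMixed p T H' := MemLp.add hF hV'
  set M : ℝ := mixedNorm p T H + mixedNorm p T H' with hMdef
  have hM0 : 0 ≤ M := add_nonneg ENNReal.toReal_nonneg ENNReal.toReal_nonneg
  -- `δ` depends only on the norms on the whole interval, so the same step length works everywhere.
  obtain ⟨δ, hδ, hδ2⟩ : ∃ δ : ℝ, 0 < δ ∧ K * (p * (δ ^ ((5 - p) / 2) * M ^ (p - 1))) ≤ 1 / 2 := by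
    have hlim : Tendsto (fun δ : ℝ => K * (p * (δ ^ ((5 - p) / 2) * M ^ (p - 1)))) (𝓝[>] 0)
        (𝓝 (K * (p * ((0 : ℝ) ^ ((5 - p) / 2) * M ^ (p - 1))))) := by
      refine (Tendsto.mono_left ?_ nhdsWithin_le_nhds)
      exact ((((Real.continuousAt_rpow_const 0 ((5 - p) / 2)
        (Or.inr (by linarith))).tendsto).mul_const _).const_mul _).const_mul _
    rw [Real.zero_rpow (by linarith), zero_mul, mul_zero, mul_zero] at hlim
    have h5 := (hlim.eventually (ge_mem_nhds (by norm_num : (0 : ℝ) < 1 / 2))).and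
      self_mem_nhdsWithin
    obtain ⟨δ, h6, h7⟩ := h5.exists
    exact ⟨δ, h7, h6⟩
  have step : ∀ a b : ℝ, 0 ≤ a → a ≤ b → b ≤ T → b - a ≤ δ →
      V =ᵐ[volume.restrict (Icc 0 a)] V' → V =ᵐ[volume.restrict (Icc 0 b)] V' := by
    intro a b ha hab hb hba hae
    have hb0 := ha.trans hab
    have hiH := (integrable_Nl hp5 (MemMixed.mono hHm hb)).1
    have hiH' := (integrable_Nl hp5 (MemMixed.mono hHm' hb)).1
    have h1 := hK.toReal_eLpNorm_sub_le hb0 hiH hiH'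
      (Represents.mono h hb) (Represents.mono h' hb)
    have hsub : volume.restrict (Ioc a b) ≤ volume.restrict (Icc 0 b) :=
      Measure.restrict_mono (Ioc_subset_Icc_self.trans (Icc_subset_Icc_left ha)) le_rfl
    have hsubT : volume.restrict (Ioc a b) ≤ volume.restrict (Icc 0 T) :=
      hsub.trans (Measure.restrict_mono (Icc_subset_Icc_right hb) le_rfl)
    have hint : Integrable (fun s => ‖Nl p (H s) - Nl p (H' s)‖) (volume.restrict (Icc 0 b)) :=
      (hiH.sub hiH').norm
    have h2 : ∫ s in Icc 0 b, ‖Nl p (H s) - Nl p (H' s)‖ =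
        ∫ s in Ioc a b, ‖Nl p (H s) - Nl p (H' s)‖ := by
      have hz : ∫ s in Icc 0 a, ‖Nl p (H s) - Nl p (H' s)‖ = 0 := by
        refine integral_eq_zero_of_ae ?_
        filter_upwards [hae] with s hs
        simp [hH, hH', hs]
      rw [← Icc_union_Ioc_eq_Icc ha hab, setIntegral_union
        (Set.disjoint_left.2 fun t h1 h2 => (h1.2.trans_lt h2.1).false) measurableSet_Ioc
        (IntegrableOn.mono_set hint (Icc_subset_Icc_right hab))
        (IntegrableOn.mono_set hint (Ioc_subset_Icc_self.trans (Icc_subset_Icc_left ha))), hz, zero_add]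
    have h3 := integral_norm_Nl_sub_le hp5 (MemLp.mono_measure hsubT hHm)
      (MemLp.mono_measure hsubT hHm')
    have e : H - H' = V - V' := by
      ext1 s
      simp [hH, hH']
    have hreal : (volume.restrict (Ioc a b)).real univ = b - a := by
      simp [Measure.real, hab]
    rw [hreal, e] at h3
    have hm1 : (eLpNorm H (tExp p) (volume.restrict (Ioc a b))).toReal ≤ mixedNorm p T H :=
      ENNReal.toReal_mono hHm.2.ne (eLpNorm_mono_measure _ hsubT)
    have hm2 : (eLpNorm H' (tExp p) (volume.restrict (Ioc a b))).toReal ≤ mixedNorm p T H' :=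
      ENNReal.toReal_mono hHm'.2.ne (eLpNorm_mono_measure _ hsubT)
    have hD : MemLp (V - V') (tExp p) (volume.restrict (Icc 0 b)) :=
      MemLp.sub (hV.mono hb) (hV'.mono hb)
    have hm3 : (eLpNorm (V - V') (tExp p) (volume.restrict (Ioc a b))).toReal ≤
        (eLpNorm (V - V') (tExp p) (volume.restrict (Icc 0 b))).toReal :=
      ENNReal.toReal_mono hD.2.ne (eLpNorm_mono_measure _ hsub)
    set Y := (eLpNorm (V - V') (tExp p) (volume.restrict (Icc 0 b))).toReal with hY
    have hY0 : 0 ≤ Y := ENNReal.toReal_nonneg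
    have h4 : Y ≤ 1 / 2 * Y := by
      calc Y ≤ K * ∫ s in Icc 0 b, ‖Nl p (H s) - Nl p (H' s)‖ := h1
        _ ≤ K * (p * (δ ^ ((5 - p) / 2) * (M ^ (p - 1) * Y))) := by
          rw [h2]
          refine mul_le_mul_of_nonneg_left (h3.trans ?_) hK0
          have hba0 : 0 ≤ b - a := sub_nonneg.2 hab
          have h5p : 0 ≤ (5 - p) / 2 := by linarith
          gcongr
          exact add_le_add hm1 hm2
        _ = K * (p * (δ ^ ((5 - p) / 2) * M ^ (p - 1))) * Y := by ring
        _ ≤ 1 / 2 * Y := mul_le_mul_of_nonneg_right hδ2 hY0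
    have h5 : Y = 0 := by linarith
    have h6 : eLpNorm (V - V') (tExp p) (volume.restrict (Icc 0 b)) = 0 :=
      ((ENNReal.toReal_eq_zero_iff _).1 h5).resolve_right hD.2.ne
    have h7 := (eLpNorm_eq_zero_iff hD.1
      (zero_lt_one.trans_le (tExp_fact p).out).ne').1 h6
    filter_upwards [h7] with s hs
    exact sub_eq_zero.1 hs
  have hind : ∀ k : ℕ, V =ᵐ[volume.restrict (Icc 0 (min T (k * δ)))] V' := by
    intro k
    induction k with
    | zero =>
      -- The induction starts on a single point, a null set.
      have : volume.restrict (Icc (0 : ℝ) (min T ((0 : ℕ) * δ))) = 0 := by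
        simp [hT]
      rw [this]
      rw [EventuallyEq, ae_zero]
      exact Filter.eventually_bot
    | succ k ih =>
      have hk : (0 : ℝ) ≤ k * δ := by positivity
      have e : ((k + 1 : ℕ) : ℝ) * δ = k * δ + δ := by push_cast; ring
      rw [e]
      refine step _ _ (le_min hT hk) (min_le_min_left _ (by linarith)) (min_le_left _ _) ?_ ih
      rcases min_cases T (k * δ) with h1 | h1 <;>
        rcases min_cases T (k * δ + δ) with h2 | h2 <;> linarith [h1.1, h1.2, h2.1, h2.2]
  obtain ⟨k, hk⟩ := exists_nat_ge (T / δ)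
  have h8 := hind k
  rwa [min_eq_left ((div_le_iff₀ hδ).1 hk)] at h8

end FixedPoint

end ForcedNLW

end

/-! ### Weak and mild solutions, uniqueness, reality and the existence time -/

noncomputable section

namespace ForcedNLW

open Filter Topology

/-- The transform of the gradient is determined by that of the function, so equality in `L²`
suffices for equality in `H¹`. -/
theorem toL2_injective : Function.Injective toL2 := by
  intro u u' h
  have h2 : ∀ j, gradL j u = gradL j u' := fun j => by
    apply L2_ext_fourier
    filter_upwards [fourier_gradL j u, fourier_gradL j u'] with ξ h1 h2
    rw [h1, h2, h]
  apply Subtype.ext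
  apply (WithLp.equiv 2 (L2 × PiLp 2 (fun _ : Fin 3 => L2))).injective
  refine Prod.ext h ?_
  apply (WithLp.equiv 2 (Fin 3 → L2)).injective
  funext j
  exact h2 j

theorem integrableOn_inner_slice {T : ℝ} {φ : ℝ × E3 → ℂ} (hφ : IsBump φ) {u : ℝ → L2}
    (hu : ContinuousOn u (Icc 0 T)) :
    IntegrableOn (fun t => inner ℂ (slice φ t) (u t)) (Icc 0 T) :=
  ContinuousOn.integrableOn_compact isCompact_Icc
    (continuous_inner.comp_continuousOn (hφ.continuous_slice.continuousOn.prodMk hu))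

/-- Subtracting the Duhamel solution, which has the same data and forcing, leaves a weak solution of
the homogeneous equation with zero data. -/
theorem weak_eq_linV {T : ℝ} (hT : 0 < T) {u z G : ℝ → L2} {v₁ : H1} {v₂ : L2}
    (hG : IntegrableOn G (Icc 0 T)) (hz : ContinuousOn z (Icc 0 T))
    (hd : ∀ t ∈ Icc 0 T, HasDerivWithinAt u (z t) (Icc 0 T) t)
    (hu0 : u 0 = toL2 v₁) (hz0 : z 0 = v₂)
    (hw : ∀ φ : ℝ × E3 → ℂ, IsBump φ → tsupport φ ⊆ Ioo 0 T ×ˢ univ →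
      ∫ t in Icc 0 T, inner ℂ (slice (waveFn φ) t) (u t) =
        ∫ t in Icc 0 T, inner ℂ (slice φ t) (G t)) :
    ∀ t ∈ Icc 0 T, u t = toL2 (linV v₁ v₂ G t) := by
  have hu : ContinuousOn u (Icc 0 T) := fun t ht => (hd t ht).continuousWithinAt
  have hl : ContinuousOn (fun t => toL2 (linV v₁ v₂ G t)) (Icc 0 T) :=
    fun t ht => (hasDerivWithinAt_linV v₁ v₂ hG ht).continuousWithinAt
  have h := weak_unique hT (u := fun t => u t - toL2 (linV v₁ v₂ G t))
    (z := fun t => z t - linW v₁ v₂ G t) (hu.sub hl) (hz.sub (continuousOn_linW v₁ v₂ hG))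
    (fun t ht => (hd t ht).sub (hasDerivWithinAt_linV v₁ v₂ hG ht))
    (by rw [hu0, linV_zero, sub_self]) (by rw [hz0, linW_zero, sub_self]) fun φ hφ hs => by
      simp_rw [inner_sub_right]
      rw [integral_sub (integrableOn_inner_slice (isBump_waveFn hφ) hu)
        (integrableOn_inner_slice (isBump_waveFn hφ) hl), hw φ hφ hs,
        weak_linV hT.le hφ hs v₁ v₂ hG, sub_self]
  exact fun t ht => sub_eq_zero.1 (h t ht)

/-- Complex conjugation on `L^r`. -/
def conjLp (r : ℝ≥0∞) [Fact (1 ≤ r)] : LpX r →L[ℝ] LpX r :=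
  (Complex.conjCLE : ℂ →L[ℝ] ℂ).compLpL r volume

theorem conjLp_ae (r : ℝ≥0∞) [Fact (1 ≤ r)] (f : LpX r) :
    (conjLp r f : E3 → ℂ) =ᵐ[volume] fun x => starRingEnd ℂ (f x) :=
  ContinuousLinearMap.coeFn_compLpL _ f

theorem conjLp_eq_self_iff {r : ℝ≥0∞} [Fact (1 ≤ r)] {f : LpX r} :
    conjLp r f = f ↔ IsRealValued f := by
  constructor
  · intro h
    have h1 := conjLp_ae r f
    rw [h] at h1
    filter_upwards [h1] with x hx
    exact Complex.conj_eq_iff_im.1 hx.symm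
  · intro h
    refine Lp.ext ?_
    filter_upwards [conjLp_ae r f, h] with x h1 h2
    rw [h1, Complex.conj_eq_iff_im.2 h2]

theorem inner_conjLp (f g : L2) :
    inner ℂ f (conjLp 2 g) = starRingEnd ℂ (inner ℂ (conjLp 2 f) g) := by
  rw [inner_L2_eq, inner_L2_eq, ← integral_conj]
  refine integral_congr_ae ?_
  filter_upwards [conjLp_ae 2 f, conjLp_ae 2 g] with x h1 h2
  rw [h1, h2, map_mul, Complex.conj_conj]

theorem slice_conjFn {φ : ℝ × E3 → ℂ} (hφ : IsBump φ) (t : ℝ) :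
    slice (conjFn φ) t = conjLp 2 (slice φ t) := by
  refine Lp.ext ?_
  filter_upwards [hφ.slice_ae t, hφ.conj.slice_ae t, conjLp_ae 2 (slice φ t)] with x h1 h2 h3
  rw [h3, h2, h1, conjFn]

theorem inner_slice_conjLp {φ : ℝ × E3 → ℂ} (hφ : IsBump φ) (t : ℝ) (f : L2) :
    inner ℂ (slice φ t) (conjLp 2 f) = starRingEnd ℂ (inner ℂ (slice (conjFn φ) t) f) := by
  rw [inner_conjLp, slice_conjFn hφ]

theorem nonlin_conj (b : ℝ) (z : ℂ) :
    nonlin b (starRingEnd ℂ z) = starRingEnd ℂ (nonlin b z) := by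
  rw [nonlin, nonlin, map_mul, Complex.conj_ofReal, RCLike.norm_conj]

theorem Nl_conjLp (b : ℝ) [Fact (3 < b)] (f : LpX (xExp b)) :
    Nl b (conjLp (xExp b) f) = conjLp 2 (Nl b f) := by
  refine Lp.ext ?_
  filter_upwards [Nl_ae b (conjLp (xExp b) f), Nl_ae b f, conjLp_ae (xExp b) f,
    conjLp_ae 2 (Nl b f)] with x h1 h2 h3 h4
  rw [h1, h4, h2, h3, nonlin_conj]

/-- The conjugated curve solves the weak equation with conjugated forcing and the same real data, so
`weak_eq_linV` identifies it. This avoids studying how the multipliers act on conjugates. -/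
theorem conjLp_toL2_linV {T : ℝ} (hT : 0 < T) {G : ℝ → L2} {v₁ : H1} {v₂ : L2}
    (hG : IntegrableOn G (Icc 0 T)) (h₁ : conjLp 2 (toL2 v₁) = toL2 v₁) (h₂ : conjLp 2 v₂ = v₂) :
    ∀ t ∈ Icc 0 T, conjLp 2 (toL2 (linV v₁ v₂ G t)) =
      toL2 (linV v₁ v₂ (fun s => conjLp 2 (G s)) t) := by
  refine weak_eq_linV hT (z := fun t => conjLp 2 (linW v₁ v₂ G t))
    ((conjLp 2).integrable_comp hG)
    ((conjLp 2).continuous.comp_continuousOn (continuousOn_linW v₁ v₂ hG)) ?_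
    (by rw [linV_zero, h₁]) (by rw [linW_zero, h₂]) ?_
  · intro t ht
    exact (conjLp 2).hasFDerivAt.comp_hasDerivWithinAt t (hasDerivWithinAt_linV v₁ v₂ hG ht)
  · intro φ hφ hs
    simp_rw [inner_slice_conjLp (isBump_waveFn hφ), inner_slice_conjLp hφ, ← waveFn_conjFn]
    rw [integral_conj, integral_conj,
      weak_linV hT.le hφ.conj (by rwa [tsupport_conjFn]) v₁ v₂ hG]

section Solution

variable {p : ℝ} [hp : Fact (3 < p)]

theorem isSolution_of_isMild (hp5 : p < 5) {T : ℝ} (hT : 0 ≤ T) {F V : ℝ → LpX (xExp p)}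
    {v₁ : H1} {v₂ : L2} (hF : MemMixed p T F) (hV : MemMixed p T V) (h : IsMild T F v₁ v₂ V) :
    IsSolution p T F v₁ v₂ (linV v₁ v₂ fun s => Nl p (F s + V s))
      (linW v₁ v₂ fun s => Nl p (F s + V s)) := by
  have hG := integrableOn_Nl hp5 hF hV
  exact
    { continuousOn_fst := continuousOn_linV v₁ v₂ hG
      continuousOn_snd := continuousOn_linW v₁ v₂ hG
      mixed := ⟨V, hV, h⟩
      deriv := fun t ht => hasDerivWithinAt_linV v₁ v₂ hG ht
      init_fst := linV_zero _ _ _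
      init_snd := linW_zero _ _ _
      equation := (weak_equation_iff h).2 fun ψ hψ hs => weak_linV hT hψ hs v₁ v₂ hG }

theorem IsSolution.exists_isMild (hp5 : p < 5) {T : ℝ} (hT : 0 < T) {F : ℝ → LpX (xExp p)}
    {v₁ : H1} {v₂ : L2} {v : ℝ → H1} {w : ℝ → L2} (hF : MemMixed p T F)
    (h : IsSolution p T F v₁ v₂ v w) :
    ∃ V, MemMixed p T V ∧ IsMild T F v₁ v₂ V ∧
      ∀ t ∈ Icc 0 T, toL2 (v t) = toL2 (linV v₁ v₂ (fun s => Nl p (F s + V s)) t) := by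
  obtain ⟨V, hV, hrep⟩ := h.mixed
  have h1 := weak_eq_linV hT (integrableOn_Nl hp5 hF hV) h.continuousOn_snd h.deriv
    (by rw [h.init_fst]) h.init_snd ((weak_equation_iff hrep).1 h.equation)
  exact ⟨V, hV, Represents.congr hrep h1, h1⟩

theorem toL2_linV_Nl_congr (hp5 : p < 5) {T t : ℝ} (ht : t ∈ Icc 0 T) {F V V' : ℝ → LpX (xExp p)}
    (v₁ : H1) (v₂ : L2) (hF : MemMixed p T F) (hV : MemMixed p T V)
    (h : V =ᵐ[volume.restrict (Icc 0 T)] V') :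
    toL2 (linV v₁ v₂ (fun s => Nl p (F s + V s)) t) =
      toL2 (linV v₁ v₂ (fun s => Nl p (F s + V' s)) t) :=
  toL2_linV_congr v₁ v₂ ht (integrableOn_Nl hp5 hF hV) (by
    filter_upwards [h] with s hs
    rw [hs])

/-- Both solutions are mild, so their `L^{2p}` representatives agree for almost every time. They
then have the same forcing, hence the same Duhamel formula at every time, and the velocities are
derivatives of the same curve. -/
theorem IsSolution.eqOn (hp5 : p < 5) {T : ℝ} (hT : 0 < T) {F : ℝ → LpX (xExp p)}
    {v₁ : H1} {v₂ : L2} {v v' : ℝ → H1} {w w' : ℝ → L2} (hF : MemMixed p T F)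
    (h : IsSolution p T F v₁ v₂ v w) (h' : IsSolution p T F v₁ v₂ v' w') :
    EqOn v' v (Icc 0 T) ∧ EqOn w' w (Icc 0 T) := by
  obtain ⟨V, hV, hm, he⟩ := h.exists_isMild hp5 hT hF
  obtain ⟨V', hV', hm', he'⟩ := h'.exists_isMild hp5 hT hF
  have hVV := hm'.ae_eq hp5 hT.le hF hV' hV hm
  have h1 : ∀ t ∈ Icc 0 T, toL2 (v' t) = toL2 (v t) := fun t ht => by
    rw [he t ht, he' t ht, toL2_linV_Nl_congr hp5 ht v₁ v₂ hF hV' hVV]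
  refine ⟨fun t ht => toL2_injective (h1 t ht), fun t ht => ?_⟩
  have h2 : HasDerivWithinAt (fun s => toL2 (v' s)) (w t) (Icc 0 T) t :=
    (h.deriv t ht).congr h1 (h1 t ht)
  exact (uniqueDiffOn_Icc hT t ht).eq_deriv _ (h'.deriv t ht) h2

/-- The conjugate of `V` is again a mild solution, because the nonlinearity commutes with
conjugation. Uniqueness makes `V` equal to its conjugate, and the Duhamel formula carries this to
every time. -/
theorem IsMild.isRealValued (hp5 : p < 5) {T : ℝ} (hT : 0 < T) {F V : ℝ → LpX (xExp p)}
    {v₁ : H1} {v₂ : L2} (hF : MemMixed p T F) (hV : MemMixed p T V) (h : IsMild T F v₁ v₂ V)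
    (h₁ : IsRealValued (toL2 v₁)) (h₂ : IsRealValued v₂)
    (hFr : ∀ᵐ t ∂(volume.restrict (Icc 0 T)), IsRealValued (F t)) :
    ∀ t ∈ Icc 0 T, IsRealValued (toL2 (linV v₁ v₂ (fun s => Nl p (F s + V s)) t)) := by
  set V' : ℝ → LpX (xExp p) := fun t => conjLp (xExp p) (V t) with hV'def
  have hV' : MemMixed p T V' := (conjLp (xExp p)).comp_memLp' hV
  have hG := integrableOn_Nl hp5 hF hV
  have hG' : IntegrableOn (fun s => conjLp 2 (Nl p (F s + V s))) (Icc 0 T) :=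
    (conjLp 2).integrable_comp hG
  have hN : ∀ᵐ s ∂(volume.restrict (Icc 0 T)),
      conjLp 2 (Nl p (F s + V s)) = Nl p (F s + V' s) := by
    filter_upwards [hFr] with s hs
    rw [← Nl_conjLp, map_add, conjLp_eq_self_iff.2 hs]
  have hc : ∀ t ∈ Icc 0 T, conjLp 2 (toL2 (linV v₁ v₂ (fun s => Nl p (F s + V s)) t)) =
      toL2 (linV v₁ v₂ (fun s => Nl p (F s + V' s)) t) := fun t ht => by
    rw [conjLp_toL2_linV hT hG (conjLp_eq_self_iff.2 h₁) (conjLp_eq_self_iff.2 h₂) t ht,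
      toL2_linV_congr v₁ v₂ ht hG' hN]
  have hm' : IsMild T F v₁ v₂ V' := by
    refine Represents.congr (u := fun t =>
      conjLp 2 (toL2 (linV v₁ v₂ (fun s => Nl p (F s + V s)) t))) ?_ hc
    filter_upwards [h] with t ht
    filter_upwards [ht, conjLp_ae (xExp p) (V t),
      conjLp_ae 2 (toL2 (linV v₁ v₂ (fun s => Nl p (F s + V s)) t))] with x h3 h4 h5
    rw [h4, h5, h3]
  have hVV := hm'.ae_eq hp5 hT.le hF hV' hV h
  intro t ht
  rw [← conjLp_eq_self_iff, hc t ht, toL2_linV_Nl_congr hp5 ht v₁ v₂ hF hV' hVV]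

/-- The local existence time: for data of size `lam`, a mild solution exists up to time
`c * lam ^ (-(2 * (p - 1) / (5 - p)))`. -/
theorem exists_time_constant (p : ℝ) [hp : Fact (3 < p)] (hp5 : p < 5) :
    ∃ c : ℝ, 0 < c ∧ ∀ (T lam : ℝ), 0 ≤ T → 0 < lam → T ≤ c * lam ^ (-(2 * (p - 1) / (5 - p))) →
      ∀ (v₁ : H1) (v₂ : L2) (F : ℝ → LpX (xExp p)), MemMixed p T F → ‖v₁‖ ≤ lam → ‖v₂‖ ≤ lam →
        mixedNorm p T F ≤ lam → ∃ V, MemMixed p T V ∧ IsMild T F v₁ v₂ V := by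
  have h3 := hp.out
  have hp0 : 0 ≤ p := by linarith
  have hp1 : 0 ≤ p - 1 := by linarith
  have hθ : 0 < (5 - p) / 2 := by linarith
  obtain ⟨K, hK⟩ := exists_strichartzBound p
  have hK0 := hK.nonneg
  set A : ℝ := ‖absD‖ + 1 with hA
  have hA0 : 0 ≤ A := by positivity
  -- The ball has radius `B λ`: the linear part uses at most `K A λ` and the nonlinear part is
  -- allowed the remaining `λ`.
  set B : ℝ := K * A + 1 with hB
  have hB0 : 0 ≤ B := by positivity
  -- `D` dominates the constant of the self-mapping condition and twice that of the contraction
  -- condition. With `c = D^{-2/(5-p)}`, the hypothesis on `T` becomes `T^{(5-p)/2} ≤ D⁻¹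
  -- λ^{-(p-1)}`.
  set D : ℝ := 1 + K * (1 + B) ^ p + 2 * (K * p * (2 * (1 + B)) ^ (p - 1)) with hD
  have hD1 : 0 ≤ K * (1 + B) ^ p := by positivity
  have hD2 : 0 ≤ K * p * (2 * (1 + B)) ^ (p - 1) := by positivity
  have hD0 : 0 < D := by positivity
  refine ⟨(D⁻¹) ^ ((5 - p) / 2)⁻¹, by positivity, ?_⟩
  intro T lam hT hlam hTle v₁ v₂ F hF h₁ h₂ hFl
  have hTθ : T ^ ((5 - p) / 2) ≤ D⁻¹ * lam ^ (-(p - 1)) := by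
    refine (Real.rpow_le_rpow hT hTle hθ.le).trans_eq ?_
    rw [Real.mul_rpow (by positivity) (by positivity), ← Real.rpow_mul (by positivity),
      ← Real.rpow_mul hlam.le, inv_mul_cancel₀ hθ.ne', Real.rpow_one]
    congr 2
    have : 5 - p ≠ 0 := by linarith
    field_simp
  have hT0 : 0 ≤ T ^ ((5 - p) / 2) := by positivity
  have e1 : lam ^ (-(p - 1)) * lam ^ (p - 1) = 1 := by
    rw [← Real.rpow_add hlam, neg_add_cancel, Real.rpow_zero]
  have e2 : lam ^ (-(p - 1)) * lam ^ p = lam := by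
    rw [← Real.rpow_add hlam]
    convert Real.rpow_one lam using 2
    ring
  have hDinv : D⁻¹ * D = 1 := inv_mul_cancel₀ hD0.ne'
  have hDi : 0 ≤ D⁻¹ := by positivity
  refine exists_mild hp5 hK hT hF (ρ := B * lam) hFl (by positivity) ?_ ?_
  · have ha : ‖absD v₁‖ + ‖v₂‖ ≤ A * lam := by
      have h4 := absD.le_opNorm v₁
      have h5 : ‖absD‖ * ‖v₁‖ ≤ ‖absD‖ * lam := by gcongr
      rw [hA, add_mul, one_mul]
      linarith
    have hb : K * (T ^ ((5 - p) / 2) * (lam + B * lam) ^ p) ≤ lam := by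
      rw [show lam + B * lam = (1 + B) * lam by ring, Real.mul_rpow (by positivity) hlam.le]
      calc K * (T ^ ((5 - p) / 2) * ((1 + B) ^ p * lam ^ p))
          ≤ K * ((D⁻¹ * lam ^ (-(p - 1))) * ((1 + B) ^ p * lam ^ p)) := by gcongr
        _ = D⁻¹ * (K * (1 + B) ^ p) * (lam ^ (-(p - 1)) * lam ^ p) := by ring
        _ ≤ D⁻¹ * D * lam := by
          rw [e2]
          gcongr
          linarith
        _ = lam := by rw [hDinv, one_mul]
    calc K * (‖absD v₁‖ + ‖v₂‖) + K * (T ^ ((5 - p) / 2) * (lam + B * lam) ^ p)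
        ≤ K * (A * lam) + lam := by gcongr
      _ = B * lam := by rw [hB]; ring
  · rw [show 2 * (lam + B * lam) = 2 * (1 + B) * lam by ring,
      Real.mul_rpow (by positivity) hlam.le]
    calc K * (p * (T ^ ((5 - p) / 2) * ((2 * (1 + B)) ^ (p - 1) * lam ^ (p - 1))))
        ≤ K * (p * ((D⁻¹ * lam ^ (-(p - 1))) * ((2 * (1 + B)) ^ (p - 1) * lam ^ (p - 1)))) := by
          gcongr
      _ = D⁻¹ * (K * p * (2 * (1 + B)) ^ (p - 1)) * (lam ^ (-(p - 1)) * lam ^ (p - 1)) := by ring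
      _ ≤ D⁻¹ * (D / 2) * 1 := by
          rw [e1]
          gcongr
          linarith
      _ = 1 / 2 := by linear_combination hDinv / 2

end Solution

end ForcedNLW

end

/-! ### Local well-posedness of the forced equation -/

theorem lemma3p1 (p : ℝ) [Fact (3 < p)] (hp5 : p < 5) :
    ∃ c : ℝ, 0 < c ∧
      ∀ (T' lam : ℝ), 0 < T' → 0 < lam →
      ∀ (v₁ : ForcedNLW.H1) (v₂ : ForcedNLW.L2) (F : ℝ → ForcedNLW.LpX (ForcedNLW.xExp p)),
        ForcedNLW.MemMixed p T' F →
        Real.sqrt (‖v₁‖ ^ 2 + ‖v₂‖ ^ 2) + ForcedNLW.mixedNorm p T' F ≤ lam →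
        ∀ T : ℝ, T = min T' (c * lam ^ (-(2 * (p - 1) / (5 - p)))) →
        ∃ (v : ℝ → ForcedNLW.H1) (w : ℝ → ForcedNLW.L2),
          ForcedNLW.IsSolution p T F v₁ v₂ v w ∧
          (∀ (v' : ℝ → ForcedNLW.H1) (w' : ℝ → ForcedNLW.L2),
            ForcedNLW.IsSolution p T F v₁ v₂ v' w' →
              EqOn v' v (Icc 0 T) ∧ EqOn w' w (Icc 0 T)) ∧
          (ForcedNLW.IsRealValued (ForcedNLW.toL2 v₁) → ForcedNLW.IsRealValued v₂ →
            (∀ᵐ t ∂(volume.restrict (Icc 0 T')), ForcedNLW.IsRealValued (F t)) →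
              ∀ t ∈ Icc 0 T, ForcedNLW.IsRealValued (ForcedNLW.toL2 (v t))) := by
  obtain ⟨c, hc, h⟩ := ForcedNLW.exists_time_constant p hp5
  refine ⟨c, hc, ?_⟩
  intro T' lam hT' hlam v₁ v₂ F hF hle T hT
  -- Strict positivity is needed for uniqueness: on a degenerate interval the derivative within it
  -- would not determine `w`.
  have hT0 : 0 < T := hT ▸ lt_min hT' (by positivity)
  have hTT' : T ≤ T' := hT ▸ min_le_left _ _
  have hFT : ForcedNLW.MemMixed p T F := hF.mono hTT'
  have hF0 : 0 ≤ ForcedNLW.mixedNorm p T' F := ENNReal.toReal_nonneg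
  have hs0 := Real.sqrt_nonneg (‖v₁‖ ^ 2 + ‖v₂‖ ^ 2)
  have h₁ : ‖v₁‖ ≤ Real.sqrt (‖v₁‖ ^ 2 + ‖v₂‖ ^ 2) :=
    Real.le_sqrt_of_sq_le (le_add_of_nonneg_right (sq_nonneg _))
  have h₂ : ‖v₂‖ ≤ Real.sqrt (‖v₁‖ ^ 2 + ‖v₂‖ ^ 2) :=
    Real.le_sqrt_of_sq_le (le_add_of_nonneg_left (sq_nonneg _))
  have hFl : ForcedNLW.mixedNorm p T F ≤ ForcedNLW.mixedNorm p T' F :=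
    ENNReal.toReal_mono hF.2.ne
      (eLpNorm_mono_measure _ (Measure.restrict_mono (Icc_subset_Icc_right hTT') le_rfl))
  obtain ⟨V, hV, hm⟩ := h T lam hT0.le hlam (hT ▸ min_le_right _ _) v₁ v₂ F hFT
    (by linarith) (by linarith) (by linarith)
  have hsol := ForcedNLW.isSolution_of_isMild hp5 hT0.le hFT hV hm
  exact ⟨_, _, hsol, fun v' w' h' => hsol.eqOn hp5 hT0 hFT h', fun hr₁ hr₂ hrF =>
    hm.isRealValued hp5 hT0 hFT hV hr₁ hr₂
      (ae_restrict_of_ae_restrict_of_subset (Icc_subset_Icc_right hTT') hrF)⟩
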